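/- Let $\Gamma\subset\mathbb R^3$ be a compact connected smooth oriented surface without boundary, let $U\supset\Gamma$ be a thin open tube on which the signed distance function $d$ of $\Gamma$ is well defined and smooth, and let $\nu=\nabla d$ and $\pi(x)=x-d(x)\nu(x)$ be the unit normal and the projection onto $\Gamma$. For $A\subset\Gamma$ relatively open, $H^m(A)$ is the space of all $w\in L^2(A)$ whose iterated weak tangential derivatives $D_{i_1}\cdots D_{i_j}w$, $j\le m$, lie in $L^2(A)$, where $D_i$ ($i=1,2,3$) is the $i$-th Cartesian component of the tangential gradient $\nabla_\Gamma$; $\|w\|^2_{H^m(A)}$ is the sum of their squared $L^2(A)$ norms. Let $k\ge1$ and fix a nodal set of the Lagrange element of degree $k$ on the flat reference triangle $K$ (unisolvent for $\mathbb P^k(K)$, invariant under the affine symmetries of $K$, with $k+1$ nodes on each edge), with Lagrange basis functions $\phi_a$. Let $\widetilde{\mathcal T}_h$ be a finite conforming triangulation of a polyhedral surface $\Gamma_h\subset U$ by planar triangles $\widetilde K_h$ with vertices on $\Gamma$, such that $\pi:\Gamma_h\to\Gamma$ is bijective. Let $h$ be the largest diameter of its triangles, and call it regular with constant $\sigma$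 if every triangle $\widetilde K_h$ contains, in its plane, a disc of diameter $\rho$ with $\operatorname{diam}\widetilde K_h\le\sigma\rho$. For a triangle $\widetilde K_h=F(K)$, $F$ affine, let $\pi_k$ be the Lagrange interpolant of degree $k$ of $\pi$ on $\widetilde K_h$ with respect to the transported nodes, $\widehat K_h=\pi_k(\widetilde K_h)$, and let $G=\pi\circ\pi_k\circ F$, so that $\widehat K_h^\ell=\pi(\widehat K_h)=G(K)$ is the lifted element and $\partial\widehat K_h^\ell=G(\partial K)$ its boundary. For $w\in C^0(\Gamma)$ the lifted Lagrange interpolant is given on $\widehat K_h^\ell$ by $$I_h^kw=\Big(\sum_a w(G(a))\,\phi_a\Big)\circ G^{-1}.$$ Let $2\le m\le k+1$. Every $w\in H^m(\Gamma)$ has a continuous representative; $I_h^k w$ is the interpolant of that representative. Moreover, for every $\sigma>0$ there are constants $C,h_0>0$, depending only on $\Gamma$ (with $U$ and $d$), $k$, $m$, the nodal set and $\sigma$, such that for every such triangulation that is regular with constant $\sigma$ and has $h\le h_0$, and for each of its elements, $\pi_k\circ F$ maps $K$ into $U$, $G$ is injective on $K$, and for all $w\in H^m(\Gamma)$ (continuous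 representative) the tangential gradient $\nabla_\Gamma(w-I_h^kw)$ on the interior of $\widehat K_h^\ell$ has a trace in $L^2(\partial\widehat K_h^\ell)$ and $$\|w-I_h^kw\|^2_{L^2(\partial\widehat K_h^\ell)}+h^2\,\|\nabla_\Gamma(w-I_h^kw)\|^2_{L^2(\partial\widehat K_h^\ell)}\le C\,h^{2m-1}\,\|w\|^2_{H^m(\widehat K_h^\ell)} .$$ -/

import Mathlib

open MeasureTheory Set Filter Topology
open scoped ENNReal ContDiff

namespace SurfaceDG

noncomputable section

/-- The ambient space `ℝ³`. -/
abbrev E3 := EuclideanSpace ℝ (Fin 3)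

/-- The parameter plane `ℝ²`. -/
abbrev E2 := EuclideanSpace ℝ (Fin 2)

/-! ### The surface -/

/-- A compact connected smooth oriented surface without boundary in `ℝ³`, given together with a
thin open tube `U` around it on which its signed distance function `d` is well defined (smooth).
The surface is the regular zero level set of `d` in `U`. -/
structure ClosedSurface where
  /-- the set of points of the surface -/
  carrier : Set E3
  isCompact : IsCompact carrier
  isConnected : IsConnected carrier
  /-- the open tube -/
  U : Set E3
  isOpen_U : IsOpen U
  subset_U : carrier ⊆ U
  /-- the signed distance function -/
  d : E3 → ℝ
  contDiffOn_d : ContDiffOn ℝ ∞ d U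
  abs_d : ∀ x ∈ U, |d x| = Metric.infDist x carrier
  norm_gradient : ∀ x ∈ carrier, ‖gradient d x‖ = 1

namespace ClosedSurface

/-- The unit normal `ν = ∇d`, on `Γ` and (extended constantly along normals) in the tube. -/
def normal (Γ : ClosedSurface) (x : E3) : E3 := gradient Γ.d x

/-- The projection `π(x) = x - d(x) ν(x)` of the tube onto the surface. -/
def proj (Γ : ClosedSurface) (x : E3) : E3 := x - Γ.d x • Γ.normal x

end ClosedSurface

/-! ### Surface Sobolev spaces -/

/-- Surface area on a subset `A` of a surface: the two-dimensional Hausdorff measure, normalised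
so that it agrees with Lebesgue measure on planes. -/
def area (A : Set E3) : Measure E3 := (Measure.euclideanHausdorffMeasure 2).restrict A

/-- Arc length on a curve `B`: the one-dimensional Hausdorff measure. -/
def arc (B : Set E3) : Measure E3 := (Measure.euclideanHausdorffMeasure 1).restrict B

/-- The squared `L²` norm, with values in `[0, ∞]`. -/
def l2Sq {F : Type*} [NormedAddCommGroup F] (μ : Measure E3) (f : E3 → F) : ℝ≥0∞ :=
  ∫⁻ x, ‖f x‖ₑ ^ 2 ∂μ

/-- `X` is a smooth regular local parametrization, defined on the open set `V` of the plane, of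
a part of `A`. -/
structure IsLocalParam (A : Set E3) (V : Set E2) (X : E2 → E3) : Prop where
  isOpen : IsOpen V
  contDiffOn : ContDiffOn ℝ ∞ X V
  injOn : InjOn X V
  immersion : ∀ y ∈ V, Function.Injective (fderiv ℝ X y)
  mapsTo : MapsTo X V A

namespace ClosedSurface

/-- For a relatively open subset `A` of `Γ`: the function `u ∈ L²(A)` has the weak tangential
gradient `∇_Γ u = g ∈ L²(A)³`. That is, `g` is tangential almost everywhere, and in every smooth
local parametrization `X` the weak partial derivatives of `u ∘ X` are `g ∘ X · ∂ⱼX`. -/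
structure HasWeakGrad (Γ : ClosedSurface) (A : Set E3) (u : E3 → ℝ) (g : E3 → E3) : Prop where
  memLp : MemLp u 2 (area A)
  memLp_grad : MemLp g 2 (area A)
  tangential : ∀ᵐ x ∂(area A), inner ℝ (g x) (Γ.normal x) = 0
  weak : ∀ (V : Set E2) (X : E2 → E3), IsLocalParam A V X →
    ∀ ψ : E2 → ℝ, ContDiff ℝ ∞ ψ → HasCompactSupport ψ → tsupport ψ ⊆ V → ∀ e : E2,
      ∫ y, u (X y) * fderiv ℝ ψ y e = - ∫ y, inner ℝ (g (X y)) (fderiv ℝ X y e) * ψ y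

/-- `u ∈ H^m(A)` for a relatively open subset `A` of `Γ`: all iterated weak tangential partial
derivatives `D_{i₁} ⋯ D_{iⱼ} u` with `j ≤ m` exist and lie in `L²(A)`; here `D_i` is the `i`-th
Cartesian component of the tangential gradient. -/
def MemSobolev (Γ : ClosedSurface) (A : Set E3) : ℕ → (E3 → ℝ) → Prop
  | 0, u => MemLp u 2 (area A)
  | m + 1, u => ∃ g : E3 → E3, Γ.HasWeakGrad A u g ∧ ∀ i, MemSobolev Γ A m (fun x => g x i)

open Classical in
/-- The weak tangential gradient on `A` (unique almost everywhere when it exists). -/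
def weakGrad (Γ : ClosedSurface) (A : Set E3) (u : E3 → ℝ) : E3 → E3 :=
  if h : ∃ g, Γ.HasWeakGrad A u g then h.choose else 0

/-- The squared norm `‖u‖²_{H^m(A)}`: the sum of `‖D_{i₁} ⋯ D_{iⱼ} u‖²_{L²(A)}` over all
`0 ≤ j ≤ m` and all `i₁, …, iⱼ ∈ {1, 2, 3}`. -/
def sobolevSq (Γ : ClosedSurface) (A : Set E3) : ℕ → (E3 → ℝ) → ℝ≥0∞
  | 0, u => l2Sq (area A) u
  | m + 1, u => l2Sq (area A) u + ∑ i, sobolevSq Γ A m (fun x => Γ.weakGrad A u x i)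

/-- `τ ∈ L²(B)` is the trace on the boundary curve `B` of the piece `A` of the surface of the
function `v ∈ H¹(A)`: there are functions in `H¹(A) ∩ C⁰(closure A)` that converge to `v` in
`H¹(A)` and whose restrictions to `B` converge to `τ` in `L²(B)`. -/
def HasTrace (Γ : ClosedSurface) (A B : Set E3) (v τ : E3 → ℝ) : Prop :=
  MemLp τ 2 (arc B) ∧
  ∃ g : E3 → E3, Γ.HasWeakGrad A v g ∧
  ∃ (φ : ℕ → E3 → ℝ) (γ : ℕ → E3 → E3),
    (∀ n, ContinuousOn (φ n) (closure A)) ∧ (∀ n, Γ.HasWeakGrad A (φ n) (γ n)) ∧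
    Tendsto (fun n => l2Sq (area A) (fun x => φ n x - v x)) atTop (𝓝 0) ∧
    Tendsto (fun n => l2Sq (area A) (fun x => γ n x - g x)) atTop (𝓝 0) ∧
    Tendsto (fun n => l2Sq (arc B) (fun x => φ n x - τ x)) atTop (𝓝 0)

/-- `t ∈ L²(B)³` is the (componentwise) trace on `B` of the weak tangential gradient on `A` of
the function `e ∈ H²(A)`. -/
def HasGradTrace (Γ : ClosedSurface) (A B : Set E3) (e : E3 → ℝ) (t : E3 → E3) : Prop :=
  ∃ g : E3 → E3, Γ.HasWeakGrad A e g ∧ ∀ i, Γ.HasTrace A B (fun x => g x i) (fun x => t x i)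

end ClosedSurface

/-! ### The reference Lagrange element -/

/-- The (closed) flat reference triangle `K`. -/
def refTriangle : Set E2 := {y | 0 ≤ y 0 ∧ 0 ≤ y 1 ∧ y 0 + y 1 ≤ 1}

/-- Evaluation of a bivariate polynomial at a point of the plane. -/
def polyEval (q : MvPolynomial (Fin 2) ℝ) (y : E2) : ℝ := MvPolynomial.eval (fun i => y i) q

/-- A set of nodal points of the Lagrange element of degree `k` on the reference triangle:
it is unisolvent for the polynomials of degree at most `k`, invariant under the affine symmetries
of the triangle, and has `k + 1` points on each edge, so that elementwise interpolants agree on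
common edges. -/
structure LagrangeNodes (k : ℕ) where
  /-- the nodal points -/
  pts : Finset E2
  mem_refTriangle : ∀ a ∈ pts, a ∈ refTriangle
  unisolvent : ∀ f : E2 → ℝ, ∃! q : MvPolynomial (Fin 2) ℝ,
    q.totalDegree ≤ k ∧ ∀ a ∈ pts, polyEval q a = f a
  swap_mem : ∀ a ∈ pts, !₂[a 1, a 0] ∈ pts
  reflect_mem : ∀ a ∈ pts, !₂[1 - a 0 - a 1, a 1] ∈ pts
  card_edge : (pts.filter fun a => a 1 = 0).card = k + 1

open Classical in
/-- The Lagrange basis polynomial of the node `a`: degree at most `k`, value `1` at `a` and `0`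
at the other nodes. -/
def LagrangeNodes.basis {k : ℕ} (N : LagrangeNodes k) (a : E2) : MvPolynomial (Fin 2) ℝ :=
  (N.unisolvent fun b => if b = a then 1 else 0).choose

/-- The affine map `F` of the reference triangle onto the planar triangle with the vertices
`p 0, p 1, p 2`. -/
def affineMap (p : Fin 3 → E3) (y : E2) : E3 := p 0 + y 0 • (p 1 - p 0) + y 1 • (p 2 - p 0)

/-! ### Triangulated polyhedral approximations of the surface -/

/-- `p` lists the three vertices of a triangle of `T`. -/
def IsElement (T : Geometry.SimplicialComplex ℝ E3) (p : Fin 3 → E3) : Prop :=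
  Function.Injective p ∧ ∃ s ∈ T.faces, (s : Set E3) = range p

/-- `T` is a conforming triangulation, by finitely many planar triangles with vertices on `Γ`,
of a polyhedral surface `Γ_h = T.space` in the tube that is mapped one-to-one onto `Γ` by the
projection `π`. (Conformity is part of the notion of a simplicial complex.) -/
structure IsTriangulation (Γ : ClosedSurface) (T : Geometry.SimplicialComplex ℝ E3) : Prop where
  finite : T.faces.Finite
  pure : ∀ s ∈ T.faces, ∃ t ∈ T.faces, s ⊆ t ∧ t.card = 3
  vertices_subset : T.vertices ⊆ Γ.carrier
  space_subset : T.space ⊆ Γ.U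
  bijOn : BijOn Γ.proj T.space Γ.carrier

/-- The mesh size: the largest diameter of an element. -/
def meshSize (T : Geometry.SimplicialComplex ℝ E3) : ℝ :=
  sSup ((fun s : Finset E3 => Metric.diam (convexHull ℝ (s : Set E3))) '' T.faces)

/-- Regularity of the triangulation with constant `σ`: each triangle `K` contains, in its plane,
a disc of some diameter `ρ` with `diam K ≤ σ ρ`. -/
def IsShapeRegular (σ : ℝ) (T : Geometry.SimplicialComplex ℝ E3) : Prop :=
  ∀ p : Fin 3 → E3, IsElement T p → ∃ c ∈ affineSpan ℝ (range p), ∃ ρ : ℝ,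
    Metric.diam (convexHull ℝ (range p)) ≤ σ * ρ ∧
    Metric.closedBall c (ρ / 2) ∩ (affineSpan ℝ (range p) : Set E3) ⊆ convexHull ℝ (range p)

/-! ### High order elements, lifted elements and the lifted interpolant -/

section Element

variable (Γ : ClosedSurface) {k : ℕ} (N : LagrangeNodes k) (p : Fin 3 → E3)

/-- The parametrization `π_k ∘ F` of the high order element `π_k(K̃)` over the reference triangle,
where `K̃` is the planar triangle with vertices `p` and `π_k` is the Lagrange interpolant of
degree `k` on `K̃` of the projection `π`. -/
def elemMap (y : E2) : E3 :=
  ∑ a ∈ N.pts, polyEval (N.basis a) y • Γ.proj (affineMap p a)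

/-- The parametrization `π ∘ π_k ∘ F` of the lifted element over the reference triangle. -/
def liftMap (y : E2) : E3 := Γ.proj (elemMap Γ N p y)

/-- The interior of the lifted element. -/
def liftInterior : Set E3 := liftMap Γ N p '' interior refTriangle

/-- The boundary of the lifted element, that is, the union of its three curved edges. -/
def liftBoundary : Set E3 := liftMap Γ N p '' frontier refTriangle

/-- The lifted Lagrange interpolant on the lifted element: the function `w ∘ π` on the high order
element is pulled back by `π_k ∘ F`, interpolated there by a polynomial of degree `k`, and the
result is transported back to the lifted element by the inverse of `π ∘ π_k ∘ F`. -/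
def interp (w : E3 → ℝ) (ξ : E3) : ℝ :=
  ∑ a ∈ N.pts, w (Γ.proj (elemMap Γ N p a)) *
    polyEval (N.basis a) (Function.invFunOn (liftMap Γ N p) refTriangle ξ)

end Element

end

end SurfaceDG

open SurfaceDG

namespace SurfaceDG

noncomputable section

open scoped NNReal

/-! ### The reference triangle -/

/-! The estimate is a scaling argument: pull everything back to the reference triangle `K`, estimate
there with constants depending only on `K`, and count powers of the element size.

Let `η` be the diameter of one planar triangle `F(K)`. The geometric core is `exists_chart_elemMap`:
for small `η` the map `G` has derivatives of each order `1 ≤ j ≤ m` bounded by a constant times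
`η^j`, and expands distances by at least `η / (4σ)`. Indeed `F` has these properties by shape
regularity. The defect `π ∘ F - F` vanishes at the three vertices and has second derivatives of
order `η²`, so it and its first derivatives are of order `η²`. Interpolating it and projecting again
changes `F` only by terms whose first derivatives are of order `η²`, which the expansion of `F`
absorbs. Derivatives of order `j ≥ 2` survive interpolation, because subtracting a polynomial of
degree less than `j` removes what the interpolant reproduces.

On `K` the lifted interpolant becomes the ordinary Lagrange interpolant of `w ∘ G`. Bramble–Hilbert,
together with the Sobolev inequality that controls nodal values, bounds the error in `H²(K)` by the
derivatives of order `m` of `w ∘ G`. By the chain rule these are at most `η^m η⁻¹ ‖w‖`, the factor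
`η⁻¹` coming from the change of area. The trace inequality on the edges of `K` and the arc length
factor `η` give `η · η^(2m-2) = η^(2m-1)` for the error itself. The tangential gradient is the
combination of the two reference derivatives with the frame dual to `∂₀G, ∂₁G`, which has size
`1/η`; this costs two powers and leaves `η^(2m-3)`. Both exponents are positive, so `η` may be
replaced by the mesh size (`combine_estimates`).

The Poincaré, trace and Sobolev inequalities on `K` are proved for smooth functions by the
fundamental theorem of calculus on segments. They pass to weak derivatives through the mollification
`mol`, which contracts `K` towards an interior disc: it samples only values inside `K`, is smooth up
to the boundary, and commutes with derivatives up to the factor `1 - δ`. On the surface, Hausdorff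
measures are compared through bi-Lipschitz bounds only, since constants do not matter. Existence of
the gradient trace follows from completeness of `L²` of the boundary curve; the estimate holds for
every admissible trace because it passes to the limit in the defining approximation. Continuous
representatives come from the Sobolev inequality in local charts, glued by continuous weights. -/

theorem isClosed_refTriangle : IsClosed refTriangle := by
  have h0 : Continuous fun y : E2 => y 0 := by fun_prop
  have h1 : Continuous fun y : E2 => y 1 := by fun_prop
  exact ((isClosed_le continuous_const h0).inter ((isClosed_le continuous_const h1).inter
    (isClosed_le (h0.add h1) continuous_const)))

theorem norm_le_of_mem_refTriangle {y : E2} (hy : y ∈ refTriangle) : ‖y‖ ≤ 1 := by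
  obtain ⟨h0, h1, h2⟩ := hy
  rw [EuclideanSpace.norm_eq, Real.sqrt_le_one]
  simp only [Fin.sum_univ_two, Real.norm_eq_abs, sq_abs]
  nlinarith

theorem isCompact_refTriangle : IsCompact refTriangle :=
  Metric.isCompact_of_isClosed_isBounded isClosed_refTriangle
    ((Metric.isBounded_closedBall (x := (0 : E2)) (r := 1)).subset fun y hy => by
      simpa using norm_le_of_mem_refTriangle hy)

theorem convex_refTriangle : Convex ℝ refTriangle := by
  intro x hx y hy a b ha hb hab
  obtain ⟨hx0, hx1, hx2⟩ := hx
  obtain ⟨hy0, hy1, hy2⟩ := hy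
  refine ⟨?_, ?_, ?_⟩ <;> simp only [PiLp.add_apply, PiLp.smul_apply, smul_eq_mul]
  · positivity
  · positivity
  · nlinarith

theorem measurableSet_refTriangle : MeasurableSet refTriangle :=
  isClosed_refTriangle.measurableSet

theorem mem_interior_refTriangle {y : E2} (h0 : 0 < y 0) (h1 : 0 < y 1) (h2 : y 0 + y 1 < 1) :
    y ∈ interior refTriangle := by
  have c0 : Continuous fun y : E2 => y 0 := by fun_prop
  have c1 : Continuous fun y : E2 => y 1 := by fun_prop
  have ho : IsOpen {y : E2 | 0 < y 0 ∧ 0 < y 1 ∧ y 0 + y 1 < 1} :=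
    ((isOpen_lt continuous_const c0).inter ((isOpen_lt continuous_const c1).inter
      (isOpen_lt (c0.add c1) continuous_const)))
  exact mem_interior.2 ⟨_, fun z hz => ⟨hz.1.le, hz.2.1.le, hz.2.2.le⟩, ho, ⟨h0, h1, h2⟩⟩

/-- An interior point of the reference triangle. -/
def centre : E2 := !₂[1 / 4, 1 / 4]

theorem centre_mem : centre ∈ interior refTriangle :=
  mem_interior_refTriangle (by norm_num [centre]) (by norm_num [centre]) (by norm_num [centre])

theorem closure_interior_refTriangle : closure (interior refTriangle) = refTriangle := by
  rw [convex_refTriangle.closure_interior_eq_closure_of_nonempty_interior ⟨_, centre_mem⟩,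
    isClosed_refTriangle.closure_eq]

theorem volume_refTriangle_lt_top : volume refTriangle < ⊤ := isCompact_refTriangle.measure_lt_top

theorem volume_refTriangle_ne_zero : volume refTriangle ≠ 0 :=
  (Measure.measure_pos_of_nonempty_interior _ ⟨_, centre_mem⟩).ne'

/-- Lebesgue measure on the reference triangle. -/
def muK : Measure E2 := volume.restrict refTriangle

theorem muK_eq_interior : muK = volume.restrict (interior refTriangle) := by
  refine Measure.restrict_congr_set ?_
  have : interior refTriangle =ᵐ[volume] refTriangle := by
    refine interior_ae_eq_of_null_frontier ?_
    exact convex_refTriangle.addHaar_frontier volume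
  exact this.symm

instance isFiniteMeasure_restrict_refTriangle :
    IsFiniteMeasure ((volume : Measure E2).restrict refTriangle) := ⟨by
  simpa using volume_refTriangle_lt_top⟩

instance isFiniteMeasure_muK : IsFiniteMeasure muK := isFiniteMeasure_restrict_refTriangle

theorem ae_muK_of_forall {q : E2 → Prop} (h : ∀ x ∈ refTriangle, q x) : ∀ᵐ x ∂muK, q x :=
  (ae_restrict_iff' measurableSet_refTriangle).2 (Eventually.of_forall h)

theorem ae_muK_of_interior {q : E2 → Prop} (h : ∀ x ∈ interior refTriangle, q x) :
    ∀ᵐ x ∂muK, q x := by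
  rw [muK_eq_interior]
  exact (ae_restrict_iff' isOpen_interior.measurableSet).2 (Eventually.of_forall h)

/-- The vertices of the reference triangle. -/
def vtx : Fin 3 → E2 := ![!₂[0, 0], !₂[1, 0], !₂[0, 1]]

/-- Some barycentric coordinate of `x` is at least 1/3, say that of vertex `i`. Moving along the two
edge directions leaving `i` takes at most 1/6 + 1/6 from it and only increases the other two. Hence
every point, boundary included, is the corner of a parallelogram of one of three fixed shapes inside
the triangle, which is what the Sobolev inequality needs. -/
theorem corner_mem (x : E2) (hx : x ∈ refTriangle) :
    ∃ i : Fin 3, ∀ s ∈ Icc (0 : ℝ) 1, ∀ t ∈ Icc (0 : ℝ) 1,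
      x + s • ((1 / 6 : ℝ) • (vtx (i + 1) - vtx i)) + t • ((1 / 6 : ℝ) • (vtx (i + 2) - vtx i))
        ∈ refTriangle := by
  obtain ⟨h0, h1, h2⟩ := hx
  by_cases a0 : 1 / 3 ≤ x 0
  · refine ⟨1, fun s hs t ht => ?_⟩
    obtain ⟨s0, s1⟩ := hs
    obtain ⟨t0, t1⟩ := ht
    refine ⟨?_, ?_, ?_⟩ <;>
      simp [vtx, show (1 : Fin 3) + 1 = 2 from rfl, show (1 : Fin 3) + 2 = 0 from rfl] <;> nlinarith
  by_cases a1 : 1 / 3 ≤ x 1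
  · refine ⟨2, fun s hs t ht => ?_⟩
    obtain ⟨s0, s1⟩ := hs
    obtain ⟨t0, t1⟩ := ht
    refine ⟨?_, ?_, ?_⟩ <;>
      simp [vtx, show (2 : Fin 3) + 1 = 0 from rfl, show (2 : Fin 3) + 2 = 1 from rfl] <;> nlinarith
  · refine ⟨0, fun s hs t ht => ?_⟩
    obtain ⟨s0, s1⟩ := hs
    obtain ⟨t0, t1⟩ := ht
    refine ⟨?_, ?_, ?_⟩ <;>
      simp [vtx] <;> nlinarith

/-- The half edges of the reference triangle: from the vertex `i` to the midpoint of the edge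
towards one of the two other vertices. -/
def halfEdge (i : Fin 3) (j : Fin 2) (s : ℝ) : E2 :=
  vtx i + s • ((1 / 2 : ℝ) • (vtx (i + if j = 0 then 1 else 2) - vtx i))

/-- A whole edge is never the side of a parallelogram inside the triangle, but half an edge is:
along both half edges from vertex `i` the coordinate of that vertex stays at least `1 - 1/2 - 1/2 =
0`. This is the reason for splitting the boundary into six pieces. -/
theorem halfEdge_corner_mem (i : Fin 3) (j : Fin 2) (s : ℝ) (hs : s ∈ Icc (0 : ℝ) 1)
    (t : ℝ) (ht : t ∈ Icc (0 : ℝ) 1) :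
    halfEdge i j s + t • ((1 / 2 : ℝ) • (vtx (i + if j = 0 then 2 else 1) - vtx i))
      ∈ refTriangle := by
  obtain ⟨s0, s1⟩ := hs
  obtain ⟨t0, t1⟩ := ht
  fin_cases i <;> fin_cases j <;> refine ⟨?_, ?_, ?_⟩ <;>
    simp [halfEdge, vtx, show (1 : Fin 3) + 1 = 2 from rfl, show (1 : Fin 3) + 2 = 0 from rfl,
      show (2 : Fin 3) + 1 = 0 from rfl, show (2 : Fin 3) + 2 = 1 from rfl] <;> nlinarith

theorem halfEdge_mem (i : Fin 3) (j : Fin 2) (s : ℝ) (hs : s ∈ Icc (0 : ℝ) 1) :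
    halfEdge i j s ∈ refTriangle := by
  simpa using halfEdge_corner_mem i j s hs 0 (by simp)

theorem frontier_refTriangle_subset :
    frontier refTriangle ⊆ ⋃ ij : Fin 3 × Fin 2, halfEdge ij.1 ij.2 '' Icc (0 : ℝ) 1 := by
  intro y hy
  rw [isClosed_refTriangle.frontier_eq] at hy
  obtain ⟨⟨h0, h1, h2⟩, hn⟩ := hy
  have hcase : y 0 = 0 ∨ y 1 = 0 ∨ y 0 + y 1 = 1 := by
    by_contra! hc
    exact hn (mem_interior_refTriangle (lt_of_le_of_ne h0 hc.1.symm) (lt_of_le_of_ne h1 hc.2.1.symm)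
      (lt_of_le_of_ne h2 hc.2.2))
  simp only [mem_iUnion, mem_image, Prod.exists]
  have key : ∀ z : E2, z 0 = y 0 → z 1 = y 1 → z = y := by
    intro z hz0 hz1
    ext i
    fin_cases i
    · exact hz0
    · exact hz1
  rcases hcase with h | h | h
  · by_cases hh : y 1 ≤ 1 / 2
    · exact ⟨0, 1, 2 * y 1, ⟨by linarith, by linarith⟩, key _ (by simp [halfEdge, vtx, h])
        (by simp [halfEdge, vtx]; ring)⟩
    · exact ⟨2, 0, 2 * (1 - y 1), ⟨by linarith, by linarith⟩,
        key _ (by simp [halfEdge, vtx, h, show (2 : Fin 3) + 1 = 0 from rfl])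
        (by simp [halfEdge, vtx, show (2 : Fin 3) + 1 = 0 from rfl]; ring)⟩
  · by_cases hh : y 0 ≤ 1 / 2
    · exact ⟨0, 0, 2 * y 0, ⟨by linarith, by linarith⟩, key _ (by simp [halfEdge, vtx]; ring)
        (by simp [halfEdge, vtx, h])⟩
    · exact ⟨1, 1, 2 * (1 - y 0), ⟨by linarith, by linarith⟩,
        key _ (by simp [halfEdge, vtx, show (1 : Fin 3) + 2 = 0 from rfl]; ring)
        (by simp [halfEdge, vtx, h, show (1 : Fin 3) + 2 = 0 from rfl])⟩
  · by_cases hh : y 0 ≤ 1 / 2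
    · exact ⟨2, 1, 2 * y 0, ⟨by linarith, by linarith⟩,
        key _ (by simp [halfEdge, vtx, show (2 : Fin 3) + 2 = 1 from rfl]; ring)
        (by simp [halfEdge, vtx, show (2 : Fin 3) + 2 = 1 from rfl]; linarith)⟩
    · exact ⟨1, 0, 2 * y 1, ⟨by linarith, by linarith⟩,
        key _ (by simp [halfEdge, vtx, show (1 : Fin 3) + 1 = 2 from rfl]; linarith)
        (by simp [halfEdge, vtx, show (1 : Fin 3) + 1 = 2 from rfl]; ring)⟩

/-! ### The `L²` norm on the reference triangle -/

/-- The `L²` norm on the reference triangle. -/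
def nK (f : E2 → ℝ) : ℝ≥0∞ := eLpNorm f 2 muK

theorem eLpNorm_two_sq {α F : Type*} [MeasurableSpace α] [NormedAddCommGroup F] (μ : Measure α)
    (f : α → F) : eLpNorm f 2 μ ^ 2 = ∫⁻ x, ‖f x‖ₑ ^ 2 ∂μ := by
  rw [eLpNorm_eq_lintegral_rpow_enorm_toReal (by simp) (by simp)]
  rw [← ENNReal.rpow_natCast, ← ENNReal.rpow_mul]
  simp

theorem nK_sq (f : E2 → ℝ) : nK f ^ 2 = ∫⁻ x in refTriangle, ‖f x‖ₑ ^ 2 :=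
  eLpNorm_two_sq _ _

theorem sq_lintegral_le {α : Type*} [MeasurableSpace α] (μ : Measure α) (f : α → ℝ≥0∞)
    (hf : AEMeasurable f μ) : (∫⁻ x, f x ∂μ) ^ 2 ≤ μ univ * ∫⁻ x, f x ^ 2 ∂μ := by
  have h := ENNReal.lintegral_mul_le_Lp_mul_Lq μ (Real.HolderConjugate.two_two) hf
    (aemeasurable_const (b := (1 : ℝ≥0∞)))
  simp only [Pi.mul_apply, mul_one, ENNReal.one_rpow, lintegral_const, one_mul] at h
  calc (∫⁻ x, f x ∂μ) ^ 2 ≤ _ := pow_le_pow_left' h 2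
    _ = _ := by
      rw [mul_pow, ← ENNReal.rpow_natCast, ← ENNReal.rpow_natCast, ← ENNReal.rpow_mul,
        ← ENNReal.rpow_mul]
      simp [mul_comm]

theorem two_mul_sq_add (a b : ℝ≥0∞) : (a + b) ^ 2 ≤ 2 * a ^ 2 + 2 * b ^ 2 := by
  have := ENNReal.rpow_add_le_mul_rpow_add_rpow a b (p := 2) (by norm_num)
  norm_num at this
  rw [mul_add] at this
  exact this

/-- The homothety with centre `z` and ratio `t` maps the convex triangle into itself and has
Jacobian `t ^ 2`. It serves both the Poincaré inequality and the `L²` bound of the mollification. -/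
theorem lintegral_contract_le (g : E2 → ℝ≥0∞) {z : E2} (hz : z ∈ refTriangle) {t : ℝ}
    (ht0 : 0 < t) (ht1 : t ≤ 1) :
    ∫⁻ x in refTriangle, g ((1 - t) • z + t • x) ≤
      ENNReal.ofReal (t⁻¹ ^ 2) * ∫⁻ x in refTriangle, g x := by
  have hd : ∀ x ∈ refTriangle, HasFDerivWithinAt (fun x : E2 => (1 - t) • z + t • x)
      (t • ContinuousLinearMap.id ℝ E2) refTriangle x := by
    intro x _
    exact (((hasFDerivAt_id x).const_smul t).const_add _).hasFDerivWithinAt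
  have hinj : InjOn (fun x : E2 => (1 - t) • z + t • x) refTriangle := by
    intro x _ y _ hxy
    simpa [ht0.ne'] using hxy
  have h := lintegral_image_eq_lintegral_abs_det_fderiv_mul volume measurableSet_refTriangle hd
    hinj g
  have hdet : |(t • ContinuousLinearMap.id ℝ E2).det| = t ^ 2 := by
    have : (t • ContinuousLinearMap.id ℝ E2).det = t ^ 2 := by
      change LinearMap.det (t • (LinearMap.id : E2 →ₗ[ℝ] E2)) = _
      rw [LinearMap.det_smul]
      simp
    rw [this, abs_of_nonneg (by positivity)]
  rw [hdet] at h
  rw [lintegral_const_mul' _ _ ENNReal.ofReal_ne_top] at h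
  have hsub : (fun x : E2 => (1 - t) • z + t • x) '' refTriangle ⊆ refTriangle := by
    rintro _ ⟨x, hx, rfl⟩
    exact convex_refTriangle hz hx (by linarith) ht0.le (by ring)
  calc _ = ENNReal.ofReal (t⁻¹ ^ 2) * (ENNReal.ofReal (t ^ 2) *
        ∫⁻ x in refTriangle, g ((1 - t) • z + t • x)) := by
        rw [← mul_assoc, ← ENNReal.ofReal_mul (by positivity)]
        field_simp
        simp
    _ ≤ _ := by
      rw [← h]
      gcongr

/-! ### Partial derivatives -/

/-- The standard basis of the plane. -/
def eb (i : Fin 2) : E2 := EuclideanSpace.single i 1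

/-- Partial derivatives. -/
def pd (i : Fin 2) (f : E2 → ℝ) : E2 → ℝ := fun x => fderiv ℝ f x (eb i)

theorem eq_sum_eb (v : E2) : v = v 0 • eb 0 + v 1 • eb 1 := by
  ext i
  fin_cases i <;> simp [eb]

theorem clm_apply_eq {F : Type*} [NormedAddCommGroup F] [NormedSpace ℝ F] (L : E2 →L[ℝ] F) (v : E2) :
    L v = v 0 • L (eb 0) + v 1 • L (eb 1) := by
  conv_lhs => rw [eq_sum_eb v]
  simp

theorem contDiff_pd {f : E2 → ℝ} (hf : ContDiff ℝ ∞ f) (i : Fin 2) : ContDiff ℝ ∞ (pd i f) :=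
  (hf.fderiv_right (m := ∞) (by simp)).clm_apply contDiff_const

theorem pd_comm {f : E2 → ℝ} (hf : ContDiff ℝ ∞ f) (i j : Fin 2) :
    pd i (pd j f) = pd j (pd i f) := by
  ext x
  have h2 : Differentiable ℝ (fderiv ℝ f) :=
    (hf.fderiv_right (m := ∞) (by simp)).differentiable (by simp)
  have key : ∀ a b : Fin 2, pd a (pd b f) x = fderiv ℝ (fderiv ℝ f) x (eb a) (eb b) := by
    intro a b
    change fderiv ℝ (fun y => fderiv ℝ f y (eb b)) x (eb a) = _
    rw [fderiv_clm_apply (h2 x) (differentiableAt_const _)]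
    simp
  rw [key, key]
  exact second_derivative_symmetric (fun y => (hf.differentiable (by simp) y).hasFDerivAt)
    (h2 x).hasFDerivAt _ _

theorem pd_add {f g : E2 → ℝ} (hf : ContDiff ℝ ∞ f) (hg : ContDiff ℝ ∞ g) (i : Fin 2) :
    pd i (f + g) = pd i f + pd i g := by
  ext x
  simp only [pd, Pi.add_apply]
  rw [fderiv_add (hf.differentiable (by simp) x) (hg.differentiable (by simp) x)]
  rfl

theorem pd_sub {f g : E2 → ℝ} (hf : ContDiff ℝ ∞ f) (hg : ContDiff ℝ ∞ g) (i : Fin 2) :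
    pd i (f - g) = pd i f - pd i g := by
  ext x
  simp only [pd, Pi.sub_apply]
  rw [fderiv_sub (hf.differentiable (by simp) x) (hg.differentiable (by simp) x)]
  rfl

theorem pd_const_mul {f : E2 → ℝ} (hf : ContDiff ℝ ∞ f) (c : ℝ) (i : Fin 2) :
    pd i (fun x => c * f x) = fun x => c * pd i f x := by
  ext x
  simp only [pd]
  rw [fderiv_const_mul (hf.differentiable (by simp) x)]
  rfl

/-! ### Sobolev, trace and Poincaré inequalities for smooth functions -/

/-- The `H¹` norm (as a sum) of a smooth function on the reference triangle. -/
def H1 (f : E2 → ℝ) : ℝ≥0∞ := nK f + nK (pd 0 f) + nK (pd 1 f)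

/-- The `H²` norm (as a sum) of a smooth function on the reference triangle. -/
def H2 (f : E2 → ℝ) : ℝ≥0∞ := H1 f + H1 (pd 0 f) + H1 (pd 1 f)

/-- Write `g 0 = g t - ∫₀ᵗ g'`, square, use Cauchy–Schwarz, and average over `t` in the unit
interval. This is the trace inequality in one dimension, from which the two-dimensional ones follow.
-/
theorem enorm_le_lintegral_add (g g' : ℝ → ℝ) (hg : ∀ x, HasDerivAt g (g' x) x)
    (hg' : Continuous g') :
    ‖g 0‖ₑ ^ 2 ≤ ∫⁻ t in Icc (0 : ℝ) 1, (2 * ‖g t‖ₑ ^ 2 + 2 * ‖g' t‖ₑ ^ 2) := by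
  have hcg : Continuous g := continuous_iff_continuousAt.2 fun x => (hg x).continuousAt
  have hvol : volume (Icc (0 : ℝ) 1) = 1 := by simp
  have h1 : ∀ t ∈ Icc (0 : ℝ) 1, ‖g 0‖ₑ ^ 2 ≤
      2 * ‖g t‖ₑ ^ 2 + 2 * ∫⁻ s in Icc (0 : ℝ) 1, ‖g' s‖ₑ ^ 2 := by
    intro t ht
    have hftc : g t - g 0 = ∫ s in (0 : ℝ)..t, g' s :=
      (intervalIntegral.integral_eq_sub_of_hasDerivAt (fun x _ => hg x)
        (hg'.intervalIntegrable _ _)).symm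
    have hb : ‖g t - g 0‖ₑ ≤ ∫⁻ s in Icc (0 : ℝ) 1, ‖g' s‖ₑ := by
      rw [hftc, intervalIntegral.integral_of_le ht.1]
      refine (enorm_integral_le_lintegral_enorm _).trans ?_
      exact lintegral_mono_set fun s hs => ⟨hs.1.le, hs.2.trans ht.2⟩
    have h0 : ‖g 0‖ₑ ≤ ‖g t‖ₑ + ‖g t - g 0‖ₑ := by
      have : g 0 = g t - (g t - g 0) := by ring
      conv_lhs => rw [this]
      exact enorm_sub_le
    calc ‖g 0‖ₑ ^ 2 ≤ (‖g t‖ₑ + ‖g t - g 0‖ₑ) ^ 2 := by gcongr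
      _ ≤ 2 * ‖g t‖ₑ ^ 2 + 2 * ‖g t - g 0‖ₑ ^ 2 := two_mul_sq_add _ _
      _ ≤ 2 * ‖g t‖ₑ ^ 2 + 2 * (∫⁻ s in Icc (0 : ℝ) 1, ‖g' s‖ₑ) ^ 2 := by gcongr
      _ ≤ _ := by
        gcongr
        refine (sq_lintegral_le _ _ hg'.enorm.measurable.aemeasurable).trans ?_
        simp
  calc ‖g 0‖ₑ ^ 2 = ∫⁻ t in Icc (0 : ℝ) 1, ‖g 0‖ₑ ^ 2 := by simp
    _ ≤ ∫⁻ t in Icc (0 : ℝ) 1, (2 * ‖g t‖ₑ ^ 2 + 2 * ∫⁻ s in Icc (0 : ℝ) 1, ‖g' s‖ₑ ^ 2) :=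
        setLIntegral_mono' measurableSet_Icc h1
    _ = _ := by
      have m1 : Measurable fun t => 2 * ‖g t‖ₑ ^ 2 :=
        (hcg.enorm.measurable.pow_const 2).const_mul 2
      rw [lintegral_add_left m1, lintegral_add_left m1]
      congr 1
      rw [lintegral_const_mul _ (hg'.enorm.measurable.pow_const 2)]
      simp

/-- The linear map `y ↦ y₀ a + y₁ b` of the plane. -/
def spanMap (a b : E2) : E2 →L[ℝ] E2 :=
  (EuclideanSpace.proj 0 : E2 →L[ℝ] ℝ).smulRight a + (EuclideanSpace.proj 1 : E2 →L[ℝ] ℝ).smulRight b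

theorem spanMap_apply (a b y : E2) : spanMap a b y = y 0 • a + y 1 • b := by
  simp [spanMap]

theorem spanMap_injective {a b : E2} (h : a 0 * b 1 - a 1 * b 0 ≠ 0) :
    Function.Injective (spanMap a b) := by
  rw [injective_iff_map_eq_zero]
  intro y hy
  rw [spanMap_apply] at hy
  have e0 := congrArg (fun v : E2 => v 0) hy
  have e1 := congrArg (fun v : E2 => v 1) hy
  simp at e0 e1
  have y0 : y 0 * (a 0 * b 1 - a 1 * b 0) = 0 := by linear_combination b 1 * e0 - b 0 * e1
  have y1 : y 1 * (a 0 * b 1 - a 1 * b 0) = 0 := by linear_combination a 0 * e1 - a 1 * e0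
  ext i
  fin_cases i
  · simpa [h] using y0
  · simpa [h] using y1

theorem det_ne_zero_of_injective {L : E2 →L[ℝ] E2} (h : Function.Injective L) : L.det ≠ 0 := by
  have hi : Function.Injective (L : E2 →ₗ[ℝ] E2) := h
  have := (LinearEquiv.ofInjectiveEndo _ hi).isUnit_det'
  exact this.ne_zero

theorem lintegral_square (Φ : E2 → ℝ≥0∞) (hΦ : Measurable Φ) :
    ∫⁻ s in Icc (0 : ℝ) 1, ∫⁻ t in Icc (0 : ℝ) 1, Φ !₂[s, t] =
      ∫⁻ y in {y : E2 | y 0 ∈ Icc (0 : ℝ) 1 ∧ y 1 ∈ Icc (0 : ℝ) 1}, Φ y := by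
  have hmp := ((EuclideanSpace.volume_preserving_symm_measurableEquiv_toLp (Fin 2)).symm).comp
    ((volume_preserving_finTwoArrow ℝ).symm)
  have hme : MeasurableEmbedding (fun q : ℝ × ℝ => (!₂[q.1, q.2] : E2)) :=
    ((MeasurableEquiv.finTwoArrow (α := ℝ)).symm.trans
      (MeasurableEquiv.toLp 2 (Fin 2 → ℝ))).measurableEmbedding
  have hmp' : MeasurePreserving (fun q : ℝ × ℝ => (!₂[q.1, q.2] : E2)) volume volume := hmp
  have hm : MeasurableSet (Icc (0 : ℝ) 1 ×ˢ Icc (0 : ℝ) 1) := measurableSet_Icc.prod measurableSet_Icc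
  have hpre : (fun q : ℝ × ℝ => (!₂[q.1, q.2] : E2)) ⁻¹'
      {y : E2 | y 0 ∈ Icc (0 : ℝ) 1 ∧ y 1 ∈ Icc (0 : ℝ) 1} = Icc (0 : ℝ) 1 ×ˢ Icc (0 : ℝ) 1 := by
    ext q
    simp only [mem_preimage, mem_ofPred_eq, mem_prod]
    exact Iff.rfl
  rw [← hmp'.setLIntegral_comp_preimage_emb hme, hpre, Measure.volume_eq_prod,
    ← Measure.prod_restrict, lintegral_prod _ (by
      exact (hΦ.comp hme.measurable).aemeasurable)]

theorem measurableSet_square :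
    MeasurableSet {y : E2 | y 0 ∈ Icc (0 : ℝ) 1 ∧ y 1 ∈ Icc (0 : ℝ) 1} := by
  have c0 : Continuous fun y : E2 => y 0 := by fun_prop
  have c1 : Continuous fun y : E2 => y 1 := by fun_prop
  exact ((isClosed_Icc.preimage c0).inter (isClosed_Icc.preimage c1)).measurableSet

/-- The constant is the inverse of the determinant of the two sides, so it does not depend on the
corner `p`. That uniformity makes a finite list of parallelogram shapes sufficient. -/
theorem lintegral_parallelogram_le {a b : E2} (h : a 0 * b 1 - a 1 * b 0 ≠ 0) :
    ∃ C : ℝ≥0, ∀ p : E2, (∀ s ∈ Icc (0 : ℝ) 1, ∀ t ∈ Icc (0 : ℝ) 1, p + s • a + t • b ∈ refTriangle) →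
      ∀ Φ : E2 → ℝ≥0∞, Measurable Φ →
      ∫⁻ s in Icc (0 : ℝ) 1, ∫⁻ t in Icc (0 : ℝ) 1, Φ (p + s • a + t • b) ≤
        C * ∫⁻ y in refTriangle, Φ y := by
  set δ := |(spanMap a b).det| with hδ
  have hδ0 : 0 < δ := abs_pos.2 (det_ne_zero_of_injective (spanMap_injective h))
  refine ⟨δ⁻¹.toNNReal, fun p hp Φ hΦ => ?_⟩
  set Q := {y : E2 | y 0 ∈ Icc (0 : ℝ) 1 ∧ y 1 ∈ Icc (0 : ℝ) 1}
  have h1 := lintegral_square (fun y => Φ (p + spanMap a b y))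
    (hΦ.comp (by fun_prop))
  have e1 : ∫⁻ s in Icc (0 : ℝ) 1, ∫⁻ t in Icc (0 : ℝ) 1, Φ (p + s • a + t • b) =
      ∫⁻ y in Q, Φ (p + spanMap a b y) := by
    rw [← h1]
    simp [spanMap_apply, add_assoc]
  have h2 := lintegral_image_eq_lintegral_abs_det_fderiv_mul volume measurableSet_square
    (f := fun y => p + spanMap a b y) (f' := fun _ => spanMap a b)
    (fun x _ => ((spanMap a b).hasFDerivAt.const_add p).hasFDerivWithinAt)
    (fun x _ y _ hxy => spanMap_injective h (by simpa using hxy)) Φ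
  rw [lintegral_const_mul' _ _ ENNReal.ofReal_ne_top] at h2
  have hsub : (fun y => p + spanMap a b y) '' Q ⊆ refTriangle := by
    rintro _ ⟨y, hy, rfl⟩
    have := hp _ hy.1 _ hy.2
    simpa [spanMap_apply, add_assoc] using this
  rw [e1]
  calc ∫⁻ y in Q, Φ (p + spanMap a b y) = ENNReal.ofReal δ⁻¹ * (ENNReal.ofReal δ *
      ∫⁻ y in Q, Φ (p + spanMap a b y)) := by
        rw [← mul_assoc, ← ENNReal.ofReal_mul (by positivity), inv_mul_cancel₀ hδ0.ne']
        simp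
    _ ≤ ENNReal.ofReal δ⁻¹ * ∫⁻ y in refTriangle, Φ y := by
        rw [← h2]
        gcongr

theorem continuous_pd {f : E2 → ℝ} (hf : ContDiff ℝ ∞ f) (i : Fin 2) : Continuous (pd i f) :=
  (contDiff_pd hf i).continuous

theorem enorm_fderiv_apply_sq_le (f : E2 → ℝ) (x v : E2) :
    ‖fderiv ℝ f x v‖ₑ ^ 2 ≤ 2 * ‖v‖ₑ ^ 2 * (‖pd 0 f x‖ₑ ^ 2 + ‖pd 1 f x‖ₑ ^ 2) := by
  have hv : ∀ i, ‖v i‖ₑ ≤ ‖v‖ₑ := fun i => by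
    rw [enorm_le_iff_norm_le]
    exact PiLp.norm_apply_le v i
  calc ‖fderiv ℝ f x v‖ₑ ^ 2 = ‖v 0 * pd 0 f x + v 1 * pd 1 f x‖ₑ ^ 2 := by
        rw [clm_apply_eq]; rfl
    _ ≤ (‖v 0 * pd 0 f x‖ₑ + ‖v 1 * pd 1 f x‖ₑ) ^ 2 := by gcongr; exact enorm_add_le _ _
    _ ≤ 2 * ‖v 0 * pd 0 f x‖ₑ ^ 2 + 2 * ‖v 1 * pd 1 f x‖ₑ ^ 2 := two_mul_sq_add _ _
    _ ≤ 2 * (‖v‖ₑ * ‖pd 0 f x‖ₑ) ^ 2 + 2 * (‖v‖ₑ * ‖pd 1 f x‖ₑ) ^ 2 := by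
        rw [enorm_mul, enorm_mul]
        gcongr <;> exact hv _
    _ = _ := by ring

theorem sum_nK_sq_le (f : E2 → ℝ) :
    nK f ^ 2 + (nK (pd 0 f) ^ 2 + nK (pd 1 f) ^ 2) ≤ H1 f ^ 2 := by
  have key : ∀ a b : ℝ≥0∞, a ^ 2 + b ^ 2 ≤ (a + b) ^ 2 := fun a b => by
    have : (a + b) ^ 2 = a ^ 2 + b ^ 2 + 2 * a * b := by ring
    rw [this]
    exact le_self_add
  rw [H1, add_assoc]
  exact (add_le_add le_rfl (key _ _)).trans (key _ _)

theorem lintegral_enorm_fderiv_le {f : E2 → ℝ} (hf : ContDiff ℝ ∞ f) (b : E2) :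
    ∫⁻ y in refTriangle, (2 * ‖f y‖ₑ ^ 2 + 2 * ‖fderiv ℝ f y b‖ₑ ^ 2) ≤
      (2 + 4 * ‖b‖ₑ ^ 2) * H1 f ^ 2 := by
  have m0 : Measurable fun y => ‖f y‖ₑ ^ 2 := hf.continuous.enorm.measurable.pow_const 2
  have m1 : ∀ i, Measurable fun y => ‖pd i f y‖ₑ ^ 2 :=
    fun i => (continuous_pd hf i).enorm.measurable.pow_const 2
  calc _ ≤ ∫⁻ y in refTriangle, (2 * ‖f y‖ₑ ^ 2 +
        4 * ‖b‖ₑ ^ 2 * (‖pd 0 f y‖ₑ ^ 2 + ‖pd 1 f y‖ₑ ^ 2)) := by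
        refine lintegral_mono fun y => ?_
        refine add_le_add le_rfl ?_
        calc 2 * ‖fderiv ℝ f y b‖ₑ ^ 2 ≤ 2 * (2 * ‖b‖ₑ ^ 2 * (‖pd 0 f y‖ₑ ^ 2 + ‖pd 1 f y‖ₑ ^ 2)) := by
              gcongr; exact enorm_fderiv_apply_sq_le f y b
          _ = _ := by ring
    _ = 2 * nK f ^ 2 + 4 * ‖b‖ₑ ^ 2 * (nK (pd 0 f) ^ 2 + nK (pd 1 f) ^ 2) := by
        rw [lintegral_add_left (m0.const_mul 2), lintegral_const_mul _ m0,
          lintegral_const_mul _ (by exact (m1 0).add (m1 1)), lintegral_add_left (m1 0), nK_sq, nK_sq, nK_sq]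
    _ ≤ (2 + 4 * ‖b‖ₑ ^ 2) * (nK f ^ 2 + (nK (pd 0 f) ^ 2 + nK (pd 1 f) ^ 2)) := by
        rw [mul_add (2 + 4 * ‖b‖ₑ ^ 2)]
        gcongr
        · exact le_self_add
        · exact le_add_self
    _ ≤ _ := by gcongr; exact sum_nK_sq_le f

/-- The trace inequality on one side of a parallelogram in the reference triangle. -/
theorem lintegral_side_le {a b : E2} (h : a 0 * b 1 - a 1 * b 0 ≠ 0) :
    ∃ C : ℝ≥0, ∀ p : E2, (∀ s ∈ Icc (0 : ℝ) 1, ∀ t ∈ Icc (0 : ℝ) 1, p + s • a + t • b ∈ refTriangle) →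
      ∀ f : E2 → ℝ, ContDiff ℝ ∞ f →
      ∫⁻ s in Icc (0 : ℝ) 1, ‖f (p + s • a)‖ₑ ^ 2 ≤ C * H1 f ^ 2 := by
  obtain ⟨C, hC⟩ := lintegral_parallelogram_le h
  refine ⟨C * (2 + 4 * ‖b‖₊ ^ 2), fun p hp f hf => ?_⟩
  have hmeas : Measurable fun y => 2 * ‖f y‖ₑ ^ 2 + 2 * ‖fderiv ℝ f y b‖ₑ ^ 2 := by
    refine ((hf.continuous.enorm.measurable.pow_const 2).const_mul 2).add
      ((Measurable.pow_const ?_ 2).const_mul 2)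
    exact ((hf.continuous_fderiv (by simp)).clm_apply continuous_const).enorm.measurable
  calc ∫⁻ s in Icc (0 : ℝ) 1, ‖f (p + s • a)‖ₑ ^ 2
      ≤ ∫⁻ s in Icc (0 : ℝ) 1, ∫⁻ t in Icc (0 : ℝ) 1, (2 * ‖f (p + s • a + t • b)‖ₑ ^ 2 +
        2 * ‖fderiv ℝ f (p + s • a + t • b) b‖ₑ ^ 2) := by
        refine lintegral_mono fun s => ?_
        -- The one-dimensional inequality is applied along the transversal `b` from each point of
        -- the side.
        have := enorm_le_lintegral_add (fun t => f (p + s • a + t • b))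
          (fun t => fderiv ℝ f (p + s • a + t • b) b) (fun t => ?_) ?_
        · simpa using this
        · have hd : HasDerivAt (fun t : ℝ => p + s • a + t • b) b t := by
            simpa using ((hasDerivAt_id t).smul_const b).const_add (p + s • a)
          exact (hf.differentiable (by simp) _).hasFDerivAt.comp_hasDerivAt t hd
        · have := hf.continuous_fderiv (by simp)
          exact (this.comp (by fun_prop)).clm_apply continuous_const
    _ ≤ C * ∫⁻ y in refTriangle, (2 * ‖f y‖ₑ ^ 2 + 2 * ‖fderiv ℝ f y b‖ₑ ^ 2) := hC p hp _ hmeas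
    _ ≤ C * ((2 + 4 * ‖b‖ₑ ^ 2) * H1 f ^ 2) := by
        gcongr
        exact lintegral_enorm_fderiv_le hf b
    _ = _ := by
        rw [← mul_assoc]
        congr 1

/-- The trace inequality on the half edges of the reference triangle. -/
theorem exists_trace_le : ∃ C : ℝ≥0, ∀ f : E2 → ℝ, ContDiff ℝ ∞ f → ∀ i j,
    eLpNorm (fun s => f (halfEdge i j s)) 2 (volume.restrict (Icc (0 : ℝ) 1)) ≤ C * H1 f := by
  have h : ∀ (i : Fin 3) (j : Fin 2), ∃ C : ℝ≥0, ∀ f : E2 → ℝ, ContDiff ℝ ∞ f →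
      ∫⁻ s in Icc (0 : ℝ) 1, ‖f (halfEdge i j s)‖ₑ ^ 2 ≤ C * H1 f ^ 2 := by
    intro i j
    obtain ⟨C, hC⟩ := lintegral_side_le (a := (1 / 2 : ℝ) • (vtx (i + if j = 0 then 1 else 2) - vtx i))
      (b := (1 / 2 : ℝ) • (vtx (i + if j = 0 then 2 else 1) - vtx i)) (by
        have hi : i = 0 ∨ i = 1 ∨ i = 2 := by omega
        have hj : j = 0 ∨ j = 1 := by omega
        rcases hi with rfl | rfl | rfl <;> rcases hj with rfl | rfl <;>
          simp [vtx, show (1 : Fin 3) + 1 = 2 from rfl,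
            show (1 : Fin 3) + 2 = 0 from rfl, show (2 : Fin 3) + 1 = 0 from rfl,
            show (2 : Fin 3) + 2 = 1 from rfl])
    exact ⟨C, fun f hf => hC (vtx i) (fun s hs t ht => halfEdge_corner_mem i j s hs t ht) f hf⟩
  choose C hC using h
  -- The added 1 makes the constant at least 1, hence at most its own square, as needed because the
  -- inequality is compared after squaring.
  refine ⟨∑ i, ∑ j, C i j + 1, fun f hf i j => ?_⟩
  rw [← ENNReal.pow_le_pow_left_iff (n := 2) (by simp), eLpNorm_two_sq, mul_pow]
  refine (hC i j f hf).trans ?_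
  gcongr
  have hle : C i j ≤ ∑ i, ∑ j, (C i j) + 1 := by
    have h1 : C i j ≤ ∑ j, C i j := Finset.single_le_sum (fun _ _ => zero_le) (Finset.mem_univ j)
    have h2 : ∑ j, C i j ≤ ∑ i, ∑ j, C i j :=
      Finset.single_le_sum (f := fun i => ∑ j, C i j) (fun _ _ => zero_le) (Finset.mem_univ i)
    exact (h1.trans h2).trans (by simp)
  have h1 : (1 : ℝ≥0) ≤ ∑ i, ∑ j, (C i j) + 1 := by simp
  norm_cast
  calc C i j ≤ ∑ i, ∑ j, C i j + 1 := hle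
    _ ≤ (∑ i, ∑ j, C i j + 1) ^ 2 := le_self_pow₀ h1 (by simp)

/-- The Sobolev inequality on the reference triangle. -/
theorem exists_sup_le : ∃ C : ℝ≥0, ∀ f : E2 → ℝ, ContDiff ℝ ∞ f → ∀ x ∈ refTriangle,
    ‖f x‖ₑ ≤ C * H2 f := by
  have h : ∀ (i : Fin 3), ∃ C : ℝ≥0, ∀ f : E2 → ℝ, ContDiff ℝ ∞ f → ∀ x,
      (∀ s ∈ Icc (0 : ℝ) 1, ∀ t ∈ Icc (0 : ℝ) 1,
      x + s • ((1 / 6 : ℝ) • (vtx (i + 1) - vtx i)) + t • ((1 / 6 : ℝ) • (vtx (i + 2) - vtx i))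
        ∈ refTriangle) → ‖f x‖ₑ ^ 2 ≤ C * H2 f ^ 2 := by
    intro i
    set a : E2 := (1 / 6 : ℝ) • (vtx (i + 1) - vtx i) with ha
    set b : E2 := (1 / 6 : ℝ) • (vtx (i + 2) - vtx i) with hb
    obtain ⟨C, hC⟩ := lintegral_side_le (a := a) (b := b) (by
        clear_value a b
        subst ha hb
        have hi : i = 0 ∨ i = 1 ∨ i = 2 := by omega
        rcases hi with rfl | rfl | rfl <;>
          simp [vtx, show (1 : Fin 3) + 1 = 2 from rfl,
            show (1 : Fin 3) + 2 = 0 from rfl, show (2 : Fin 3) + 1 = 0 from rfl,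
            show (2 : Fin 3) + 2 = 1 from rfl])
    refine ⟨(2 + 4 * ‖a‖₊ ^ 2) * C, fun f hf x hx => ?_⟩
    have hpar := hC x hx
    have hm : ∀ g : E2 → ℝ, ContDiff ℝ ∞ g → Measurable fun s : ℝ => ‖g (x + s • a)‖ₑ ^ 2 :=
      fun g hg => ((hg.continuous.comp (by fun_prop :
        Continuous fun s : ℝ => x + s • a)).enorm.measurable.pow_const 2)
    have hle : H1 f ^ 2 + (H1 (pd 0 f) ^ 2 + H1 (pd 1 f) ^ 2) ≤ H2 f ^ 2 := by
      have key : ∀ a b : ℝ≥0∞, a ^ 2 + b ^ 2 ≤ (a + b) ^ 2 := fun a b => by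
        have : (a + b) ^ 2 = a ^ 2 + b ^ 2 + 2 * a * b := by ring
        rw [this]
        exact le_self_add
      rw [H2, add_assoc]
      exact (add_le_add le_rfl (key _ _)).trans (key _ _)
    -- Integrating along `a` bounds the value at `x` by `f` and a first derivative on one side of
    -- the parallelogram. The trace inequality on that side, applied to `f` and to its first
    -- derivatives, costs one further derivative.
    calc ‖f x‖ₑ ^ 2 ≤ ∫⁻ s in Icc (0 : ℝ) 1,
          (2 * ‖f (x + s • a)‖ₑ ^ 2 + 2 * ‖fderiv ℝ f (x + s • a) a‖ₑ ^ 2) := by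
          have := enorm_le_lintegral_add (fun t => f (x + t • a))
            (fun t => fderiv ℝ f (x + t • a) a) (fun t => ?_) ?_
          · simpa using this
          · have hd : HasDerivAt (fun t : ℝ => x + t • a) a t := by
              simpa using ((hasDerivAt_id t).smul_const a).const_add x
            exact (hf.differentiable (by simp) _).hasFDerivAt.comp_hasDerivAt t hd
          · have := hf.continuous_fderiv (by simp)
            exact (this.comp (by fun_prop)).clm_apply continuous_const
      _ ≤ ∫⁻ s in Icc (0 : ℝ) 1, (2 * ‖f (x + s • a)‖ₑ ^ 2 + 4 * ‖a‖ₑ ^ 2 *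
          (‖pd 0 f (x + s • a)‖ₑ ^ 2 + ‖pd 1 f (x + s • a)‖ₑ ^ 2)) := by
          refine lintegral_mono fun s => add_le_add le_rfl ?_
          calc _ ≤ 2 * (2 * ‖a‖ₑ ^ 2 * (‖pd 0 f (x + s • a)‖ₑ ^ 2 + ‖pd 1 f (x + s • a)‖ₑ ^ 2)) := by
                gcongr; exact enorm_fderiv_apply_sq_le f _ a
            _ = _ := by ring
      _ = 2 * (∫⁻ s in Icc (0 : ℝ) 1, ‖f (x + s • a)‖ₑ ^ 2) + 4 * ‖a‖ₑ ^ 2 *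
          ((∫⁻ s in Icc (0 : ℝ) 1, ‖pd 0 f (x + s • a)‖ₑ ^ 2) +
            ∫⁻ s in Icc (0 : ℝ) 1, ‖pd 1 f (x + s • a)‖ₑ ^ 2) := by
          have m0 := hm f hf
          have m1 := hm _ (contDiff_pd hf 0)
          have m2 := hm _ (contDiff_pd hf 1)
          rw [lintegral_add_left (m0.const_mul 2), lintegral_const_mul _ m0,
            lintegral_const_mul _ (by exact m1.add m2), lintegral_add_left m1]
      _ ≤ 2 * (C * H1 f ^ 2) + 4 * ‖a‖ₑ ^ 2 * (C * H1 (pd 0 f) ^ 2 + C * H1 (pd 1 f) ^ 2) := by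
          gcongr
          · exact hpar f hf
          · exact hpar _ (contDiff_pd hf 0)
          · exact hpar _ (contDiff_pd hf 1)
      _ ≤ (2 + 4 * ‖a‖ₑ ^ 2) * (C * H1 f ^ 2 + (C * H1 (pd 0 f) ^ 2 + C * H1 (pd 1 f) ^ 2)) := by
          rw [mul_add (2 + 4 * ‖a‖ₑ ^ 2)]
          gcongr
          · exact le_self_add
          · exact le_add_self
      _ = (2 + 4 * ‖a‖ₑ ^ 2) * C * (H1 f ^ 2 + (H1 (pd 0 f) ^ 2 + H1 (pd 1 f) ^ 2)) := by ring
      _ ≤ (2 + 4 * ‖a‖ₑ ^ 2) * C * H2 f ^ 2 := by gcongr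
      _ = _ := by
        push_cast
        rfl
  choose C hC using h
  refine ⟨∑ i, C i + 1, fun f hf x hx => ?_⟩
  obtain ⟨i, hi⟩ := corner_mem x hx
  rw [← ENNReal.pow_le_pow_left_iff (n := 2) (by simp), mul_pow]
  refine (hC i f hf x hi).trans ?_
  gcongr
  have hle : C i ≤ ∑ i, C i + 1 :=
    (Finset.single_le_sum (fun _ _ => zero_le) (Finset.mem_univ i)).trans (by simp)
  have h1 : (1 : ℝ≥0) ≤ ∑ i, C i + 1 := by simp
  norm_cast
  exact hle.trans (le_self_pow₀ h1 (by simp))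

/-- Fundamental theorem of calculus along the segment from `z` to `x`, then Cauchy–Schwarz. The
factor 8 is `2 * 2 ^ 2`, since points of the triangle are at distance at most 2. -/
theorem enorm_sub_sq_le {f : E2 → ℝ} (hf : ContDiff ℝ ∞ f) {x z : E2} (hx : x ∈ refTriangle)
    (hz : z ∈ refTriangle) :
    ‖f x - f z‖ₑ ^ 2 ≤ ∫⁻ t in Icc (0 : ℝ) 1, 8 *
      (‖pd 0 f ((1 - t) • z + t • x)‖ₑ ^ 2 + ‖pd 1 f ((1 - t) • z + t • x)‖ₑ ^ 2) := by
  have hd : ∀ t : ℝ, HasDerivAt (fun t : ℝ => (1 - t) • z + t • x) (x - z) t := by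
    intro t
    have h1 := (((hasDerivAt_id t).const_sub 1).smul_const z).add ((hasDerivAt_id t).smul_const x)
    refine h1.congr_deriv ?_
    simp [sub_eq_neg_add]
  have hd' : ∀ t : ℝ, HasDerivAt (fun t : ℝ => f ((1 - t) • z + t • x))
      (fderiv ℝ f ((1 - t) • z + t • x) (x - z)) t := fun t =>
    (hf.differentiable (by simp) _).hasFDerivAt.comp_hasDerivAt t (hd t)
  have hcont : Continuous fun t : ℝ => fderiv ℝ f ((1 - t) • z + t • x) (x - z) := by
    have := hf.continuous_fderiv (by simp)
    exact (this.comp (by fun_prop)).clm_apply continuous_const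
  have hftc : f x - f z = ∫ t in (0 : ℝ)..1, fderiv ℝ f ((1 - t) • z + t • x) (x - z) := by
    rw [intervalIntegral.integral_eq_sub_of_hasDerivAt (fun t _ => hd' t)
      (hcont.intervalIntegrable _ _)]
    simp
  have hb : ‖f x - f z‖ₑ ≤ ∫⁻ t in Icc (0 : ℝ) 1, ‖fderiv ℝ f ((1 - t) • z + t • x) (x - z)‖ₑ := by
    rw [hftc, intervalIntegral.integral_of_le zero_le_one]
    exact (enorm_integral_le_lintegral_enorm _).trans (lintegral_mono_set Ioc_subset_Icc_self)
  have hxz : ‖x - z‖ₑ ≤ 2 := by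
    calc ‖x - z‖ₑ = ENNReal.ofReal ‖x - z‖ := (ofReal_norm _).symm
      _ ≤ ENNReal.ofReal 2 := by
        refine ENNReal.ofReal_le_ofReal ((norm_sub_le _ _).trans ?_)
        linarith [norm_le_of_mem_refTriangle hx, norm_le_of_mem_refTriangle hz]
      _ = 2 := by simp
  calc ‖f x - f z‖ₑ ^ 2 ≤ _ := pow_le_pow_left' hb 2
    _ ≤ _ := sq_lintegral_le _ _ hcont.enorm.measurable.aemeasurable
    _ ≤ _ := by
      simp only [Measure.restrict_apply_univ, Real.volume_Icc, sub_zero, ENNReal.ofReal_one, one_mul]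
      refine lintegral_mono fun t => ?_
      refine (enorm_fderiv_apply_sq_le f _ _).trans ?_
      gcongr
      calc 2 * ‖x - z‖ₑ ^ 2 ≤ 2 * 2 ^ 2 := by gcongr
        _ = 8 := by norm_num

/-- The Poincaré inequality on the reference triangle. -/
theorem exists_poincare : ∃ C : ℝ≥0, ∀ f : E2 → ℝ, ContDiff ℝ ∞ f → ∃ c : ℝ,
    nK (fun x => f x - c) ≤ C * (nK (pd 0 f) + nK (pd 1 f)) := by
  -- 32 is 8 from `enorm_sub_sq_le` times 4, the largest inverse Jacobian of a contraction of ratio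
  -- at least 1/2. The subtracted constant is the mean value of `f`.
  refine ⟨32, fun f hf => ?_⟩
  set V := volume refTriangle with hV
  have hV0 : V ≠ 0 := volume_refTriangle_ne_zero
  have hVt : V ≠ ⊤ := volume_refTriangle_lt_top.ne
  have hint : IntegrableOn f refTriangle := hf.continuous.continuousOn.integrableOn_compact
    isCompact_refTriangle
  refine ⟨(V.toReal)⁻¹ * ∫ z in refTriangle, f z, ?_⟩
  set c := (V.toReal)⁻¹ * ∫ z in refTriangle, f z with hc
  set Ψ : E2 → ℝ≥0∞ := fun y => ‖pd 0 f y‖ₑ ^ 2 + ‖pd 1 f y‖ₑ ^ 2 with hΨ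
  have hΨm : Measurable Ψ := ((continuous_pd hf 0).enorm.measurable.pow_const 2).add
    ((continuous_pd hf 1).enorm.measurable.pow_const 2)
  have hVr : V.toReal ≠ 0 := (ENNReal.toReal_pos hV0 hVt).ne'
  -- pointwise bound by the mean over pairs
  have h1 : ∀ x ∈ refTriangle, ‖f x - c‖ₑ ^ 2 ≤ V⁻¹ * ∫⁻ z in refTriangle, ‖f x - f z‖ₑ ^ 2 := by
    intro x hx
    have e1 : f x - c = (V.toReal)⁻¹ * ∫ z in refTriangle, (f x - f z) := by
      rw [integral_sub (integrable_const _) hint, integral_const, hc, mul_sub]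
      simp only [smul_eq_mul, Measure.real, Measure.restrict_apply_univ]
      rw [← hV, ← mul_assoc, inv_mul_cancel₀ hVr, one_mul]
    have e2 : ‖f x - c‖ₑ ≤ V⁻¹ * ∫⁻ z in refTriangle, ‖f x - f z‖ₑ := by
      rw [e1, enorm_mul]
      refine mul_le_mul' (le_of_eq ?_) (enorm_integral_le_lintegral_enorm _)
      rw [Real.enorm_eq_ofReal (by positivity), ENNReal.ofReal_inv_of_pos (ENNReal.toReal_pos hV0 hVt),
        ENNReal.ofReal_toReal hVt]
    have hm : AEMeasurable (fun z => ‖f x - f z‖ₑ) (volume.restrict refTriangle) :=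
      (continuous_const.sub hf.continuous).enorm.measurable.aemeasurable
    calc ‖f x - c‖ₑ ^ 2 ≤ (V⁻¹ * ∫⁻ z in refTriangle, ‖f x - f z‖ₑ) ^ 2 := by gcongr
      _ = V⁻¹ ^ 2 * (∫⁻ z in refTriangle, ‖f x - f z‖ₑ) ^ 2 := mul_pow _ _ _
      _ ≤ V⁻¹ ^ 2 * (V * ∫⁻ z in refTriangle, ‖f x - f z‖ₑ ^ 2) := by
          gcongr
          simpa using sq_lintegral_le _ _ hm
      _ = (V⁻¹ * V) * (V⁻¹ * ∫⁻ z in refTriangle, ‖f x - f z‖ₑ ^ 2) := by ring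
      _ = _ := by rw [ENNReal.inv_mul_cancel hV0 hVt, one_mul]
  have hmeas3 : Measurable fun q : (E2 × E2) × ℝ => Ψ ((1 - q.2) • q.1.2 + q.2 • q.1.1) :=
    hΨm.comp (by fun_prop)
  have h2 : ∀ t ∈ Icc (0 : ℝ) 1,
      ∫⁻ x in refTriangle, ∫⁻ z in refTriangle, Ψ ((1 - t) • z + t • x) ≤
        4 * V * ∫⁻ y in refTriangle, Ψ y := by
    intro t ht
    have hm2 : Measurable fun q : E2 × E2 => Ψ ((1 - t) • q.2 + t • q.1) := hΨm.comp (by fun_prop)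
    -- The point `(1 - t) z + t x` is a contraction in `z` of ratio `1 - t` and in `x` of ratio `t`.
    -- Integrating in the variable with ratio at least 1/2 avoids the singular Jacobian at `t = 0`
    -- and `t = 1`.
    rcases le_total t (1 / 2) with hle | hle
    · have hx : ∀ x ∈ refTriangle, ∫⁻ z in refTriangle, Ψ ((1 - t) • z + t • x) ≤
          4 * ∫⁻ y in refTriangle, Ψ y := by
        intro x hx
        have := lintegral_contract_le Ψ hx (t := 1 - t) (by linarith) (by linarith [ht.1])
        simp only [sub_sub_cancel] at this
        calc _ = ∫⁻ z in refTriangle, Ψ (t • x + (1 - t) • z) := by simp [add_comm]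
          _ ≤ _ := this
          _ ≤ _ := by
            gcongr
            rw [show (4 : ℝ≥0∞) = ENNReal.ofReal 4 by simp]
            refine ENNReal.ofReal_le_ofReal ?_
            have : (1 - t)⁻¹ ≤ 2 := by
              rw [inv_le_comm₀ (by linarith) (by norm_num)]
              linarith
            have h0 : 0 ≤ (1 - t)⁻¹ := inv_nonneg.2 (by linarith)
            nlinarith
      calc _ ≤ ∫⁻ x in refTriangle, 4 * ∫⁻ y in refTriangle, Ψ y :=
            setLIntegral_mono' measurableSet_refTriangle hx
        _ = _ := by
          rw [lintegral_const, Measure.restrict_apply_univ]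
          ring
    · rw [lintegral_lintegral_swap hm2.aemeasurable]
      have hz : ∀ z ∈ refTriangle, ∫⁻ x in refTriangle, Ψ ((1 - t) • z + t • x) ≤
          4 * ∫⁻ y in refTriangle, Ψ y := by
        intro z hz
        refine (lintegral_contract_le Ψ hz (t := t) (by linarith) ht.2).trans ?_
        gcongr
        rw [show (4 : ℝ≥0∞) = ENNReal.ofReal 4 by simp]
        refine ENNReal.ofReal_le_ofReal ?_
        have : t⁻¹ ≤ 2 := by
          rw [inv_le_comm₀ (by linarith) (by norm_num)]
          linarith
        have h0 : 0 ≤ t⁻¹ := inv_nonneg.2 (by linarith)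
        nlinarith
      calc _ ≤ ∫⁻ z in refTriangle, 4 * ∫⁻ y in refTriangle, Ψ y :=
            setLIntegral_mono' measurableSet_refTriangle hz
        _ = _ := by
          rw [lintegral_const, Measure.restrict_apply_univ]
          ring
  have hdiff : ∫⁻ x in refTriangle, ∫⁻ z in refTriangle, ‖f x - f z‖ₑ ^ 2 ≤
      32 * V * ∫⁻ y in refTriangle, Ψ y := by
    calc _ ≤ ∫⁻ x in refTriangle, ∫⁻ z in refTriangle, ∫⁻ t in Icc (0 : ℝ) 1,
          8 * Ψ ((1 - t) • z + t • x) :=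
          setLIntegral_mono' measurableSet_refTriangle fun x hx =>
            setLIntegral_mono' measurableSet_refTriangle fun z hz => enorm_sub_sq_le hf hx hz
      _ = ∫⁻ x in refTriangle, ∫⁻ t in Icc (0 : ℝ) 1, ∫⁻ z in refTriangle,
          8 * Ψ ((1 - t) • z + t • x) := by
          congr 1
          ext x
          have hm : Measurable fun q : E2 × ℝ => 8 * Ψ ((1 - q.2) • q.1 + q.2 • x) :=
            (hΨm.comp (by fun_prop)).const_mul 8
          exact lintegral_lintegral_swap hm.aemeasurable
      _ = ∫⁻ t in Icc (0 : ℝ) 1, ∫⁻ x in refTriangle, ∫⁻ z in refTriangle,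
          8 * Ψ ((1 - t) • z + t • x) := by
          have hm : Measurable fun q : (E2 × ℝ) × E2 => 8 * Ψ ((1 - q.1.2) • q.2 + q.1.2 • q.1.1) :=
            (hΨm.comp (by fun_prop)).const_mul 8
          exact lintegral_lintegral_swap (hm.lintegral_prod_right').aemeasurable
      _ = ∫⁻ t in Icc (0 : ℝ) 1, 8 * ∫⁻ x in refTriangle, ∫⁻ z in refTriangle,
          Ψ ((1 - t) • z + t • x) := by
          congr 1
          ext t
          rw [← lintegral_const_mul' _ _ (by simp)]
          congr 1
          ext x
          rw [← lintegral_const_mul' _ _ (by simp)]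
      _ ≤ ∫⁻ t in Icc (0 : ℝ) 1, 8 * (4 * V * ∫⁻ y in refTriangle, Ψ y) :=
          setLIntegral_mono' measurableSet_Icc fun t ht => mul_le_mul' le_rfl (h2 t ht)
      _ = _ := by
          simp only [lintegral_const, Measure.restrict_apply_univ, Real.volume_Icc, sub_zero,
            ENNReal.ofReal_one, mul_one]
          rw [← mul_assoc, ← mul_assoc]
          norm_num
  rw [← ENNReal.pow_le_pow_left_iff (n := 2) (by simp), nK_sq]
  calc ∫⁻ x in refTriangle, ‖f x - c‖ₑ ^ 2
      ≤ ∫⁻ x in refTriangle, V⁻¹ * ∫⁻ z in refTriangle, ‖f x - f z‖ₑ ^ 2 :=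
        setLIntegral_mono' measurableSet_refTriangle h1
    _ = V⁻¹ * ∫⁻ x in refTriangle, ∫⁻ z in refTriangle, ‖f x - f z‖ₑ ^ 2 :=
        lintegral_const_mul' _ _ (by simp [hV0])
    _ ≤ V⁻¹ * (32 * V * ∫⁻ y in refTriangle, Ψ y) := by gcongr
    _ = (V⁻¹ * V) * (32 * ∫⁻ y in refTriangle, Ψ y) := by ring
    _ = 32 * (nK (pd 0 f) ^ 2 + nK (pd 1 f) ^ 2) := by
        rw [ENNReal.inv_mul_cancel hV0 hVt, one_mul, hΨ,
          lintegral_add_left ((continuous_pd hf 0).enorm.measurable.pow_const 2), nK_sq, nK_sq]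
    _ ≤ 32 ^ 2 * (nK (pd 0 f) + nK (pd 1 f)) ^ 2 := by
        refine mul_le_mul' (by norm_num) ?_
        rw [add_sq, add_right_comm]
        exact le_self_add
    _ = _ := by rw [mul_pow]; rfl

/-! ### Higher partial derivatives and polynomials -/

/-- The partial derivative `∂₀ᵃ ∂₁ᵇ f`. -/
def D (a b : ℕ) (f : E2 → ℝ) : E2 → ℝ := (pd 0)^[a] ((pd 1)^[b] f)

theorem contDiff_iterate_pd {f : E2 → ℝ} (hf : ContDiff ℝ ∞ f) (i : Fin 2) (n : ℕ) :
    ContDiff ℝ ∞ ((pd i)^[n] f) := by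
  induction n with
  | zero => exact hf
  | succ n ih =>
    rw [Function.iterate_succ_apply']
    exact contDiff_pd ih i

theorem contDiff_D {f : E2 → ℝ} (hf : ContDiff ℝ ∞ f) (a b : ℕ) : ContDiff ℝ ∞ (D a b f) :=
  contDiff_iterate_pd (contDiff_iterate_pd hf 1 b) 0 a

theorem pd_zero_D (a b : ℕ) (f : E2 → ℝ) : pd 0 (D a b f) = D (a + 1) b f := by
  rw [D, D, Function.iterate_succ_apply']

theorem pd_one_iterate {f : E2 → ℝ} (hf : ContDiff ℝ ∞ f) (n : ℕ) :
    pd 1 ((pd 0)^[n] f) = (pd 0)^[n] (pd 1 f) := by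
  induction n with
  | zero => rfl
  | succ n ih =>
    rw [Function.iterate_succ_apply', Function.iterate_succ_apply', ← ih,
      pd_comm (contDiff_iterate_pd hf 0 n)]

theorem pd_one_D {f : E2 → ℝ} (hf : ContDiff ℝ ∞ f) (a b : ℕ) : pd 1 (D a b f) = D a (b + 1) f := by
  rw [D, D, pd_one_iterate (contDiff_iterate_pd hf 1 b), Function.iterate_succ_apply']

theorem iterate_pd_add {f g : E2 → ℝ} (hf : ContDiff ℝ ∞ f) (hg : ContDiff ℝ ∞ g) (i : Fin 2)
    (n : ℕ) : (pd i)^[n] (f + g) = (pd i)^[n] f + (pd i)^[n] g := by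
  induction n with
  | zero => rfl
  | succ n ih =>
    simp only [Function.iterate_succ_apply']
    rw [ih, pd_add (contDiff_iterate_pd hf i n) (contDiff_iterate_pd hg i n)]

theorem iterate_pd_const_mul {f : E2 → ℝ} (hf : ContDiff ℝ ∞ f) (c : ℝ) (i : Fin 2)
    (n : ℕ) : (pd i)^[n] (fun x => c * f x) = fun x => c * (pd i)^[n] f x := by
  induction n with
  | zero => rfl
  | succ n ih =>
    simp only [Function.iterate_succ_apply']
    rw [ih, pd_const_mul (contDiff_iterate_pd hf i n)]

theorem D_add {f g : E2 → ℝ} (hf : ContDiff ℝ ∞ f) (hg : ContDiff ℝ ∞ g) (a b : ℕ) :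
    D a b (f + g) = D a b f + D a b g := by
  rw [D, iterate_pd_add hf hg, iterate_pd_add (contDiff_iterate_pd hf 1 b)
    (contDiff_iterate_pd hg 1 b)]
  rfl

theorem D_const_mul {f : E2 → ℝ} (hf : ContDiff ℝ ∞ f) (c : ℝ) (a b : ℕ) :
    D a b (fun x => c * f x) = fun x => c * D a b f x := by
  rw [D, iterate_pd_const_mul hf, iterate_pd_const_mul (contDiff_iterate_pd hf 1 b)]
  rfl

theorem D_sub {f g : E2 → ℝ} (hf : ContDiff ℝ ∞ f) (hg : ContDiff ℝ ∞ g) (a b : ℕ) :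
    D a b (f - g) = D a b f - D a b g := by
  have h : f = (f - g) + g := by simp
  conv_rhs => rw [h, D_add (f := f - g) (hf.sub hg) hg]
  simp

theorem D_zero (a b : ℕ) : D a b (0 : E2 → ℝ) = 0 := by
  have := D_const_mul (contDiff_const (c := (0 : ℝ)) : ContDiff ℝ ∞ (fun _ : E2 => (0 : ℝ))) 0 a b
  simp only [zero_mul] at this
  exact this

theorem D_finset_sum {ι : Type*} (s : Finset ι) (f : ι → E2 → ℝ) (hf : ∀ i ∈ s, ContDiff ℝ ∞ (f i))
    (a b : ℕ) : D a b (fun x => ∑ i ∈ s, f i x) = fun x => ∑ i ∈ s, D a b (f i) x := by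
  classical
  induction s using Finset.induction_on with
  | empty =>
    simp only [Finset.sum_empty]
    exact D_zero a b
  | insert i s his ih =>
    simp only [Finset.sum_insert his]
    have h1 : ContDiff ℝ ∞ fun x => ∑ j ∈ s, f j x :=
      ContDiff.sum fun j hj => hf j (Finset.mem_insert_of_mem hj)
    have := D_add (hf i (Finset.mem_insert_self i s)) h1 a b
    rw [ih fun j hj => hf j (Finset.mem_insert_of_mem hj)] at this
    exact this

theorem contDiff_polyEval (q : MvPolynomial (Fin 2) ℝ) : ContDiff ℝ ∞ (polyEval q) := by
  induction q using MvPolynomial.induction_on with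
  | C c =>
    have : polyEval (MvPolynomial.C c) = fun _ => c := by ext; simp [polyEval]
    rw [this]
    exact contDiff_const
  | add p q hp hq =>
    have : polyEval (p + q) = fun y => polyEval p y + polyEval q y := by ext; simp [polyEval]
    rw [this]
    exact hp.add hq
  | mul_X p i hp =>
    have : polyEval (p * MvPolynomial.X i) = fun y => polyEval p y * y i := by ext; simp [polyEval]
    rw [this]
    exact hp.mul (EuclideanSpace.proj i : E2 →L[ℝ] ℝ).contDiff

/-- The normalised monomial `x₀ⁱ x₁ʲ / (i! j!)`. -/
def mono (i j : ℕ) (y : E2) : ℝ := y 0 ^ i / i.factorial * (y 1 ^ j / j.factorial)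

theorem hasFDerivAt_coord_pow (i : Fin 2) (n : ℕ) (y : E2) :
    HasFDerivAt (fun y : E2 => y i ^ (n + 1) / (n + 1).factorial)
      ((y i ^ n / n.factorial) • (EuclideanSpace.proj i : E2 →L[ℝ] ℝ)) y := by
  have h := (((EuclideanSpace.proj i : E2 →L[ℝ] ℝ).hasFDerivAt (x := y)).pow (n + 1)).mul_const
    (((n + 1).factorial : ℝ)⁻¹)
  refine h.congr_fderiv ?_
  ext v
  simp [Nat.factorial_succ]
  have h1 : (n.factorial : ℝ) ≠ 0 := by exact_mod_cast n.factorial_ne_zero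
  have h2 : (n : ℝ) + 1 ≠ 0 := by positivity
  field_simp

theorem contDiff_mono (i j : ℕ) : ContDiff ℝ ∞ (mono i j) := by
  unfold mono
  have h : ∀ i : Fin 2, ContDiff ℝ ∞ fun y : E2 => y i :=
    fun i => (EuclideanSpace.proj i : E2 →L[ℝ] ℝ).contDiff
  exact (((h 0).pow i).div_const _).mul (((h 1).pow j).div_const _)

theorem differentiable_coord_pow (i : Fin 2) (n : ℕ) :
    Differentiable ℝ fun y : E2 => y i ^ n / n.factorial := by
  have h : ContDiff ℝ ∞ fun y : E2 => y i := (EuclideanSpace.proj i : E2 →L[ℝ] ℝ).contDiff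
  exact ((h.pow n).div_const _).differentiable (by simp)

theorem fderiv_coord_pow_of_ne {i l : Fin 2} (h : i ≠ l) (n : ℕ) (y : E2) :
    fderiv ℝ (fun y : E2 => y i ^ n / n.factorial) y (eb l) = 0 := by
  cases n with
  | zero => simp
  | succ n => rw [(hasFDerivAt_coord_pow i n y).fderiv]; simp [eb, h]

theorem pd_zero_mono (i j : ℕ) : pd 0 (mono (i + 1) j) = mono i j := by
  ext y
  change fderiv ℝ (fun y : E2 => y 0 ^ (i + 1) / (Nat.factorial (i + 1) : ℝ) *
    (y 1 ^ (j) / (Nat.factorial (j) : ℝ))) y (eb 0) = _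
  rw [fderiv_fun_mul (differentiable_coord_pow 0 _ y) (differentiable_coord_pow 1 _ y)]
  simp only [add_apply, smul_apply]
  rw [fderiv_coord_pow_of_ne (by simp), (hasFDerivAt_coord_pow 0 i y).fderiv]
  simp [eb, mono, mul_comm]

theorem pd_one_mono (i j : ℕ) : pd 1 (mono i (j + 1)) = mono i j := by
  ext y
  change fderiv ℝ (fun y : E2 => y 0 ^ (i) / (Nat.factorial (i) : ℝ) *
    (y 1 ^ (j + 1) / (Nat.factorial (j + 1) : ℝ))) y (eb 1) = _
  rw [fderiv_fun_mul (differentiable_coord_pow 0 _ y) (differentiable_coord_pow 1 _ y)]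
  simp only [add_apply, smul_apply]
  rw [fderiv_coord_pow_of_ne (i := 0) (by simp), (hasFDerivAt_coord_pow 1 j y).fderiv]
  simp [eb, mono]

theorem pd_zero_mono_zero (j : ℕ) : pd 0 (mono 0 j) = 0 := by
  ext y
  change fderiv ℝ (fun y : E2 => y 0 ^ (0) / (Nat.factorial (0) : ℝ) *
    (y 1 ^ (j) / (Nat.factorial (j) : ℝ))) y (eb 0) = _
  rw [fderiv_fun_mul (differentiable_coord_pow 0 _ y) (differentiable_coord_pow 1 _ y)]
  simp only [add_apply, smul_apply]
  rw [fderiv_coord_pow_of_ne (by simp)]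
  simp

theorem pd_one_mono_zero (i : ℕ) : pd 1 (mono i 0) = 0 := by
  ext y
  change fderiv ℝ (fun y : E2 => y 0 ^ (i) / (Nat.factorial (i) : ℝ) *
    (y 1 ^ (0) / (Nat.factorial (0) : ℝ))) y (eb 1) = _
  rw [fderiv_fun_mul (differentiable_coord_pow 0 _ y) (differentiable_coord_pow 1 _ y)]
  simp only [add_apply, smul_apply]
  rw [fderiv_coord_pow_of_ne (i := 0) (by simp)]
  simp

theorem iterate_pd_one_mono (i j b : ℕ) :
    (pd 1)^[b] (mono i j) = if b ≤ j then mono i (j - b) else 0 := by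
  induction b with
  | zero => simp
  | succ b ih =>
    rw [Function.iterate_succ_apply', ih]
    split_ifs with h1 h2 h2
    · obtain ⟨c, hc⟩ : ∃ c, j - b = c + 1 := ⟨j - b - 1, by omega⟩
      rw [hc, pd_one_mono]
      congr 1
      omega
    · rw [show j - b = 0 by omega, pd_one_mono_zero]
    · omega
    · exact D_zero 0 1

theorem D_mono (i j a b : ℕ) :
    D a b (mono i j) = if a ≤ i ∧ b ≤ j then mono (i - a) (j - b) else 0 := by
  rw [D, iterate_pd_one_mono]
  by_cases hb : b ≤ j
  · simp only [hb, if_true, and_true]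
    induction a with
    | zero => simp
    | succ a ih =>
      rw [Function.iterate_succ_apply', ih]
      split_ifs with h1 h2 h2
      · obtain ⟨c, hc⟩ : ∃ c, i - a = c + 1 := ⟨i - a - 1, by omega⟩
        rw [hc, pd_zero_mono]
        congr 1
        omega
      · rw [show i - a = 0 by omega, pd_zero_mono_zero]
      · omega
      · exact D_zero 1 0
  · simp only [hb, if_false, and_false]
    exact D_zero a 0

theorem mono_eq_polyEval (i j : ℕ) : mono i j = polyEval
    (MvPolynomial.C ((i.factorial : ℝ)⁻¹ * (j.factorial : ℝ)⁻¹) *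
      (MvPolynomial.X 0 ^ i * MvPolynomial.X 1 ^ j)) := by
  ext y
  simp [mono, polyEval]
  ring

/-- Among monomials normalised by factorials, the derivative `D a b` with `a + b = m` sends exactly
one of degree `m` to 1 and the others to 0. So the prescribed top derivatives are the coefficients
of a homogeneous polynomial, and higher derivatives vanish. -/
theorem exists_poly_top (m : ℕ) (c : ℕ → ℕ → ℝ) : ∃ q : MvPolynomial (Fin 2) ℝ,
    q.totalDegree ≤ m ∧ (∀ a b, a + b = m → D a b (polyEval q) = fun _ => c a b) ∧
    ∀ a b, m + 1 ≤ a + b → D a b (polyEval q) = 0 := by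
  set P : ℕ → MvPolynomial (Fin 2) ℝ := fun i =>
    MvPolynomial.C (c i (m - i)) * (MvPolynomial.C ((i.factorial : ℝ)⁻¹ * ((m - i).factorial : ℝ)⁻¹) *
      (MvPolynomial.X 0 ^ i * MvPolynomial.X 1 ^ (m - i))) with hP
  have heval : polyEval (∑ i ∈ Finset.range (m + 1), P i) =
      fun y => ∑ i ∈ Finset.range (m + 1), c i (m - i) * mono i (m - i) y := by
    ext y
    simp only [mono_eq_polyEval, hP, polyEval, map_sum, map_mul, MvPolynomial.eval_C]
  have hD : ∀ a b, D a b (polyEval (∑ i ∈ Finset.range (m + 1), P i)) =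
      fun y => ∑ i ∈ Finset.range (m + 1), c i (m - i) * D a b (mono i (m - i)) y := by
    intro a b
    rw [heval, D_finset_sum _ _ fun i _ => contDiff_const.mul (contDiff_mono _ _)]
    simp only [D_const_mul (contDiff_mono _ _)]
  refine ⟨∑ i ∈ Finset.range (m + 1), P i, ?_, ?_, ?_⟩
  · refine (MvPolynomial.totalDegree_finsetSum _ _).trans (Finset.sup_le fun i hi => ?_)
    rw [Finset.mem_range] at hi
    simp only [hP]
    refine (MvPolynomial.totalDegree_mul _ _).trans ?_
    rw [MvPolynomial.totalDegree_C, zero_add]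
    refine (MvPolynomial.totalDegree_mul _ _).trans ?_
    rw [MvPolynomial.totalDegree_C, zero_add]
    refine (MvPolynomial.totalDegree_mul _ _).trans ?_
    rw [MvPolynomial.totalDegree_X_pow, MvPolynomial.totalDegree_X_pow]
    omega
  · intro a b hab
    rw [hD]
    ext y
    rw [Finset.sum_eq_single a]
    · obtain rfl : b = m - a := by omega
      rw [D_mono]
      simp [mono]
    · intro i hi hia
      rw [Finset.mem_range] at hi
      rw [D_mono, if_neg (by omega)]
      simp
    · intro ha
      rw [Finset.mem_range] at ha
      omega
  · intro a b hab
    rw [hD]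
    ext y
    refine Finset.sum_eq_zero fun i hi => ?_
    rw [Finset.mem_range] at hi
    rw [D_mono, if_neg (by omega)]
    simp

theorem polyEval_add (p q : MvPolynomial (Fin 2) ℝ) : polyEval (p + q) = polyEval p + polyEval q := by
  ext
  simp [polyEval]

/-- The Bramble–Hilbert lemma on the reference triangle. -/
theorem exists_bramble_hilbert (m : ℕ) : ∃ C : ℝ≥0, ∀ f : E2 → ℝ, ContDiff ℝ ∞ f → ∀ M : ℝ≥0∞,
    (∀ a b, a + b = m → nK (D a b f) ≤ M) → ∃ q : MvPolynomial (Fin 2) ℝ,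
      q.totalDegree ≤ m - 1 ∧ (∀ a b, m ≤ a + b → D a b (polyEval q) = 0) ∧
      ∀ a b, a + b ≤ m → nK (D a b (f - polyEval q)) ≤ C * M := by
  induction m with
  | zero =>
    -- With truncated subtraction the degree bound `m - 1` is 0 for `m = 0`; the zero polynomial is
    -- taken, and it also satisfies the vanishing condition, which here starts at order 0.
    refine ⟨1, fun f hf M hM => ⟨0, by simp, ?_, ?_⟩⟩
    · intro a b _
      have : polyEval 0 = 0 := by ext; simp [polyEval]
      rw [this, D_zero]
    · intro a b hab
      have : polyEval 0 = 0 := by ext; simp [polyEval]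
      rw [this, sub_zero]
      simpa using hM a b (by omega)
  | succ m ih =>
    obtain ⟨C, hC⟩ := ih
    obtain ⟨P, hP⟩ := exists_poincare
    refine ⟨C * (P * 2) + 1, fun f hf M hM => ?_⟩
    -- The Poincaré constants of the derivatives of order `m` are realised as the top derivatives of
    -- a homogeneous polynomial `q`. After subtracting `q`, the derivatives of order `m` are
    -- controlled by those of order `m + 1`, and the induction hypothesis supplies the lower part of
    -- the polynomial.
    choose c hc using fun a b => hP (D a b f) (contDiff_D hf a b)
    obtain ⟨q, hq1, hq2, hq3⟩ := exists_poly_top m c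
    have hqs := contDiff_polyEval q
    obtain ⟨r, hr1, hr2, hr3⟩ := hC (f - polyEval q) (hf.sub hqs) (P * 2 * M) (by
      intro a b hab
      rw [D_sub hf hqs, hq2 a b hab]
      refine (hc a b).trans ?_
      rw [mul_assoc, two_mul]
      gcongr
      · rw [pd_zero_D]; exact hM _ _ (by omega)
      · rw [pd_one_D hf]; exact hM _ _ (by omega))
    have hrs := contDiff_polyEval r
    refine ⟨q + r, ?_, ?_, ?_⟩
    · refine (MvPolynomial.totalDegree_add _ _).trans (max_le ?_ ?_) <;> omega
    · intro a b hab
      rw [polyEval_add, D_add hqs hrs, hq3 a b hab, hr2 a b (by omega), add_zero]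
    · intro a b hab
      rcases Nat.lt_or_ge (a + b) (m + 1) with h | h
      · rw [polyEval_add, ← sub_sub]
        refine (hr3 a b (by omega)).trans ?_
        rw [← mul_assoc]
        gcongr
        push_cast
        exact le_self_add
      · rw [polyEval_add, D_sub (g := polyEval q + polyEval r) hf (hqs.add hrs), D_add hqs hrs, hq3 a b h, hr2 a b (by omega),
          add_zero, sub_zero]
        refine (hM a b (by omega)).trans ?_
        push_cast
        rw [add_mul, one_mul]
        exact le_add_self

/-! ### Uniform bounds of scaled derivatives -/

/-- All partial derivatives `∂₀ᵃ ∂₁ᵇ f`, `a + b ≤ n`, are bounded by `A hᵃ⁺ᵇ` on the reference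
triangle. -/
def BdK (n : ℕ) (h A : ℝ) (f : E2 → ℝ) : Prop :=
  ∀ a b, a + b ≤ n → ∀ x ∈ refTriangle, |D a b f x| ≤ A * h ^ (a + b)

theorem D_pd_zero {f : E2 → ℝ} (hf : ContDiff ℝ ∞ f) (a b : ℕ) : D a b (pd 0 f) = D (a + 1) b f := by
  have key : ∀ n, (pd 1)^[n] (pd 0 f) = pd 0 ((pd 1)^[n] f) := by
    intro n
    induction n with
    | zero => rfl
    | succ n ih =>
      rw [Function.iterate_succ_apply', ih, Function.iterate_succ_apply',
        pd_comm (contDiff_iterate_pd hf 1 n)]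
  rw [D, D, key, ← Function.iterate_succ_apply]

theorem D_pd_one (f : E2 → ℝ) (a b : ℕ) : D a b (pd 1 f) = D a (b + 1) f := by
  rw [D, D, ← Function.iterate_succ_apply]

theorem bdK_zero_iff {h A : ℝ} {f : E2 → ℝ} : BdK 0 h A f ↔ ∀ x ∈ refTriangle, |f x| ≤ A := by
  constructor
  · intro H x hx
    simpa [D] using H 0 0 le_rfl x hx
  · intro H a b hab x hx
    obtain ⟨rfl, rfl⟩ : a = 0 ∧ b = 0 := by omega
    simpa [D] using H x hx

/-- Each derivative carries one factor `h`, which moves into the constant. This form makes induction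
on the order possible for products and compositions. -/
theorem bdK_succ_iff {n : ℕ} {h A : ℝ} {f : E2 → ℝ} (hf : ContDiff ℝ ∞ f) :
    BdK (n + 1) h A f ↔ (∀ x ∈ refTriangle, |f x| ≤ A) ∧ ∀ i, BdK n h (A * h) (pd i f) := by
  constructor
  · intro H
    refine ⟨fun x hx => by simpa [D] using H 0 0 (by omega) x hx, fun i a b hab x hx => ?_⟩
    have hi : i = 0 ∨ i = 1 := by omega
    rcases hi with rfl | rfl
    · rw [D_pd_zero hf]
      refine (H (a + 1) b (by omega) x hx).trans_eq ?_
      ring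
    · rw [D_pd_one]
      refine (H a (b + 1) (by omega) x hx).trans_eq ?_
      ring
  · rintro ⟨H0, H1⟩ a b hab x hx
    rcases a with _ | a
    · rcases b with _ | b
      · simpa [D] using H0 x hx
      · rw [← D_pd_one]
        refine (H1 1 0 b (by omega) x hx).trans_eq ?_
        ring
    · rw [← D_pd_zero hf]
      refine (H1 0 a b (by omega) x hx).trans_eq ?_
      ring

theorem BdK.of_le {n n' : ℕ} {h A : ℝ} {f : E2 → ℝ} (H : BdK n h A f) (hn : n' ≤ n) :
    BdK n' h A f := fun a b hab => H a b (hab.trans hn)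

theorem BdK.mono {n : ℕ} {h A A' : ℝ} (hh : 0 ≤ h) {f : E2 → ℝ} (H : BdK n h A f) (hA : A ≤ A') :
    BdK n h A' f := fun a b hab x hx => (H a b hab x hx).trans (by gcongr)

theorem BdK.nonneg {n : ℕ} {h A : ℝ} {f : E2 → ℝ} (H : BdK n h A f) : 0 ≤ A := by
  have := H 0 0 (by omega) centre (interior_subset centre_mem)
  simpa using (abs_nonneg _).trans this

theorem BdK.add {n : ℕ} {h A B : ℝ} {f g : E2 → ℝ} (hf : ContDiff ℝ ∞ f) (hg : ContDiff ℝ ∞ g)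
    (H : BdK n h A f) (H' : BdK n h B g) : BdK n h (A + B) (fun x => f x + g x) := by
  intro a b hab x hx
  have := D_add hf hg a b
  change |D a b (f + g) x| ≤ _
  rw [this, add_mul]
  exact (abs_add_le _ _).trans (add_le_add (H a b hab x hx) (H' a b hab x hx))

theorem BdK.sum {ι : Type*} (s : Finset ι) {n : ℕ} {h : ℝ} {A : ι → ℝ} {f : ι → E2 → ℝ}
    (hf : ∀ i ∈ s, ContDiff ℝ ∞ (f i)) (H : ∀ i ∈ s, BdK n h (A i) (f i)) :
    BdK n h (∑ i ∈ s, A i) (fun x => ∑ i ∈ s, f i x) := by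
  intro a b hab x hx
  rw [D_finset_sum s f hf, Finset.sum_mul]
  exact (Finset.abs_sum_le_sum_abs _ _).trans (Finset.sum_le_sum fun i hi => H i hi a b hab x hx)

theorem pd_mul {f g : E2 → ℝ} (hf : ContDiff ℝ ∞ f) (hg : ContDiff ℝ ∞ g) (i : Fin 2) :
    pd i (fun x => f x * g x) = fun x => pd i f x * g x + f x * pd i g x := by
  ext x
  simp only [pd]
  rw [fderiv_fun_mul (hf.differentiable (by simp) x) (hg.differentiable (by simp) x)]
  simp
  ring

/-- Leibniz rule: each differentiation doubles the number of terms, while every term of order `j`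
keeps exactly the power `h ^ j`. -/
theorem BdK.mul {n : ℕ} : ∀ {h A B : ℝ} {f g : E2 → ℝ}, 0 ≤ h → ContDiff ℝ ∞ f → ContDiff ℝ ∞ g →
    BdK n h A f → BdK n h B g → BdK n h (2 ^ n * A * B) (fun x => f x * g x) := by
  induction n with
  | zero =>
    intro h A B f g hh hf hg H H'
    have hA := H.nonneg
    rw [bdK_zero_iff] at *
    intro x hx
    rw [abs_mul]
    simp only [pow_zero, one_mul]
    exact mul_le_mul (H x hx) (H' x hx) (abs_nonneg _) hA
  | succ n ih =>
    intro h A B f g hh hf hg H H'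
    have hA := H.nonneg
    have hB := H'.nonneg
    have Hn := H.of_le (Nat.le_succ n)
    have Hn' := H'.of_le (Nat.le_succ n)
    rw [bdK_succ_iff hf] at H
    rw [bdK_succ_iff hg] at H'
    rw [bdK_succ_iff (hf.mul hg)]
    refine ⟨fun x hx => ?_, fun i => ?_⟩
    · rw [abs_mul]
      calc |f x| * |g x| ≤ A * B := mul_le_mul (H.1 x hx) (H'.1 x hx) (abs_nonneg _) hA
        _ = 1 * (A * B) := (one_mul _).symm
        _ ≤ 2 ^ (n + 1) * (A * B) := by gcongr; exact one_le_pow₀ (by norm_num)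
        _ = _ := by ring
    · rw [pd_mul hf hg]
      have h1 := ih hh (contDiff_pd hf i) hg (H.2 i) Hn'
      have h2 := ih hh hf (contDiff_pd hg i) Hn (H'.2 i)
      refine (h1.add ((contDiff_pd hf i).mul hg) (hf.mul (contDiff_pd hg i)) h2).mono hh (le_of_eq ?_)
      ring

/-- The basis vectors of `ℝ³`. -/
def e3 (c : Fin 3) : E3 := EuclideanSpace.single c 1

theorem eq_sum_e3 (v : E3) : v = ∑ c, v c • e3 c := by
  ext i
  fin_cases i <;> simp [e3, Fin.sum_univ_three]

theorem pd_comp {g : E3 → ℝ} {Φ : E2 → E3} (hg : ContDiff ℝ ∞ g) (hΦ : ContDiff ℝ ∞ Φ) (i : Fin 2) :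
    pd i (fun y => g (Φ y)) =
      fun y => ∑ c, fderiv ℝ g (Φ y) (e3 c) * pd i (fun y => Φ y c) y := by
  ext y
  have h1 := (hg.differentiable (by simp) (Φ y)).hasFDerivAt
  have h2 := (hΦ.differentiable (by simp) y).hasFDerivAt
  have h3 : ∀ c, pd i (fun y => Φ y c) y = (fderiv ℝ Φ y (eb i)) c := by
    intro c
    simp only [pd]
    have := ((EuclideanSpace.proj c : E3 →L[ℝ] ℝ).hasFDerivAt).comp y h2
    rw [show (fun y => Φ y c) = (EuclideanSpace.proj c : E3 →L[ℝ] ℝ) ∘ Φ from rfl, this.fderiv]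
    rfl
  simp only [h3]
  change fderiv ℝ (g ∘ Φ) y (eb i) = _
  rw [(h1.comp y h2).fderiv]
  simp only [ContinuousLinearMap.comp_apply]
  conv_lhs => rw [eq_sum_e3 (fderiv ℝ Φ y (eb i)), map_sum]
  simp [mul_comm]

theorem contDiff_coord {Φ : E2 → E3} (hΦ : ContDiff ℝ ∞ Φ) (c : Fin 3) :
    ContDiff ℝ ∞ fun y => Φ y c :=
  (EuclideanSpace.proj c : E3 →L[ℝ] ℝ).contDiff.comp hΦ

/-- Composition of a fixed smooth function with compact support with a map with small
derivatives. -/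
theorem exists_bdK_comp (n : ℕ) (A : ℝ) : ∀ g : E3 → ℝ, ContDiff ℝ ∞ g → HasCompactSupport g →
    ∃ C : ℝ, 0 ≤ C ∧ ∀ h : ℝ, 0 ≤ h → ∀ Φ : E2 → E3, ContDiff ℝ ∞ Φ →
      (∀ i c, BdK n h (A * h) (pd i fun y => Φ y c)) → BdK n h C (fun y => g (Φ y)) := by
  induction n with
  | zero =>
    intro g hg hgs
    obtain ⟨C, hC⟩ := hgs.exists_bound_of_continuous hg.continuous
    refine ⟨C, (norm_nonneg _).trans (hC 0), fun h hh Φ hΦ _ => ?_⟩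
    rw [bdK_zero_iff]
    exact fun x _ => hC _
  | succ n ih =>
    intro g hg hgs
    obtain ⟨C, hC⟩ := hgs.exists_bound_of_continuous hg.continuous
    have hC0 : 0 ≤ C := (norm_nonneg _).trans (hC 0)
    have hgc : ∀ c, ContDiff ℝ ∞ fun x => fderiv ℝ g x (e3 c) := fun c =>
      (hg.fderiv_right (m := ∞) (by simp)).clm_apply contDiff_const
    have hgsc : ∀ c, HasCompactSupport fun x => fderiv ℝ g x (e3 c) := fun c =>
      hgs.fderiv_apply (𝕜 := ℝ) (e3 c)
    choose B hB0 hB using fun c => ih _ (hgc c) (hgsc c)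
    have hS : 0 ≤ ∑ c, 2 ^ n * B c * |A| := Finset.sum_nonneg fun c _ =>
      mul_nonneg (mul_nonneg (by positivity) (hB0 c)) (abs_nonneg A)
    refine ⟨C + ∑ c, 2 ^ n * B c * |A|, by positivity, fun h hh Φ hΦ H => ?_⟩
    rw [bdK_succ_iff (f := fun y => g (Φ y)) (hg.comp hΦ)]
    refine ⟨fun x _ => (hC _).trans (le_add_of_nonneg_right hS), fun i => ?_⟩
    -- By the chain rule a derivative is a sum of products of a component of `g'`, composed with
    -- `Φ`, and a derivative of `Φ`. The induction hypothesis applies to the first factor, which is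
    -- again smooth with compact support; the second provides the power of `h`.
    rw [pd_comp hg hΦ]
    have h1 : ∀ c ∈ Finset.univ, BdK n h (2 ^ n * B c * (A * h))
        (fun y => fderiv ℝ g (Φ y) (e3 c) * pd i (fun y => Φ y c) y) := fun c _ =>
      BdK.mul hh ((hgc c).comp hΦ) (contDiff_pd (contDiff_coord hΦ c) i)
        (hB c h hh Φ hΦ fun i c => (H i c).of_le (Nat.le_succ n)) ((H i c).of_le (Nat.le_succ n))
    refine (BdK.sum Finset.univ (fun c _ => ((hgc c).comp hΦ).mul
      (contDiff_pd (contDiff_coord hΦ c) i)) h1).mono hh ?_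
    rw [add_mul, Finset.sum_mul]
    refine (Finset.sum_le_sum fun c _ => ?_).trans (le_add_of_nonneg_left (by positivity))
    rw [mul_assoc]
    have := hB0 c
    calc 2 ^ n * (B c * (A * h)) ≤ 2 ^ n * (B c * (|A| * h)) := by gcongr; exact le_abs_self A
      _ = _ := by ring

/-! ### The Lagrange interpolant on the reference triangle -/

namespace LagrangeNodes

variable {k : ℕ} (N : LagrangeNodes k)

/-- The Lagrange interpolant on the reference triangle. -/
def interpolant (f : E2 → ℝ) (y : E2) : ℝ := ∑ a ∈ N.pts, f a * polyEval (N.basis a) y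

open Classical in
theorem basis_apply (a : E2) {b : E2} (hb : b ∈ N.pts) :
    polyEval (N.basis a) b = if b = a then 1 else 0 :=
  (N.unisolvent fun b => if b = a then 1 else 0).choose_spec.1.2 b hb

open Classical in
theorem totalDegree_basis (a : E2) : (N.basis a).totalDegree ≤ k :=
  (N.unisolvent fun b => if b = a then 1 else 0).choose_spec.1.1

theorem contDiff_interpolant (f : E2 → ℝ) : ContDiff ℝ ∞ (N.interpolant f) :=
  ContDiff.sum fun _ _ => contDiff_const.mul (contDiff_polyEval _)

theorem interpolant_sub (f g : E2 → ℝ) :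
    N.interpolant (f - g) = N.interpolant f - N.interpolant g := by
  ext y
  simp [interpolant, sub_mul, Finset.sum_sub_distrib]

/-- The interpolant is itself a polynomial of degree at most `k` with the same nodal values as `q`,
so unisolvence forces equality. All approximation properties rest on this reproduction. -/
theorem interpolant_polyEval {q : MvPolynomial (Fin 2) ℝ} (hq : q.totalDegree ≤ k) :
    N.interpolant (polyEval q) = polyEval q := by
  have h1 : N.interpolant (polyEval q) =
      polyEval (∑ a ∈ N.pts, MvPolynomial.C (polyEval q a) * N.basis a) := by
    ext y
    simp only [interpolant, polyEval, map_sum, map_mul, MvPolynomial.eval_C]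
  rw [h1]
  congr 1
  refine (N.unisolvent (polyEval q)).unique ⟨?_, fun b hb => ?_⟩ ⟨hq, fun _ _ => rfl⟩
  · refine (MvPolynomial.totalDegree_finsetSum _ _).trans (Finset.sup_le fun a _ => ?_)
    refine (MvPolynomial.totalDegree_mul _ _).trans ?_
    rw [MvPolynomial.totalDegree_C, zero_add]
    exact N.totalDegree_basis a
  · rw [← h1, interpolant, Finset.sum_eq_single b]
    · rw [N.basis_apply b hb]
      simp
    · intro a _ hab
      rw [N.basis_apply a hb, if_neg hab.symm, mul_zero]
    · exact fun h => (h hb).elim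

theorem D_interpolant (f : E2 → ℝ) (a b : ℕ) :
    D a b (N.interpolant f) = fun y => ∑ p ∈ N.pts, f p * D a b (polyEval (N.basis p)) y := by
  have := D_finset_sum N.pts (fun p y => f p * polyEval (N.basis p) y)
    (fun p _ => contDiff_const.mul (contDiff_polyEval _)) a b
  simp only [D_const_mul (contDiff_polyEval _)] at this
  exact this

/-- A bound of the derivatives of the interpolant by the nodal values. -/
theorem exists_interpolant_le (n : ℕ) : ∃ C : ℝ, 0 ≤ C ∧ ∀ (f : E2 → ℝ) (M : ℝ), 0 ≤ M →
    (∀ a ∈ N.pts, |f a| ≤ M) →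
    ∀ a b, a + b ≤ n → ∀ x ∈ refTriangle, |D a b (N.interpolant f) x| ≤ C * M := by
  have h : ∀ p : E2, ∀ a b, ∃ C : ℝ, 0 ≤ C ∧
      ∀ x ∈ refTriangle, |D a b (polyEval (N.basis p)) x| ≤ C := by
    intro p a b
    obtain ⟨C, hC⟩ := isCompact_refTriangle.exists_bound_of_continuousOn
      (contDiff_D (contDiff_polyEval (N.basis p)) a b).continuous.continuousOn
    exact ⟨C, (norm_nonneg _).trans (hC _ (interior_subset centre_mem)), hC⟩
  choose B hB0 hB using h
  refine ⟨∑ p ∈ N.pts, ∑ a ∈ Finset.range (n + 1), ∑ b ∈ Finset.range (n + 1), B p a b,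
    Finset.sum_nonneg fun _ _ => Finset.sum_nonneg fun _ _ => Finset.sum_nonneg fun _ _ => hB0 _ _ _,
    fun f M hM0 hM a b hab x hx => ?_⟩
  rw [D_interpolant, Finset.sum_mul]
  refine (Finset.abs_sum_le_sum_abs _ _).trans (Finset.sum_le_sum fun p hp => ?_)
  rw [abs_mul, mul_comm]
  refine mul_le_mul ?_ (hM p hp) (abs_nonneg _)
    (Finset.sum_nonneg fun _ _ => Finset.sum_nonneg fun _ _ => hB0 _ _ _)
  refine (hB p a b x hx).trans ?_
  refine (Finset.single_le_sum (f := fun b => B p a b) (fun _ _ => hB0 _ _ _)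
    (Finset.mem_range.2 (by omega : b < n + 1))).trans ?_
  exact Finset.single_le_sum (f := fun a => ∑ b ∈ Finset.range (n + 1), B p a b)
    (fun _ _ => Finset.sum_nonneg fun _ _ => hB0 _ _ _) (Finset.mem_range.2 (by omega : a < n + 1))

end LagrangeNodes

theorem H2_le {f : E2 → ℝ} (hf : ContDiff ℝ ∞ f) {M : ℝ≥0∞} (h : ∀ a b, a + b ≤ 2 → nK (D a b f) ≤ M) :
    H2 f ≤ 9 * M := by
  have e0 : pd 0 f = D 1 0 f := rfl
  have e1 : pd 1 f = D 0 1 f := rfl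
  rw [H2, H1, H1, H1, e0, e1, pd_zero_D, pd_zero_D, pd_one_D hf, pd_one_D hf]
  calc _ ≤ M + M + M + (M + M + M) + (M + M + M) := by
        gcongr
        · simpa [D] using h 0 0 (by omega)
        all_goals exact h _ _ (by omega)
    _ = 9 * M := by ring

/-- Approximation by polynomials in the supremum norm, with all derivatives of low order in
`L²`. -/
theorem exists_poly_approx {m : ℕ} (hm : 2 ≤ m) : ∃ C : ℝ≥0, ∀ f : E2 → ℝ, ContDiff ℝ ∞ f →
    ∀ M : ℝ≥0∞, (∀ a b, a + b = m → nK (D a b f) ≤ M) → ∃ q : MvPolynomial (Fin 2) ℝ,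
      q.totalDegree ≤ m - 1 ∧ (∀ a b, m ≤ a + b → D a b (polyEval q) = 0) ∧
      (∀ a b, a + b ≤ m → nK (D a b (f - polyEval q)) ≤ C * M) ∧
      ∀ x ∈ refTriangle, ‖(f - polyEval q) x‖ₑ ≤ C * M := by
  obtain ⟨C, hC⟩ := exists_bramble_hilbert m
  obtain ⟨S, hS⟩ := exists_sup_le
  refine ⟨C + S * (9 * C), fun f hf M hM => ?_⟩
  obtain ⟨q, hq1, hq2, hq3⟩ := hC f hf M hM
  have hg : ContDiff ℝ ∞ (f - polyEval q) := hf.sub (contDiff_polyEval q)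
  refine ⟨q, hq1, hq2, fun a b hab => (hq3 a b hab).trans ?_, fun x hx => (hS _ hg x hx).trans ?_⟩
  · push_cast
    gcongr
    exact le_self_add
  · calc S * H2 (f - polyEval q) ≤ S * (9 * (C * M)) := by
          gcongr
          exact H2_le hg fun a b hab => hq3 a b (by omega)
      _ = (S * (9 * C)) * M := by ring
      _ ≤ _ := by
        push_cast
        gcongr
        exact le_add_self

theorem nK_sub_le {f g : E2 → ℝ} (hf : ContDiff ℝ ∞ f) (hg : ContDiff ℝ ∞ g) :
    nK (f - g) ≤ nK f + nK g :=
  eLpNorm_sub_le hf.continuous.aestronglyMeasurable hg.continuous.aestronglyMeasurable (by simp)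

theorem nK_le_of_bound {f : E2 → ℝ} {A : ℝ} (h : ∀ x ∈ refTriangle, |f x| ≤ A) :
    nK f ≤ muK univ ^ (1 / 2 : ℝ) * ENNReal.ofReal A := by
  have := eLpNorm_le_of_ae_bound (p := 2) (μ := muK) (f := f) (C := A)
    (ae_muK_of_forall fun x hx => h x hx)
  simpa [nK] using this

theorem nK_lt_top {f : E2 → ℝ} (hf : Continuous f) : nK f < ⊤ := by
  obtain ⟨C, hC⟩ := isCompact_refTriangle.exists_bound_of_continuousOn hf.continuousOn
  refine (nK_le_of_bound hC).trans_lt ?_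
  exact ENNReal.mul_lt_top (ENNReal.rpow_lt_top_of_nonneg (by simp) (measure_ne_top _ _)) (by simp)

/-- The interpolation error of smooth functions on the reference triangle. -/
theorem LagrangeNodes.exists_interpolation_error_le {k : ℕ} (N : LagrangeNodes k) {m : ℕ} (hm : 2 ≤ m)
    (hmk : m ≤ k + 1) : ∃ C : ℝ≥0, ∀ f : E2 → ℝ, ContDiff ℝ ∞ f → ∀ M : ℝ≥0∞, M ≠ ⊤ →
    (∀ a b, a + b = m → nK (D a b f) ≤ M) →
    ∀ a b, a + b ≤ 2 → nK (D a b (f - N.interpolant f)) ≤ C * M := by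
  obtain ⟨C, hC⟩ := exists_poly_approx hm
  obtain ⟨B, hB0, hB⟩ := N.exists_interpolant_le 2
  have hV : muK univ ^ (1 / 2 : ℝ) ≠ ⊤ :=
    (ENNReal.rpow_lt_top_of_nonneg (by simp) (measure_ne_top _ _)).ne
  set V : ℝ≥0 := (muK univ ^ (1 / 2 : ℝ)).toNNReal with hVdef
  refine ⟨C + V * (B.toNNReal * C), fun f hf M hMt hM a b hab => ?_⟩
  obtain ⟨q, hq1, hq2, hq3, hq4⟩ := hC f hf M hM
  set g := f - polyEval q with hg
  have hgs : ContDiff ℝ ∞ g := hf.sub (contDiff_polyEval q)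
  -- The polynomial has degree at most `m - 1 ≤ k`, hence is reproduced and cancels. What remains is
  -- the error of `g`, whose nodal values are bounded in the supremum norm.
  have e1 : f - N.interpolant f = g - N.interpolant g := by
    rw [hg, N.interpolant_sub, N.interpolant_polyEval (by omega)]
    abel
  have hCM : (C : ℝ≥0∞) * M ≠ ⊤ := ENNReal.mul_ne_top (by simp) hMt
  have hb : ∀ x ∈ refTriangle, |D a b (N.interpolant g) x| ≤ B * ((C : ℝ≥0∞) * M).toReal := by
    refine hB g _ ENNReal.toReal_nonneg (fun p hp => ?_) a b hab
    have := hq4 p (N.mem_refTriangle p hp)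
    rw [← ENNReal.toReal_le_toReal (by simp) hCM] at this
    simpa using this
  rw [e1, D_sub hgs (N.contDiff_interpolant g)]
  refine (nK_sub_le (contDiff_D hgs a b) (contDiff_D (N.contDiff_interpolant g) a b)).trans ?_
  calc _ ≤ C * M + muK univ ^ (1 / 2 : ℝ) * ENNReal.ofReal (B * ((C : ℝ≥0∞) * M).toReal) := by
        gcongr
        · exact hq3 a b (by omega)
        · exact nK_le_of_bound hb
    _ = _ := by
        rw [ENNReal.ofReal_mul hB0, ENNReal.ofReal_toReal hCM]
        push_cast
        rw [hVdef, ENNReal.coe_toNNReal hV, ENNReal.ofReal]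
        ring

/-- The derivatives of order `m` of the interpolant are controlled by those of the function. -/
theorem LagrangeNodes.exists_D_interpolant_le {k : ℕ} (N : LagrangeNodes k) {m : ℕ} (hm : 2 ≤ m)
    (hmk : m ≤ k + 1) : ∃ C : ℝ, 0 ≤ C ∧ ∀ f : E2 → ℝ, ContDiff ℝ ∞ f → ∀ M : ℝ, 0 ≤ M →
    (∀ a b, a + b = m → ∀ x ∈ refTriangle, |D a b f x| ≤ M) →
    ∀ a b, a + b = m → ∀ x ∈ refTriangle, |D a b (N.interpolant f) x| ≤ C * M := by
  obtain ⟨C, hC⟩ := exists_poly_approx hm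
  obtain ⟨B, hB0, hB⟩ := N.exists_interpolant_le m
  have hV : muK univ ^ (1 / 2 : ℝ) ≠ ⊤ :=
    (ENNReal.rpow_lt_top_of_nonneg (by simp) (measure_ne_top _ _)).ne
  set V : ℝ := (muK univ ^ (1 / 2 : ℝ)).toReal with hVdef
  refine ⟨B * (C * V), by positivity, fun f hf M hM0 hM a b hab x hx => ?_⟩
  obtain ⟨q, hq1, hq2, hq3, hq4⟩ := hC f hf (muK univ ^ (1 / 2 : ℝ) * ENNReal.ofReal M)
    fun a b hab => nK_le_of_bound (hM a b hab)
  set g := f - polyEval q with hg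
  have hgs : ContDiff ℝ ∞ g := hf.sub (contDiff_polyEval q)
  -- Derivatives of order `m` annihilate `q`, so only the interpolant of the small remainder `g`
  -- contributes.
  have e1 : N.interpolant f = polyEval q + N.interpolant g := by
    rw [hg, N.interpolant_sub, N.interpolant_polyEval (by omega)]
    abel
  rw [e1, D_add (contDiff_polyEval q) (N.contDiff_interpolant g), hq2 a b (by omega), zero_add]
  refine (hB g (C * V * M) (by positivity) (fun p hp => ?_) a b hab.le x hx).trans_eq (by ring)
  have := hq4 p (N.mem_refTriangle p hp)
  rw [← ENNReal.toReal_le_toReal (by simp) (ENNReal.mul_ne_top (by simp)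
    (ENNReal.mul_ne_top hV (by simp)))] at this
  rw [ENNReal.toReal_mul, ENNReal.toReal_mul, ENNReal.toReal_ofReal hM0] at this
  rw [hVdef, mul_assoc]
  simpa using this

/-! ### Weak derivatives on the reference triangle -/

/-- Test functions on the interior of the reference triangle. -/
structure IsTest (ψ : E2 → ℝ) : Prop where
  contDiff : ContDiff ℝ ∞ ψ
  hasCompactSupport : HasCompactSupport ψ
  tsupport_subset : tsupport ψ ⊆ interior refTriangle

/-- `v'` is the weak partial derivative `∂ᵢ v` on the interior of the reference triangle. -/
def HasD (v : E2 → ℝ) (i : Fin 2) (v' : E2 → ℝ) : Prop :=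
  ∀ ψ, IsTest ψ → ∫ y, v y * pd i ψ y = -∫ y, v' y * ψ y

theorem IsTest.eq_zero {ψ : E2 → ℝ} (hψ : IsTest ψ) {y : E2} (hy : y ∉ refTriangle) : ψ y = 0 :=
  image_eq_zero_of_notMem_tsupport fun h => hy (interior_subset (hψ.tsupport_subset h))

theorem IsTest.pd {ψ : E2 → ℝ} (hψ : IsTest ψ) (i : Fin 2) : IsTest (pd i ψ) where
  contDiff := contDiff_pd hψ.contDiff i
  hasCompactSupport := hψ.hasCompactSupport.fderiv_apply (𝕜 := ℝ) _
  tsupport_subset := (tsupport_fderiv_apply_subset ℝ _).trans hψ.tsupport_subset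

theorem IsTest.integral_eq {ψ : E2 → ℝ} (hψ : IsTest ψ) (v : E2 → ℝ) :
    ∫ y, v y * ψ y = ∫ y, v y * ψ y ∂muK :=
  (setIntegral_eq_integral_of_forall_compl_eq_zero fun y hy => by rw [hψ.eq_zero hy, mul_zero]).symm

theorem IsTest.memLp {ψ : E2 → ℝ} (hψ : IsTest ψ) : MemLp ψ 2 muK :=
  (hψ.contDiff.continuous.memLp_of_hasCompactSupport (μ := volume) hψ.hasCompactSupport).restrict _

theorem IsTest.integrable {ψ : E2 → ℝ} (hψ : IsTest ψ) {v : E2 → ℝ} (hv : MemLp v 2 muK) :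
    Integrable (fun y => v y * ψ y) volume := by
  have h : Integrable (fun y => v y * ψ y) muK := hv.integrable_mul hψ.memLp
  refine (integrableOn_iff_integrable_of_support_subset (s := refTriangle) fun y hy => ?_).1 h
  by_contra hn
  exact hy (by simp [hψ.eq_zero hn])

theorem HasD.congr {v u v' u' : E2 → ℝ} {i : Fin 2} (h : HasD v i v') (hv : v =ᵐ[muK] u)
    (hv' : v' =ᵐ[muK] u') : HasD u i u' := by
  intro ψ hψ
  have e1 : ∫ y, u y * SurfaceDG.pd i ψ y = ∫ y, v y * SurfaceDG.pd i ψ y := by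
    rw [(hψ.pd i).integral_eq, (hψ.pd i).integral_eq]
    refine integral_congr_ae ?_
    filter_upwards [hv] with y hy
    rw [hy]
  have e2 : ∫ y, u' y * ψ y = ∫ y, v' y * ψ y := by
    rw [hψ.integral_eq, hψ.integral_eq]
    refine integral_congr_ae ?_
    filter_upwards [hv'] with y hy
    rw [hy]
  rw [e1, e2, h ψ hψ]

/-- The difference of two candidates integrates to zero against every test function on the open
triangle, hence vanishes almost everywhere. The frontier is negligible by convexity. -/
theorem HasD.unique {v v₁ v₂ : E2 → ℝ} {i : Fin 2} (h₁ : HasD v i v₁) (h₂ : HasD v i v₂)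
    (m₁ : MemLp v₁ 2 muK) (m₂ : MemLp v₂ 2 muK) : v₁ =ᵐ[muK] v₂ := by
  have hint : IntegrableOn (v₁ - v₂) (interior refTriangle) := by
    have := (m₁.sub m₂).integrable (by norm_num)
    rw [muK_eq_interior] at this
    exact this
  have key := isOpen_interior.ae_eq_zero_of_integral_contDiff_smul_eq_zero
    (f := v₁ - v₂) (μ := volume) hint.locallyIntegrableOn fun g hg hgc hgs => by
      have hT : IsTest g := ⟨hg, hgc, hgs⟩
      have e := (h₁ g hT).symm.trans (h₂ g hT)
      have : ∫ y, g y • (v₁ - v₂) y = ∫ y, (v₁ y * g y - v₂ y * g y) := by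
        congr 1
        ext y
        simp only [Pi.sub_apply, smul_eq_mul]
        ring
      rw [this, integral_sub (hT.integrable m₁) (hT.integrable m₂)]
      linarith
  rw [muK_eq_interior]
  filter_upwards [(ae_restrict_iff' isOpen_interior.measurableSet).2 key] with y hy
  simpa [sub_eq_zero] using hy

theorem hasD_of_contDiff {f : E2 → ℝ} (hf : ContDiff ℝ ∞ f) (i : Fin 2) : HasD f i (pd i f) := by
  intro ψ hψ
  have hc : ∀ g : E2 → ℝ, Continuous g → ∀ {φ : E2 → ℝ}, IsTest φ →
      Integrable fun y => g y * φ y := fun g hg φ hφ =>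
    (hg.mul hφ.contDiff.continuous).integrable_of_hasCompactSupport hφ.hasCompactSupport.mul_left
  exact integral_mul_fderiv_eq_neg_fderiv_mul_of_integrable
    (hc _ (continuous_pd hf i) hψ) (hc _ hf.continuous (hψ.pd i)) (hc _ hf.continuous hψ)
    (fun x _ => hf.differentiable (by simp) x) (fun x _ => hψ.contDiff.differentiable (by simp) x)

theorem memLp_of_continuous {f : E2 → ℝ} (hf : Continuous f) : MemLp f 2 muK :=
  ⟨hf.aestronglyMeasurable, nK_lt_top hf⟩

theorem MemLp.continuous_mul {a v : E2 → ℝ} (ha : Continuous a) (hv : MemLp v 2 muK) :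
    MemLp (fun y => a y * v y) 2 muK := by
  obtain ⟨C, hC⟩ := isCompact_refTriangle.exists_bound_of_continuousOn ha.continuousOn
  refine hv.of_le_mul (c := C) (ha.aestronglyMeasurable.mul hv.1) ?_
  refine ae_muK_of_forall fun x hx => ?_
  rw [norm_mul]
  gcongr
  exact hC x hx

theorem HasD.add {v u v' u' : E2 → ℝ} {i : Fin 2} (h : HasD v i v') (h' : HasD u i u')
    (mv : MemLp v 2 muK) (mu : MemLp u 2 muK) (mv' : MemLp v' 2 muK) (mu' : MemLp u' 2 muK) :
    HasD (fun y => v y + u y) i (fun y => v' y + u' y) := by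
  intro ψ hψ
  simp only [add_mul]
  rw [integral_add ((hψ.pd i).integrable mv) ((hψ.pd i).integrable mu),
    integral_add (hψ.integrable mv') (hψ.integrable mu'), h ψ hψ, h' ψ hψ]
  ring

theorem HasD.const_mul {v v' : E2 → ℝ} {i : Fin 2} (h : HasD v i v') (c : ℝ) :
    HasD (fun y => c * v y) i (fun y => c * v' y) := by
  intro ψ hψ
  simp only [mul_assoc]
  rw [integral_const_mul, integral_const_mul, h ψ hψ]
  ring

theorem HasD.sub {v u v' u' : E2 → ℝ} {i : Fin 2} (h : HasD v i v') (h' : HasD u i u')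
    (mv : MemLp v 2 muK) (mu : MemLp u 2 muK) (mv' : MemLp v' 2 muK) (mu' : MemLp u' 2 muK) :
    HasD (fun y => v y - u y) i (fun y => v' y - u' y) := by
  have := h.add (h'.const_mul (-1)) mv (mu.const_mul (-1)) mv' (mu'.const_mul (-1))
  simpa [sub_eq_add_neg] using this

theorem HasD.finset_sum {ι : Type*} (s : Finset ι) {v v' : ι → E2 → ℝ} {i : Fin 2}
    (h : ∀ j ∈ s, HasD (v j) i (v' j)) (mv : ∀ j ∈ s, MemLp (v j) 2 muK)
    (mv' : ∀ j ∈ s, MemLp (v' j) 2 muK) :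
    HasD (fun y => ∑ j ∈ s, v j y) i (fun y => ∑ j ∈ s, v' j y) := by
  intro ψ hψ
  simp only [Finset.sum_mul]
  rw [integral_finsetSum _ fun j hj => (hψ.pd i).integrable (mv j hj),
    integral_finsetSum _ fun j hj => hψ.integrable (mv' j hj), ← Finset.sum_neg_distrib]
  exact Finset.sum_congr rfl fun j hj => h j hj ψ hψ

theorem HasD.mul {a v v' : E2 → ℝ} {i : Fin 2} (ha : ContDiff ℝ ∞ a) (h : HasD v i v')
    (mv : MemLp v 2 muK) (mv' : MemLp v' 2 muK) :
    HasD (fun y => a y * v y) i (fun y => SurfaceDG.pd i a y * v y + a y * v' y) := by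
  intro ψ hψ
  have hT : IsTest fun y => a y * ψ y :=
    ⟨ha.mul hψ.contDiff, hψ.hasCompactSupport.mul_left,
      (tsupport_mul_subset_right).trans hψ.tsupport_subset⟩
  have e := h _ hT
  rw [pd_mul ha hψ.contDiff] at e
  have i1 : Integrable fun y => v y * (SurfaceDG.pd i a y * ψ y) := by
    have := hψ.integrable (MemLp.continuous_mul (continuous_pd ha i) mv)
    refine this.congr (Eventually.of_forall fun y => ?_)
    simp only
    ring
  have i2 : Integrable fun y => v y * (a y * SurfaceDG.pd i ψ y) := by
    have := (hψ.pd i).integrable (MemLp.continuous_mul ha.continuous mv)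
    refine this.congr (Eventually.of_forall fun y => ?_)
    simp only
    ring
  have i3 : Integrable fun y => v' y * (a y * ψ y) := hT.integrable mv'
  simp only [mul_add] at e
  rw [integral_add i1 i2] at e
  have l1 : ∫ y, a y * v y * SurfaceDG.pd i ψ y = ∫ y, v y * (a y * SurfaceDG.pd i ψ y) := by
    congr 1
    ext y
    ring
  have l2 : ∫ y, (SurfaceDG.pd i a y * v y + a y * v' y) * ψ y =
      ∫ y, (v y * (SurfaceDG.pd i a y * ψ y) + v' y * (a y * ψ y)) := by
    congr 1
    ext y
    ring
  rw [l1, l2, integral_add i1 i3]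
  linarith

/-! ### Contracting mollifiers -/

/-- A bump function in the interior of the reference triangle. -/
def bump : ContDiffBump centre := ⟨1 / 16, 1 / 8, by norm_num, by norm_num⟩

/-- A smooth probability density in the interior of the reference triangle. -/
def dens : E2 → ℝ := bump.normed volume

theorem contDiff_dens : ContDiff ℝ ∞ dens := bump.contDiff_normed

theorem dens_nonneg (z : E2) : 0 ≤ dens z := bump.nonneg_normed z

theorem integral_dens : ∫ z, dens z = 1 := bump.integral_normed

theorem closedBall_centre_subset : Metric.closedBall centre (1 / 8) ⊆ interior refTriangle := by
  intro y hy
  rw [mem_closedBall_iff_norm] at hy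
  have h : ∀ i, |y i - 1 / 4| ≤ 1 / 8 := by
    intro i
    have := (PiLp.norm_apply_le (y - centre) i).trans hy
    fin_cases i <;> simpa [centre] using this
  have h0 := abs_le.1 (h 0)
  have h1 := abs_le.1 (h 1)
  exact mem_interior_refTriangle (by linarith) (by linarith) (by linarith)

theorem dens_eq_zero {z : E2} (hz : z ∉ Metric.closedBall centre (1 / 8)) : dens z = 0 := by
  have := bump.tsupport_normed_eq (μ := (volume : Measure E2))
  refine image_eq_zero_of_notMem_tsupport (f := dens) ?_
  rw [dens, this]
  exact hz

theorem hasCompactSupport_dens : HasCompactSupport dens :=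
  HasCompactSupport.intro (isCompact_closedBall centre (1 / 8)) fun _ hz => dens_eq_zero hz

theorem integrable_dens : Integrable dens :=
  contDiff_dens.continuous.integrable_of_hasCompactSupport hasCompactSupport_dens

theorem lintegral_dens : ∫⁻ z, ‖dens z‖ₑ = 1 := by
  have h : ∀ z, ‖dens z‖ₑ = ENNReal.ofReal (dens z) := fun z => Real.enorm_eq_ofReal (dens_nonneg z)
  simp only [h]
  rw [← ofReal_integral_eq_lintegral_ofReal integrable_dens (Eventually.of_forall dens_nonneg),
    integral_dens, ENNReal.ofReal_one]

/-- The scaled reflected density. -/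
def kap (δ : ℝ) (w : E2) : ℝ := (δ ^ 2)⁻¹ * dens (-(δ⁻¹ • w))

theorem contDiff_kap (δ : ℝ) : ContDiff ℝ ∞ (kap δ) :=
  contDiff_const.mul (contDiff_dens.comp (contDiff_id.const_smul _).neg)

theorem kap_eq_zero {δ : ℝ} {w : E2} (hw : -(δ⁻¹ • w) ∉ Metric.closedBall centre (1 / 8)) :
    kap δ w = 0 := by
  rw [kap, dens_eq_zero hw, mul_zero]

theorem hasCompactSupport_kap {δ : ℝ} (hδ : 0 < δ) : HasCompactSupport (kap δ) := by
  refine HasCompactSupport.intro ((isCompact_closedBall centre (1 / 8)).image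
    (f := fun z => -(δ • z)) (by fun_prop)) fun w hw => kap_eq_zero fun h => hw ⟨_, h, ?_⟩
  simp [smul_smul, hδ.ne']

/-- The mollification of `v` on the reference triangle that only uses values of `v` inside:
`x ↦ ∫ v((1 - δ) x + δ z) dens z dz`. -/
def mol (δ : ℝ) (v : E2 → ℝ) (x : E2) : ℝ :=
  convolution (refTriangle.indicator v) (kap δ) (ContinuousLinearMap.mul ℝ ℝ) volume ((1 - δ) • x)

theorem mol_def (δ : ℝ) (v : E2 → ℝ) (x : E2) :
    mol δ v x = ∫ y, refTriangle.indicator v y * kap δ ((1 - δ) • x - y) := rfl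

theorem integrable_indicator {v : E2 → ℝ} (hv : MemLp v 2 muK) :
    Integrable (refTriangle.indicator v) :=
  (integrable_indicator_iff measurableSet_refTriangle).2 (hv.integrable (by norm_num))

theorem contDiff_mol {δ : ℝ} (hδ : 0 < δ) {v : E2 → ℝ} (hv : MemLp v 2 muK) :
    ContDiff ℝ ∞ (mol δ v) :=
  ((hasCompactSupport_kap hδ).contDiff_convolution_right (n := ⊤) _
    (integrable_indicator hv).locallyIntegrable (contDiff_kap δ)).comp (contDiff_id.const_smul _)

theorem mol_congr (δ : ℝ) {u v : E2 → ℝ} (h : u =ᵐ[muK] v) : mol δ u = mol δ v := by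
  ext x
  rw [mol_def, mol_def]
  refine integral_congr_ae ?_
  filter_upwards [(ae_restrict_iff' measurableSet_refTriangle).1 h] with y hy
  by_cases hyK : y ∈ refTriangle
  · simp [hyK, hy hyK]
  · simp [hyK]

theorem combo_mem_interior {δ : ℝ} (hδ : 0 < δ) (hδ1 : δ < 1) {x z : E2} (hx : x ∈ refTriangle)
    (hz : z ∈ Metric.closedBall centre (1 / 8)) : (1 - δ) • x + δ • z ∈ interior refTriangle :=
  convex_refTriangle.combo_self_interior_mem_interior hx (closedBall_centre_subset hz)
    (by linarith) hδ (by ring)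

/-- The support lies in `(1 - δ) x + δ B` with `B` a closed disc in the interior, and such convex
combinations are interior even for `x` on the boundary. Thus the kernel is an admissible test
function in the integration variable at every point of the closed triangle. -/
theorem isTest_kap {δ : ℝ} (hδ : 0 < δ) (hδ1 : δ < 1) {x : E2} (hx : x ∈ refTriangle) :
    IsTest fun y => kap δ ((1 - δ) • x - y) := by
  have hsub : tsupport (fun y => kap δ ((1 - δ) • x - y)) ⊆ interior refTriangle := by
    have hcl : IsClosed {y : E2 | -(δ⁻¹ • ((1 - δ) • x - y)) ∈ Metric.closedBall centre (1 / 8)} :=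
      Metric.isClosed_closedBall.preimage (by fun_prop)
    refine (closure_minimal (fun y hy => ?_) hcl).trans (fun y hy => ?_)
    · by_contra hn
      exact hy (kap_eq_zero hn)
    · have := combo_mem_interior hδ hδ1 hx hy
      have e : (1 - δ) • x + δ • -(δ⁻¹ • ((1 - δ) • x - y)) = y := by
        rw [smul_neg, smul_smul, mul_inv_cancel₀ hδ.ne', one_smul]
        abel
      rwa [e] at this
  refine ⟨(contDiff_kap δ).comp (contDiff_const.sub contDiff_id), ?_, hsub⟩
  exact isCompact_refTriangle.of_isClosed_subset (isClosed_tsupport _) (hsub.trans interior_subset)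

/-- Differentiate the kernel, then move the derivative to `v` by the definition of the weak
derivative; no boundary term arises because the kernel is a test function. The factor `1 - δ` is the
chain rule for the dilation. -/
theorem pd_mol {δ : ℝ} (hδ : 0 < δ) (hδ1 : δ < 1) {v v' : E2 → ℝ} {i : Fin 2} (h : HasD v i v')
    (mv : MemLp v 2 muK) {x : E2} (hx : x ∈ refTriangle) :
    pd i (mol δ v) x = (1 - δ) * mol δ v' x := by
  have hloc := (integrable_indicator mv).locallyIntegrable
  have hck := hasCompactSupport_kap hδ
  have hd := hck.hasFDerivAt_convolution_right (ContinuousLinearMap.mul ℝ ℝ) hloc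
    ((contDiff_kap δ).of_le (by exact_mod_cast le_top)) ((1 - δ) • x)
  have hd2 : HasFDerivAt (fun x : E2 => (1 - δ) • x) ((1 - δ) • ContinuousLinearMap.id ℝ E2) x :=
    ((1 - δ) • ContinuousLinearMap.id ℝ E2).hasFDerivAt
  have hT := isTest_kap hδ hδ1 hx
  have e1 : pd i (mol δ v) x = (1 - δ) * ∫ y, refTriangle.indicator v y *
      fderiv ℝ (kap δ) ((1 - δ) • x - y) (eb i) := by
    have := (hd.comp x hd2).fderiv
    rw [pd, show mol δ v = convolution (refTriangle.indicator v) (kap δ)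
      (ContinuousLinearMap.mul ℝ ℝ) volume ∘ fun x : E2 => (1 - δ) • x from rfl, this]
    simp only [ContinuousLinearMap.comp_apply, smul_apply, ContinuousLinearMap.id_apply,
      map_smul, smul_eq_mul]
    congr 1
    rw [convolution_precompR_apply _ hloc (hck.fderiv ℝ) ((contDiff_kap δ).continuous_fderiv (by simp))]
    rfl
  have e2 : ∀ y, pd i (fun y => kap δ ((1 - δ) • x - y)) y =
      -fderiv ℝ (kap δ) ((1 - δ) • x - y) (eb i) := by
    intro y
    have hk := ((contDiff_kap δ).differentiable (by simp) ((1 - δ) • x - y)).hasFDerivAt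
    have := hk.comp y ((hasFDerivAt_id y).const_sub ((1 - δ) • x))
    rw [pd, show (fun y => kap δ ((1 - δ) • x - y)) = kap δ ∘ fun y => (1 - δ) • x - y from rfl,
      this.fderiv]
    simp
  have e3 := h _ hT
  have e4 : ∀ u : E2 → ℝ, ∀ φ : E2 → ℝ, IsTest φ →
      ∫ y, refTriangle.indicator u y * φ y = ∫ y, u y * φ y := by
    intro u φ hφ
    congr 1
    ext y
    by_cases hy : y ∈ refTriangle
    · simp [hy]
    · simp [hy, hφ.eq_zero hy]
  rw [e1, mol_def, e4 _ _ hT]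
  congr 1
  have e5 : ∫ y, refTriangle.indicator v y * fderiv ℝ (kap δ) ((1 - δ) • x - y) (eb i) =
      -∫ y, refTriangle.indicator v y * pd i (fun y => kap δ ((1 - δ) • x - y)) y := by
    rw [← integral_neg]
    congr 1
    ext y
    rw [e2]
    ring
  rw [e5, e4 _ _ (hT.pd i), e3, neg_neg]

theorem mol_eq {δ : ℝ} (hδ : 0 < δ) (hδ1 : δ < 1) (v : E2 → ℝ) {x : E2} (hx : x ∈ refTriangle) :
    mol δ v x = ∫ z, dens z * v ((1 - δ) • x + δ • z) := by
  set F : E2 → ℝ := fun y => refTriangle.indicator v y * dens (δ⁻¹ • (y - (1 - δ) • x)) with hF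
  have e1 : mol δ v x = (δ ^ 2)⁻¹ * ∫ y, F y := by
    rw [mol_def, ← integral_const_mul]
    congr 1
    ext y
    rw [kap, hF]
    simp only
    rw [← smul_neg, neg_sub]
    ring
  have e2 : ∫ y, F y = ∫ y, F ((1 - δ) • x + y) := (integral_add_left_eq_self F _).symm
  have e3 := Measure.integral_comp_smul (volume : Measure E2) (fun y => F ((1 - δ) • x + y)) δ
  rw [finrank_euclideanSpace_fin, abs_of_nonneg (by positivity), smul_eq_mul] at e3
  rw [e1, e2, ← e3]
  congr 1
  ext z
  simp only [hF, add_sub_cancel_left, smul_smul, inv_mul_cancel₀ hδ.ne', one_smul]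
  by_cases hz : z ∈ Metric.closedBall centre (1 / 8)
  · rw [indicator_of_mem (interior_subset (combo_mem_interior hδ hδ1 hx hz)), mul_comm]
  · rw [dens_eq_zero hz, zero_mul, mul_zero]

theorem nK_congr {u v : E2 → ℝ} (h : u =ᵐ[muK] v) : nK u = nK v := eLpNorm_congr_ae h

/-- In the form `mol_eq` the mollification averages `v` over contractions of the triangle against a
probability density. Cauchy–Schwarz in the average, Tonelli and `lintegral_contract_le` give the
bound. -/
theorem nK_mol_le {δ : ℝ} (hδ : 0 < δ) (hδ1 : δ < 1) {v : E2 → ℝ} (hv : MemLp v 2 muK) :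
    nK (mol δ v) ≤ ENNReal.ofReal (1 - δ)⁻¹ * nK v := by
  -- Both sides depend only on the class of `v` modulo null sets. A strictly measurable
  -- representative makes the double integral measurable.
  wlog hm : StronglyMeasurable v generalizing v
  · have h := this (hv.ae_eq hv.1.ae_eq_mk) hv.1.stronglyMeasurable_mk
    rwa [← mol_congr δ hv.1.ae_eq_mk, ← nK_congr hv.1.ae_eq_mk] at h
  have hvm : Measurable v := hm.measurable
  rw [← ENNReal.pow_le_pow_left_iff (n := 2) (by simp), mul_pow, nK_sq, nK_sq,
    ← ENNReal.ofReal_pow (by rw [inv_nonneg]; linarith)]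
  have hdm : Measurable fun z => ‖dens z‖ₑ := contDiff_dens.continuous.enorm.measurable
  set P : Measure E2 := volume.withDensity fun z => ‖dens z‖ₑ with hP
  have hPu : P univ = 1 := by
    rw [hP, withDensity_apply _ MeasurableSet.univ, Measure.restrict_univ, lintegral_dens]
  have hjm : Measurable fun q : E2 × E2 => ‖v ((1 - δ) • q.1 + δ • q.2)‖ₑ ^ 2 :=
    (hvm.comp (by fun_prop)).enorm.pow_const 2
  have h1 : ∀ x ∈ refTriangle, ‖mol δ v x‖ₑ ^ 2 ≤
      ∫⁻ z, ‖dens z‖ₑ * ‖v ((1 - δ) • x + δ • z)‖ₑ ^ 2 := by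
    intro x hx
    have hmx : Measurable fun z => ‖v ((1 - δ) • x + δ • z)‖ₑ := (hvm.comp (by fun_prop)).enorm
    calc ‖mol δ v x‖ₑ ^ 2 ≤ (∫⁻ z, ‖dens z * v ((1 - δ) • x + δ • z)‖ₑ) ^ 2 := by
          rw [mol_eq hδ hδ1 v hx]
          gcongr
          exact enorm_integral_le_lintegral_enorm _
      _ = (∫⁻ z, ‖v ((1 - δ) • x + δ • z)‖ₑ ∂P) ^ 2 := by
          rw [hP, lintegral_withDensity_eq_lintegral_mul _ hdm hmx]
          simp [enorm_mul]
      _ ≤ P univ * ∫⁻ z, ‖v ((1 - δ) • x + δ • z)‖ₑ ^ 2 ∂P := sq_lintegral_le _ _ hmx.aemeasurable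
      _ = _ := by
          rw [hPu, one_mul, hP, lintegral_withDensity_eq_lintegral_mul _ hdm (hmx.pow_const 2)]
          rfl
  calc ∫⁻ x in refTriangle, ‖mol δ v x‖ₑ ^ 2
      ≤ ∫⁻ x in refTriangle, ∫⁻ z, ‖dens z‖ₑ * ‖v ((1 - δ) • x + δ • z)‖ₑ ^ 2 :=
        setLIntegral_mono' measurableSet_refTriangle h1
    _ = ∫⁻ z, ∫⁻ x in refTriangle, ‖dens z‖ₑ * ‖v ((1 - δ) • x + δ • z)‖ₑ ^ 2 := by
        refine lintegral_lintegral_swap (Measurable.aemeasurable ?_)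
        exact (hdm.comp measurable_snd).mul hjm
    _ = ∫⁻ z, ‖dens z‖ₑ * ∫⁻ x in refTriangle, ‖v ((1 - δ) • x + δ • z)‖ₑ ^ 2 := by
        congr 1
        ext z
        rw [lintegral_const_mul' _ _ (by simp)]
    _ ≤ ∫⁻ z, ‖dens z‖ₑ * (ENNReal.ofReal ((1 - δ)⁻¹ ^ 2) * ∫⁻ x in refTriangle, ‖v x‖ₑ ^ 2) := by
        refine lintegral_mono fun z => ?_
        by_cases hz : z ∈ Metric.closedBall centre (1 / 8)
        · refine mul_le_mul' le_rfl ?_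
          have := lintegral_contract_le (fun y => ‖v y‖ₑ ^ 2)
            (interior_subset (closedBall_centre_subset hz)) (t := 1 - δ) (by linarith) (by linarith)
          simp only [sub_sub_cancel] at this
          simpa only [add_comm] using this
        · simp [dens_eq_zero hz]
    _ = _ := by
        rw [lintegral_mul_const' _ _ (ENNReal.mul_ne_top (by simp) ?_), lintegral_dens, one_mul]
        rw [← nK_sq]
        exact ENNReal.pow_ne_top hv.2.ne

theorem mol_uniform {v : E2 → ℝ} (hv : ContinuousOn v refTriangle) {ε : ℝ} (hε : 0 < ε) :
    ∃ δ₀ > 0, ∀ δ, 0 < δ → δ < 1 → δ < δ₀ → ∀ x ∈ refTriangle, |mol δ v x - v x| ≤ ε := by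
  have hu := isCompact_refTriangle.uniformContinuousOn_of_continuous hv
  rw [Metric.uniformContinuousOn_iff] at hu
  obtain ⟨η, hη, hu⟩ := hu ε hε
  refine ⟨η / 2, by positivity, fun δ hδ hδ1 hδη x hx => ?_⟩
  have hpt : ∀ z ∈ Metric.closedBall centre (1 / 8), |v ((1 - δ) • x + δ • z) - v x| ≤ ε := by
    intro z hz
    have hzK := interior_subset (closedBall_centre_subset hz)
    refine (hu _ (interior_subset (combo_mem_interior hδ hδ1 hx hz)) x hx ?_).le
    rw [dist_eq_norm, show (1 - δ) • x + δ • z - x = δ • (z - x) by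
      rw [sub_smul, one_smul, smul_sub]; abel, norm_smul, Real.norm_of_nonneg hδ.le]
    have : ‖z - x‖ ≤ 2 := (norm_sub_le _ _).trans
      (by linarith [norm_le_of_mem_refTriangle hx, norm_le_of_mem_refTriangle hzK])
    nlinarith
  have hcont : Continuous fun z => dens z * v x := contDiff_dens.continuous.mul continuous_const
  have hi2 : Integrable fun z => dens z * v x := integrable_dens.mul_const _
  have hi1 : Integrable fun z => dens z * v ((1 - δ) • x + δ • z) := by
    have hon : ContinuousOn (fun z => dens z * v ((1 - δ) • x + δ • z))
        (Metric.closedBall centre (1 / 8)) := by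
      refine contDiff_dens.continuous.continuousOn.mul (hv.comp (by fun_prop) fun z hz => ?_)
      exact interior_subset (combo_mem_interior hδ hδ1 hx hz)
    refine (integrableOn_iff_integrable_of_support_subset fun z hz => ?_).1
      (hon.integrableOn_compact (isCompact_closedBall _ _))
    by_contra hn
    exact hz (by simp [dens_eq_zero hn])
  have e : mol δ v x - v x = ∫ z, dens z * (v ((1 - δ) • x + δ • z) - v x) := by
    have : v x = ∫ z, dens z * v x := by rw [integral_mul_const, integral_dens, one_mul]
    rw [mol_eq hδ hδ1 v hx]
    conv_lhs => rw [this]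
    rw [← integral_sub hi1 hi2]
    simp only [mul_sub]
  rw [e, ← Real.norm_eq_abs]
  calc _ ≤ ∫ z, dens z * ε := by
        refine norm_integral_le_of_norm_le (integrable_dens.mul_const _) (Eventually.of_forall fun z => ?_)
        rw [norm_mul, Real.norm_of_nonneg (dens_nonneg z)]
        by_cases hz : z ∈ Metric.closedBall centre (1 / 8)
        · exact mul_le_mul_of_nonneg_left (hpt z hz) (dens_nonneg z)
        · simp [dens_eq_zero hz]
    _ = ε := by rw [integral_mul_const, integral_dens, one_mul]

theorem mol_sub {δ : ℝ} (hδ : 0 < δ) {u v : E2 → ℝ} (hu : MemLp u 2 muK) (hv : MemLp v 2 muK) :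
    mol δ (u - v) = mol δ u - mol δ v := by
  ext x
  simp only [Pi.sub_apply, mol_def]
  have hi : ∀ w : E2 → ℝ, MemLp w 2 muK →
      Integrable fun y => refTriangle.indicator w y * kap δ ((1 - δ) • x - y) := by
    intro w hw
    obtain ⟨C, hC⟩ := (hasCompactSupport_kap hδ).exists_bound_of_continuous (contDiff_kap δ).continuous
    refine (integrable_indicator hw).mul_bdd (c := C) ?_ (Eventually.of_forall fun y => hC _)
    exact ((contDiff_kap δ).continuous.comp (by fun_prop)).aestronglyMeasurable
  rw [← integral_sub (hi u hu) (hi v hv)]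
  congr 1
  ext y
  by_cases hy : y ∈ refTriangle
  · simp [hy, sub_mul]
  · simp [hy]

/-- The sequence of mollifications of `v`. -/
def moll (n : ℕ) (v : E2 → ℝ) : E2 → ℝ := mol (1 / (n + 2)) v

/-- The shift by 2 keeps the parameter in `(0, 1/2]`, so the `L²` constant `1 / (1 - δ)` stays at
most 2. -/
theorem moll_param (n : ℕ) : (0 : ℝ) < 1 / (n + 2) ∧ (1 : ℝ) / (n + 2) ≤ 1 / 2 := by
  constructor
  · positivity
  · apply one_div_le_one_div_of_le <;> linarith [(Nat.cast_nonneg n : (0 : ℝ) ≤ n)]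

theorem tendsto_moll_param : Tendsto (fun n : ℕ => (1 : ℝ) / (n + 2)) atTop (𝓝 0) := by
  have := (tendsto_add_atTop_iff_nat (f := fun n : ℕ => (1 : ℝ) / n) 2).2 tendsto_one_div_atTop_nhds_zero_nat
  simpa using this

theorem contDiff_moll (n : ℕ) {v : E2 → ℝ} (hv : MemLp v 2 muK) : ContDiff ℝ ∞ (moll n v) :=
  contDiff_mol (moll_param n).1 hv

theorem pd_moll (n : ℕ) {v v' : E2 → ℝ} {i : Fin 2} (h : HasD v i v') (mv : MemLp v 2 muK) {x : E2}
    (hx : x ∈ refTriangle) : pd i (moll n v) x = (1 - 1 / (n + 2)) * moll n v' x :=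
  pd_mol (moll_param n).1 (by linarith [(moll_param n).2]) h mv hx

theorem nK_moll_le (n : ℕ) {v : E2 → ℝ} (hv : MemLp v 2 muK) : nK (moll n v) ≤ 2 * nK v := by
  obtain ⟨h0, h1⟩ := moll_param n
  refine (nK_mol_le h0 (by linarith) hv).trans ?_
  gcongr
  rw [show (2 : ℝ≥0∞) = ENNReal.ofReal 2 by simp]
  refine ENNReal.ofReal_le_ofReal ?_
  rw [inv_le_comm₀ (by linarith) (by norm_num)]
  linarith

theorem nK_le_of_eqOn {f g : E2 → ℝ} (h : EqOn f g refTriangle) : nK f = nK g :=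
  nK_congr (ae_muK_of_forall h)

theorem tendstoUniformlyOn_moll {v : E2 → ℝ} (hv : ContinuousOn v refTriangle) :
    TendstoUniformlyOn (fun n => moll n v) v atTop refTriangle := by
  rw [Metric.tendstoUniformlyOn_iff]
  intro ε hε
  obtain ⟨δ₀, hδ₀, h⟩ := mol_uniform hv (half_pos hε)
  filter_upwards [tendsto_moll_param.eventually (gt_mem_nhds hδ₀)] with n hn x hx
  have := h _ (moll_param n).1 (by linarith [(moll_param n).2]) hn x hx
  rw [dist_comm, Real.dist_eq]
  exact this.trans_lt (half_lt_self hε)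

theorem tendsto_nK_of_uniform {f : ℕ → E2 → ℝ} {g : E2 → ℝ}
    (h : TendstoUniformlyOn f g atTop refTriangle) :
    Tendsto (fun n => nK (f n - g)) atTop (𝓝 0) := by
  have hV : muK univ ^ (1 / 2 : ℝ) ≠ ⊤ :=
    (ENNReal.rpow_lt_top_of_nonneg (by simp) (measure_ne_top _ _)).ne
  rw [ENNReal.tendsto_nhds_zero]
  intro ε hε
  obtain ⟨c, hc0, hc⟩ : ∃ c : ℝ, 0 < c ∧ muK univ ^ (1 / 2 : ℝ) * ENNReal.ofReal c ≤ ε := by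
    have ht : Tendsto (fun c : ℝ => muK univ ^ (1 / 2 : ℝ) * ENNReal.ofReal c) (𝓝[>] 0) (𝓝 0) := by
      have h1 : Tendsto (fun c : ℝ => ENNReal.ofReal c) (𝓝[>] 0) (𝓝 0) := by
        have := (ENNReal.continuous_ofReal.tendsto 0).mono_left (nhdsWithin_le_nhds (s := Ioi 0))
        simpa using this
      have := ENNReal.Tendsto.const_mul (a := muK univ ^ (1 / 2 : ℝ)) h1 (Or.inr hV)
      simpa using this
    obtain ⟨c, hc1, hc2⟩ := ((ht.eventually (ge_mem_nhds hε)).and self_mem_nhdsWithin).exists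
    exact ⟨c, hc2, hc1⟩
  rw [Metric.tendstoUniformlyOn_iff] at h
  filter_upwards [h c hc0] with n hn
  refine (nK_le_of_bound fun x hx => ?_).trans hc
  have := (hn x hx).le
  rwa [dist_comm, Real.dist_eq] at this

theorem nK_add_le {f g : E2 → ℝ} (hf : MemLp f 2 muK) (hg : MemLp g 2 muK) :
    nK (f + g) ≤ nK f + nK g := eLpNorm_add_le hf.1 hg.1 (by simp)

theorem memLp_moll (n : ℕ) {v : E2 → ℝ} (hv : MemLp v 2 muK) : MemLp (moll n v) 2 muK :=
  memLp_of_continuous (contDiff_moll n hv).continuous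

theorem nK_sub_comm (f g : E2 → ℝ) : nK (f - g) = nK (g - f) := by
  rw [nK, nK, eLpNorm_sub_comm]

/-- Continuous functions are dense in `L²`, mollifications of continuous functions converge
uniformly on the triangle, and the operators are bounded by 2 uniformly in `n`. -/
theorem tendsto_nK_moll {v : E2 → ℝ} (hv : MemLp v 2 muK) :
    Tendsto (fun n => nK (moll n v - v)) atTop (𝓝 0) := by
  have : muK.Regular := by unfold muK; infer_instance
  rw [ENNReal.tendsto_nhds_zero]
  intro ε hε
  rcases eq_or_ne ε ⊤ with rfl | hεt
  · simp
  obtain ⟨g, -, hg1, hg2, hg3⟩ := hv.exists_hasCompactSupport_eLpNorm_sub_le (p := 2) (by simp)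
    (ε := ε / 4) (by simpa using hε.ne')
  change nK (v - g) ≤ ε / 4 at hg1
  have hgu := tendsto_nK_of_uniform (tendstoUniformlyOn_moll (v := g) hg2.continuousOn)
  have h4 : 0 < ε / 4 := ENNReal.div_pos hε.ne' (by simp)
  filter_upwards [hgu.eventually (ge_mem_nhds h4)] with n hn
  have hvg : MemLp (v - g) 2 muK := hv.sub hg3
  have e : moll n v - v = moll n (v - g) + ((moll n g - g) + (g - v)) := by
    have := mol_sub (moll_param n).1 hv hg3
    simp only [moll]
    rw [this]
    abel
  have m1 := memLp_moll n hvg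
  have m2 : MemLp (moll n g - g) 2 muK := (memLp_moll n hg3).sub hg3
  have m3 : MemLp (g - v) 2 muK := hg3.sub hv
  rw [e]
  calc _ ≤ nK (moll n (v - g)) + (nK (moll n g - g) + nK (g - v)) :=
        (nK_add_le m1 (m2.add m3)).trans (add_le_add le_rfl (nK_add_le m2 m3))
    _ ≤ 2 * (ε / 4) + (ε / 4 + ε / 4) := by
        gcongr
        · exact (nK_moll_le n hvg).trans (by gcongr)
        · rw [nK_sub_comm]; exact hg1
    _ = 4 * (ε / 4) := by ring
    _ = ε := ENNReal.mul_div_cancel (by simp) (by simp)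

/-- At boundary points `fderiv` also sees values outside the triangle. Equality is therefore
obtained on the interior and extended by continuity of the derivatives to its closure. -/
theorem pd_eqOn {f g : E2 → ℝ} (hf : ContDiff ℝ ∞ f) (hg : ContDiff ℝ ∞ g)
    (h : EqOn f g refTriangle) (i : Fin 2) : EqOn (pd i f) (pd i g) refTriangle := by
  have hint : EqOn (pd i f) (pd i g) (interior refTriangle) := by
    intro x hx
    have : f =ᶠ[𝓝 x] g := by
      filter_upwards [mem_interior_iff_mem_nhds.1 hx] with y hy
      exact h hy
    simp only [pd, this.fderiv_eq]
  have := hint.closure (continuous_pd hf i) (continuous_pd hg i)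
  rwa [closure_interior_refTriangle] at this

theorem D_eqOn {f g : E2 → ℝ} (hf : ContDiff ℝ ∞ f) (hg : ContDiff ℝ ∞ g)
    (h : EqOn f g refTriangle) (a b : ℕ) : EqOn (D a b f) (D a b g) refTriangle := by
  induction b generalizing f g with
  | zero =>
    induction a with
    | zero => exact h
    | succ a ih =>
      rw [← pd_zero_D, ← pd_zero_D]
      exact pd_eqOn (contDiff_D hf a 0) (contDiff_D hg a 0) ih 0
  | succ b ih =>
    rw [← D_pd_one, ← D_pd_one]
    exact ih (contDiff_pd hf 1) (contDiff_pd hg 1) (pd_eqOn hf hg h 1)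

theorem nK_const_mul (c : ℝ) (f : E2 → ℝ) : nK (fun x => c * f x) = ‖c‖ₑ * nK f :=
  eLpNorm_const_smul c f 2 muK

/-- By `pd_moll` the derivative is the mollification of `v'` up to the vanishing correction `δ ·
moll n v'`. -/
theorem tendsto_nK_pd_moll {v v' : E2 → ℝ} {i : Fin 2} (h : HasD v i v') (mv : MemLp v 2 muK)
    (mv' : MemLp v' 2 muK) : Tendsto (fun n => nK (pd i (moll n v) - v')) atTop (𝓝 0) := by
  have e : ∀ n : ℕ, nK (pd i (moll n v) - v') ≤
      nK (moll n v' - v') + ‖(1 : ℝ) / (n + 2)‖ₑ * (2 * nK v') := by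
    intro n
    have h1 : EqOn (pd i (moll n v) - v')
        ((moll n v' - v') + fun x => -(1 / (n + 2)) * moll n v' x) refTriangle := by
      intro x hx
      simp only [Pi.sub_apply, Pi.add_apply, pd_moll n h mv hx]
      ring
    rw [nK_le_of_eqOn h1]
    refine (nK_add_le ((memLp_moll n mv').sub mv') ((memLp_moll n mv').const_mul _)).trans ?_
    rw [nK_const_mul, enorm_neg]
    gcongr
    exact nK_moll_le n mv'
  have h2 : Tendsto (fun n : ℕ => nK (moll n v' - v') + ‖(1 : ℝ) / (n + 2)‖ₑ * (2 * nK v')) atTop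
      (𝓝 (0 + 0 * (2 * nK v'))) := by
    refine (tendsto_nK_moll mv').add (ENNReal.Tendsto.mul_const ?_ (Or.inr ?_))
    · have := (continuous_enorm (E := ℝ)).tendsto 0
      rw [enorm_zero] at this
      exact this.comp tendsto_moll_param
    · exact ENNReal.mul_ne_top (by simp) mv'.2.ne
  rw [zero_mul, zero_add] at h2
  exact tendsto_of_tendsto_of_tendsto_of_le_of_le tendsto_const_nhds h2 (fun _ => zero_le) e

theorem tendsto_nK_pd_pd_moll {v v' v'' : E2 → ℝ} {i j : Fin 2} (h : HasD v i v') (h' : HasD v' j v'')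
    (mv : MemLp v 2 muK) (mv' : MemLp v' 2 muK) (mv'' : MemLp v'' 2 muK) :
    Tendsto (fun n => nK (pd j (pd i (moll n v)) - v'')) atTop (𝓝 0) := by
  have e : ∀ n : ℕ, nK (pd j (pd i (moll n v)) - v'') ≤
      nK (pd j (moll n v') - v'') + ‖(1 : ℝ) / (n + 2)‖ₑ * (2 * nK v'') := by
    intro n
    have hs := contDiff_moll n mv'
    have h1 : EqOn (pd j (pd i (moll n v)) - v'')
        ((pd j (moll n v') - v'') + fun x => -(1 / (n + 2)) * pd j (moll n v') x) refTriangle := by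
      intro x hx
      have h2 := pd_eqOn (contDiff_pd (contDiff_moll n mv) i)
        (g := fun x => (1 - 1 / ((n : ℝ) + 2)) * moll n v' x) (contDiff_const.mul hs)
        (fun x hx => pd_moll n h mv hx) j hx
      rw [pd_const_mul hs] at h2
      simp only [Pi.sub_apply, Pi.add_apply, h2]
      ring
    rw [nK_le_of_eqOn h1]
    have mp : MemLp (pd j (moll n v')) 2 muK := memLp_of_continuous (continuous_pd hs j)
    refine (nK_add_le (mp.sub mv'') (mp.const_mul _)).trans ?_
    rw [nK_const_mul, enorm_neg]
    gcongr
    have h3 : EqOn (pd j (moll n v')) (fun x => (1 - 1 / ((n : ℝ) + 2)) * moll n v'' x) refTriangle :=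
      fun x hx => pd_moll n h' mv' hx
    rw [nK_le_of_eqOn h3, nK_const_mul]
    calc _ ≤ 1 * nK (moll n v'') := by
          gcongr
          obtain ⟨a1, a2⟩ := moll_param n
          rw [Real.enorm_eq_ofReal (by linarith)]
          exact ENNReal.ofReal_le_one.2 (by linarith)
      _ ≤ _ := by rw [one_mul]; exact nK_moll_le n mv''
  have h2 : Tendsto (fun n : ℕ => nK (pd j (moll n v') - v'') + ‖(1 : ℝ) / (n + 2)‖ₑ * (2 * nK v'')) atTop
      (𝓝 (0 + 0 * (2 * nK v''))) := by
    refine (tendsto_nK_pd_moll h' mv' mv'').add (ENNReal.Tendsto.mul_const ?_ (Or.inr ?_))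
    · have := (continuous_enorm (E := ℝ)).tendsto 0
      rw [enorm_zero] at this
      exact this.comp tendsto_moll_param
    · exact ENNReal.mul_ne_top (by simp) mv''.2.ne
  rw [zero_mul, zero_add] at h2
  exact tendsto_of_tendsto_of_tendsto_of_le_of_le tendsto_const_nhds h2 (fun _ => zero_le) e

/-! ### Scaled Sobolev bounds -/

/-- The function `v` has square integrable weak derivatives on the reference triangle up to the
order `j`, and those of order `l` have `L²` norm at most `hˡ M`. -/
def SobBd : ℕ → ℝ≥0∞ → (E2 → ℝ) → ℝ≥0∞ → Prop
  | 0, _, v, M => MemLp v 2 muK ∧ nK v ≤ M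
  | j + 1, h, v, M => MemLp v 2 muK ∧ nK v ≤ M ∧ ∀ i, ∃ v', HasD v i v' ∧ SobBd j h v' (h * M)

theorem SobBd.memLp {j : ℕ} {h M : ℝ≥0∞} {v : E2 → ℝ} (H : SobBd j h v M) : MemLp v 2 muK := by
  cases j with
  | zero => exact H.1
  | succ j => exact H.1

theorem SobBd.mono {j : ℕ} : ∀ {h M M' : ℝ≥0∞} {v : E2 → ℝ}, SobBd j h v M → M ≤ M' →
    SobBd j h v M' := by
  induction j with
  | zero => exact fun H hM => ⟨H.1, H.2.trans hM⟩
  | succ j ih =>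
    intro h M M' v H hM
    refine ⟨H.1, H.2.1.trans hM, fun i => ?_⟩
    obtain ⟨v', h1, h2⟩ := H.2.2 i
    exact ⟨v', h1, ih h2 (by gcongr)⟩

theorem SobBd.of_succ {j : ℕ} : ∀ {h M : ℝ≥0∞} {v : E2 → ℝ}, SobBd (j + 1) h v M → SobBd j h v M := by
  induction j with
  | zero => exact fun H => ⟨H.1, H.2.1⟩
  | succ j ih =>
    intro h M v H
    refine ⟨H.1, H.2.1, fun i => ?_⟩
    obtain ⟨v', h1, h2⟩ := H.2.2 i
    exact ⟨v', h1, ih h2⟩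

theorem SobBd.congr {j : ℕ} {h M : ℝ≥0∞} {v u : E2 → ℝ} (H : SobBd j h v M) (hu : v =ᵐ[muK] u) :
    SobBd j h u M := by
  cases j with
  | zero => exact ⟨H.1.ae_eq hu, (nK_congr hu).symm.trans_le H.2⟩
  | succ j =>
    refine ⟨H.1.ae_eq hu, (nK_congr hu).symm.trans_le H.2.1, fun i => ?_⟩
    obtain ⟨v', h1, h2⟩ := H.2.2 i
    exact ⟨v', h1.congr hu (ae_eq_refl _), h2⟩

theorem SobBd.finset_sum {ι : Type*} (s : Finset ι) {j : ℕ} : ∀ {h : ℝ≥0∞} {M : ι → ℝ≥0∞}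
    {v : ι → E2 → ℝ}, (∀ c ∈ s, SobBd j h (v c) (M c)) →
    SobBd j h (fun y => ∑ c ∈ s, v c y) (∑ c ∈ s, M c) := by
  have h0 : ∀ {M : ι → ℝ≥0∞} {v : ι → E2 → ℝ}, (∀ c ∈ s, MemLp (v c) 2 muK) →
      (∀ c ∈ s, nK (v c) ≤ M c) →
      MemLp (fun y => ∑ c ∈ s, v c y) 2 muK ∧ nK (fun y => ∑ c ∈ s, v c y) ≤ ∑ c ∈ s, M c := by
    intro M v h1 h2
    refine ⟨memLp_finsetSum s h1, ?_⟩
    have : nK (∑ c ∈ s, v c) ≤ ∑ c ∈ s, nK (v c) := eLpNorm_sum_le (fun c hc => (h1 c hc).1) (by simp)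
    have e : (fun y => ∑ c ∈ s, v c y) = ∑ c ∈ s, v c := by ext; simp
    rw [e]
    exact this.trans (Finset.sum_le_sum h2)
  induction j with
  | zero => exact fun H => h0 (fun c hc => (H c hc).1) (fun c hc => (H c hc).2)
  | succ j ih =>
    intro h M v H
    obtain ⟨h1, h2⟩ := h0 (fun c hc => (H c hc).1) (fun c hc => (H c hc).2.1)
    refine ⟨h1, h2, fun i => ?_⟩
    classical
    choose! v' hv' hv'' using fun c hc => (H c hc).2.2 i
    refine ⟨fun y => ∑ c ∈ s, v' c y, ?_, ?_⟩
    · exact HasD.finset_sum s hv' (fun c hc => (H c hc).1) (fun c hc => (hv'' c hc).memLp)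
    · rw [Finset.mul_sum]
      exact ih hv''

theorem SobBd.add {j : ℕ} {h M₁ M₂ : ℝ≥0∞} {v u : E2 → ℝ} (H₁ : SobBd j h v M₁)
    (H₂ : SobBd j h u M₂) : SobBd j h (fun y => v y + u y) (M₁ + M₂) := by
  have := SobBd.finset_sum (Finset.univ : Finset (Fin 2)) (j := j) (h := h) (M := ![M₁, M₂])
    (v := ![v, u]) (fun c _ => by fin_cases c; exacts [H₁, H₂])
  simpa [Fin.sum_univ_two] using this

theorem SobBd.mul {j : ℕ} : ∀ {h : ℝ} {A : ℝ} {M : ℝ≥0∞} {a v : E2 → ℝ}, 0 ≤ h →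
    ContDiff ℝ ∞ a → BdK j h A a → SobBd j (ENNReal.ofReal h) v M →
    SobBd j (ENNReal.ofReal h) (fun y => a y * v y) (2 ^ j * ENNReal.ofReal A * M) := by
  have h0 : ∀ {A : ℝ} {M : ℝ≥0∞} {a v : E2 → ℝ}, ContDiff ℝ ∞ a → (∀ x ∈ refTriangle, |a x| ≤ A) →
      MemLp v 2 muK → nK v ≤ M → nK (fun y => a y * v y) ≤ ENNReal.ofReal A * M := by
    intro A M a v ha hA hv hM
    refine le_trans ?_ (mul_le_mul' le_rfl hM)
    refine eLpNorm_le_mul_eLpNorm_of_ae_le_mul (c := A) ?_ 2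
    refine ae_muK_of_forall fun x hx => ?_
    rw [norm_mul]
    gcongr
    exact hA x hx
  induction j with
  | zero =>
    intro h A M a v hh ha hA H
    rw [bdK_zero_iff] at hA
    refine ⟨MemLp.continuous_mul ha.continuous H.1, ?_⟩
    rw [pow_zero, one_mul]
    exact h0 ha hA H.1 H.2
  | succ j ih =>
    intro h A M a v hh ha hA H
    have hA0 := hA.nonneg
    have hAj := hA.of_le (Nat.le_succ j)
    have Hj := H.of_succ
    rw [bdK_succ_iff ha] at hA
    refine ⟨MemLp.continuous_mul ha.continuous H.1, ?_, fun i => ?_⟩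
    · refine (h0 ha hA.1 H.1 H.2.1).trans ?_
      gcongr
      calc ENNReal.ofReal A = 1 * ENNReal.ofReal A := (one_mul _).symm
        _ ≤ _ := by gcongr; exact one_le_pow₀ (by norm_num)
    · obtain ⟨v', hv', Hv'⟩ := H.2.2 i
      refine ⟨_, HasD.mul ha hv' H.1 Hv'.memLp, ?_⟩
      have h1 := ih hh (contDiff_pd ha i) (hA.2 i) Hj
      have h2 := ih hh ha hAj Hv'
      refine (h1.add h2).mono (le_of_eq ?_)
      rw [ENNReal.ofReal_mul hA0]
      ring

/-- Each derivative passes through the mollification at the price of a factor `1 - δ ≤ 1`, so only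
the final `L²` bound by 2 enters, whatever the order. -/
theorem nK_D_moll_le {j : ℕ} : ∀ {h M : ℝ≥0∞} {v : E2 → ℝ}, SobBd j h v M → ∀ a b, a + b = j → ∀ n,
    nK (D a b (moll n v)) ≤ 2 * (h ^ j * M) := by
  induction j with
  | zero =>
    intro h M v H a b hab n
    obtain ⟨rfl, rfl⟩ : a = 0 ∧ b = 0 := by omega
    refine (nK_moll_le n H.1).trans ?_
    rw [pow_zero, one_mul]
    gcongr
    exact H.2
  | succ j ih =>
    intro h M v H a b hab n
    have hs := contDiff_moll n H.1
    have key : ∀ i, ∀ a' b', a' + b' = j → nK (D a' b' (pd i (moll n v))) ≤ 2 * (h ^ (j + 1) * M) := by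
      intro i a' b' hab'
      obtain ⟨v', hv', Hv'⟩ := H.2.2 i
      have hs' := contDiff_moll n Hv'.memLp
      have h1 := D_eqOn (contDiff_pd hs i) (g := fun x => (1 - 1 / ((n : ℝ) + 2)) * moll n v' x)
        (contDiff_const.mul hs') (fun x hx => pd_moll n hv' H.1 hx) a' b'
      rw [nK_le_of_eqOn h1, D_const_mul hs', nK_const_mul]
      calc _ ≤ 1 * (2 * (h ^ j * (h * M))) := by
            refine mul_le_mul' ?_ (ih Hv' a' b' hab' n)
            obtain ⟨a1, a2⟩ := moll_param n
            rw [Real.enorm_eq_ofReal (by linarith)]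
            exact ENNReal.ofReal_le_one.2 (by linarith)
        _ = _ := by ring
    rcases b with _ | b
    · obtain ⟨a, rfl⟩ : ∃ a', a = a' + 1 := ⟨a - 1, by omega⟩
      rw [← D_pd_zero hs]
      exact key 0 a 0 (by omega)
    · rw [← D_pd_one]
      exact key 1 a b (by omega)

theorem nK_le_of_tendsto {f : ℕ → E2 → ℝ} {g : E2 → ℝ} {C : ℝ≥0∞} (hf : ∀ n, MemLp (f n) 2 muK)
    (hg : MemLp g 2 muK) (h : Tendsto (fun n => nK (f n - g)) atTop (𝓝 0)) (hC : ∀ n, nK (f n) ≤ C) :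
    nK g ≤ C := by
  have h1 : ∀ n, nK g ≤ nK (f n - g) + C := by
    intro n
    have e : g = (g - f n) + f n := by abel
    calc nK g = nK ((g - f n) + f n) := by rw [← e]
      _ ≤ nK (g - f n) + nK (f n) := nK_add_le (hg.sub (hf n)) (hf n)
      _ ≤ _ := by rw [nK_sub_comm]; gcongr; exact hC n
  have h2 : Tendsto (fun n => nK (f n - g) + C) atTop (𝓝 (0 + C)) := h.add tendsto_const_nhds
  rw [zero_add] at h2
  exact ge_of_tendsto' h2 h1

/-- The trace inequality for weakly differentiable functions that are continuous up to the
boundary. -/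
theorem exists_weak_trace_le : ∃ C : ℝ≥0, ∀ v : E2 → ℝ, ContinuousOn v refTriangle →
    ∀ v' : Fin 2 → E2 → ℝ, (∀ i, HasD v i (v' i)) → MemLp v 2 muK → (∀ i, MemLp (v' i) 2 muK) →
    ∀ i j, eLpNorm (fun s => v (halfEdge i j s)) 2 (volume.restrict (Icc (0 : ℝ) 1)) ≤
      C * (nK v + nK (v' 0) + nK (v' 1)) := by
  obtain ⟨C, hC⟩ := exists_trace_le
  refine ⟨C, fun v hvc v' hv' mv mv' i j => ?_⟩
  set μ := (volume : Measure ℝ).restrict (Icc (0 : ℝ) 1)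
  have hγ : Continuous (halfEdge i j) := by unfold halfEdge; fun_prop
  have hm : AEStronglyMeasurable (fun s => v (halfEdge i j s)) μ :=
    (hvc.comp hγ.continuousOn fun s hs => halfEdge_mem i j s hs).aestronglyMeasurable measurableSet_Icc
  have hmn : ∀ n, AEStronglyMeasurable (fun s => moll n v (halfEdge i j s)) μ := fun n =>
    ((contDiff_moll n mv).continuous.comp hγ).aestronglyMeasurable
  have h1 : ∀ n, eLpNorm (fun s => v (halfEdge i j s)) 2 μ ≤
      eLpNorm (fun s => v (halfEdge i j s) - moll n v (halfEdge i j s)) 2 μ +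
        C * (nK (moll n v - v) + nK (pd 0 (moll n v) - v' 0) + nK (pd 1 (moll n v) - v' 1) +
          (nK v + nK (v' 0) + nK (v' 1))) := by
    intro n
    have hs := contDiff_moll n mv
    have e : (fun s => v (halfEdge i j s)) =
        (fun s => v (halfEdge i j s) - moll n v (halfEdge i j s)) +
          fun s => moll n v (halfEdge i j s) := by
      ext s
      simp
    conv_lhs => rw [e]
    refine (eLpNorm_add_le (hm.sub (hmn n)) (hmn n) (by simp)).trans ?_
    refine add_le_add le_rfl ((hC _ hs i j).trans ?_)
    gcongr
    rw [H1]
    have key : ∀ f g : E2 → ℝ, MemLp f 2 muK → MemLp g 2 muK → nK f ≤ nK (f - g) + nK g := by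
      intro f g hf hg
      have := nK_add_le (hf.sub hg) hg
      rwa [sub_add_cancel] at this
    calc _ ≤ nK (moll n v - v) + nK v + (nK (pd 0 (moll n v) - v' 0) + nK (v' 0)) +
          (nK (pd 1 (moll n v) - v' 1) + nK (v' 1)) := by
          gcongr
          · exact key _ _ (memLp_moll n mv) mv
          · exact key _ _ (memLp_of_continuous (continuous_pd hs 0)) (mv' 0)
          · exact key _ _ (memLp_of_continuous (continuous_pd hs 1)) (mv' 1)
      _ = _ := by ring
  -- Continuity up to the boundary gives uniform convergence and hence convergence of the edge
  -- values. For the derivatives, `L²` convergence is enough on the right-hand side.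
  have h0 : Tendsto (fun n => eLpNorm (fun s => v (halfEdge i j s) - moll n v (halfEdge i j s)) 2 μ)
      atTop (𝓝 0) := by
    have hu := tendstoUniformlyOn_moll hvc
    rw [Metric.tendstoUniformlyOn_iff] at hu
    rw [ENNReal.tendsto_nhds_zero]
    intro ε hε
    rcases eq_or_ne ε ⊤ with rfl | hεt
    · simp
    filter_upwards [hu ε.toReal (ENNReal.toReal_pos hε.ne' hεt)] with n hn
    have := eLpNorm_le_of_ae_bound (p := 2) (μ := μ) (C := ε.toReal)
      (f := fun s => v (halfEdge i j s) - moll n v (halfEdge i j s))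
      ((ae_restrict_iff' measurableSet_Icc).2 (Eventually.of_forall fun s hs =>
        (hn _ (halfEdge_mem i j s hs)).le))
    simpa [μ, ENNReal.ofReal_toReal hεt] using this
  have h2 := h0.add (ENNReal.Tendsto.const_mul (a := C) ((((tendsto_nK_moll mv).add
    (tendsto_nK_pd_moll (hv' 0) mv (mv' 0))).add (tendsto_nK_pd_moll (hv' 1) mv (mv' 1))).add
      (tendsto_const_nhds (x := nK v + nK (v' 0) + nK (v' 1)))) (Or.inr (by simp)))
  simp only [add_zero, zero_add] at h2
  exact ge_of_tendsto' h2 h1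

/-- The interpolation error of Sobolev functions on the reference triangle. -/
theorem LagrangeNodes.exists_weak_interpolation_error_le {k : ℕ} (N : LagrangeNodes k) {m : ℕ}
    (hm : 2 ≤ m) (hmk : m ≤ k + 1) : ∃ C : ℝ≥0, ∀ (h M : ℝ≥0∞) (u : E2 → ℝ), h ≠ ⊤ → M ≠ ⊤ →
    ContinuousOn u refTriangle → SobBd m h u M → ∃ (E : Fin 2 → E2 → ℝ) (F : Fin 2 → Fin 2 → E2 → ℝ),
      (∀ i, HasD (fun y => u y - N.interpolant u y) i (E i)) ∧ (∀ i j, HasD (E i) j (F i j)) ∧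
      MemLp (fun y => u y - N.interpolant u y) 2 muK ∧
      (∀ i, MemLp (E i) 2 muK) ∧ (∀ i j, MemLp (F i j) 2 muK) ∧
      nK (fun y => u y - N.interpolant u y) ≤ C * (h ^ m * M) ∧ (∀ i, nK (E i) ≤ C * (h ^ m * M)) ∧
      (∀ i j, nK (F i j) ≤ C * (h ^ m * M)) := by
  obtain ⟨C, hC⟩ := N.exists_interpolation_error_le hm hmk
  obtain ⟨B, hB0, hB⟩ := N.exists_interpolant_le 2
  refine ⟨C * 2, fun h M u hh hM huc H => ?_⟩
  -- Writing `m` as a double successor exposes two layers of `SobBd`, which provide the first and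
  -- second weak derivatives of `u`.
  obtain ⟨m', rfl⟩ : ∃ m', m = m' + 1 + 1 := ⟨m - 2, by omega⟩
  have mu := H.1
  choose v hv Hv using H.2.2
  have mv := fun i => (Hv i).memLp
  choose w hw Hw using fun i => (Hv i).2.2
  have mw := fun i j => (Hw i j).memLp
  set f : ℕ → E2 → ℝ := fun n => moll n u with hf
  have fs : ∀ n, ContDiff ℝ ∞ (f n) := fun n => contDiff_moll n mu
  have Is : ∀ g : E2 → ℝ, ContDiff ℝ ∞ (N.interpolant g) := N.contDiff_interpolant
  have memI : ∀ (g : E2 → ℝ) a b, MemLp (D a b (N.interpolant g)) 2 muK := fun g a b =>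
    memLp_of_continuous (contDiff_D (Is g) a b).continuous
  have herr : ∀ n a b, a + b ≤ 2 → nK (D a b (f n - N.interpolant (f n))) ≤
      ↑(C * 2) * (h ^ (m' + 1 + 1) * M) := by
    intro n a b hab
    refine (hC (f n) (fs n) _ ?_ (fun a b hab => nK_D_moll_le H a b hab n) a b hab).trans_eq ?_
    · exact ENNReal.mul_ne_top (by simp) (ENNReal.mul_ne_top (ENNReal.pow_ne_top hh) hM)
    · push_cast
      ring
  have hunif : TendstoUniformlyOn f u atTop refTriangle := tendstoUniformlyOn_moll huc
  -- Nodal values of the mollifications converge because `u` is continuous on the closed triangle.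
  -- The interpolant depends on finitely many of them, so all its derivatives converge uniformly.
  have hIt : ∀ a b, a + b ≤ 2 →
      Tendsto (fun n => nK (D a b (N.interpolant (f n)) - D a b (N.interpolant u))) atTop (𝓝 0) := by
    intro a b hab
    refine tendsto_nK_of_uniform ?_
    rw [Metric.tendstoUniformlyOn_iff] at hunif ⊢
    intro ε hε
    filter_upwards [hunif (ε / (B + 1)) (by positivity)] with n hn x hx
    have := hB (f n - u) (ε / (B + 1)) (by positivity) (fun p hp => by
      have := (hn p (N.mem_refTriangle p hp)).le
      rwa [dist_comm, Real.dist_eq] at this) a b hab x hx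
    rw [N.interpolant_sub, D_sub (Is _) (Is _)] at this
    rw [dist_comm, Real.dist_eq]
    refine this.trans_lt ?_
    rw [mul_div_assoc', div_lt_iff₀ (by positivity)]
    nlinarith
  -- The error bound for the smooth functions `f n` passes to their `L²` limits, with the same
  -- constant for the function and for its first and second derivatives.
  have key : ∀ a b, a + b ≤ 2 → ∀ g : E2 → ℝ, MemLp g 2 muK →
      Tendsto (fun n => nK (D a b (f n) - g)) atTop (𝓝 0) →
      nK (fun y => g y - D a b (N.interpolant u) y) ≤ ↑(C * 2) * (h ^ (m' + 1 + 1) * M) := by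
    intro a b hab g hg ht
    refine nK_le_of_tendsto (f := fun n => D a b (f n - N.interpolant (f n)))
      (g := g - D a b (N.interpolant u)) (fun n => ?_) (hg.sub (memI u a b)) ?_
      (fun n => herr n a b hab)
    · exact memLp_of_continuous (contDiff_D ((fs n).sub (Is _)) a b).continuous
    · have hle : ∀ n, nK (D a b (f n - N.interpolant (f n)) - (g - D a b (N.interpolant u))) ≤
          nK (D a b (f n) - g) + nK (D a b (N.interpolant (f n)) - D a b (N.interpolant u)) := by
        intro n
        have m1 : MemLp (D a b (f n) - g) 2 muK :=
          (memLp_of_continuous (contDiff_D (fs n) a b).continuous).sub hg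
        have m2 : MemLp (D a b (N.interpolant (f n)) - D a b (N.interpolant u)) 2 muK :=
          (memI _ a b).sub (memI _ a b)
        rw [D_sub (fs n) (Is _), show D a b (f n) - D a b (N.interpolant (f n)) -
          (g - D a b (N.interpolant u)) = (D a b (f n) - g) -
            (D a b (N.interpolant (f n)) - D a b (N.interpolant u)) by abel]
        exact eLpNorm_sub_le m1.1 m2.1 (by simp)
      have h2 := ht.add (hIt a b hab)
      rw [add_zero] at h2
      exact tendsto_of_tendsto_of_tendsto_of_le_of_le tendsto_const_nhds h2 (fun _ => zero_le) hle
  have hpp : ∀ i j, ∃ a b, a + b = 2 ∧ ∀ g : E2 → ℝ, ContDiff ℝ ∞ g → pd j (pd i g) = D a b g := by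
    intro i j
    have hi : i = 0 ∨ i = 1 := by omega
    have hj : j = 0 ∨ j = 1 := by omega
    rcases hi with rfl | rfl <;> rcases hj with rfl | rfl
    · exact ⟨2, 0, rfl, fun g _ => rfl⟩
    · exact ⟨1, 1, rfl, fun g hg => pd_one_D hg 1 0⟩
    · exact ⟨1, 1, rfl, fun g _ => rfl⟩
    · exact ⟨0, 2, rfl, fun g _ => rfl⟩
  have hp : ∀ i, ∃ a b, a + b = 1 ∧ ∀ g : E2 → ℝ, pd i g = D a b g := by
    intro i
    have hi : i = 0 ∨ i = 1 := by omega
    rcases hi with rfl | rfl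
    · exact ⟨1, 0, rfl, fun g => rfl⟩
    · exact ⟨0, 1, rfl, fun g => rfl⟩
  have cI : ∀ i, ContDiff ℝ ∞ (pd i (N.interpolant u)) := fun i => contDiff_pd (Is u) i
  have mI0 : MemLp (N.interpolant u) 2 muK := memLp_of_continuous (Is u).continuous
  have mI1 : ∀ i, MemLp (pd i (N.interpolant u)) 2 muK := fun i =>
    memLp_of_continuous (cI i).continuous
  have mI2 : ∀ i j, MemLp (pd j (pd i (N.interpolant u))) 2 muK := fun i j =>
    memLp_of_continuous (continuous_pd (cI i) j)
  refine ⟨fun i y => v i y - pd i (N.interpolant u) y,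
    fun i j y => w i j y - pd j (pd i (N.interpolant u)) y, fun i => ?_, fun i j => ?_, mu.sub mI0,
    fun i => (mv i).sub (mI1 i), fun i j => (mw i j).sub (mI2 i j), ?_, fun i => ?_, fun i j => ?_⟩
  · exact (hv i).sub (hasD_of_contDiff (Is u) i) mu mI0 (mv i) (mI1 i)
  · exact (hw i j).sub (hasD_of_contDiff (cI i) j) (mv i) (mI1 i) (mw i j) (mI2 i j)
  · exact key 0 0 (by omega) u mu (tendsto_nK_moll mu)
  · obtain ⟨a, b, hab, e⟩ := hp i
    have := key a b (by omega) (v i) (mv i) (by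
      simpa only [← e] using tendsto_nK_pd_moll (hv i) mu (mv i))
    simpa only [← e] using this
  · obtain ⟨a, b, hab, e⟩ := hpp i j
    have := key a b (by omega) (w i j) (mw i j) (by
      simpa only [← e _ (fs _)] using tendsto_nK_pd_pd_moll (hv i) (hw i j) mu (mv i) (mw i j))
    simpa only [← e _ (Is u)] using this

/-- The Sobolev embedding: functions with weak derivatives of second order have a continuous
representative. -/
theorem exists_continuous_representative {h M : ℝ≥0∞} {u : E2 → ℝ} (H : SobBd 2 h u M) :
    ∃ g : E2 → ℝ, ContinuousOn g refTriangle ∧ u =ᵐ[muK] g := by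
  obtain ⟨S, hS⟩ := exists_sup_le
  have mu := H.1
  choose v hv Hv using H.2.2
  have mv := fun i => (Hv i).memLp
  choose w hw Hw using fun i => (Hv i).2.2
  have mw := fun i j => (Hw i j).memLp
  have fs : ∀ n, ContDiff ℝ ∞ (moll n u) := fun n => contDiff_moll n mu
  set η : ℕ → ℝ≥0∞ := fun n => nK (moll n u - u) + ∑ i, nK (pd i (moll n u) - v i) +
    ∑ i, ∑ j, nK (pd j (pd i (moll n u)) - w i j) with hη
  have hηt : Tendsto η atTop (𝓝 0) := by
    have := ((tendsto_nK_moll mu).add (tendsto_finsetSum Finset.univ fun i _ =>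
      tendsto_nK_pd_moll (hv i) mu (mv i))).add (tendsto_finsetSum Finset.univ fun i _ =>
      tendsto_finsetSum Finset.univ fun j _ => tendsto_nK_pd_pd_moll (hv i) (hw i j) mu (mv i) (mw i j))
    simpa only [Finset.sum_const_zero, add_zero] using this
  have tri : ∀ f g u : E2 → ℝ, MemLp f 2 muK → MemLp g 2 muK → MemLp u 2 muK →
      nK (f - g) ≤ nK (f - u) + nK (g - u) := by
    intro f g u hf hg hu
    have := nK_add_le (hf.sub hu) (hu.sub hg)
    rw [sub_add_sub_cancel] at this
    rwa [nK_sub_comm g u]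
  have hle : ∀ n p, H2 (moll n u - moll p u) ≤ 9 * (η n + η p) := by
    intro n p
    have b0 : nK (moll n u - moll p u) ≤ η n + η p := by
      refine (tri _ _ u (memLp_moll n mu) (memLp_moll p mu) mu).trans ?_
      gcongr <;> · simp only [hη]; rw [add_assoc]; exact le_self_add
    have b1 : ∀ i, nK (pd i (moll n u - moll p u)) ≤ η n + η p := by
      intro i
      rw [pd_sub (fs n) (fs p)]
      refine (tri _ _ (v i) (memLp_of_continuous (continuous_pd (fs n) i))
        (memLp_of_continuous (continuous_pd (fs p) i)) (mv i)).trans ?_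
      have : ∀ n, nK (pd i (moll n u) - v i) ≤ η n := fun n =>
        (Finset.single_le_sum (f := fun i => nK (pd i (moll n u) - v i)) (fun _ _ => zero_le)
          (Finset.mem_univ i)).trans (le_add_self.trans le_self_add)
      exact add_le_add (this n) (this p)
    have b2 : ∀ i j, nK (pd j (pd i (moll n u - moll p u))) ≤ η n + η p := by
      intro i j
      rw [pd_sub (fs n) (fs p), pd_sub (contDiff_pd (fs n) i) (contDiff_pd (fs p) i)]
      refine (tri _ _ (w i j) (memLp_of_continuous (continuous_pd (contDiff_pd (fs n) i) j))
        (memLp_of_continuous (continuous_pd (contDiff_pd (fs p) i) j)) (mw i j)).trans ?_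
      have : ∀ n, nK (pd j (pd i (moll n u)) - w i j) ≤ η n := fun n =>
        ((Finset.single_le_sum (f := fun j => nK (pd j (pd i (moll n u)) - w i j)) (fun _ _ => zero_le)
          (Finset.mem_univ j)).trans (Finset.single_le_sum
          (f := fun i => ∑ j, nK (pd j (pd i (moll n u)) - w i j)) (fun _ _ => zero_le)
          (Finset.mem_univ i))).trans le_add_self
      exact add_le_add (this n) (this p)
    rw [H2, H1, H1, H1]
    calc _ ≤ (η n + η p) + (η n + η p) + (η n + η p) + ((η n + η p) + (η n + η p) + (η n + η p)) +
          ((η n + η p) + (η n + η p) + (η n + η p)) := by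
          gcongr
          exacts [b1 0, b1 1, b1 0, b2 0 0, b2 0 1, b1 1, b2 1 0, b2 1 1]
      _ = _ := by ring
  -- The mollifications are Cauchy in `H²`, hence uniformly Cauchy on the triangle by the Sobolev
  -- inequality. Their uniform limit is the continuous representative.
  have hcau : ∀ ε > 0, ∃ n₀, ∀ n ≥ n₀, ∀ p ≥ n₀, ∀ x ∈ refTriangle,
      |moll n u x - moll p u x| ≤ ε := by
    intro ε hε
    have h1 : Tendsto (fun n => (S : ℝ≥0∞) * 9 * 2 * η n) atTop (𝓝 0) := by
      have := ENNReal.Tendsto.const_mul (a := (S : ℝ≥0∞) * 9 * 2) hηt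
        (Or.inr (ENNReal.mul_ne_top (ENNReal.mul_ne_top (by simp) (by simp)) (by simp)))
      simpa using this
    obtain ⟨n₀, hn₀⟩ := eventually_atTop.1 (h1.eventually (ge_mem_nhds (ENNReal.ofReal_pos.2 hε)))
    refine ⟨n₀, fun n hn p hp x hx => ?_⟩
    have h2 := hS _ ((fs n).sub (fs p)) x hx
    have h3 : ‖moll n u x - moll p u x‖ₑ ≤ ENNReal.ofReal ε := by
      refine h2.trans ?_
      calc _ ≤ (S : ℝ≥0∞) * (9 * (η n + η p)) := by gcongr; exact hle n p
        _ = (S * 9 * 2 * η n + S * 9 * 2 * η p) / 2 := by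
            rw [← mul_add, mul_comm (S * 9 * 2 : ℝ≥0∞), mul_div_assoc,
              show (S * 9 * 2 : ℝ≥0∞) / 2 = S * 9 from ENNReal.mul_div_cancel_right (by simp) (by simp)]
            ring
        _ ≤ (ENNReal.ofReal ε + ENNReal.ofReal ε) / 2 := by
            gcongr
            · exact hn₀ n hn
            · exact hn₀ p hp
        _ = ENNReal.ofReal ε := by
            rw [← mul_two]
            exact ENNReal.mul_div_cancel_right (by simp) (by simp)
    rwa [Real.enorm_eq_ofReal_abs, ENNReal.ofReal_le_ofReal_iff hε.le] at h3
  have hlim : ∀ x ∈ refTriangle, ∃ y, Tendsto (fun n => moll n u x) atTop (𝓝 y) := by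
    intro x hx
    refine cauchySeq_tendsto_of_complete (Metric.cauchySeq_iff'.2 fun ε hε => ?_)
    obtain ⟨n₀, hn₀⟩ := hcau (ε / 2) (half_pos hε)
    exact ⟨n₀, fun n hn => (hn₀ n hn n₀ le_rfl x hx).trans_lt (half_lt_self hε)⟩
  choose! g hg using hlim
  have hunif : TendstoUniformlyOn (fun n => moll n u) g atTop refTriangle := by
    rw [Metric.tendstoUniformlyOn_iff]
    intro ε hε
    obtain ⟨n₀, hn₀⟩ := hcau (ε / 2) (half_pos hε)
    filter_upwards [eventually_ge_atTop n₀] with n hn x hx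
    have : |g x - moll n u x| ≤ ε / 2 :=
      le_of_tendsto ((hg x hx).sub_const _).abs ((eventually_ge_atTop n₀).mono fun p hp =>
        hn₀ p hp n hn x hx)
    exact this.trans_lt (half_lt_self hε)
  have hgc : ContinuousOn g refTriangle :=
    hunif.continuousOn (Frequently.of_forall fun n => (fs n).continuous.continuousOn)
  refine ⟨g, hgc, ?_⟩
  have mg : MemLp g 2 muK := by
    refine ⟨hgc.aestronglyMeasurable measurableSet_refTriangle, ?_⟩
    obtain ⟨C, hC⟩ := isCompact_refTriangle.exists_bound_of_continuousOn hgc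
    refine (nK_le_of_bound hC).trans_lt ?_
    exact ENNReal.mul_lt_top (ENNReal.rpow_lt_top_of_nonneg (by simp) (measure_ne_top _ _)) (by simp)
  have hz : nK (u - g) = 0 := by
    have h1 : ∀ n, nK (u - g) ≤ nK (moll n u - u) + nK (moll n u - g) := by
      intro n
      have := tri u g (moll n u) mu mg (memLp_moll n mu)
      rwa [nK_sub_comm u (moll n u), nK_sub_comm g (moll n u)] at this
    have h2 := (tendsto_nK_moll mu).add (tendsto_nK_of_uniform hunif)
    rw [add_zero] at h2
    exact le_antisymm (ge_of_tendsto' h2 h1) zero_le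
  have := (eLpNorm_eq_zero_iff (mu.1.sub mg.1) (by simp)).1 hz
  filter_upwards [this] with x hx
  simpa [sub_eq_zero] using hx

/-! ### Hausdorff measure and bi-Lipschitz parametrizations -/

open Measure in
-- Both sides carry the same normalising constant times the usual Hausdorff measure, so the
-- Lipschitz bound transfers unchanged.
theorem hausdorff_image_le {X Y : Type*} [MetricSpace X] [MeasurableSpace X] [BorelSpace X]
    [MetricSpace Y] [MeasurableSpace Y] [BorelSpace Y] (n : ℕ) {f : X → Y} {s : Set X} {L : ℝ≥0}
    (hf : LipschitzOnWith L f s) :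
    (euclideanHausdorffMeasure n : Measure Y) (f '' s) ≤
      (L : ℝ≥0∞) ^ n * (euclideanHausdorffMeasure n : Measure X) s := by
  have h := hf.hausdorffMeasure_image_le (d := n) (Nat.cast_nonneg n)
  rw [euclideanHausdorffMeasure_def, euclideanHausdorffMeasure_def, Measure.smul_apply,
    Measure.smul_apply, ENNReal.smul_def, ENNReal.smul_def, smul_eq_mul, smul_eq_mul]
  rw [ENNReal.rpow_natCast] at h
  calc _ ≤ _ := mul_le_mul_right h _
    _ = _ := by ring

/-- `X` is bi-Lipschitz on `s` with upper constant `L` and inverse lower constant `l`. -/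
structure BiLip (s : Set E2) (X : E2 → E3) (l L : ℝ≥0) : Prop where
  measurable : MeasurableSet s
  lip : LipschitzOnWith L X s
  anti : ∀ x ∈ s, ∀ y ∈ s, dist x y ≤ l * dist (X x) (X y)

namespace BiLip

variable {s : Set E2} {X : E2 → E3} {l L : ℝ≥0} (H : BiLip s X l L)
include H

theorem injOn : InjOn X s := fun x hx y hy hxy => by
  have := H.anti x hx y hy
  rw [hxy, dist_self, mul_zero] at this
  exact dist_le_zero.1 this

theorem measurableSet_image : MeasurableSet (X '' s) :=
  H.measurable.image_of_continuousOn_injOn H.lip.continuousOn H.injOn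

theorem lip_inv {Y : E3 → E2} (hY : ∀ x ∈ s, Y (X x) = x) : LipschitzOnWith l Y (X '' s) := by
  rw [lipschitzOnWith_iff_dist_le_mul]
  rintro _ ⟨x, hx, rfl⟩ _ ⟨y, hy, rfl⟩
  rw [hY x hx, hY y hy]
  exact H.anti x hx y hy

/-- Here and in its converse, Lipschitz bounds take the place of an area formula: only comparability
of the measures matters, with constants that scale correctly in the size of the chart. -/
theorem measure_image_le {S : Set E2} (hS : S ⊆ s) :
    Measure.euclideanHausdorffMeasure 2 (X '' S) ≤ (L : ℝ≥0∞) ^ 2 * volume S := by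
  have := hausdorff_image_le 2 (H.lip.mono hS)
  rwa [EuclideanSpace.euclideanHausdorffMeasure_eq_volume] at this

theorem volume_le_measure_image {S : Set E2} (hS : S ⊆ s) :
    volume S ≤ (l : ℝ≥0∞) ^ 2 * Measure.euclideanHausdorffMeasure 2 (X '' S) := by
  classical
  have h0 := fun x hx => Function.invFunOn_apply_eq (f := X) (s := s) (a := x) hx
  have h1 : ∀ x ∈ s, Function.invFunOn X s (X x) = x := fun x hx => H.injOn.leftInvOn_invFunOn hx
  have := hausdorff_image_le 2 ((H.lip_inv h1).mono (image_mono hS))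
  rw [EuclideanSpace.euclideanHausdorffMeasure_eq_volume, image_image,
    image_congr (fun x hx => h1 x (hS hx)), image_id'] at this
  exact this

theorem ae_comp {q : E3 → Prop} (hq : ∀ᵐ x ∂(area (X '' s)), q x) :
    ∀ᵐ y ∂(volume.restrict s), q (X y) := by
  rw [area, ae_restrict_iff' H.measurableSet_image] at hq
  rw [ae_restrict_iff' H.measurable]
  rw [ae_iff] at hq ⊢
  refine le_antisymm ((H.volume_le_measure_image (S := {a | ¬(a ∈ s → q (X a))}) ?_).trans ?_) zero_le
  · intro x hx; simp only [mem_ofPred_eq, Classical.not_imp] at hx; exact hx.1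
  · refine le_of_eq (mul_eq_zero_of_right _ (measure_mono_null ?_ hq))
    rintro _ ⟨x, hx, rfl⟩
    simp only [mem_ofPred_eq, Classical.not_imp] at hx ⊢
    exact ⟨⟨x, hx.1, rfl⟩, hx.2⟩

theorem ae_of_comp {q : E3 → Prop} (hq : ∀ᵐ y ∂(volume.restrict s), q (X y)) :
    ∀ᵐ x ∂(area (X '' s)), q x := by
  rw [area, ae_restrict_iff' H.measurableSet_image]
  rw [ae_restrict_iff' H.measurable] at hq
  rw [ae_iff] at hq ⊢
  have h1 : {a | ¬(a ∈ X '' s → q a)} = X '' {a | ¬(a ∈ s → q (X a))} := by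
    ext x
    simp only [mem_ofPred_eq, Classical.not_imp, mem_image]
    constructor
    · rintro ⟨⟨y, hy, rfl⟩, h⟩; exact ⟨y, ⟨hy, h⟩, rfl⟩
    · rintro ⟨y, ⟨hy, h⟩, rfl⟩; exact ⟨⟨y, hy, rfl⟩, h⟩
  rw [h1]
  refine le_antisymm ((H.measure_image_le ?_).trans (by rw [hq, mul_zero])) zero_le
  intro x hx; simp only [mem_ofPred_eq, Classical.not_imp] at hx; exact hx.1

theorem aemeasurable : AEMeasurable X (volume.restrict s) :=
  H.lip.continuousOn.aemeasurable H.measurable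

theorem map_absolutelyContinuous : (volume.restrict s).map X ≪ area (X '' s) := by
  refine Measure.AbsolutelyContinuous.mk fun S hS h => ?_
  rw [Measure.map_apply_of_aemeasurable H.aemeasurable hS]
  have h1 : ∀ᵐ x ∂(area (X '' s)), x ∉ S := measure_eq_zero_iff_ae_notMem.1 h
  exact measure_eq_zero_iff_ae_notMem.2 (H.ae_comp h1)

theorem aestronglyMeasurable_comp {F : Type*} [NormedAddCommGroup F] {f : E3 → F}
    (hf : AEStronglyMeasurable f (area (X '' s))) :
    AEStronglyMeasurable (fun y => f (X y)) (volume.restrict s) :=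
  (hf.mono_ac H.map_absolutelyContinuous).comp_aemeasurable H.aemeasurable

theorem aemeasurable_inv {Y : E3 → E2} (hY : ∀ x ∈ s, Y (X x) = x) :
    AEMeasurable Y (area (X '' s)) :=
  (H.lip_inv hY).continuousOn.aemeasurable H.measurableSet_image

theorem aestronglyMeasurable_inv {F : Type*} [NormedAddCommGroup F] {Y : E3 → E2}
    (hY : ∀ x ∈ s, Y (X x) = x) {f : E2 → F} (hf : AEStronglyMeasurable f (volume.restrict s)) :
    AEStronglyMeasurable (fun y => f (Y y)) (area (X '' s)) := by
  refine (hf.mono_ac ?_).comp_aemeasurable (H.aemeasurable_inv hY)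
  refine Measure.AbsolutelyContinuous.mk fun S hS h => ?_
  rw [Measure.map_apply_of_aemeasurable (H.aemeasurable_inv hY) hS]
  have h1 : ∀ᵐ x ∂(volume.restrict s), x ∉ S := measure_eq_zero_iff_ae_notMem.1 h
  refine measure_eq_zero_iff_ae_notMem.2 (H.ae_of_comp (q := fun x => x ∉ Y ⁻¹' S) ?_)
  filter_upwards [h1, ae_restrict_mem H.measurable] with x hx hxs
  rwa [mem_preimage, hY x hxs]

/-- Lebesgue measure on `s` is dominated by a multiple of the image of surface measure under the
inverse parametrization. Comparing measures gives the inequality for every `g`, measurable or not.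
-/
theorem lintegral_comp_le (g : E3 → ℝ≥0∞) :
    ∫⁻ y in s, g (X y) ≤ (l : ℝ≥0∞) ^ 2 * ∫⁻ x, g x ∂(area (X '' s)) := by
  set Y := Function.invFunOn X s
  have hY : ∀ x ∈ s, Y (X x) = x := fun x hx => H.injOn.leftInvOn_invFunOn hx
  have h1 : volume.restrict s ≤ ((l : ℝ≥0∞) ^ 2) • (area (X '' s)).map Y := by
    refine Measure.le_iff.2 fun S hS => ?_
    rw [Measure.smul_apply, Measure.map_apply_of_aemeasurable (H.aemeasurable_inv hY) hS,
      Measure.restrict_apply hS, area, Measure.restrict_apply' H.measurableSet_image, smul_eq_mul]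
    refine (H.volume_le_measure_image inter_subset_right).trans ?_
    gcongr
    rintro _ ⟨x, hx, rfl⟩
    exact ⟨by simpa [hY x hx.2] using hx.1, x, hx.2, rfl⟩
  calc ∫⁻ y in s, g (X y) ≤ ∫⁻ y, g (X y) ∂(((l : ℝ≥0∞) ^ 2) • (area (X '' s)).map Y) :=
        lintegral_mono' h1 le_rfl
    _ = (l : ℝ≥0∞) ^ 2 * ∫⁻ y, g (X y) ∂((area (X '' s)).map Y) := by
        rw [lintegral_smul_measure, smul_eq_mul]
    _ ≤ (l : ℝ≥0∞) ^ 2 * ∫⁻ x, g (X (Y x)) ∂(area (X '' s)) := by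
        gcongr; exact lintegral_map_le _ _
    _ = _ := by
        congr 1
        refine setLIntegral_congr_fun H.measurableSet_image ?_
        rintro _ ⟨x, hx, rfl⟩
        simp only [hY x hx]

theorem lintegral_le_comp (g : E3 → ℝ≥0∞) :
    ∫⁻ x, g x ∂(area (X '' s)) ≤ (L : ℝ≥0∞) ^ 2 * ∫⁻ y in s, g (X y) := by
  have h1 : area (X '' s) ≤ ((L : ℝ≥0∞) ^ 2) • (volume.restrict s).map X := by
    refine Measure.le_iff.2 fun S hS => ?_
    rw [Measure.smul_apply, Measure.map_apply_of_aemeasurable H.aemeasurable hS,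
      Measure.restrict_apply' H.measurable, area, Measure.restrict_apply hS, smul_eq_mul]
    refine le_trans ?_ (H.measure_image_le inter_subset_right)
    refine measure_mono ?_
    rintro _ ⟨hx, x, hxs, rfl⟩
    exact ⟨x, ⟨hx, hxs⟩, rfl⟩
  calc _ ≤ ∫⁻ x, g x ∂(((L : ℝ≥0∞) ^ 2) • (volume.restrict s).map X) := lintegral_mono' h1 le_rfl
    _ = (L : ℝ≥0∞) ^ 2 * ∫⁻ x, g x ∂((volume.restrict s).map X) := by
        rw [lintegral_smul_measure, smul_eq_mul]
    _ ≤ _ := by gcongr; exact lintegral_map_le _ _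

theorem eLpNorm_comp_le {F : Type*} [NormedAddCommGroup F] (g : E3 → F) :
    eLpNorm (fun y => g (X y)) 2 (volume.restrict s) ≤ l * eLpNorm g 2 (area (X '' s)) := by
  rw [← ENNReal.pow_le_pow_left_iff (two_ne_zero), mul_pow, eLpNorm_two_sq, eLpNorm_two_sq]
  exact H.lintegral_comp_le fun x => ‖g x‖ₑ ^ 2

theorem eLpNorm_le_comp {F : Type*} [NormedAddCommGroup F] (g : E3 → F) :
    eLpNorm g 2 (area (X '' s)) ≤ L * eLpNorm (fun y => g (X y)) 2 (volume.restrict s) := by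
  rw [← ENNReal.pow_le_pow_left_iff (two_ne_zero), mul_pow, eLpNorm_two_sq, eLpNorm_two_sq]
  exact H.lintegral_le_comp fun x => ‖g x‖ₑ ^ 2

theorem memLp_comp {F : Type*} [NormedAddCommGroup F] {g : E3 → F} (hg : MemLp g 2 (area (X '' s))) :
    MemLp (fun y => g (X y)) 2 (volume.restrict s) :=
  ⟨H.aestronglyMeasurable_comp hg.1, (H.eLpNorm_comp_le g).trans_lt
    (ENNReal.mul_lt_top (by simp) hg.2)⟩

theorem memLp_inv {F : Type*} [NormedAddCommGroup F] {Y : E3 → E2} (hY : ∀ x ∈ s, Y (X x) = x)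
    {f : E2 → F} (hf : MemLp f 2 (volume.restrict s)) :
    MemLp (fun x => f (Y x)) 2 (area (X '' s)) := by
  refine ⟨H.aestronglyMeasurable_inv hY hf.1, (H.eLpNorm_le_comp _).trans_lt
    (ENNReal.mul_lt_top (by simp) ?_)⟩
  refine lt_of_eq_of_lt (eLpNorm_congr_ae ?_) hf.2
  filter_upwards [ae_restrict_mem H.measurable] with x hx
  rw [hY x hx]

end BiLip

/-! ### Local parametrizations -/

/-- An injective derivative on the plane is bounded below by `1 / K`. Strict differentiability
approximates increments of `X` by it with error `1 / (2K)`, which uses up half of the bound and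
leaves the inverse constant `2K`. -/
theorem IsLocalParam.exists_biLip {A : Set E3} {V : Set E2} {X : E2 → E3} (H : IsLocalParam A V X)
    {y : E2} (hy : y ∈ V) :
    ∃ s ∈ 𝓝 y, s ⊆ V ∧ ∃ l L : ℝ≥0, BiLip s X l L := by
  have hc : ContDiffAt ℝ ∞ X y := H.contDiffOn.contDiffAt (H.isOpen.mem_nhds hy)
  have hs : HasStrictFDerivAt X (fderiv ℝ X y) y := hc.hasStrictFDerivAt (by simp)
  obtain ⟨K, hK, hanti⟩ := LinearMap.exists_antilipschitzWith (fderiv ℝ X y : E2 →ₗ[ℝ] E3)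
    (LinearMap.ker_eq_bot.2 (H.immersion y hy))
  have hK' : 0 < (2 * K)⁻¹ := by positivity
  obtain ⟨t, ht, happ⟩ := hs.approximates_deriv_on_nhds (c := (2 * K)⁻¹) (Or.inr hK')
  obtain ⟨L, t', ht', hL⟩ := hs.exists_lipschitzOnWith
  obtain ⟨s, hst, hso, hys⟩ := mem_nhds_iff.1 (inter_mem (inter_mem ht ht') (H.isOpen.mem_nhds hy))
  refine ⟨s, hso.mem_nhds hys, fun x hx => (hst hx).2, 2 * K, L, hso.measurableSet,
    hL.mono fun x hx => (hst hx).1.2, fun x hx z hz => ?_⟩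
  have h1 := happ x (hst hx).1.1 z (hst hz).1.1
  have h2 : ‖x - z‖ ≤ K * ‖fderiv ℝ X y (x - z)‖ := by
    have := hanti.le_mul_dist x z
    simpa [dist_eq_norm, ← map_sub] using this
  rw [dist_eq_norm, dist_eq_norm]
  have h3 : ‖fderiv ℝ X y (x - z)‖ ≤ ‖X x - X z‖ + ((2 * K)⁻¹ : ℝ≥0) * ‖x - z‖ := by
    calc _ = ‖(X x - X z) - (X x - X z - fderiv ℝ X y (x - z))‖ := by congr 1; abel
      _ ≤ _ := (norm_sub_le _ _).trans (by gcongr)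
  have hKr : (0 : ℝ) < K := hK
  push_cast at h3 ⊢
  have h4 : (K : ℝ) * ((2 * (K : ℝ))⁻¹ * ‖x - z‖) = ‖x - z‖ / 2 := by field_simp
  nlinarith [mul_le_mul_of_nonneg_left h3 hKr.le]

theorem area_mono {A A' : Set E3} (h : A ⊆ A') : area A ≤ area A' := Measure.restrict_mono h le_rfl

namespace IsLocalParam

variable {A : Set E3} {V : Set E2} {X : E2 → E3} (H : IsLocalParam A V X)
include H

theorem mono {A' : Set E3} (h : A ⊆ A') : IsLocalParam A' V X :=
  ⟨H.isOpen, H.contDiffOn, H.injOn, H.immersion, H.mapsTo.mono_right h⟩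

/-- Null sets pull back to null sets through the bi-Lipschitz pieces, and a set that is locally null
is null. -/
theorem ae_comp {q : E3 → Prop} (hq : ∀ᵐ x ∂(area A), q x) :
    ∀ᵐ y ∂(volume.restrict V), q (X y) := by
  rw [ae_restrict_iff' H.isOpen.measurableSet, ae_iff]
  refine measure_null_of_locally_null _ fun y hy => ?_
  have hyV : y ∈ V := by simp only [mem_ofPred_eq, Classical.not_imp] at hy; exact hy.1
  obtain ⟨s, hs, hsV, l, L, hB⟩ := H.exists_biLip hyV
  have h1 := hB.ae_comp (ae_mono (area_mono (image_subset_iff.2 (H.mapsTo.mono_left hsV))) hq)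
  rw [ae_restrict_iff' hB.measurable, ae_iff] at h1
  refine ⟨s ∩ {a | ¬(a ∈ V → q (X a))}, ?_, measure_mono_null ?_ h1⟩
  · rw [inter_comm]; exact inter_mem_nhdsWithin _ hs
  · rintro x ⟨hx, hx'⟩
    simp only [mem_ofPred_eq, Classical.not_imp] at hx' ⊢
    exact ⟨hx, hx'.2⟩

theorem integrable_comp_mul {u : E3 → ℝ} (hu : MemLp u 2 (area A)) {φ : E2 → ℝ}
    (hφ : Continuous φ) (hc : HasCompactSupport φ) (hV : tsupport φ ⊆ V) :
    Integrable fun y => u (X y) * φ y := by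
  have h1 : LocallyIntegrableOn (fun y => u (X y)) V := by
    intro y hy
    obtain ⟨s, hs, hsV, l, L, hB⟩ := H.exists_biLip hy
    obtain ⟨r, hr, hrs⟩ := Metric.nhds_basis_ball.mem_iff.1 hs
    have h2 := hB.memLp_comp (hu.mono_measure
      (area_mono (image_subset_iff.2 (H.mapsTo.mono_left hsV))))
    refine ⟨Metric.ball y r, mem_nhdsWithin_of_mem_nhds (Metric.ball_mem_nhds y hr), ?_⟩
    have : IsFiniteMeasure (volume.restrict (Metric.ball y r)) :=
      ⟨by rw [Measure.restrict_apply_univ]; exact measure_ball_lt_top⟩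
    exact (h2.mono_measure (Measure.restrict_mono hrs le_rfl)).integrable (by norm_num)
  have h2 : IntegrableOn (fun y => u (X y) * φ y) (tsupport φ) :=
    (h1.integrableOn_compact_subset hV hc).mul_continuousOn hφ.continuousOn hc
  refine (integrableOn_iff_integrable_of_support_subset ?_).1 h2
  exact (Function.support_mul_subset_right _ _).trans (subset_tsupport φ)

theorem continuous_coord_mul {ψ : E2 → ℝ} (hψ : Continuous ψ) (hV : tsupport ψ ⊆ V) (e : E2)
    (c : Fin 3) : Continuous fun y => (fderiv ℝ X y e) c * ψ y := by
  rw [continuous_iff_continuousAt]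
  intro y
  by_cases hy : y ∈ V
  · have h1 : ContinuousAt (fderiv ℝ X) y :=
      (H.contDiffOn.continuousOn_fderiv_of_isOpen H.isOpen (by simp)).continuousAt
        (H.isOpen.mem_nhds hy)
    have h2 : ContinuousAt (fun y => fderiv ℝ X y e) y := h1.clm_apply continuousAt_const
    exact ((EuclideanSpace.proj (𝕜 := ℝ) c).continuous.continuousAt.comp h2).mul hψ.continuousAt
  · have h1 : ψ =ᶠ[𝓝 y] 0 := notMem_tsupport_iff_eventuallyEq.1 fun h => hy (hV h)
    refine (continuousAt_const (y := (0 : ℝ))).congr ?_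
    filter_upwards [h1] with z hz
    simp [hz]

theorem integrable_inner_mul {g : E3 → E3} (hg : MemLp g 2 (area A)) {ψ : E2 → ℝ}
    (hψ : Continuous ψ) (hc : HasCompactSupport ψ) (hV : tsupport ψ ⊆ V) (e : E2) :
    Integrable fun y => inner ℝ (g (X y)) (fderiv ℝ X y e) * ψ y := by
  have h1 : ∀ c : Fin 3, Integrable fun y => g (X y) c * ((fderiv ℝ X y e) c * ψ y) := fun c => by
    refine H.integrable_comp_mul (u := fun x => g x c)
      ((EuclideanSpace.proj (𝕜 := ℝ) c).comp_memLp' hg) (H.continuous_coord_mul hψ hV e c) ?_ ?_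
    · exact hc.mul_left
    · exact (tsupport_mul_subset_right).trans hV
  refine (integrable_finsetSum Finset.univ fun c _ => h1 c).congr (Eventually.of_forall fun y => ?_)
  simp only [PiLp.inner_apply, RCLike.inner_apply, conj_trivial, Finset.sum_mul]
  exact Finset.sum_congr rfl fun c _ => by ring

end IsLocalParam

namespace ClosedSurface

variable {Γ : ClosedSurface}

theorem integral_congr_of_ae {V : Set E2} {f g φ : E2 → ℝ} (hVm : MeasurableSet V)
    (hV : Function.support φ ⊆ V)
    (h : ∀ᵐ y ∂(volume.restrict V), f y = g y) : ∫ y, f y * φ y = ∫ y, g y * φ y := by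
  refine integral_congr_ae ?_
  rw [ae_restrict_iff' hVm] at h
  filter_upwards [h] with y hy
  by_cases hyV : y ∈ V
  · rw [hy hyV]
  · rw [show φ y = 0 from not_not.1 fun h0 => hyV (hV h0), mul_zero, mul_zero]

theorem HasWeakGrad.congr {A : Set E3} {u u' : E3 → ℝ} {g : E3 → E3}
    (H : Γ.HasWeakGrad A u g) (hu : u =ᵐ[area A] u') : Γ.HasWeakGrad A u' g where
  memLp := H.memLp.ae_eq hu
  memLp_grad := H.memLp_grad
  tangential := H.tangential
  weak V X hX ψ h1 h2 h3 e := by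
    rw [← H.weak V X hX ψ h1 h2 h3 e]
    refine integral_congr_of_ae hX.isOpen.measurableSet ?_ (hX.ae_comp hu.symm)
    intro y hy
    exact h3 (support_fderiv_subset ℝ (fun h0 => hy (by simp [h0])))

theorem HasWeakGrad.mono {A A' : Set E3} {u : E3 → ℝ} {g : E3 → E3}
    (H : Γ.HasWeakGrad A u g) (h : A' ⊆ A) : Γ.HasWeakGrad A' u g where
  memLp := H.memLp.mono_measure (area_mono h)
  memLp_grad := H.memLp_grad.mono_measure (area_mono h)
  tangential := ae_mono (area_mono h) H.tangential
  weak V X hX := H.weak V X (hX.mono h)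

theorem HasWeakGrad.sub {A : Set E3} {u u' : E3 → ℝ} {g g' : E3 → E3}
    (H : Γ.HasWeakGrad A u g) (H' : Γ.HasWeakGrad A u' g') :
    Γ.HasWeakGrad A (fun x => u x - u' x) (fun x => g x - g' x) where
  memLp := H.memLp.sub H'.memLp
  memLp_grad := H.memLp_grad.sub H'.memLp_grad
  tangential := by
    filter_upwards [H.tangential, H'.tangential] with x h1 h2
    rw [inner_sub_left, h1, h2, sub_zero]
  weak V X hX ψ h1 h2 h3 e := by
    have hs : tsupport (fun y => fderiv ℝ ψ y e) ⊆ V := (tsupport_fderiv_apply_subset ℝ e).trans h3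
    have hc : Continuous fun y => fderiv ℝ ψ y e :=
      (h1.continuous_fderiv (by simp)).clm_apply continuous_const
    simp only [sub_mul, inner_sub_left]
    rw [integral_sub (hX.integrable_comp_mul H.memLp hc (h2.fderiv_apply ℝ e) hs)
      (hX.integrable_comp_mul H'.memLp hc (h2.fderiv_apply ℝ e) hs),
      integral_sub (hX.integrable_inner_mul H.memLp_grad h1.continuous h2 h3 e)
      (hX.integrable_inner_mul H'.memLp_grad h1.continuous h2 h3 e),
      H.weak V X hX ψ h1 h2 h3 e, H'.weak V X hX ψ h1 h2 h3 e]
    ring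

theorem MemSobolev.mono {A A' : Set E3} (h : A' ⊆ A) : ∀ {m : ℕ} {u : E3 → ℝ},
    Γ.MemSobolev A m u → Γ.MemSobolev A' m u
  | 0, _, H => H.mono_measure (area_mono h)
  | _ + 1, _, ⟨g, hg, hm⟩ => ⟨g, hg.mono h, fun i => (hm i).mono h⟩

theorem MemSobolev.congr {A : Set E3} {m : ℕ} {u u' : E3 → ℝ} (hu : u =ᵐ[area A] u')
    (H : Γ.MemSobolev A m u) : Γ.MemSobolev A m u' := by
  cases m with
  | zero => exact MemLp.ae_eq hu H
  | succ m => obtain ⟨g, hg, hm⟩ := H; exact ⟨g, hg.congr hu, hm⟩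

theorem weakGrad_spec {A : Set E3} {u : E3 → ℝ} {g : E3 → E3} (H : Γ.HasWeakGrad A u g) :
    Γ.HasWeakGrad A u (Γ.weakGrad A u) := by
  have h : ∃ g, Γ.HasWeakGrad A u g := ⟨g, H⟩
  rw [weakGrad, dif_pos h]
  exact h.choose_spec

end ClosedSurface

/-! ### Curved triangles on the surface -/

/-- The tangent vector `∂ₗ G`. -/
def tv (G : E2 → E3) (l : Fin 2) (y : E2) : E3 := fderiv ℝ G y (eb l)

theorem tv_apply {G : E2 → E3} (hG : ContDiff ℝ ∞ G) (l : Fin 2) (y : E2) (c : Fin 3) :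
    tv G l y c = pd l (fun y => G y c) y := by
  have h1 : HasFDerivAt (fun y => G y c)
      ((EuclideanSpace.proj c : E3 →L[ℝ] ℝ).comp (fderiv ℝ G y)) y :=
    (EuclideanSpace.proj c : E3 →L[ℝ] ℝ).hasFDerivAt.comp y
      (hG.differentiable (by simp) y).hasFDerivAt
  rw [pd, h1.fderiv]
  rfl

theorem fderiv_eq_tv {G : E2 → E3} (y v : E2) : fderiv ℝ G y v = v 0 • tv G 0 y + v 1 • tv G 1 y :=
  clm_apply_eq _ _

theorem contDiff_tv {G : E2 → E3} (hG : ContDiff ℝ ∞ G) (l : Fin 2) : ContDiff ℝ ∞ (tv G l) :=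
  (hG.fderiv_right (m := ∞) (by simp)).clm_apply contDiff_const

/-- `G` parametrizes a curved triangle of size `h` on the surface, with scaled derivatives up to
the order `n + 1` bounded by `Λ` and lower Lipschitz constant `l h`. -/
structure IsChart (Γ : ClosedSurface) (n : ℕ) (h Λ l : ℝ) (G : E2 → E3) : Prop where
  contDiff : ContDiff ℝ ∞ G
  h_pos : 0 < h
  h_le : h ≤ 1
  l_pos : 0 < l
  mapsTo : MapsTo G refTriangle Γ.carrier
  lower : ∀ x ∈ refTriangle, ∀ y ∈ refTriangle, l * h * dist x y ≤ dist (G x) (G y)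
  bd : ∀ i c, BdK n h (Λ * h) (pd i fun y => G y c)

theorem norm_e3_le (v : E3) {M : ℝ} (h : ∀ c, |v c| ≤ M) : ‖v‖ ≤ 3 * M := by
  rw [eq_sum_e3 v]
  refine (norm_sum_le _ _).trans ?_
  rw [Fin.sum_univ_three]
  have : ∀ c, ‖v c • e3 c‖ ≤ M := fun c => by simpa [norm_smul, e3] using h c
  linarith [this 0, this 1, this 2]

theorem abs_e2_le (v : E2) (i : Fin 2) : |v i| ≤ ‖v‖ := PiLp.norm_apply_le v i

namespace IsChart

variable {Γ : ClosedSurface} {n : ℕ} {h Λ l : ℝ} {G : E2 → E3} (H : IsChart Γ n h Λ l G)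
include H

theorem Λ_nonneg : 0 ≤ Λ := nonneg_of_mul_nonneg_left ((H.bd 0 0).nonneg) H.h_pos

theorem norm_tv_le {y : E2} (hy : y ∈ refTriangle) (i : Fin 2) : ‖tv G i y‖ ≤ 3 * (Λ * h) := by
  refine norm_e3_le _ fun c => ?_
  rw [tv_apply H.contDiff]
  simpa [D] using H.bd i c 0 0 (Nat.zero_le _) y hy

theorem norm_fderiv_le {y : E2} (hy : y ∈ refTriangle) : ‖fderiv ℝ G y‖ ≤ 6 * Λ * h := by
  have hΛ := H.Λ_nonneg
  have hh := H.h_pos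
  refine ContinuousLinearMap.opNorm_le_bound _ (by positivity) fun v => ?_
  rw [fderiv_eq_tv]
  refine (norm_add_le _ _).trans ?_
  rw [norm_smul, norm_smul]
  have h0 := mul_le_mul (abs_e2_le v 0) (H.norm_tv_le hy 0) (norm_nonneg _) (norm_nonneg _)
  have h1 := mul_le_mul (abs_e2_le v 1) (H.norm_tv_le hy 1) (norm_nonneg _) (norm_nonneg _)
  simp only [Real.norm_eq_abs]
  linarith

theorem lipschitzOn : LipschitzOnWith (6 * Λ * h).toNNReal G refTriangle := by
  have hΛ := H.Λ_nonneg
  have hh := H.h_pos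
  refine convex_refTriangle.lipschitzOnWith_of_nnnorm_fderiv_le (𝕜 := ℝ)
    (fun x _ => H.contDiff.differentiable (by simp) x) fun x hx => ?_
  rw [← NNReal.coe_le_coe, coe_nnnorm, Real.coe_toNNReal _ (by positivity)]
  exact H.norm_fderiv_le hx

theorem biLip : BiLip (interior refTriangle) G (1 / (l * h)).toNNReal (6 * Λ * h).toNNReal := by
  have hl := H.l_pos
  have hh := H.h_pos
  refine ⟨isOpen_interior.measurableSet, H.lipschitzOn.mono interior_subset, fun x hx y hy => ?_⟩
  rw [Real.coe_toNNReal _ (by positivity), one_div, ← div_eq_inv_mul, le_div_iff₀ (by positivity)]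
  linarith [H.lower x (interior_subset hx) y (interior_subset hy)]

theorem injOn : InjOn G refTriangle := fun x hx y hy hxy => by
  have hl := H.l_pos
  have hh := H.h_pos
  have h1 := H.lower x hx y hy
  rw [hxy, dist_self] at h1
  exact dist_le_zero.1 (nonpos_of_mul_nonpos_right h1 (by positivity))

/-- The lower Lipschitz bound passes to the limit of difference quotients at interior points. It
extends to the boundary by continuity of the derivative. -/
theorem lower_fderiv {y : E2} (hy : y ∈ refTriangle) (v : E2) : l * h * ‖v‖ ≤ ‖fderiv ℝ G y v‖ := by
  have hcl : IsClosed {y : E2 | l * h * ‖v‖ ≤ ‖fderiv ℝ G y v‖} :=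
    isClosed_le continuous_const
      ((H.contDiff.continuous_fderiv (by simp)).clm_apply continuous_const).norm
  have hint : interior refTriangle ⊆ {y : E2 | l * h * ‖v‖ ≤ ‖fderiv ℝ G y v‖} := by
    intro y hy
    have h1 : HasDerivAt (fun t : ℝ => G (y + t • v)) (fderiv ℝ G y v) 0 := by
      have h2 : HasFDerivAt G (fderiv ℝ G y) (y + (0 : ℝ) • v) := by
        simpa using (H.contDiff.differentiable (by simp) y).hasFDerivAt
      have h3 : HasDerivAt (fun t : ℝ => y + t • v) v 0 := by
        simpa using ((hasDerivAt_id (0 : ℝ)).smul_const v).const_add y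
      exact h2.comp_hasDerivAt (0 : ℝ) h3
    have h2 := (hasDerivAt_iff_tendsto_slope.1 h1).norm
    refine ge_of_tendsto h2 ?_
    have h4 : ∀ᶠ t : ℝ in 𝓝[≠] 0, y + t • v ∈ interior refTriangle := by
      refine nhdsWithin_le_nhds (ContinuousAt.preimage_mem_nhds (x := (0 : ℝ)) (by fun_prop) ?_)
      simpa using isOpen_interior.mem_nhds hy
    filter_upwards [h4, self_mem_nhdsWithin] with t ht ht0
    have h5 := H.lower _ (interior_subset ht) _ (interior_subset hy)
    rw [dist_eq_norm, dist_eq_norm, add_sub_cancel_left, norm_smul] at h5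
    rw [slope_def_module, norm_smul, sub_zero, norm_inv, inv_mul_eq_div, zero_smul, add_zero,
      le_div_iff₀ (norm_pos_iff.2 ht0)]
    linarith
  have h6 := closure_minimal hint hcl
  rw [closure_interior_refTriangle] at h6
  exact h6 hy

theorem isLocalParam : IsLocalParam (G '' interior refTriangle) (interior refTriangle) G where
  isOpen := isOpen_interior
  contDiffOn := H.contDiff.contDiffOn
  injOn := H.injOn.mono interior_subset
  immersion y hy := by
    have hl := H.l_pos
    have hh := H.h_pos
    rw [injective_iff_map_eq_zero]
    intro v hv
    have h1 := H.lower_fderiv (interior_subset hy) v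
    rw [hv, norm_zero] at h1
    exact norm_le_zero_iff.1 (nonpos_of_mul_nonpos_right h1 (by positivity))
  mapsTo := mapsTo_image _ _

theorem image_subset : G '' interior refTriangle ⊆ Γ.carrier :=
  image_subset_iff.2 (H.mapsTo.mono_left interior_subset)

end IsChart

theorem ClosedSurface.d_eq_zero (Γ : ClosedSurface) {x : E3} (hx : x ∈ Γ.carrier) : Γ.d x = 0 := by
  have := Γ.abs_d x (Γ.subset_U hx)
  rw [Metric.infDist_zero_of_mem hx] at this
  exact abs_eq_zero.1 this

theorem ClosedSurface.differentiableAt_d (Γ : ClosedSurface) {x : E3} (hx : x ∈ Γ.U) :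
    DifferentiableAt ℝ Γ.d x :=
  (Γ.contDiffOn_d.contDiffAt (Γ.isOpen_U.mem_nhds hx)).differentiableAt (by simp)

namespace IsChart

variable {Γ : ClosedSurface} {n : ℕ} {h Λ l : ℝ} {G : E2 → E3} (H : IsChart Γ n h Λ l G)
include H

theorem inner_tv_normal {y : E2} (hy : y ∈ interior refTriangle) (i : Fin 2) :
    inner ℝ (tv G i y) (Γ.normal (G y)) = 0 := by
  have hm := H.mapsTo (interior_subset hy)
  have h1 : HasFDerivAt (fun z => Γ.d (G z)) ((fderiv ℝ Γ.d (G y)).comp (fderiv ℝ G y)) y :=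
    (Γ.differentiableAt_d (Γ.subset_U hm)).hasFDerivAt.comp y
      (H.contDiff.differentiable (by simp) y).hasFDerivAt
  have h2 : (fun z => Γ.d (G z)) =ᶠ[𝓝 y] fun _ => 0 := by
    filter_upwards [isOpen_interior.mem_nhds hy] with z hz
    exact Γ.d_eq_zero (H.mapsTo (interior_subset hz))
  have h3 := (h1.congr_of_eventuallyEq h2.symm).unique (hasFDerivAt_const (0 : ℝ) y)
  rw [real_inner_comm, ClosedSurface.normal, inner_gradient_left]
  exact congrArg (fun L => L (eb i)) h3

end IsChart

/-! ### The dual frame -/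

/-- Inversion is cut off near zero so that it can be composed with globally smooth functions whose
positivity is known only on the triangle. -/
theorem exists_smooth_inv {δ : ℝ} (hδ : 0 < δ) :
    ∃ r : ℝ → ℝ, ContDiff ℝ ∞ r ∧ ∀ x, δ ≤ x → r x = x⁻¹ := by
  refine ⟨fun x => Real.smoothTransition (2 / δ * x - 1) * x⁻¹, ?_, fun x hx => ?_⟩
  · rw [contDiff_iff_contDiffAt]
    intro x
    by_cases hx : x = 0
    · refine (contDiffAt_const (c := (0 : ℝ))).congr_of_eventuallyEq ?_
      have : ∀ᶠ z in 𝓝 x, 2 / δ * z - 1 < 0 := by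
        refine ContinuousAt.eventually_lt (by fun_prop) continuousAt_const ?_
        simp [hx]
      filter_upwards [this] with z hz
      rw [Real.smoothTransition.zero_of_nonpos hz.le, zero_mul]
    · refine ContDiffAt.mul ?_ (contDiffAt_inv ℝ hx)
      exact (Real.smoothTransition.contDiff (n := ⊤)).contDiffAt.comp x
        (ContDiff.contDiffAt (by fun_prop))
  · beta_reduce
    rw [Real.smoothTransition.one_of_one_le, one_mul]
    have : 2 / δ * δ ≤ 2 / δ * x := by gcongr
    rw [div_mul_cancel₀ _ hδ.ne'] at this
    linarith

theorem BdK.const_mul {n : ℕ} {h A : ℝ} {f : E2 → ℝ} (hf : ContDiff ℝ ∞ f) (H : BdK n h A f) (c : ℝ) :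
    BdK n h (|c| * A) (fun x => c * f x) := by
  intro a b hab x hx
  rw [D_const_mul hf, abs_mul, mul_assoc]
  exact mul_le_mul_of_nonneg_left (H a b hab x hx) (abs_nonneg _)

theorem BdK.one_of_le {n : ℕ} {h A : ℝ} {f : E2 → ℝ} (h0 : 0 ≤ h) (h1 : h ≤ 1) (H : BdK n h A f) :
    BdK n 1 A f := by
  intro a b hab x hx
  refine (H a b hab x hx).trans ?_
  rw [one_pow]
  exact mul_le_mul_of_nonneg_left (pow_le_one₀ h0 h1) H.nonneg

theorem bdK_one_comp {r : ℝ → ℝ} (hr : ContDiff ℝ ∞ r) {δ : ℝ} (hδ : 0 < δ)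
    (hrx : ∀ x, δ ≤ x → r x = x⁻¹) {h A : ℝ} (hh : 0 ≤ h) {f : E2 → ℝ} (hf : ContDiff ℝ ∞ f)
    (H : BdK 1 h A f) (hfl : ∀ y ∈ refTriangle, 2 * δ ≤ f y) :
    BdK 1 h (δ⁻¹ + (δ ^ 2)⁻¹ * A) (fun y => r (f y)) := by
  have hA := H.nonneg
  have hc : ContDiff ℝ ∞ (fun y => r (f y)) := hr.comp hf
  rw [bdK_succ_iff hf] at H
  rw [bdK_succ_iff hc]
  refine ⟨fun y hy => ?_, fun i => bdK_zero_iff.2 fun y hy => ?_⟩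
  · have h1 := hfl y hy
    rw [hrx _ (by linarith), abs_inv, abs_of_pos (by linarith)]
    have : (f y)⁻¹ ≤ δ⁻¹ := inv_anti₀ hδ (by linarith)
    have h2 : 0 ≤ (δ ^ 2)⁻¹ * A := by positivity
    linarith
  · have h1 := hfl y hy
    have hfy : 0 < f y := by linarith
    have h2 : HasDerivAt r (-(f y ^ 2)⁻¹) (f y) := by
      refine (hasDerivAt_inv hfy.ne').congr_of_eventuallyEq ?_
      filter_upwards [lt_mem_nhds (show δ < f y by linarith)] with z hz
      exact hrx z hz.le
    have h3 := (h2.comp_hasFDerivAt y (hf.differentiable (by simp) y).hasFDerivAt).fderiv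
    have h4 : pd i (fun y => r (f y)) y = -(f y ^ 2)⁻¹ * pd i f y := by
      rw [pd, show (fun y => r (f y)) = r ∘ f from rfl, h3]
      rfl
    rw [h4, abs_mul, abs_neg, abs_inv, abs_of_pos (by positivity)]
    have h5 := bdK_zero_iff.1 (H.2 i) y hy
    have h6 : (f y ^ 2)⁻¹ ≤ (δ ^ 2)⁻¹ := inv_anti₀ (by positivity) (by gcongr; linarith)
    calc (f y ^ 2)⁻¹ * |pd i f y| ≤ (δ ^ 2)⁻¹ * (A * h) := by gcongr
      _ ≤ (δ⁻¹ + (δ ^ 2)⁻¹ * A) * h := by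
        have : 0 ≤ δ⁻¹ * h := by positivity
        linarith

/-- Gram determinant of two vectors. -/
def gram (X Y : E3) : ℝ := inner ℝ X X * inner ℝ Y Y - inner ℝ X Y ^ 2

/-- The quadratic form is at least `l ^ 2` times the squared norm. At `(1, 0)` this bounds `⟨X, X⟩`
from below; at `(-⟨X, Y⟩, ⟨X, X⟩)` the form equals `⟨X, X⟩ * gram X Y`, which yields the second
factor `l ^ 2`. -/
theorem gram_ge {X Y : E3} {l : ℝ} (hl : 0 < l) (h : ∀ a b : ℝ, l * ‖(!₂[a, b] : E2)‖ ≤ ‖a • X + b • Y‖) :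
    l ^ 4 ≤ gram X Y := by
  have key : ∀ a b : ℝ, l ^ 2 * (a ^ 2 + b ^ 2) ≤
      a ^ 2 * inner ℝ X X + 2 * (a * b) * inner ℝ X Y + b ^ 2 * inner ℝ Y Y := by
    intro a b
    have h1 := pow_le_pow_left₀ (by positivity) (h a b) 2
    have h2 : inner ℝ Y X = inner ℝ X Y := real_inner_comm _ _
    have h3 : ‖a • X + b • Y‖ ^ 2 =
        a ^ 2 * inner ℝ X X + 2 * (a * b) * inner ℝ X Y + b ^ 2 * inner ℝ Y Y := by
      rw [← real_inner_self_eq_norm_sq]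
      simp only [inner_add_left, inner_add_right, real_inner_smul_left, real_inner_smul_right, h2]
      ring
    have h4 : ‖(!₂[a, b] : E2)‖ ^ 2 = a ^ 2 + b ^ 2 := by
      simp [EuclideanSpace.norm_sq_eq, Fin.sum_univ_two]
    rwa [mul_pow, h3, h4] at h1
  have h1 := key 1 0
  have h2 := key (-inner ℝ X Y) (inner ℝ X X)
  have hX : l ^ 2 ≤ inner ℝ X X := by linarith
  have hXp : 0 < inner ℝ X X := lt_of_lt_of_le (by positivity) hX
  have h3 : l ^ 2 * inner ℝ X X ≤ gram X Y := by
    have : inner ℝ X X * (l ^ 2 * inner ℝ X X) ≤ inner ℝ X X * gram X Y := by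
      rw [gram]
      nlinarith [mul_nonneg (sq_nonneg l) (sq_nonneg (inner ℝ X Y))]
    exact le_of_mul_le_mul_left this hXp
  nlinarith [mul_le_mul_of_nonneg_left hX (sq_nonneg l)]

/-- Scaled dual frame built from a function `r` that inverts the Gram determinant. -/
def dualVec (r : ℝ → ℝ) (h : ℝ) (G : E2 → E3) (i : Fin 2) (y : E2) : E3 :=
  let T : Fin 2 → E3 := fun j => h⁻¹ • tv G j y
  (h⁻¹ * r (gram (T 0) (T 1))) • (inner ℝ (T (1 - i)) (T (1 - i)) • T i - inner ℝ (T 0) (T 1) • T (1 - i))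

theorem inner_dualVec {r : ℝ → ℝ} {h : ℝ} (hh : h ≠ 0) {G : E2 → E3} {y : E2}
    (hr : r (gram (h⁻¹ • tv G 0 y) (h⁻¹ • tv G 1 y)) * gram (h⁻¹ • tv G 0 y) (h⁻¹ • tv G 1 y) = 1)
    (i j : Fin 2) : inner ℝ (dualVec r h G i y) (tv G j y) = if i = j then 1 else 0 := by
  have h1 : tv G j y = h • (h⁻¹ • tv G j y) := by rw [smul_inv_smul₀ hh]
  rw [h1, dualVec]
  simp only [real_inner_smul_right, real_inner_smul_left, inner_sub_left] at hr ⊢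
  set q := r (gram (h⁻¹ • tv G 0 y) (h⁻¹ • tv G 1 y))
  have e : inner ℝ (tv G 1 y) (tv G 0 y) = inner ℝ (tv G 0 y) (tv G 1 y) := real_inner_comm _ _
  simp only [gram, real_inner_smul_right, real_inner_smul_left] at hr
  have e0 : (1 : Fin 2) - 0 = 1 := rfl
  have e1 : (1 : Fin 2) - 1 = 0 := rfl
  fin_cases i <;> fin_cases j <;> simp only [Fin.zero_eta, Fin.mk_one, e0, e1, e, if_true,
    Fin.isValue, one_ne_zero, zero_ne_one, if_false]
  · rw [← hr]; field_simp
  · ring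
  · ring
  · rw [← hr]; field_simp

/-- `b` is the frame of tangent vector fields dual to `∂₀G`, `∂₁G`, with components and their
first derivatives bounded by `A`. -/
structure IsFrame (Γ : ClosedSurface) (G : E2 → E3) (A : ℝ) (b : Fin 2 → E2 → E3) : Prop where
  contDiff : ∀ i, ContDiff ℝ ∞ (b i)
  inner_tv : ∀ y ∈ refTriangle, ∀ i j, inner ℝ (b i y) (tv G j y) = if i = j then 1 else 0
  inner_normal : ∀ y ∈ interior refTriangle, ∀ i, inner ℝ (b i y) (Γ.normal (G y)) = 0
  bd : ∀ i c, BdK 1 1 A fun y => b i y c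

theorem inner_e3 (x y : E3) : inner ℝ x y = ∑ c, x c * y c := by
  simp only [PiLp.inner_apply, RCLike.inner_apply, conj_trivial]
  exact Finset.sum_congr rfl fun c _ => mul_comm _ _

theorem bdK_inner {n : ℕ} {h A B : ℝ} (hh : 0 ≤ h) {X Y : E2 → E3} (hX : ContDiff ℝ ∞ X)
    (hY : ContDiff ℝ ∞ Y) (HX : ∀ c, BdK n h A fun y => X y c) (HY : ∀ c, BdK n h B fun y => Y y c) :
    BdK n h (3 * (2 ^ n * A * B)) fun y => inner ℝ (X y) (Y y) := by
  have h1 := BdK.sum Finset.univ (f := fun c y => X y c * Y y c) (A := fun _ : Fin 3 => 2 ^ n * A * B)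
    (fun c _ => (contDiff_coord hX c).mul (contDiff_coord hY c))
    (fun c _ => BdK.mul hh (contDiff_coord hX c) (contDiff_coord hY c) (HX c) (HY c))
  simpa [inner_e3] using h1

/-- The rescaled tangents `h⁻¹ ∂G` satisfy bounds independent of `h`, and their Gram determinant is
at least `l ^ 4`. Cramer's rule thus gives a dual frame whose only dependence on the size is the
factor `1 / h`. -/
theorem exists_frame (Λ l : ℝ) : ∃ C : ℝ, ∀ (Γ : ClosedSurface) (n : ℕ) (h : ℝ) (G : E2 → E3),
    1 ≤ n → IsChart Γ n h Λ l G → ∃ b, IsFrame Γ G (C / h) b := by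
  by_cases hl : 0 < l
  swap
  · exact ⟨0, fun Γ n h G _ H => absurd H.l_pos hl⟩
  -- Half of the lower bound of the Gram determinant: the smooth substitute then equals the inverse
  -- on a neighbourhood of all occurring values, so its derivative there is known too.
  have hδ : 0 < l ^ 4 / 2 := by positivity
  obtain ⟨r, hr, hrx⟩ := exists_smooth_inv hδ
  set N : ℝ := 3 * (2 ^ 1 * Λ * Λ) with hN
  set Dt : ℝ := 2 ^ 1 * N * N + |(-1)| * (2 ^ 1 * N * N) with hDt
  set Q : ℝ := (l ^ 4 / 2)⁻¹ + ((l ^ 4 / 2) ^ 2)⁻¹ * Dt with hQ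
  set W : ℝ := 2 ^ 1 * N * Λ + |(-1)| * (2 ^ 1 * N * Λ) with hW
  refine ⟨2 ^ 1 * Q * W, fun Γ n h G hn H => ⟨dualVec r h G, ?_⟩⟩
  have hh := H.h_pos
  set T : Fin 2 → E2 → E3 := fun j y => h⁻¹ • tv G j y with hT
  have cT : ∀ j, ContDiff ℝ ∞ (T j) := fun j => (contDiff_tv H.contDiff j).const_smul h⁻¹
  have bT : ∀ j c, BdK 1 h Λ fun y => T j y c := by
    intro j c
    have h1 := ((H.bd j c).of_le hn).const_mul
      (contDiff_pd (contDiff_coord H.contDiff c) j) h⁻¹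
    have h2 : |h⁻¹| * (Λ * h) = Λ := by
      rw [abs_of_pos (by positivity)]; field_simp
    rw [h2] at h1
    have h3 : (fun y => T j y c) = fun y => h⁻¹ * pd j (fun y => G y c) y := by
      funext y
      simp only [hT, PiLp.smul_apply, smul_eq_mul, tv_apply H.contDiff]
    rw [h3]; exact h1
  have cI : ∀ i j, ContDiff ℝ ∞ fun y => inner ℝ (T i y) (T j y) := fun i j => (cT i).inner ℝ (cT j)
  have bI : ∀ i j, BdK 1 h N fun y => inner ℝ (T i y) (T j y) := fun i j =>
    bdK_inner hh.le (cT i) (cT j) (bT i) (bT j)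
  have cg : ContDiff ℝ ∞ fun y => gram (T 0 y) (T 1 y) :=
    ((cI 0 0).mul (cI 1 1)).sub ((cI 0 1).pow 2)
  have hgr : (fun y => gram (T 0 y) (T 1 y)) = (fun y => inner ℝ (T 0 y) (T 0 y) * inner ℝ (T 1 y) (T 1 y)) +
      fun y => (-1) * (inner ℝ (T 0 y) (T 1 y) * inner ℝ (T 0 y) (T 1 y)) := by
    funext y; simp only [gram, Pi.add_apply]; ring
  have bg : BdK 1 h Dt fun y => gram (T 0 y) (T 1 y) := by
    rw [hgr]
    exact BdK.add ((cI 0 0).mul (cI 1 1)) (contDiff_const.mul ((cI 0 1).mul (cI 0 1)))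
      (BdK.mul hh.le (cI 0 0) (cI 1 1) (bI 0 0) (bI 1 1))
      ((BdK.mul hh.le (cI 0 1) (cI 0 1) (bI 0 1) (bI 0 1)).const_mul ((cI 0 1).mul (cI 0 1)) (-1))
  have hge : ∀ y ∈ refTriangle, l ^ 4 ≤ gram (T 0 y) (T 1 y) := by
    intro y hy
    refine gram_ge H.l_pos fun a b => ?_
    have h1 := H.lower_fderiv hy !₂[a, b]
    rw [fderiv_eq_tv] at h1
    have h2 : a • T 0 y + b • T 1 y = h⁻¹ • (a • tv G 0 y + b • tv G 1 y) := by
      simp only [hT, smul_add]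
      rw [smul_comm a, smul_comm b]
    rw [h2, norm_smul, Real.norm_of_nonneg (by positivity : 0 ≤ h⁻¹)]
    rw [inv_mul_eq_div, le_div_iff₀ hh]
    have h3 : (!₂[a, b] : E2) 0 = a := rfl
    have h4 : (!₂[a, b] : E2) 1 = b := rfl
    rw [h3, h4] at h1
    linarith
  have cr : ContDiff ℝ ∞ fun y => r (gram (T 0 y) (T 1 y)) := hr.comp cg
  have br : BdK 1 h Q fun y => r (gram (T 0 y) (T 1 y)) :=
    bdK_one_comp hr hδ hrx hh.le cg bg fun y hy => by linarith [hge y hy]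
  refine ⟨fun i => ?_, fun y hy i j => ?_, fun y hy i => ?_, fun i c => ?_⟩
  · exact (contDiff_const.mul cr).smul (((cI (1 - i) (1 - i)).smul (cT i)).sub ((cI 0 1).smul (cT (1 - i))))
  · refine inner_dualVec hh.ne' ?_ i j
    have h1 := hge y hy
    have h2 : 0 < l ^ 4 := by positivity
    rw [hrx _ (by simp only [hT] at h1; linarith)]
    exact inv_mul_cancel₀ (ne_of_gt (by simp only [hT] at h1; linarith))
  · simp only [dualVec, real_inner_smul_left, inner_sub_left, H.inner_tv_normal hy]
    ring
  · have h1 : (fun y => dualVec r h G i y c) = fun y => h⁻¹ * (r (gram (T 0 y) (T 1 y)) *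
        (inner ℝ (T (1 - i) y) (T (1 - i) y) * T i y c + (-1) * (inner ℝ (T 0 y) (T 1 y) * T (1 - i) y c))) := by
      funext y
      simp only [dualVec, hT, PiLp.smul_apply, PiLp.sub_apply, smul_eq_mul]
      ring
    rw [h1]
    have c1 := fun i => contDiff_coord (cT i) c
    have c2 : ContDiff ℝ ∞ fun y => inner ℝ (T (1 - i) y) (T (1 - i) y) * T i y c :=
      (cI _ _).mul (c1 i)
    have c3 : ContDiff ℝ ∞ fun y => inner ℝ (T 0 y) (T 1 y) * T (1 - i) y c := (cI _ _).mul (c1 _)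
    have c4 : ContDiff ℝ ∞ fun y => inner ℝ (T (1 - i) y) (T (1 - i) y) * T i y c +
      (-1) * (inner ℝ (T 0 y) (T 1 y) * T (1 - i) y c) := c2.add (contDiff_const.mul c3)
    have b4 : BdK 1 h W fun y => inner ℝ (T (1 - i) y) (T (1 - i) y) * T i y c +
        (-1) * (inner ℝ (T 0 y) (T 1 y) * T (1 - i) y c) :=
      BdK.add (f := fun y => inner ℝ (T (1 - i) y) (T (1 - i) y) * T i y c)
        (g := fun y => (-1) * (inner ℝ (T 0 y) (T 1 y) * T (1 - i) y c)) c2 (contDiff_const.mul c3)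
        (BdK.mul hh.le (cI _ _) (c1 i) (bI _ _) (bT i c))
        ((BdK.mul hh.le (cI 0 1) (c1 _) (bI 0 1) (bT _ c)).const_mul c3 (-1))
    -- As `h ≤ 1`, the powers of `h` gained by differentiating are discarded. The frame and its
    -- first derivatives are both bounded by `C / h`, which is all the trace inequality uses.
    have b5 := ((BdK.mul hh.le cr c4 br b4).const_mul (cr.mul c4) h⁻¹).one_of_le hh.le H.h_le
    refine b5.mono zero_le_one (le_of_eq ?_)
    rw [abs_of_pos (by positivity)]
    field_simp

namespace IsChart

variable {Γ : ClosedSurface} {n : ℕ} {h Λ l A : ℝ} {G : E2 → E3} (H : IsChart Γ n h Λ l G)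
  {b : Fin 2 → E2 → E3} (Hb : IsFrame Γ G A b)
include H Hb

/-- The two tangents and the normal form a basis of `ℝ³`: the normal is orthogonal to the tangents,
and pairing with the dual frame separates these. The difference of the two sides is orthogonal to
all three, hence zero. -/
theorem eq_sum_frame {y : E2} (hy : y ∈ interior refTriangle) {v : E3}
    (hv : inner ℝ v (Γ.normal (G y)) = 0) : v = ∑ i, inner ℝ v (tv G i y) • b i y := by
  have hyK := interior_subset hy
  set ν := Γ.normal (G y) with hν
  have hν1 : ‖ν‖ = 1 := Γ.norm_gradient _ (H.mapsTo hyK)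
  have hli : LinearIndependent ℝ ![tv G 0 y, tv G 1 y, ν] := by
    rw [Fintype.linearIndependent_iff]
    intro g hg
    simp only [Fin.sum_univ_three, Matrix.cons_val] at hg
    have h2 : g 2 = 0 := by
      have h3 : ∀ i, inner ℝ (tv G i y) ν = 0 := H.inner_tv_normal hy
      have h4 : inner ℝ ν ν = 1 := by rw [real_inner_self_eq_norm_sq, hν1, one_pow]
      have := congrArg (fun z => inner ℝ z ν) hg
      simpa only [inner_add_left, real_inner_smul_left, h3, h4, inner_zero_left, mul_zero, zero_add,
        mul_one] using this
    rw [h2, zero_smul, add_zero] at hg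
    have h0 : g 0 = 0 := by
      have := congrArg (fun z => inner ℝ (b 0 y) z) hg
      simpa [inner_add_right, real_inner_smul_right, Hb.inner_tv y hyK] using this
    have h1 : g 1 = 0 := by
      have := congrArg (fun z => inner ℝ (b 1 y) z) hg
      simpa [inner_add_right, real_inner_smul_right, Hb.inner_tv y hyK] using this
    intro i; fin_cases i <;> assumption
  have hspan := hli.span_eq_top_of_card_eq_finrank (by simp)
  rw [← sub_eq_zero]
  set s := v - ∑ i, inner ℝ v (tv G i y) • b i y with hs
  have s0 : ∀ i, inner ℝ (tv G i y) s = 0 := by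
    intro i
    rw [real_inner_comm, hs, inner_sub_left, sum_inner]
    simp [real_inner_smul_left, Hb.inner_tv y hyK]
  have s1 : inner ℝ ν s = 0 := by
    rw [real_inner_comm, hs, inner_sub_left, sum_inner, hv]
    simp [real_inner_smul_left, hν, Hb.inner_normal y hy]
  have hmem : s ∈ Submodule.span ℝ (range ![tv G 0 y, tv G 1 y, ν]) := hspan ▸ Submodule.mem_top
  refine inner_self_eq_zero (𝕜 := ℝ).1 ?_
  refine Submodule.span_induction (p := fun z _ => inner ℝ z s = 0) ?_ ?_ ?_ ?_ hmem
  · rintro _ ⟨i, rfl⟩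
    fin_cases i
    · exact s0 0
    · exact s0 1
    · exact s1
  · simp
  · intro x z _ _ hx hz; rw [inner_add_left, hx, hz, add_zero]
  · intro c x _ hx; rw [real_inner_smul_left, hx, mul_zero]

omit Hb in
theorem memLp_comp {F : Type*} [NormedAddCommGroup F] {u : E3 → F}
    (hu : MemLp u 2 (area (G '' interior refTriangle))) : MemLp (fun y => u (G y)) 2 muK := by
  rw [muK_eq_interior]; exact H.biLip.memLp_comp hu

omit Hb in
theorem ae_comp {q : E3 → Prop} (hq : ∀ᵐ x ∂(area (G '' interior refTriangle)), q x) :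
    ∀ᵐ y ∂muK, q (G y) := by
  rw [muK_eq_interior]; exact H.biLip.ae_comp hq

omit Hb in
theorem ae_of_comp {q : E3 → Prop} (hq : ∀ᵐ y ∂muK, q (G y)) :
    ∀ᵐ x ∂(area (G '' interior refTriangle)), q x := by
  rw [muK_eq_interior] at hq; exact H.biLip.ae_of_comp hq

omit Hb in
/-- Weak tangential gradients pull back to weak derivatives on the reference triangle. -/
theorem hasD_comp {u : E3 → ℝ} {g : E3 → E3}
    (hu : Γ.HasWeakGrad (G '' interior refTriangle) u g) (i : Fin 2) :
    HasD (fun y => u (G y)) i (fun y => inner ℝ (g (G y)) (tv G i y)) := fun ψ hψ =>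
  hu.weak _ G H.isLocalParam ψ hψ.contDiff hψ.hasCompactSupport hψ.tsupport_subset (eb i)

omit Hb in
theorem memLp_inner_tv {g : E3 → E3} (hg : MemLp g 2 (area (G '' interior refTriangle))) (i : Fin 2) :
    MemLp (fun y => inner ℝ (g (G y)) (tv G i y)) 2 muK := by
  have h1 : ∀ c ∈ (Finset.univ : Finset (Fin 3)), MemLp (fun y => tv G i y c * g (G y) c) 2 muK :=
    fun c _ => MemLp.continuous_mul (contDiff_coord (contDiff_tv H.contDiff i) c).continuous
      ((EuclideanSpace.proj (𝕜 := ℝ) c).comp_memLp' (H.memLp_comp hg))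
  refine (memLp_finsetSum _ h1).ae_eq (Eventually.of_forall fun y => ?_)
  simp only [inner_e3]
  exact Finset.sum_congr rfl fun c _ => mul_comm _ _

theorem ae_eq_sum_frame {g : E3 → E3}
    (hg : ∀ᵐ x ∂(area (G '' interior refTriangle)), inner ℝ (g x) (Γ.normal x) = 0) :
    ∀ᵐ y ∂muK, g (G y) = ∑ i, inner ℝ (g (G y)) (tv G i y) • b i y := by
  filter_upwards [H.ae_comp hg, ae_muK_of_interior (q := fun y => y ∈ interior refTriangle)
    fun _ h => h] with y hy hyi
  exact H.eq_sum_frame Hb hyi hy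

/-- Weak tangential gradients are unique. -/
theorem weakGrad_unique {u : E3 → ℝ} {g g' : E3 → E3}
    (hu : Γ.HasWeakGrad (G '' interior refTriangle) u g)
    (hu' : Γ.HasWeakGrad (G '' interior refTriangle) u g') :
    g =ᵐ[area (G '' interior refTriangle)] g' := by
  have h1 := fun i => (H.hasD_comp hu i).unique (H.hasD_comp hu' i) (H.memLp_inner_tv hu.memLp_grad i)
    (H.memLp_inner_tv hu'.memLp_grad i)
  refine H.ae_of_comp ?_
  filter_upwards [h1 0, h1 1, H.ae_eq_sum_frame Hb hu.tangential,
    H.ae_eq_sum_frame Hb hu'.tangential] with y h0 h1 h2 h3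
  rw [h2, h3, Fin.sum_univ_two, Fin.sum_univ_two, h0, h1]

omit Hb in
theorem inv_apply {y : E2} (hy : y ∈ refTriangle) : Function.invFunOn G refTriangle (G y) = y :=
  H.injOn.leftInvOn_invFunOn hy

omit Hb in
theorem dist_inv_le {x z : E3} (hx : x ∈ G '' refTriangle) (hz : z ∈ G '' refTriangle) :
    dist (Function.invFunOn G refTriangle x) (Function.invFunOn G refTriangle z) ≤
      (l * h)⁻¹ * dist x z := by
  obtain ⟨x, hx, rfl⟩ := hx
  obtain ⟨z, hz, rfl⟩ := hz
  have hl := H.l_pos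
  have hh := H.h_pos
  rw [H.inv_apply hx, H.inv_apply hz, inv_mul_eq_div, le_div_iff₀ (by positivity)]
  linarith [H.lower x hx z hz]

/-- The derivative of the transition map from a local parametrization to the chart. -/
theorem hasFDerivAt_transition {V : Set E2} {X : E2 → E3}
    (hX : IsLocalParam (G '' interior refTriangle) V X) {y : E2} (hy : y ∈ V) :
    HasFDerivAt (fun z => Function.invFunOn G refTriangle (X z))
      (∑ i, ((innerSL ℝ (b i (Function.invFunOn G refTriangle (X y)))).comp (fderiv ℝ X y)).smulRight
        (eb i)) y := by
  set Gi := Function.invFunOn G refTriangle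
  set T : E2 → E2 := fun z => Gi (X z) with hT
  have hTG : ∀ z ∈ V, T z ∈ interior refTriangle ∧ G (T z) = X z := by
    intro z hz
    obtain ⟨p, hp, hpz⟩ := hX.mapsTo hz
    have : T z = p := by rw [hT]; beta_reduce; rw [← hpz]; exact H.inv_apply (interior_subset hp)
    rw [this]; exact ⟨hp, hpz⟩
  set P : E3 →L[ℝ] E2 := ∑ i, (innerSL ℝ (b i (T y))).smulRight (eb i) with hP
  have hsum : (∑ i, ((innerSL ℝ (b i (T y))).comp (fderiv ℝ X y)).smulRight (eb i)) =
      P.comp (fderiv ℝ X y) := by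
    ext v : 1
    simp [hP]
  rw [show Gi (X y) = T y from rfl, hsum]
  have hVn : ∀ᶠ z in 𝓝 y, z ∈ V := hX.isOpen.mem_nhds hy
  have hXd : HasFDerivAt X (fderiv ℝ X y) y :=
    ((hX.contDiffOn.contDiffAt hVn).differentiableAt (by simp)).hasFDerivAt
  -- The lower bound of `G` gives Lipschitz continuity of its inverse on the image.
  -- Differentiability follows by applying the left inverse `P` of `fderiv ℝ G (T y)` to the
  -- expansions of both sides of `G (T z) = X z`.
  have hO : (fun z => T z - T y) =O[𝓝 y] fun z => X z - X y := by
    refine Asymptotics.IsBigO.of_bound (l * h)⁻¹ ?_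
    filter_upwards [hVn] with z hz
    rw [← dist_eq_norm, ← dist_eq_norm]
    exact H.dist_inv_le (image_mono interior_subset (hX.mapsTo hz))
      (image_mono interior_subset (hX.mapsTo hy))
  have hO2 : (fun z => T z - T y) =O[𝓝 y] fun z => z - y := hO.trans hXd.isBigO_sub
  have hTc : Tendsto T (𝓝 y) (𝓝 (T y)) := by
    have h1 : Tendsto (fun z => T z - T y) (𝓝 y) (𝓝 0) := by
      refine hO2.trans_tendsto ?_
      have : Continuous fun z : E2 => z - y := by fun_prop
      simpa using this.tendsto y
    simpa using h1.add_const (T y)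
  have hG : HasFDerivAt G (fderiv ℝ G (T y)) (T y) :=
    (H.contDiff.differentiable (by simp) _).hasFDerivAt
  have hPG : ∀ v, P (fderiv ℝ G (T y) v) = v := by
    intro v
    have hyK := interior_subset (hTG y hy).1
    rw [fderiv_eq_tv]
    simp only [hP, _root_.sum_apply, ContinuousLinearMap.smulRight_apply,
      innerSL_apply_apply, inner_add_right, real_inner_smul_right, Hb.inner_tv _ hyK]
    rw [Fin.sum_univ_two]
    simp only [if_true, mul_one, one_ne_zero, zero_ne_one, if_false, mul_zero, add_zero, zero_add]
    exact (eq_sum_eb v).symm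
  have o1 : (fun z => G (T z) - G (T y) - fderiv ℝ G (T y) (T z - T y)) =o[𝓝 y] fun z => z - y :=
    (hG.isLittleO.comp_tendsto hTc).trans_isBigO hO2
  have o2 := hXd.isLittleO
  have o3 := (P.isBigO_comp (fun z => (X z - X y - fderiv ℝ X y (z - y)) -
    (G (T z) - G (T y) - fderiv ℝ G (T y) (T z - T y))) (𝓝 y)).trans_isLittleO (o2.sub o1)
  refine HasFDerivAt.of_isLittleO (o3.congr' ?_ EventuallyEq.rfl)
  filter_upwards [hVn] with z hz
  simp only [map_sub, hPG, (hTG z hz).2, (hTG y hy).2, ContinuousLinearMap.comp_apply]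
  abel

omit H Hb in
theorem _root_.SurfaceDG.memLp_of_continuous' {F : Type*} [NormedAddCommGroup F] {f : E2 → F}
    (hf : Continuous f) [SecondCountableTopologyEither E2 F] : MemLp f 2 muK := by
  obtain ⟨C, hC⟩ := isCompact_refTriangle.exists_bound_of_continuousOn hf.continuousOn
  exact MemLp.of_bound hf.aestronglyMeasurable C (ae_muK_of_forall fun x hx => hC x hx)

/-- The tangential gradient of a function that is smooth in the chart. -/
def _root_.SurfaceDG.chartGrad (G : E2 → E3) (b : Fin 2 → E2 → E3) (f : E2 → ℝ) (x : E3) : E3 :=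
  ∑ i, pd i f (Function.invFunOn G refTriangle x) • b i (Function.invFunOn G refTriangle x)

/-- In any local parametrization the function is differentiable as a composition with the transition
map to the chart, so the weak identity is classical integration by parts against a test function. -/
theorem hasWeakGrad_of_contDiff {f : E2 → ℝ} (hf : ContDiff ℝ ∞ f) :
    Γ.HasWeakGrad (G '' interior refTriangle) (fun x => f (Function.invFunOn G refTriangle x))
      (chartGrad G b f) := by
  set Gi := Function.invFunOn G refTriangle with hGi
  have hY : ∀ x ∈ interior refTriangle, Gi (G x) = x := fun x hx => H.inv_apply (interior_subset hx)
  have hγ : ContDiff ℝ ∞ fun y => ∑ i, pd i f y • b i y :=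
    ContDiff.sum fun i _ => (contDiff_pd hf i).smul (Hb.contDiff i)
  have m1 : MemLp (fun x => f (Gi x)) 2 (area (G '' interior refTriangle)) := by
    refine H.biLip.memLp_inv hY ?_
    rw [← muK_eq_interior]; exact memLp_of_continuous' hf.continuous
  have m2 : MemLp (chartGrad G b f) 2 (area (G '' interior refTriangle)) := by
    refine H.biLip.memLp_inv (f := fun y => ∑ i, pd i f y • b i y) hY ?_
    rw [← muK_eq_interior]; exact memLp_of_continuous' hγ.continuous
  refine ⟨m1, m2, ?_, ?_⟩
  · refine H.ae_of_comp (ae_muK_of_interior fun y hy => ?_)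
    rw [chartGrad, sum_inner]
    refine Finset.sum_eq_zero fun i _ => ?_
    rw [real_inner_smul_left, H.inv_apply (interior_subset hy), Hb.inner_normal y hy, mul_zero]
  · intro V X hX ψ h1 h2 h3 e
    have hd : ∀ y ∈ V, HasFDerivAt (fun z => f (Gi (X z))) ((fderiv ℝ f (Gi (X y))).comp
        (∑ i, ((innerSL ℝ (b i (Gi (X y)))).comp (fderiv ℝ X y)).smulRight (eb i))) y := fun y hy =>
      (hf.differentiable (by simp) _).hasFDerivAt.comp y (H.hasFDerivAt_transition Hb hX hy)
    have hd' : ∀ y ∈ V, fderiv ℝ (fun z => f (Gi (X z))) y e =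
        inner ℝ (chartGrad G b f (X y)) (fderiv ℝ X y e) := by
      intro y hy
      rw [(hd y hy).fderiv]
      simp only [chartGrad, ContinuousLinearMap.comp_apply, _root_.sum_apply,
        ContinuousLinearMap.smulRight_apply, innerSL_apply_apply, map_sum, map_smul, smul_eq_mul,
        sum_inner, real_inner_smul_left, pd]
      exact Finset.sum_congr rfl fun i _ => mul_comm _ _
    have hs : tsupport (fun y => fderiv ℝ ψ y e) ⊆ V := (tsupport_fderiv_apply_subset ℝ e).trans h3
    have hc : Continuous fun y => fderiv ℝ ψ y e :=
      (h1.continuous_fderiv (by simp)).clm_apply continuous_const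
    have e1 : ∀ y, fderiv ℝ (fun z => f (Gi (X z))) y e * ψ y =
        inner ℝ (chartGrad G b f (X y)) (fderiv ℝ X y e) * ψ y := by
      intro y
      by_cases hy : y ∈ V
      · rw [hd' y hy]
      · rw [image_eq_zero_of_notMem_tsupport fun h => hy (h3 h), mul_zero, mul_zero]
    simp only [← e1]
    refine integral_mul_fderiv_eq_neg_fderiv_mul_of_integrable ?_
      (hX.integrable_comp_mul m1 hc (h2.fderiv_apply ℝ e) hs)
      (hX.integrable_comp_mul m1 h1.continuous h2 h3)
      (fun y hy => (hd y (h3 hy)).differentiableAt) (fun y _ => h1.differentiable (by simp) y)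
    simp only [e1]
    exact hX.integrable_inner_mul m2 h1.continuous h2 h3 e

end IsChart

/-! ### Pullback of Sobolev functions to the reference triangle -/

theorem l2Sq_eq {F : Type*} [NormedAddCommGroup F] (μ : Measure E3) (f : E3 → F) :
    l2Sq μ f = eLpNorm f 2 μ ^ 2 := (eLpNorm_two_sq μ f).symm

theorem ofReal_div_mul {a h : ℝ} (ha : 0 ≤ a) (hh : 0 < h) :
    ENNReal.ofReal (a / h) = ENNReal.ofReal a * (ENNReal.ofReal h)⁻¹ := by
  rw [div_eq_mul_inv, ENNReal.ofReal_mul ha, ENNReal.ofReal_inv_of_pos hh]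

theorem ofReal_mul_inv_cancel {h : ℝ} (hh : 0 < h) :
    ENNReal.ofReal h * (ENNReal.ofReal h)⁻¹ = 1 :=
  ENNReal.mul_inv_cancel (by simpa using hh) ENNReal.ofReal_ne_top

theorem IsChart.nK_comp_le {Γ : ClosedSurface} {n : ℕ} {h Λ l : ℝ} {G : E2 → E3}
    (H : IsChart Γ n h Λ l G) (u : E3 → ℝ) :
    nK (fun y => u (G y)) ≤ ENNReal.ofReal (1 / l) * (ENNReal.ofReal h)⁻¹ *
      eLpNorm u 2 (area (G '' interior refTriangle)) := by
  have hl := H.l_pos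
  have h1 := H.biLip.eLpNorm_comp_le u
  rw [← muK_eq_interior] at h1
  rwa [← ofReal_div_mul (by positivity) H.h_pos, div_div]

/-- The derivative `∂ᵢ(u ∘ G)` is `∑ ∂ᵢG_c · (D_c u) ∘ G`. Each differentiation therefore gains a
factor `h` from `∂G`, while the comparison of area with Lebesgue measure costs one factor `h⁻¹` in
all. The components `D_c u` are treated by induction. -/
theorem exists_sobBd_comp (Λ l : ℝ) (j : ℕ) : ∃ C : ℝ≥0, ∀ {Γ : ClosedSurface} {n : ℕ} {h A : ℝ}
    {G : E2 → E3} {b : Fin 2 → E2 → E3}, IsChart Γ n h Λ l G → IsFrame Γ G A b → j ≤ n + 1 →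
    ∀ u : E3 → ℝ, Γ.MemSobolev (G '' interior refTriangle) j u →
      Γ.sobolevSq (G '' interior refTriangle) j u ≠ ⊤ ∧
      ∀ S : ℝ≥0∞, Γ.sobolevSq (G '' interior refTriangle) j u ≤ S ^ 2 →
        SobBd j (ENNReal.ofReal h) (fun y => u (G y)) (C * (ENNReal.ofReal h)⁻¹ * S) := by
  have hfin : ∀ {A : Set E3} {u : E3 → ℝ}, MemLp u 2 (area A) → l2Sq (area A) u ≠ ⊤ := by
    intro A u hu
    rw [l2Sq_eq]; exact ENNReal.pow_ne_top hu.2.ne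
  have hbd : ∀ {Γ : ClosedSurface} {n : ℕ} {h : ℝ} {G : E2 → E3}, IsChart Γ n h Λ l G →
      ∀ (u : E3 → ℝ) (S : ℝ≥0∞), l2Sq (area (G '' interior refTriangle)) u ≤ S ^ 2 →
      nK (fun y => u (G y)) ≤ ENNReal.ofReal (1 / l) * (ENNReal.ofReal h)⁻¹ * S := by
    intro Γ n h G H u S hS
    rw [l2Sq_eq, ENNReal.pow_le_pow_left_iff two_ne_zero] at hS
    exact (H.nK_comp_le u).trans (by gcongr)
  induction j with
  | zero =>
    refine ⟨(1 / l).toNNReal, fun {Γ n h A G b} H _ _ u hu => ⟨hfin hu, fun S hS => ?_⟩⟩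
    exact ⟨H.memLp_comp hu, hbd H u S hS⟩
  | succ j ih =>
    obtain ⟨C, hC⟩ := ih
    refine ⟨(1 / l).toNNReal + 3 * 2 ^ j * Λ.toNNReal * C, fun {Γ n h A G b} H Hb hj u hu => ?_⟩
    obtain ⟨g, hg, hgm⟩ := hu
    set W := Γ.weakGrad (G '' interior refTriangle) u with hW
    have hWg := ClosedSurface.weakGrad_spec hg
    have hgW := H.weakGrad_unique Hb hg hWg
    -- The norm is defined through the chosen gradient `weakGrad`. By uniqueness it agrees almost
    -- everywhere with the given gradient and inherits its Sobolev regularity.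
    have hWm : ∀ i, Γ.MemSobolev (G '' interior refTriangle) j fun x => W x i := fun i =>
      (hgm i).congr (by filter_upwards [hgW] with x hx; rw [hx])
    have hCi := fun i => hC H Hb (by omega) _ (hWm i)
    refine ⟨?_, fun S hS => ⟨H.memLp_comp hg.memLp, ?_, fun i => ?_⟩⟩
    · rw [ClosedSurface.sobolevSq]
      exact ENNReal.add_ne_top.2 ⟨hfin hg.memLp, ENNReal.sum_ne_top.2 fun i _ => (hCi i).1⟩
    · rw [ClosedSurface.sobolevSq] at hS
      refine (hbd H u S (le_self_add.trans hS)).trans ?_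
      gcongr
      push_cast
      exact le_self_add
    · refine ⟨_, H.hasD_comp hWg i, ?_⟩
      have h1 : ∀ c ∈ (Finset.univ : Finset (Fin 3)), SobBd j (ENNReal.ofReal h)
          (fun y => pd i (fun y => G y c) y * W (G y) c)
          (2 ^ j * ENNReal.ofReal (Λ * h) * (C * (ENNReal.ofReal h)⁻¹ * S)) := by
        intro c _
        refine SobBd.mul H.h_pos.le (contDiff_pd (contDiff_coord H.contDiff c) i)
          ((H.bd i c).of_le (by omega)) ((hCi c).2 S ?_)
        refine le_trans ?_ hS
        rw [ClosedSurface.sobolevSq]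
        exact (Finset.single_le_sum (f := fun c => Γ.sobolevSq (G '' interior refTriangle) j
          fun x => W x c) (fun _ _ => zero_le) (Finset.mem_univ c)).trans le_add_self
      have h2 := SobBd.finset_sum _ h1
      have h3 : (fun y => ∑ c, pd i (fun y => G y c) y * W (G y) c) =
          fun y => inner ℝ (W (G y)) (tv G i y) := by
        funext y
        rw [inner_e3]
        exact Finset.sum_congr rfl fun c _ => by rw [tv_apply H.contDiff, mul_comm]
      rw [h3] at h2
      refine h2.mono ?_
      rw [Finset.sum_const, Finset.card_univ, Fintype.card_fin, nsmul_eq_mul,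
        ENNReal.ofReal_mul H.Λ_nonneg]
      push_cast
      calc _ = ENNReal.ofReal h * ((3 * 2 ^ j * ENNReal.ofReal Λ * C) * (ENNReal.ofReal h)⁻¹ * S) := by
            ring
        _ ≤ _ := by
            gcongr
            exact le_add_self

/-! ### Edges -/

theorem lintegral_arc_image_le {c : ℝ → E3} {s : Set ℝ} (hs : MeasurableSet s) {L : ℝ≥0}
    (hc : LipschitzOnWith L c s) (g : E3 → ℝ≥0∞) :
    ∫⁻ x, g x ∂(arc (c '' s)) ≤ L * ∫⁻ t in s, g (c t) := by
  have hm : AEMeasurable c (volume.restrict s) := hc.continuousOn.aemeasurable hs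
  have h1 : arc (c '' s) ≤ (L : ℝ≥0∞) • (volume.restrict s).map c := by
    refine Measure.le_iff.2 fun S hS => ?_
    rw [Measure.smul_apply, Measure.map_apply_of_aemeasurable hm hS,
      Measure.restrict_apply' hs, arc, Measure.restrict_apply hS, smul_eq_mul]
    have h2 := hausdorff_image_le 1 (hc.mono (inter_subset_right (s := c ⁻¹' S)))
    have h3 : (Measure.euclideanHausdorffMeasure 1 : Measure ℝ) = volume := by
      have := InnerProductSpace.euclideanHausdorffMeasure_eq_volume (V := ℝ)
      rwa [Module.finrank_self] at this
    rw [h3, pow_one] at h2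
    refine le_trans (measure_mono ?_) h2
    rintro _ ⟨hx, t, ht, rfl⟩
    exact ⟨t, ⟨hx, ht⟩, rfl⟩
  calc _ ≤ ∫⁻ x, g x ∂((L : ℝ≥0∞) • (volume.restrict s).map c) := lintegral_mono' h1 le_rfl
    _ = L * ∫⁻ x, g x ∂((volume.restrict s).map c) := by
        rw [lintegral_smul_measure, smul_eq_mul]
    _ ≤ _ := by gcongr; exact lintegral_map_le _ _

theorem lipschitz_halfEdge (i : Fin 3) (j : Fin 2) : LipschitzWith 1 (halfEdge i j) := by
  refine LipschitzWith.of_dist_le_mul fun s t => ?_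
  have h1 : halfEdge i j s - halfEdge i j t =
      (s - t) • ((1 / 2 : ℝ) • (vtx (i + if j = 0 then 1 else 2) - vtx i)) := by
    simp only [halfEdge]; rw [sub_smul]; abel
  have h2 : ∀ i : Fin 3, ‖vtx i‖ ≤ 1 := by
    intro i
    refine norm_le_of_mem_refTriangle ?_
    fin_cases i <;> simp [vtx, refTriangle]
  rw [dist_eq_norm, h1, norm_smul, norm_smul, dist_eq_norm]
  have h3 : ‖vtx (i + if j = 0 then 1 else 2) - vtx i‖ ≤ 2 :=
    (norm_sub_le _ _).trans (by linarith [h2 (i + if j = 0 then 1 else 2), h2 i])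
  have h4 : ‖(1 / 2 : ℝ)‖ = 1 / 2 := by norm_num
  rw [h4]
  have := norm_nonneg (s - t)
  push_cast
  nlinarith

namespace IsChart

variable {Γ : ClosedSurface} {n : ℕ} {h Λ l A : ℝ} {G : E2 → E3} (H : IsChart Γ n h Λ l G)
  {b : Fin 2 → E2 → E3} (Hb : IsFrame Γ G A b)
include H

/-- The six curved half edges cover the boundary. Only an upper bound of arc length is needed, so
overlaps are harmless and the Lipschitz constant `6 Λ h` suffices. -/
theorem lintegral_arc_le (g : E3 → ℝ≥0∞) :
    ∫⁻ x, g x ∂(arc (G '' frontier refTriangle)) ≤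
      ∑ ij : Fin 3 × Fin 2, ENNReal.ofReal (6 * Λ * h) *
        ∫⁻ t in Icc (0 : ℝ) 1, g (G (halfEdge ij.1 ij.2 t)) := by
  have h1 : G '' frontier refTriangle ⊆
      ⋃ ij : Fin 3 × Fin 2, (fun t => G (halfEdge ij.1 ij.2 t)) '' Icc (0 : ℝ) 1 := by
    rintro _ ⟨x, hx, rfl⟩
    obtain ⟨ij, t, ht, rfl⟩ := mem_iUnion.1 (frontier_refTriangle_subset hx)
    exact mem_iUnion.2 ⟨ij, t, ht, rfl⟩
  have h2 : arc (G '' frontier refTriangle) ≤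
      Measure.sum fun ij : Fin 3 × Fin 2 => arc ((fun t => G (halfEdge ij.1 ij.2 t)) '' Icc (0 : ℝ) 1) :=
    (Measure.restrict_mono h1 le_rfl).trans Measure.restrict_iUnion_le
  refine (lintegral_mono' h2 le_rfl).trans ?_
  rw [lintegral_sum_measure, tsum_fintype]
  refine Finset.sum_le_sum fun ij _ => ?_
  have h3 := H.lipschitzOn.comp ((lipschitz_halfEdge ij.1 ij.2).lipschitzOnWith (s := Icc (0 : ℝ) 1))
    (fun t ht => halfEdge_mem ij.1 ij.2 t ht)
  rw [mul_one] at h3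
  exact lintegral_arc_image_le measurableSet_Icc h3 g

theorem l2Sq_arc_le {F : Type*} [NormedAddCommGroup F] (g : E3 → F) {M : ℝ≥0∞}
    (hM : ∀ i j, eLpNorm (fun s => g (G (halfEdge i j s))) 2 (volume.restrict (Icc (0 : ℝ) 1)) ≤ M) :
    l2Sq (arc (G '' frontier refTriangle)) g ≤ ENNReal.ofReal (36 * Λ * h) * M ^ 2 := by
  refine (H.lintegral_arc_le _).trans ?_
  calc _ ≤ ∑ ij : Fin 3 × Fin 2, ENNReal.ofReal (6 * Λ * h) * M ^ 2 := by
        refine Finset.sum_le_sum fun ij _ => ?_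
        gcongr
        rw [← eLpNorm_two_sq]
        exact pow_le_pow_left₀ zero_le (hM _ _) 2
    _ = _ := by
        rw [Finset.sum_const, Finset.card_univ, Fintype.card_prod, Fintype.card_fin, Fintype.card_fin,
          nsmul_eq_mul, ← mul_assoc]
        congr 1
        rw [show (36 * Λ * h) = (6 : ℝ) * (6 * Λ * h) by ring,
          ENNReal.ofReal_mul (p := 6) (q := 6 * Λ * h) (by norm_num)]
        congr 1
        norm_num

theorem closure_image : closure (G '' interior refTriangle) = G '' refTriangle := by
  refine subset_antisymm (closure_minimal (image_mono interior_subset)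
    (isCompact_refTriangle.image H.contDiff.continuous).isClosed) ?_
  have := image_closure_subset_closure_image H.contDiff.continuous (s := interior refTriangle)
  rwa [closure_interior_refTriangle] at this

omit H in
theorem _root_.SurfaceDG.frontier_refTriangle_subset_self : frontier refTriangle ⊆ refTriangle :=
  isClosed_refTriangle.frontier_subset

theorem isCompact_boundary : IsCompact (G '' frontier refTriangle) :=
  (isCompact_refTriangle.of_isClosed_subset isClosed_frontier frontier_refTriangle_subset_self).image
    H.contDiff.continuous

theorem arc_boundary_lt_top : arc (G '' frontier refTriangle) univ < ⊤ := by
  have := H.lintegral_arc_le fun _ => 1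
  rw [lintegral_one] at this
  refine this.trans_lt ?_
  simp only [lintegral_one, Measure.restrict_apply_univ, Real.volume_Icc]
  refine ENNReal.sum_lt_top.2 fun _ _ => ENNReal.mul_lt_top ENNReal.ofReal_lt_top (by simp)

theorem memLp_arc {φ : E3 → ℝ} (hφ : ContinuousOn φ (G '' refTriangle)) :
    MemLp φ 2 (arc (G '' frontier refTriangle)) := by
  have h1 := hφ.mono (image_mono (f := G) frontier_refTriangle_subset_self)
  have hB := H.isCompact_boundary
  obtain ⟨C, hC⟩ := hB.exists_bound_of_continuousOn h1
  have : IsFiniteMeasure (arc (G '' frontier refTriangle)) := ⟨H.arc_boundary_lt_top⟩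
  refine MemLp.of_bound (h1.aestronglyMeasurable hB.isClosed.measurableSet) C ?_
  exact (ae_restrict_iff' hB.isClosed.measurableSet).2 (Eventually.of_forall hC)

end IsChart

/-! ### Traces -/

theorem enorm_le_of_sq {a b : ℝ≥0∞} (h : a ^ 2 ≤ b ^ 2) : a ≤ b :=
  (ENNReal.pow_le_pow_left_iff two_ne_zero).1 h

theorem tendsto_zero_of_sq {f : ℕ → ℝ≥0∞} (h : Tendsto (fun n => f n ^ 2) atTop (𝓝 0)) :
    Tendsto f atTop (𝓝 0) := by
  have h1 := (ENNReal.continuous_rpow_const (y := 1 / 2)).continuousAt.tendsto.comp h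
  have h2 : ((0 : ℝ≥0∞) ^ (1 / 2 : ℝ)) = 0 := ENNReal.zero_rpow_of_pos (by norm_num)
  rw [h2] at h1
  refine h1.congr fun n => ?_
  rw [Function.comp_apply, ← ENNReal.rpow_natCast, ← ENNReal.rpow_mul]
  norm_num

theorem tendsto_sq_zero {f : ℕ → ℝ≥0∞} (h : Tendsto f atTop (𝓝 0)) :
    Tendsto (fun n => f n ^ 2) atTop (𝓝 0) := by
  have := ENNReal.Tendsto.pow (n := 2) h
  simpa using this

theorem tendsto_const_mul_zero {c : ℝ≥0∞} (hc : c ≠ ⊤) {f : ℕ → ℝ≥0∞} (h : Tendsto f atTop (𝓝 0)) :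
    Tendsto (fun n => c * f n) atTop (𝓝 0) := by
  simpa only [mul_zero] using ENNReal.Tendsto.const_mul h (Or.inr hc)

namespace IsChart

variable {Γ : ClosedSurface} {n : ℕ} {h Λ l A : ℝ} {G : E2 → E3} (H : IsChart Γ n h Λ l G)
  {b : Fin 2 → E2 → E3} (Hb : IsFrame Γ G A b)
include H

theorem nK_inner_tv_le (v : E3 → E3) (i : Fin 2) :
    nK (fun y => inner ℝ (v (G y)) (tv G i y)) ≤ ENNReal.ofReal (3 * (Λ * h)) *
      (((1 / (l * h)).toNNReal : ℝ≥0∞) * eLpNorm v 2 (area (G '' interior refTriangle))) := by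
  have h1 := H.biLip.eLpNorm_comp_le v
  rw [← muK_eq_interior] at h1
  refine le_trans ?_ (mul_le_mul_right h1 _)
  refine eLpNorm_le_mul_eLpNorm_of_ae_le_mul (ae_muK_of_forall fun y hy => ?_) 2
  rw [mul_comm]
  exact (norm_inner_le_norm _ _).trans (by gcongr; exact H.norm_tv_le hy i)

theorem eLpNorm_arc_le (g : E3 → ℝ) {M : ℝ≥0∞}
    (hM : ∀ i j, eLpNorm (fun s => g (G (halfEdge i j s))) 2 (volume.restrict (Icc (0 : ℝ) 1)) ≤ M) :
    eLpNorm g 2 (arc (G '' frontier refTriangle)) ≤ ENNReal.ofReal (√(36 * Λ * h)) * M := by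
  have hΛ := H.Λ_nonneg
  have hh := H.h_pos
  refine enorm_le_of_sq ?_
  rw [mul_pow, ← l2Sq_eq, ← ENNReal.ofReal_pow (Real.sqrt_nonneg _), Real.sq_sqrt (by positivity)]
  exact H.l2Sq_arc_le g hM

end IsChart

/-- The trace inequality for traces on the boundary of a curved triangle. -/
theorem exists_l2Sq_trace_le : ∃ C : ℝ≥0, ∀ {Γ : ClosedSurface} {n : ℕ} {h Λ l : ℝ} {G : E2 → E3},
    IsChart Γ n h Λ l G → ∀ (v τ : E3 → ℝ) (E : Fin 2 → E2 → ℝ) (M : ℝ≥0∞),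
    Γ.HasTrace (G '' interior refTriangle) (G '' frontier refTriangle) v τ →
    (∀ i, HasD (fun y => v (G y)) i (E i)) → (∀ i, MemLp (E i) 2 muK) →
    nK (fun y => v (G y)) ≤ M → (∀ i, nK (E i) ≤ M) →
    l2Sq (arc (G '' frontier refTriangle)) τ ≤ ENNReal.ofReal (36 * Λ * h) * (C * M) ^ 2 := by
  obtain ⟨C, hC⟩ := exists_weak_trace_le
  refine ⟨C * 3, fun {Γ n h Λ l G} H v τ E M hτ hE mE hM hEM => ?_⟩
  obtain ⟨mτ, g, hg, φ, γ, hφc, hφ, t1, t2, t3⟩ := hτ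
  have hΛ := H.Λ_nonneg
  have hh := H.h_pos
  set AA := G '' interior refTriangle
  set B := G '' frontier refTriangle
  simp only [l2Sq_eq] at t1 t2 t3
  replace t1 := tendsto_zero_of_sq t1
  replace t2 := tendsto_zero_of_sq t2
  replace t3 := tendsto_zero_of_sq t3
  have hcl : closure AA = G '' refTriangle := H.closure_image
  set a : ℕ → ℝ≥0∞ := fun n => ((1 / (l * h)).toNNReal : ℝ≥0∞) * eLpNorm (fun x => φ n x - v x) 2 (area AA)
  set c : ℕ → ℝ≥0∞ := fun n => ENNReal.ofReal (3 * (Λ * h)) * (((1 / (l * h)).toNNReal : ℝ≥0∞) *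
    eLpNorm (fun x => γ n x - g x) 2 (area AA))
  have ta : Tendsto a atTop (𝓝 0) := tendsto_const_mul_zero ENNReal.coe_ne_top t1
  have tc : Tendsto c atTop (𝓝 0) :=
    tendsto_const_mul_zero ENNReal.ofReal_ne_top (tendsto_const_mul_zero ENNReal.coe_ne_top t2)
  have mv := H.memLp_comp hg.memLp
  -- Weak derivatives on the reference triangle are unique, so the gradient supplied with the trace
  -- obeys the bounds given for `E`.
  have hEn : ∀ i, nK (fun y => inner ℝ (g (G y)) (tv G i y)) ≤ M := fun i => by
    rw [nK_congr ((H.hasD_comp hg i).unique (hE i) (H.memLp_inner_tv hg.memLp_grad i) (mE i))]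
    exact hEM i
  have b1 : ∀ n, nK (fun y => φ n (G y)) ≤ a n + M := by
    intro n
    have h1 := H.biLip.eLpNorm_comp_le (fun x => φ n x - v x)
    rw [← muK_eq_interior] at h1
    have h2 := nK_add_le (f := fun y => φ n (G y) - v (G y)) (g := fun y => v (G y))
      ((H.memLp_comp (hφ n).memLp).sub mv) mv
    have h3 : ((fun y => φ n (G y) - v (G y)) + fun y => v (G y)) = fun y => φ n (G y) := by
      funext y; simp
    rw [h3] at h2
    exact h2.trans (add_le_add h1 hM)
  have b2 : ∀ n i, nK (fun y => inner ℝ (γ n (G y)) (tv G i y)) ≤ c n + M := by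
    intro n i
    have h1 := H.nK_inner_tv_le (fun x => γ n x - g x) i
    have h2 := nK_add_le (f := fun y => inner ℝ (γ n (G y) - g (G y)) (tv G i y))
      (g := fun y => inner ℝ (g (G y)) (tv G i y))
      (H.memLp_inner_tv (g := fun x => γ n x - g x) ((hφ n).memLp_grad.sub hg.memLp_grad) i)
      (H.memLp_inner_tv hg.memLp_grad i)
    have h3 : ((fun y => inner ℝ (γ n (G y) - g (G y)) (tv G i y)) +
        fun y => inner ℝ (g (G y)) (tv G i y)) = fun y => inner ℝ (γ n (G y)) (tv G i y) := by
      funext y; simp [inner_sub_left]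
    rw [h3] at h2
    exact h2.trans (add_le_add h1 (hEn i))
  -- Each approximant is continuous up to the boundary, so the trace inequality on the reference
  -- triangle applies to it. The bound for `τ` follows in the limit, whichever approximating
  -- sequence was given.
  have b3 : ∀ n, eLpNorm (φ n) 2 (arc B) ≤
      ENNReal.ofReal (√(36 * Λ * h)) * (C * (a n + 2 * c n + 3 * M)) := by
    intro n
    refine H.eLpNorm_arc_le _ fun i j => ?_
    refine (hC (fun y => φ n (G y)) ?_ (fun i y => inner ℝ (γ n (G y)) (tv G i y))
      (fun i => H.hasD_comp (hφ n) i) (H.memLp_comp (hφ n).memLp)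
      (fun i => H.memLp_inner_tv (hφ n).memLp_grad i) i j).trans ?_
    · have := hφc n
      rw [hcl] at this
      exact this.comp H.contDiff.continuous.continuousOn (mapsTo_image _ _)
    · refine mul_le_mul_right ?_ _
      exact (add_le_add (add_le_add (b1 n) (b2 n 0)) (b2 n 1)).trans (le_of_eq (by ring))
  have mφ : ∀ n, MemLp (φ n) 2 (arc B) := fun n => H.memLp_arc (hcl ▸ hφc n)
  have b4 : ∀ n, eLpNorm τ 2 (arc B) ≤ eLpNorm (fun x => φ n x - τ x) 2 (arc B) +
      ENNReal.ofReal (√(36 * Λ * h)) * (C * (a n + 2 * c n + 3 * M)) := by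
    intro n
    have h1 := eLpNorm_sub_le (mφ n).1 ((mφ n).sub mτ).1 (p := 2) (by norm_num)
    have h2 : φ n - (φ n - τ) = τ := by simp
    rw [h2, add_comm] at h1
    exact h1.trans (add_le_add le_rfl (b3 n))
  have b5 : eLpNorm τ 2 (arc B) ≤ 0 + ENNReal.ofReal (√(36 * Λ * h)) * (C * (0 + 2 * 0 + 3 * M)) := by
    refine ge_of_tendsto' (t3.add ?_) b4
    refine ENNReal.Tendsto.const_mul (ENNReal.Tendsto.const_mul ((ta.add
      (ENNReal.Tendsto.const_mul tc (Or.inr (by simp)))).add tendsto_const_nhds) (Or.inr (by simp)))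
      (Or.inr (by simp))
  rw [l2Sq_eq]
  refine (pow_le_pow_left₀ zero_le b5 2).trans (le_of_eq ?_)
  rw [mul_zero, zero_add, zero_add, zero_add, mul_pow, ← ENNReal.ofReal_pow (Real.sqrt_nonneg _),
    Real.sq_sqrt (by positivity)]
  push_cast
  ring

namespace IsChart

variable {Γ : ClosedSurface} {n : ℕ} {h Λ l A : ℝ} {G : E2 → E3} (H : IsChart Γ n h Λ l G)
  {b : Fin 2 → E2 → E3} (Hb : IsFrame Γ G A b)
include H

theorem continuousOn_inv : ContinuousOn (Function.invFunOn G refTriangle) (G '' refTriangle) := by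
  have hl := H.l_pos
  have hh := H.h_pos
  refine (LipschitzOnWith.of_dist_le_mul (K := ((l * h)⁻¹).toNNReal) fun x hx z hz => ?_).continuousOn
  rw [Real.coe_toNNReal _ (by positivity)]
  exact H.dist_inv_le hx hz

include Hb

theorem eLpNorm_sub_chartGrad_le {v : E3 → ℝ} {γ : E3 → E3}
    (hv : Γ.HasWeakGrad (G '' interior refTriangle) v γ) {f : E2 → ℝ} (hf : ContDiff ℝ ∞ f) :
    eLpNorm (fun x => chartGrad G b f x - γ x) 2 (area (G '' interior refTriangle)) ≤
      ((6 * Λ * h).toNNReal : ℝ≥0∞) * ∑ i, ENNReal.ofReal (3 * A) *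
        nK (pd i f - fun y => inner ℝ (γ (G y)) (tv G i y)) := by
  refine (H.biLip.eLpNorm_le_comp _).trans ?_
  gcongr
  rw [← muK_eq_interior]
  set w : Fin 2 → E2 → ℝ := fun i => pd i f - fun y => inner ℝ (γ (G y)) (tv G i y)
  have mw : ∀ i, MemLp (w i) 2 muK := fun i =>
    (memLp_of_continuous (contDiff_pd hf i).continuous).sub (H.memLp_inner_tv hv.memLp_grad i)
  have h1 : (fun y => chartGrad G b f (G y) - γ (G y)) =ᵐ[muK] ∑ i, fun y => w i y • b i y := by
    filter_upwards [H.ae_eq_sum_frame Hb hv.tangential,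
      ae_muK_of_interior (q := fun y => y ∈ interior refTriangle) fun _ h => h] with y hy hyi
    rw [hy, chartGrad, H.inv_apply (interior_subset hyi), Finset.sum_apply, ← Finset.sum_sub_distrib]
    exact Finset.sum_congr rfl fun i _ => by simp [w, sub_smul]
  rw [eLpNorm_congr_ae h1]
  refine (eLpNorm_sum_le (fun i _ => (mw i).1.smul (Hb.contDiff i).continuous.aestronglyMeasurable)
    (by norm_num)).trans (Finset.sum_le_sum fun i _ => ?_)
  refine eLpNorm_le_mul_eLpNorm_of_ae_le_mul (ae_muK_of_forall fun y hy => ?_) 2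
  change ‖w i y • b i y‖ ≤ 3 * A * ‖w i y‖
  rw [norm_smul, mul_comm]
  gcongr
  refine norm_e3_le _ fun c => ?_
  simpa [D] using Hb.bd i c 0 0 (Nat.zero_le _) y hy

/-- Every function in `H¹` of a curved triangle has a trace on the boundary. -/
theorem exists_trace {v : E3 → ℝ} {γ : E3 → E3}
    (hv : Γ.HasWeakGrad (G '' interior refTriangle) v γ) :
    ∃ τ, Γ.HasTrace (G '' interior refTriangle) (G '' frontier refTriangle) v τ := by
  obtain ⟨C, hC⟩ := exists_weak_trace_le
  set Gi := Function.invFunOn G refTriangle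
  set B := G '' frontier refTriangle
  have mv := H.memLp_comp hv.memLp
  set E : Fin 2 → E2 → ℝ := fun i y => inner ℝ (γ (G y)) (tv G i y)
  have hE : ∀ i, HasD (fun y => v (G y)) i (E i) := H.hasD_comp hv
  have mE : ∀ i, MemLp (E i) 2 muK := H.memLp_inner_tv hv.memLp_grad
  -- The approximants are the mollified pullbacks of `v`, transported back to the surface by the
  -- inverse chart.
  set f : ℕ → E2 → ℝ := fun n => moll n fun y => v (G y)
  have hf : ∀ n, ContDiff ℝ ∞ (f n) := fun n => contDiff_moll n mv
  set φ : ℕ → E3 → ℝ := fun n x => f n (Gi x)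
  have hφc : ∀ n, ContinuousOn (φ n) (G '' refTriangle) := fun n =>
    (hf n).continuous.comp_continuousOn H.continuousOn_inv
  have t0 : Tendsto (fun n => nK (f n - fun y => v (G y))) atTop (𝓝 0) := tendsto_nK_moll mv
  have t1 : ∀ i, Tendsto (fun n => nK (pd i (f n) - E i)) atTop (𝓝 0) := fun i =>
    tendsto_nK_pd_moll (hE i) mv (mE i)
  set K : ℝ≥0∞ := ENNReal.ofReal (√(36 * Λ * h)) * C with hK
  have hKt : K ≠ ⊤ := ENNReal.mul_ne_top ENNReal.ofReal_ne_top (by simp)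
  set a : ℕ → ℝ≥0∞ := fun n => K * (nK (f n - fun y => v (G y)) + nK (pd 0 (f n) - E 0) +
    nK (pd 1 (f n) - E 1))
  have ta : Tendsto a atTop (𝓝 0) := by
    have := ENNReal.Tendsto.const_mul (a := K) ((t0.add (t1 0)).add (t1 1)) (Or.inr hKt)
    simpa using this
  have mφ : ∀ n, MemLp (φ n) 2 (arc B) := fun n => H.memLp_arc (hφc n)
  have mpd : ∀ i n, MemLp (pd i (f n)) 2 muK := fun i n =>
    memLp_of_continuous (contDiff_pd (hf n) i).continuous
  have mf : ∀ n, MemLp (f n) 2 muK := fun n => memLp_of_continuous (hf n).continuous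
  have htri : ∀ {x y z : E2 → ℝ}, MemLp x 2 muK → MemLp y 2 muK → MemLp z 2 muK →
      nK (x - y) ≤ nK (x - z) + nK (y - z) := by
    intro x y z hx hy hz
    have h1 := nK_add_le (hx.sub hz) (hz.sub hy)
    rw [sub_add_sub_cancel] at h1
    rwa [nK_sub_comm y z]
  -- The trace inequality for differences turns convergence in `H¹` of the triangle into a Cauchy
  -- property in `L²` of the boundary. Completeness provides the trace.
  have hcau : ∀ n m, eLpNorm (φ n - φ m) 2 (arc B) ≤ a n + a m := by
    intro n m
    have h1 : eLpNorm (φ n - φ m) 2 (arc B) ≤ ENNReal.ofReal (√(36 * Λ * h)) *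
        (C * (nK (f n - f m) + nK (pd 0 (f n - f m)) + nK (pd 1 (f n - f m)))) := by
      refine H.eLpNorm_arc_le _ fun i j => ?_
      have hsm : ContDiff ℝ ∞ (f n - f m) := (hf n).sub (hf m)
      refine le_trans (le_of_eq ?_) (hC (f n - f m) hsm.continuous.continuousOn
        (fun i => pd i (f n - f m)) (fun i => hasD_of_contDiff hsm i) (memLp_of_continuous hsm.continuous)
        (fun i => memLp_of_continuous (contDiff_pd hsm i).continuous) i j)
      refine eLpNorm_congr_ae ?_
      filter_upwards [ae_restrict_mem measurableSet_Icc] with s hs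
      have : Gi (G (halfEdge i j s)) = halfEdge i j s := H.inv_apply (halfEdge_mem i j s hs)
      simp only [φ, Pi.sub_apply, this]
    refine h1.trans ?_
    rw [← mul_assoc, ← hK, pd_sub (hf n) (hf m), pd_sub (hf n) (hf m), ← mul_add]
    refine mul_le_mul_right ?_ _
    have e : ∀ p p' q q' r r' : ℝ≥0∞, (p + p') + (q + q') + (r + r') = (p + q + r) + (p' + q' + r') := by
      intros; ring
    exact (add_le_add (add_le_add (htri (mf n) (mf m) mv) (htri (mpd 0 n) (mpd 0 m) (mE 0)))
      (htri (mpd 1 n) (mpd 1 m) (mE 1))).trans (le_of_eq (e _ _ _ _ _ _))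
  have hcs : CauchySeq fun n => (mφ n).toLp (φ n) := by
    rw [Lp.cauchySeq_Lp_iff_cauchySeq_eLpNorm]
    have h2 : Tendsto (fun p : ℕ × ℕ => a p.1 + a p.2) atTop (𝓝 0) := by
      rw [← prod_atTop_atTop_eq]
      simpa using (ta.comp tendsto_fst).add (ta.comp tendsto_snd)
    refine tendsto_of_tendsto_of_tendsto_of_le_of_le tendsto_const_nhds h2 (fun _ => zero_le)
      fun p => ?_
    refine le_trans (le_of_eq (eLpNorm_congr_ae ?_)) (hcau p.1 p.2)
    exact (mφ p.1).coeFn_toLp.sub (mφ p.2).coeFn_toLp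
  obtain ⟨T, hT⟩ := cauchySeq_tendsto_of_complete hcs
  have hT' : Tendsto (fun n => eLpNorm (φ n - (T : E3 → ℝ)) 2 (arc B)) atTop (𝓝 0) := by
    rw [Lp.tendsto_Lp_iff_tendsto_eLpNorm'] at hT
    refine hT.congr fun n => eLpNorm_congr_ae ?_
    exact (mφ n).coeFn_toLp.sub EventuallyEq.rfl
  refine ⟨T, Lp.memLp T, γ, hv, φ, fun n => chartGrad G b (f n), fun n => ?_,
    fun n => H.hasWeakGrad_of_contDiff Hb (hf n), ?_, ?_, ?_⟩
  · rw [H.closure_image]; exact hφc n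
  · simp only [l2Sq_eq]
    refine tendsto_sq_zero ?_
    have h1 := tendsto_const_mul_zero (c := ((6 * Λ * h).toNNReal : ℝ≥0∞)) ENNReal.coe_ne_top t0
    refine tendsto_of_tendsto_of_tendsto_of_le_of_le tendsto_const_nhds h1 (fun _ => zero_le)
      fun n => ?_
    refine (H.biLip.eLpNorm_le_comp _).trans (le_of_eq ?_)
    congr 1
    rw [← muK_eq_interior]
    refine eLpNorm_congr_ae (ae_muK_of_forall fun y hy => ?_)
    have : Gi (G y) = y := H.inv_apply hy
    simp only [φ, this, Pi.sub_apply]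
  · simp only [l2Sq_eq]
    refine tendsto_sq_zero ?_
    have h1 := ENNReal.Tendsto.const_mul (a := ((6 * Λ * h).toNNReal : ℝ≥0∞))
      (tendsto_finsetSum Finset.univ fun i _ => ENNReal.Tendsto.const_mul
        (a := ENNReal.ofReal (3 * A)) (t1 i) (Or.inr ENNReal.ofReal_ne_top)) (Or.inr (by simp))
    simp only [mul_zero, Finset.sum_const_zero] at h1
    exact tendsto_of_tendsto_of_tendsto_of_le_of_le tendsto_const_nhds h1 (fun _ => zero_le)
      fun n => H.eLpNorm_sub_chartGrad_le Hb hv (hf n)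
  · simp only [l2Sq_eq]
    exact tendsto_sq_zero hT'

end IsChart

/-! ### The interpolation estimate on a curved triangle -/

namespace IsChart

variable {Γ : ClosedSurface} {n : ℕ} {h Λ l A : ℝ} {G : E2 → E3} (H : IsChart Γ n h Λ l G)
  {b : Fin 2 → E2 → E3} (Hb : IsFrame Γ G A b)
include H Hb

/-- The gradient of `e` is that of `w` minus `chartGrad G b f`. Its components have weak gradients:
those of `w` because at least two derivatives exist, those of `chartGrad` because they are again
smooth in the chart. Hence `exists_trace` applies componentwise. -/
theorem exists_gradTrace {w e : E3 → ℝ} {m : ℕ}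
    (hw : Γ.MemSobolev (G '' interior refTriangle) (m + 2) w) {f : E2 → ℝ} (hf : ContDiff ℝ ∞ f)
    (he : ∀ y ∈ refTriangle, e (G y) = w (G y) - f y) :
    ∃ t, Γ.HasGradTrace (G '' interior refTriangle) (G '' frontier refTriangle) e t := by
  obtain ⟨g, hg, hgm⟩ := hw
  have h1 := hg.sub (H.hasWeakGrad_of_contDiff Hb hf)
  have h2 : (fun x => w x - f (Function.invFunOn G refTriangle x)) =ᵐ[area (G '' interior refTriangle)] e :=
    H.ae_of_comp (ae_muK_of_forall fun y hy => by
      rw [he y hy]; beta_reduce; rw [H.inv_apply hy])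
  have h3 : ∀ i : Fin 3, ContDiff ℝ ∞ fun y => ∑ j, pd j f y * b j y i := fun i =>
    ContDiff.sum fun j _ => (contDiff_pd hf j).mul (contDiff_coord (Hb.contDiff j) i)
  have h4 : ∀ i : Fin 3, ∃ τ, Γ.HasTrace (G '' interior refTriangle) (G '' frontier refTriangle)
      (fun x => (g x - chartGrad G b f x) i) τ := by
    intro i
    obtain ⟨γ, hγ, -⟩ := hgm i
    have h5 := hγ.sub (H.hasWeakGrad_of_contDiff Hb (h3 i))
    refine H.exists_trace Hb (h5.congr (Eventually.of_forall fun x => ?_))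
    simp [chartGrad]
  choose τ hτ using h4
  exact ⟨fun x => WithLp.toLp 2 fun i => τ i x, _, h1.congr h2, fun i => hτ i⟩

/-- Pulled back, the surface gradient is `∑ bᵢ Eᵢ`, so its `H¹` norm on the reference triangle costs
the frame bound `A`, later of order `1 / h`. The 4 counts two terms of the sum and the factor 2 of
the product rule; scale 1 is used because no further powers are tracked. -/
theorem sobBd_grad_comp {e : E3 → ℝ} {g : E3 → E3} (hg : Γ.HasWeakGrad (G '' interior refTriangle) e g)
    {E : Fin 2 → E2 → ℝ} {F : Fin 2 → Fin 2 → E2 → ℝ} {M : ℝ≥0∞}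
    (hE : ∀ i, HasD (fun y => e (G y)) i (E i)) (hF : ∀ i j, HasD (E i) j (F i j))
    (mE : ∀ i, MemLp (E i) 2 muK) (mF : ∀ i j, MemLp (F i j) 2 muK)
    (bE : ∀ i, nK (E i) ≤ M) (bF : ∀ i j, nK (F i j) ≤ M) (c : Fin 3) :
    SobBd 1 1 (fun y => g (G y) c) (4 * ENNReal.ofReal A * M) := by
  have h1 : ∀ i ∈ (Finset.univ : Finset (Fin 2)), SobBd 1 (ENNReal.ofReal 1)
      (fun y => b i y c * E i y) (2 ^ 1 * ENNReal.ofReal A * M) := by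
    intro i _
    refine SobBd.mul zero_le_one (contDiff_coord (Hb.contDiff i) c) (Hb.bd i c) ?_
    refine ⟨mE i, bE i, fun j => ⟨F i j, hF i j, mF i j, ?_⟩⟩
    rw [ENNReal.ofReal_one, one_mul]; exact bF i j
  have h2 := SobBd.finset_sum _ h1
  rw [ENNReal.ofReal_one, Finset.sum_const, Finset.card_univ, Fintype.card_fin, nsmul_eq_mul] at h2
  have h3 := fun i => (H.hasD_comp hg i).unique (hE i) (H.memLp_inner_tv hg.memLp_grad i) (mE i)
  refine (h2.congr ?_).mono (le_of_eq ?_)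
  · filter_upwards [h3 0, h3 1, H.ae_eq_sum_frame Hb hg.tangential] with y e0 e1 e2
    rw [e2, Fin.sum_univ_two, Fin.sum_univ_two, e0, e1]
    simp [mul_comm]
  · push_cast; ring

end IsChart

/-- Power counting on one element: the reference error is of order `h ^ (m - 1)`. Squaring and the
arc length factor `h` give `h ^ (2m - 1)`; for the gradient the frame contributes `h⁻²` after
squaring. -/
theorem LagrangeNodes.exists_chart_estimate {k : ℕ} (N : LagrangeNodes k) {m : ℕ} (hm : 2 ≤ m)
    (hmk : m ≤ k + 1) (Λ l : ℝ) : ∃ C : ℝ≥0, ∀ (Γ : ClosedSurface) (n : ℕ) (h : ℝ) (G : E2 → E3),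
    m ≤ n + 1 → IsChart Γ n h Λ l G → ∀ w e : E3 → ℝ,
    Γ.MemSobolev (G '' interior refTriangle) m w → ContinuousOn w Γ.carrier →
    (∀ y ∈ refTriangle, e (G y) = w (G y) - N.interpolant (fun y => w (G y)) y) →
    (∃ t, Γ.HasGradTrace (G '' interior refTriangle) (G '' frontier refTriangle) e t) ∧
    ∀ t, Γ.HasGradTrace (G '' interior refTriangle) (G '' frontier refTriangle) e t →
      l2Sq (arc (G '' frontier refTriangle)) e ≤
        C * ENNReal.ofReal h ^ (2 * m - 1) * Γ.sobolevSq (G '' interior refTriangle) m w ∧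
      l2Sq (arc (G '' frontier refTriangle)) t ≤
        C * ENNReal.ofReal h ^ (2 * m - 3) * Γ.sobolevSq (G '' interior refTriangle) m w := by
  obtain ⟨C1, hC1⟩ := N.exists_weak_interpolation_error_le hm hmk
  obtain ⟨C2, hC2⟩ := exists_sobBd_comp Λ l m
  obtain ⟨C3, hC3⟩ := exists_weak_trace_le
  obtain ⟨C4, hC4⟩ := exists_l2Sq_trace_le
  obtain ⟨C5, hC5⟩ := exists_frame Λ l
  obtain ⟨m, rfl⟩ : ∃ m', m = m' + 2 := ⟨m - 2, by omega⟩
  refine ⟨(36 * Λ).toNNReal * (3 * C3 * C1 * C2) ^ 2 +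
    3 * (36 * Λ).toNNReal * (4 * C4 * C5.toNNReal * C1 * C2) ^ 2, fun Γ n h G hmn H w e hw hwc he => ?_⟩
  obtain ⟨b, Hb⟩ := hC5 Γ n h G (by omega) H
  refine ⟨H.exists_gradTrace Hb hw (N.contDiff_interpolant _) he, fun t ht => ?_⟩
  have hh := H.h_pos
  have hΛ := H.Λ_nonneg
  obtain ⟨hfin, hbd⟩ := hC2 H Hb hmn w hw
  set S := Γ.sobolevSq (G '' interior refTriangle) (m + 2) w with hS
  set s : ℝ≥0∞ := S ^ (1 / 2 : ℝ) with hs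
  have hsS : s ^ 2 = S := by
    rw [hs, ← ENNReal.rpow_natCast, ← ENNReal.rpow_mul]; norm_num
  have hst : s ≠ ⊤ := ENNReal.rpow_ne_top_of_nonneg (by norm_num) hfin
  set η := ENNReal.ofReal h with hη
  have hη1 : η * η⁻¹ = 1 := ofReal_mul_inv_cancel hh
  have hηt : η⁻¹ ≠ ⊤ := ENNReal.inv_ne_top.2 (by simpa [hη] using hh)
  have huc : ContinuousOn (fun y => w (G y)) refTriangle :=
    hwc.comp H.contDiff.continuous.continuousOn H.mapsTo
  obtain ⟨E, F, hE, hF, mv, mE, mF, bv, bE, bF⟩ := hC1 η (C2 * η⁻¹ * s) (fun y => w (G y))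
    ENNReal.ofReal_ne_top (ENNReal.mul_ne_top (ENNReal.mul_ne_top ENNReal.coe_ne_top hηt) hst) huc
    (hbd s hsS.ge)
  -- After the shift the Sobolev order is `m + 2`: that many powers come from the derivatives of the
  -- chart, and one is lost to the area scaling.
  have hM : (C1 : ℝ≥0∞) * (η ^ (m + 2) * (C2 * η⁻¹ * s)) = C1 * C2 * η ^ (m + 1) * s := by
    calc _ = C1 * C2 * η ^ (m + 1) * s * (η * η⁻¹) := by ring
      _ = _ := by rw [hη1, mul_one]
  rw [hM] at bv
  simp only [hM] at bE bF
  set M := (C1 : ℝ≥0∞) * C2 * η ^ (m + 1) * s with hMdef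
  have hev : (fun y => w (G y) - N.interpolant (fun y => w (G y)) y) =ᵐ[muK] fun y => e (G y) :=
    ae_muK_of_forall fun y hy => (he y hy).symm
  have hE' := fun i => (hE i).congr hev EventuallyEq.rfl
  have h36 : ENNReal.ofReal (36 * Λ * h) = ((36 * Λ).toNNReal : ℝ≥0∞) * η :=
    ENNReal.ofReal_mul (by positivity)
  constructor
  · have h1 : l2Sq (arc (G '' frontier refTriangle)) e ≤ ENNReal.ofReal (36 * Λ * h) * (C3 * (3 * M)) ^ 2 := by
      refine H.l2Sq_arc_le e fun i j => ?_
      have h2 := hC3 _ (huc.sub (N.contDiff_interpolant _).continuous.continuousOn) E hE mv mE i j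
      have h3 : eLpNorm (fun s => e (G (halfEdge i j s))) 2 (volume.restrict (Icc (0 : ℝ) 1)) =
          eLpNorm (fun s => w (G (halfEdge i j s)) -
            N.interpolant (fun y => w (G y)) (halfEdge i j s)) 2 (volume.restrict (Icc (0 : ℝ) 1)) := by
        refine eLpNorm_congr_ae ?_
        filter_upwards [ae_restrict_mem measurableSet_Icc] with s hs
        exact he _ (halfEdge_mem i j s hs)
      rw [h3]
      refine h2.trans (mul_le_mul_right ?_ _)
      exact (add_le_add (add_le_add bv (bE 0)) (bE 1)).trans (le_of_eq (by ring))
    refine h1.trans ?_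
    rw [show 2 * (m + 2) - 1 = 2 * m + 3 by omega, h36, ← hsS]
    calc _ = (((36 * Λ).toNNReal : ℝ≥0∞) * (3 * C3 * C1 * C2) ^ 2) * η ^ (2 * m + 3) * s ^ 2 := by
          rw [hMdef]; ring
      _ ≤ _ := by
          refine mul_le_mul_left (mul_le_mul_left ?_ _) _
          push_cast
          exact le_self_add
  · obtain ⟨g, hg, ht⟩ := ht
    have hSg := H.sobBd_grad_comp Hb hg hE' hF mE mF bE bF
    have h1 : ∀ c : Fin 3, l2Sq (arc (G '' frontier refTriangle)) (fun x => t x c) ≤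
        ENNReal.ofReal (36 * Λ * h) * (C4 * (4 * ENNReal.ofReal (C5 / h) * M)) ^ 2 := by
      intro c
      obtain ⟨-, hb, hd⟩ := hSg c
      choose v' hv' hv'' using hd
      refine hC4 H _ _ v' _ (ht c) hv' (fun i => (hv'' i).1) hb fun i => ?_
      have := (hv'' i).2
      rwa [one_mul] at this
    have h2 : l2Sq (arc (G '' frontier refTriangle)) t =
        ∑ c, l2Sq (arc (G '' frontier refTriangle)) (fun x => t x c) := by
      simp only [l2Sq]
      rw [← lintegral_finsetSum' _ fun c _ => ((ht c).1.1.enorm.pow_const 2)]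
      refine lintegral_congr fun x => ?_
      have h3 : ‖t x‖ ^ 2 = ∑ c, ‖t x c‖ ^ 2 := EuclideanSpace.norm_sq_eq _
      simp only [← ofReal_norm, ← ENNReal.ofReal_pow (norm_nonneg _), h3]
      exact ENNReal.ofReal_sum_of_nonneg fun c _ => by positivity
    rw [h2]
    refine (Finset.sum_le_sum fun c _ => h1 c).trans ?_
    rw [Finset.sum_const, Finset.card_univ, Fintype.card_fin, nsmul_eq_mul,
      ENNReal.ofReal_div_of_pos hh, h36, ← hsS, show 2 * (m + 2) - 3 = 2 * m + 1 by omega,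
      show ENNReal.ofReal C5 = (C5.toNNReal : ℝ≥0∞) from rfl, ← hη, div_eq_mul_inv]
    calc _ = (3 * ((36 * Λ).toNNReal : ℝ≥0∞) * (4 * C4 * C5.toNNReal * C1 * C2) ^ 2) *
            η ^ (2 * m + 1) * s ^ 2 * (η * η⁻¹) ^ 2 := by rw [hMdef]; push_cast; ring
      _ = (3 * ((36 * Λ).toNNReal : ℝ≥0∞) * (4 * C4 * C5.toNNReal * C1 * C2) ^ 2) *
            η ^ (2 * m + 1) * s ^ 2 := by rw [hη1, one_pow, mul_one]
      _ ≤ _ := by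
          refine mul_le_mul_left (mul_le_mul_left ?_ _) _
          push_cast
          exact le_add_self

/-! ### The projection onto the surface -/

open scoped Manifold in
-- Multiplication by a smooth cutoff that is 1 near `K` and vanishes off a compact subset of `U`. It
-- makes locally defined maps global and bounded with all derivatives, as the composition estimates
-- require.
theorem exists_contDiff_extension {E F : Type*} [NormedAddCommGroup E] [NormedSpace ℝ E]
    [FiniteDimensional ℝ E] [NormedAddCommGroup F] [NormedSpace ℝ F] {f : E → F} {U K : Set E}
    (hU : IsOpen U) (hf : ContDiffOn ℝ ∞ f U) (hK : IsCompact K) (hKU : K ⊆ U) :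
    ∃ g : E → F, ContDiff ℝ ∞ g ∧ HasCompactSupport g ∧ EqOn g f K := by
  obtain ⟨K', hK', hKK', hK'U⟩ := exists_compact_between hK hU hKU
  obtain ⟨χ, h1, h0, -⟩ := exists_contMDiffMap_one_nhds_of_subset_interior (n := ⊤) 𝓘(ℝ, E)
    hK.isClosed hKK'
  have hχ : ContDiff ℝ ∞ χ := χ.contMDiff.contDiff
  refine ⟨fun x => χ x • f x, ?_, ?_, fun x hx => ?_⟩
  · rw [contDiff_iff_contDiffAt]
    intro x
    by_cases hx : x ∈ K'
    · exact hχ.contDiffAt.smul (hf.contDiffAt (hU.mem_nhds (hK'U hx)))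
    · refine (contDiffAt_const (c := (0 : F))).congr_of_eventuallyEq ?_
      filter_upwards [hK'.isClosed.isOpen_compl.mem_nhds hx] with z hz
      rw [h0 z hz, zero_smul]
  · exact HasCompactSupport.intro hK' fun x hx => by rw [h0 x hx, zero_smul]
  · beta_reduce
    rw [h1.self_of_nhdsSet x hx, one_smul]

namespace ClosedSurface

variable (Γ : ClosedSurface)

theorem nonempty : Γ.carrier.Nonempty := Γ.isConnected.nonempty

theorem mem_carrier_iff {x : E3} (hx : x ∈ Γ.U) : x ∈ Γ.carrier ↔ Γ.d x = 0 := by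
  refine ⟨Γ.d_eq_zero, fun h => ?_⟩
  have h1 := Γ.abs_d x hx
  rw [h, abs_zero] at h1
  exact (Γ.isCompact.isClosed.mem_iff_infDist_zero Γ.nonempty).2 h1.symm

theorem proj_eq_self {x : E3} (hx : x ∈ Γ.carrier) : Γ.proj x = x := by
  rw [proj, Γ.d_eq_zero hx, zero_smul, sub_zero]

/-- The projection maps the tube to the surface. -/
theorem proj_mem {x : E3} (hx : x ∈ Γ.U) : Γ.proj x ∈ Γ.carrier := by
  by_cases h0 : Γ.d x = 0
  · have := (Γ.mem_carrier_iff hx).2 h0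
    rwa [Γ.proj_eq_self this]
  obtain ⟨z, hz, hzx⟩ := Γ.isCompact.exists_infDist_eq_dist Γ.nonempty x
  -- The sign `s` of `d x`: near `x` the function `s * d` is positive and thus equals the distance
  -- to the surface, which is differentiable there.
  obtain ⟨s, hs, hsd⟩ : ∃ s : ℝ, s ^ 2 = 1 ∧ 0 < s * Γ.d x := by
    rcases lt_or_gt_of_ne h0 with h | h
    · exact ⟨-1, by norm_num, by linarith⟩
    · exact ⟨1, by norm_num, by linarith⟩
  have hs1 : |s| = 1 := by
    rw [← sq_eq_sq₀ (abs_nonneg s) zero_le_one, sq_abs, hs, one_pow]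
  have habs : ∀ y, 0 < s * Γ.d y → |Γ.d y| = s * Γ.d y := by
    intro y hy
    rw [← abs_of_pos hy, abs_mul, hs1, one_mul]
  set r := |Γ.d x| with hr
  have hr0 : 0 < r := abs_pos.2 h0
  have hrz : dist x z = r := by rw [hr, Γ.abs_d x hx, hzx]
  have hdiff := Γ.differentiableAt_d hx
  have hev : ∀ᶠ y in 𝓝 x, y ∈ Γ.U ∧ 0 < s * Γ.d y :=
    (show ∀ᶠ y in 𝓝 x, y ∈ Γ.U from Γ.isOpen_U.mem_nhds hx).and
      ((continuousAt_const.mul hdiff.continuousAt).eventually (lt_mem_nhds hsd))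
  have hinf : ∀ᶠ y in 𝓝 x, s * Γ.d y = Metric.infDist y Γ.carrier := by
    filter_upwards [hev] with y hy
    rw [← Γ.abs_d y hy.1, habs y hy.2]
  set L := fderiv ℝ Γ.d x
  have hD : HasFDerivAt (fun y => s * Γ.d y) (s • L) x := hdiff.hasFDerivAt.const_mul s
  have hDi : HasFDerivAt (fun y => Metric.infDist y Γ.carrier) (s • L) x :=
    hD.congr_of_eventuallyEq (hinf.mono fun y hy => hy.symm)
  -- The distance to a set is 1-Lipschitz, so its derivative has norm at most 1.
  have hnorm : ‖s • L‖ ≤ 1 := by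
    have := hDi.le_of_lipschitz (Metric.lipschitz_infDist_pt Γ.carrier)
    simpa using this
  set u : E3 := r⁻¹ • (x - z) with hu
  have hun : ‖u‖ = 1 := by
    rw [hu, norm_smul, ← dist_eq_norm, hrz, norm_inv, Real.norm_of_nonneg hr0.le,
      inv_mul_cancel₀ hr0.ne']
  have hline : HasDerivAt (fun t : ℝ => Metric.infDist (x - t • u) Γ.carrier) ((s • L) (-u)) 0 := by
    have h1 : HasDerivAt (fun t : ℝ => x - t • u) (-u) 0 := by
      simpa using ((hasDerivAt_id (0 : ℝ)).smul_const u).const_sub x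
    have h2 : HasFDerivAt (fun y => Metric.infDist y Γ.carrier) (s • L) (x - (0 : ℝ) • u) := by
      simpa using hDi
    exact h2.comp_hasDerivAt (0 : ℝ) h1
  -- On the segment to a nearest point `z` the distance decreases at unit rate. Hence the derivative
  -- of the distance in the direction `u` is exactly 1.
  have hval : ∀ t : ℝ, 0 ≤ t → t ≤ r → Metric.infDist (x - t • u) Γ.carrier = r - t := by
    intro t ht0 ht
    apply le_antisymm
    · refine (Metric.infDist_le_dist_of_mem hz).trans (le_of_eq ?_)
      have h1 : x - t • u - z = (r - t) • u := by
        rw [hu, smul_smul, smul_smul, sub_mul, mul_inv_cancel₀ hr0.ne', sub_smul, one_smul]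
        abel
      rw [dist_eq_norm, h1, norm_smul, hun, mul_one, Real.norm_of_nonneg (by linarith)]
    · have h1 := Metric.infDist_le_infDist_add_dist (s := Γ.carrier) (x := x) (y := x - t • u)
      rw [hzx, hrz, dist_eq_norm, sub_sub_cancel, norm_smul, hun, mul_one,
        Real.norm_of_nonneg ht0] at h1
      linarith
  have hder : HasDerivWithinAt (fun t : ℝ => Metric.infDist (x - t • u) Γ.carrier) (-1) (Ici 0) 0 := by
    have h1 : HasDerivWithinAt (fun t : ℝ => r - t) (-1) (Ici 0) 0 :=
      ((hasDerivAt_id (0 : ℝ)).const_sub r).hasDerivWithinAt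
    refine h1.congr_of_eventuallyEq ?_ (hval 0 le_rfl hr0.le)
    filter_upwards [self_mem_nhdsWithin, nhdsWithin_le_nhds (gt_mem_nhds hr0)] with t ht ht'
    exact hval t ht ht'.le
  have hLu : (s • L) u = 1 := by
    have h1 := (uniqueDiffWithinAt_Ici (0 : ℝ)).eq_deriv _ hline.hasDerivWithinAt hder
    rw [map_neg] at h1
    linarith
  -- A vector of norm at most 1 whose inner product with the unit vector `u` is 1 must be `u`. So `d
  -- x • ν x` is `x - z`, and the projection is the nearest point.
  have hgrad : s • Γ.normal x = u := by
    have h1 : inner ℝ (s • Γ.normal x) u = 1 := by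
      rw [real_inner_smul_left, normal, inner_gradient_left, ← hLu]; rfl
    have h2 : ‖s • Γ.normal x‖ ≤ 1 := by
      have : ‖Γ.normal x‖ = ‖L‖ := LinearIsometryEquiv.norm_map _ _
      rwa [norm_smul, this, ← norm_smul]
    rw [← sub_eq_zero, ← norm_eq_zero, ← sq_eq_zero_iff]
    have h3 := norm_sub_sq_real (s • Γ.normal x) u
    rw [h1, hun] at h3
    have h4 : ‖s • Γ.normal x‖ ^ 2 ≤ 1 := pow_le_one₀ (norm_nonneg _) h2
    exact le_antisymm (by linarith) (sq_nonneg _)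
  have hfin : Γ.proj x = z := by
    have h1 : Γ.d x • Γ.normal x = x - z := by
      have h2 : Γ.d x = r * s := by
        rw [hr, habs x hsd, mul_comm s, mul_assoc, ← sq, hs, mul_one]
      rw [h2, mul_smul, hgrad, hu, smul_inv_smul₀ hr0.ne']
    rw [proj, h1, sub_sub_cancel]
  rw [hfin]; exact hz

theorem contDiffOn_proj : ContDiffOn ℝ ∞ Γ.proj Γ.U := by
  have h1 : ContDiffOn ℝ ∞ (fderiv ℝ Γ.d) Γ.U := Γ.contDiffOn_d.fderiv_of_isOpen Γ.isOpen_U (by simp)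
  have h2 : ContDiffOn ℝ ∞ Γ.normal Γ.U :=
    (InnerProductSpace.toDual ℝ E3).symm.contDiff.comp_contDiffOn h1
  exact contDiffOn_id.sub (Γ.contDiffOn_d.smul h2)

/-- A global smooth map that coincides with the projection near the surface. -/
theorem exists_proj_extension : ∃ ε : ℝ, 0 < ε ∧ Metric.cthickening ε Γ.carrier ⊆ Γ.U ∧
    ∃ P : E3 → E3, ContDiff ℝ ∞ P ∧ HasCompactSupport P ∧
      EqOn P Γ.proj (Metric.cthickening ε Γ.carrier) := by
  obtain ⟨ε, hε, hεU⟩ := Γ.isCompact.exists_cthickening_subset_open Γ.isOpen_U Γ.subset_U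
  exact ⟨ε, hε, hεU, exists_contDiff_extension Γ.isOpen_U Γ.contDiffOn_proj Γ.isCompact.cthickening hεU⟩

end ClosedSurface

/-! ### Local charts and continuous representatives -/

theorem exists_bdK_one (n : ℕ) : ∀ {f : E2 → ℝ}, ContDiff ℝ ∞ f → ∃ A, BdK n 1 A f := by
  induction n with
  | zero =>
    intro f hf
    obtain ⟨C, hC⟩ := isCompact_refTriangle.exists_bound_of_continuousOn hf.continuous.continuousOn
    exact ⟨C, bdK_zero_iff.2 hC⟩
  | succ n ih =>
    intro f hf
    obtain ⟨C, hC⟩ := isCompact_refTriangle.exists_bound_of_continuousOn hf.continuous.continuousOn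
    choose A hA using fun i => ih (contDiff_pd hf i)
    refine ⟨max C (max (A 0) (A 1)), (bdK_succ_iff hf).2 ⟨fun x hx => (hC x hx).trans (le_max_left _ _),
      fun i => ?_⟩⟩
    rw [mul_one]
    refine (hA i).mono zero_le_one ?_
    have hi : i = 0 ∨ i = 1 := by omega
    rcases hi with rfl | rfl
    · exact (le_max_left _ _).trans (le_max_right _ _)
    · exact (le_max_right _ _).trans (le_max_right _ _)

/-- Charts of size 1 with no uniformity in the constant: enough for qualitative statements such as
the existence of continuous representatives. -/
theorem IsChart.of_lower {Γ : ClosedSurface} {G : E2 → E3} (hG : ContDiff ℝ ∞ G)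
    (hm : MapsTo G refTriangle Γ.carrier) {l : ℝ} (hl : 0 < l)
    (hlow : ∀ x ∈ refTriangle, ∀ y ∈ refTriangle, l * dist x y ≤ dist (G x) (G y)) (n : ℕ) :
    ∃ Λ, IsChart Γ n 1 Λ l G := by
  choose A hA using fun (p : Fin 2 × Fin 3) => exists_bdK_one n
    (contDiff_pd (contDiff_coord hG p.2) p.1)
  refine ⟨∑ p, |A p|, hG, one_pos, le_rfl, hl, hm, fun x hx y hy => by
    rw [mul_one]; exact hlow x hx y hy, fun i c => ?_⟩
  rw [mul_one]
  exact (hA (i, c)).mono zero_le_one ((le_abs_self _).trans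
    (Finset.single_le_sum (f := fun p => |A p|) (fun _ _ => abs_nonneg _) (Finset.mem_univ (i, c))))

namespace ClosedSurface

variable (Γ : ClosedSurface)

/-- A neighbourhood of every point of the surface is covered by a chart. -/
theorem exists_chart {x₀ : E3} (hx₀ : x₀ ∈ Γ.carrier) (n : ℕ) : ∃ (Λ l : ℝ) (G : E2 → E3),
    IsChart Γ n 1 Λ l G ∧ ∃ r > 0, Metric.ball x₀ r ∩ Γ.carrier ⊆ G '' interior refTriangle := by
  set ν := Γ.normal x₀ with hν
  have hν1 : ‖ν‖ = 1 := Γ.norm_gradient x₀ hx₀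
  have hνν : inner ℝ ν ν = (1 : ℝ) := by rw [real_inner_self_eq_norm_sq, hν1, one_pow]
  have hd0 := Γ.d_eq_zero hx₀
  have hU := Γ.isOpen_U.mem_nhds (Γ.subset_U hx₀)
  -- `Ψ` replaces the component of `x - x₀` along `ν` by `d x`. Its derivative at `x₀` is the
  -- identity, because the derivative of `d` there is pairing with `ν`, and it carries the zero set
  -- of `d` to the tangent plane.
  set Ψ : E3 → E3 := fun x => x - (inner ℝ ν (x - x₀) : ℝ) • ν + Γ.d x • ν with hΨ
  have hΨc : ContDiffOn ℝ ∞ Ψ Γ.U :=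
    (contDiffOn_id.sub (((innerSL ℝ ν).contDiff.comp (contDiff_id.sub contDiff_const)).contDiffOn.smul
      contDiffOn_const)).add (Γ.contDiffOn_d.smul contDiffOn_const)
  have hΨd : HasFDerivAt Ψ ((ContinuousLinearEquiv.refl ℝ E3 : E3 ≃L[ℝ] E3) : E3 →L[ℝ] E3) x₀ := by
    have h1 : HasFDerivAt (fun x => (inner ℝ ν (x - x₀) : ℝ) • ν) ((innerSL ℝ ν).smulRight ν) x₀ :=
      ((innerSL ℝ ν).hasFDerivAt.comp x₀ ((hasFDerivAt_id x₀).sub_const x₀)).smul_const ν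
    have h2 : HasFDerivAt (fun x => Γ.d x • ν) ((fderiv ℝ Γ.d x₀).smulRight ν) x₀ :=
      (Γ.differentiableAt_d (Γ.subset_U hx₀)).hasFDerivAt.smul_const ν
    refine (((hasFDerivAt_id x₀).sub h1).add h2).congr_fderiv ?_
    ext v : 1
    have h3 : fderiv ℝ Γ.d x₀ v = inner ℝ ν v := (inner_gradient_left ..).symm
    simp [h3]
  have hΨ0 : Ψ x₀ = x₀ := by simp [hΨ, hd0]
  have hΨat : ContDiffAt ℝ ∞ Ψ x₀ := hΨc.contDiffAt hU
  set e := hΨat.toOpenPartialHomeomorph Ψ hΨd (by simp) with he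
  have hes : x₀ ∈ e.source := hΨat.mem_toOpenPartialHomeomorph_source hΨd (by simp)
  have hec : ∀ x, e x = Ψ x := fun x => rfl
  have het : x₀ ∈ e.target := by
    have := e.map_source hes
    rwa [hec, hΨ0] at this
  have hsymm0 : e.symm x₀ = x₀ := by
    have := e.left_inv hes
    rwa [hec, hΨ0] at this
  -- regular points near `x₀`
  obtain ⟨Lc, t, ht, hLip⟩ := (hΨat.hasStrictFDerivAt (by simp)).exists_lipschitzOnWith
  have hgood : ∀ᶠ x in 𝓝 x₀, x ∈ Γ.U ∧ x ∈ t ∧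
      fderiv ℝ Ψ x ∈ range ((↑) : (E3 ≃L[ℝ] E3) → E3 →L[ℝ] E3) := by
    refine (show ∀ᶠ x in 𝓝 x₀, x ∈ Γ.U from hU).and ((show ∀ᶠ x in 𝓝 x₀, x ∈ t from ht).and ?_)
    have h1 : ContinuousAt (fderiv ℝ Ψ) x₀ :=
      (hΨc.continuousOn_fderiv_of_isOpen Γ.isOpen_U (by simp)).continuousAt hU
    refine h1.eventually ?_
    rw [hΨd.fderiv]
    exact ContinuousLinearEquiv.nhds _
  have hsc : Tendsto e.symm (𝓝 x₀) (𝓝 x₀) := by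
    have := e.tendsto_symm hes
    rwa [hec, hΨ0] at this
  obtain ⟨R, hR, hRs⟩ := Metric.eventually_nhds_iff_ball.1
    ((hsc.eventually hgood).and (e.open_target.mem_nhds het))
  have hsm : ContDiffOn ℝ ∞ e.symm (Metric.ball x₀ R) := by
    intro p hp
    obtain ⟨⟨h1, -, E, hE⟩, h3⟩ := hRs p hp
    have h4 : ContDiffAt ℝ ∞ Ψ (e.symm p) := hΨc.contDiffAt (Γ.isOpen_U.mem_nhds h1)
    have h5 : HasFDerivAt Ψ (E : E3 →L[ℝ] E3) (e.symm p) := by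
      rw [hE]; exact (h4.differentiableAt (by simp)).hasFDerivAt
    exact (e.contDiffAt_symm h3 h5 h4).contDiffWithinAt
  -- `IsChart` asks for a globally smooth map, so the local inverse of `Ψ` is extended from a
  -- smaller closed ball.
  obtain ⟨Θ, hΘc, -, hΘ⟩ := exists_contDiff_extension Metric.isOpen_ball hsm
    (isCompact_closedBall x₀ (R / 2)) (Metric.closedBall_subset_ball (by linarith))
  -- the tangent plane
  have hfr : Fact (Module.finrank ℝ E3 = 2 + 1) := ⟨by simp⟩
  have hν0 : ν ≠ 0 := by rw [← norm_ne_zero_iff, hν1]; exact one_ne_zero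
  set β := OrthonormalBasis.fromOrthogonalSpanSingleton (𝕜 := ℝ) 2 hν0
  set J : E2 → E3 := fun y => ((β.repr.symm y : (ℝ ∙ ν)ᗮ) : E3) with hJ
  have hJc : ContDiff ℝ ∞ J :=
    ((ℝ ∙ ν)ᗮ.subtypeL.comp (β.repr.symm.toContinuousLinearEquiv : E2 →L[ℝ] (ℝ ∙ ν)ᗮ)).contDiff
  have hJn : ∀ y z, dist (J y) (J z) = dist y z := fun y z => by
    rw [hJ, ← Subtype.dist_eq, β.repr.symm.dist_map]
  have hJν : ∀ y, inner ℝ ν (J y) = (0 : ℝ) := fun y =>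
    Submodule.mem_orthogonal_singleton_iff_inner_right.1 (β.repr.symm y).2
  -- Points of the triangle are within distance 2 of `centre`, so the scaled copy of the triangle in
  -- the tangent plane stays in the ball of radius `R / 2`.
  set ρ := R / 4 with hρ
  have hρ0 : 0 < ρ := by positivity
  set q : E2 → E3 := fun y => x₀ + ρ • J (y - centre) with hq
  have hqc : ContDiff ℝ ∞ q :=
    contDiff_const.add ((hJc.comp (contDiff_id.sub contDiff_const)).const_smul ρ)
  have hqd : ∀ y z, dist (q y) (q z) = ρ * dist y z := by
    intro y z
    rw [hq]
    simp only [dist_add_left]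
    rw [dist_smul₀, Real.norm_of_nonneg hρ0.le, hJn, dist_sub_right]
  have hq0 : q centre = x₀ := by
    have : J (0 : E2) = 0 := by simp [hJ]
    simp [hq, this]
  have hqm : ∀ y ∈ refTriangle, q y ∈ Metric.closedBall x₀ (R / 2) := by
    intro y hy
    have h0 : dist (q y) x₀ = ρ * dist y centre := by rw [← hqd, hq0]
    rw [Metric.mem_closedBall, h0, dist_eq_norm]
    have h1 := norm_sub_le y centre
    have h2 := norm_le_of_mem_refTriangle hy
    have h3 := norm_le_of_mem_refTriangle (interior_subset centre_mem)
    nlinarith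
  have hΘq : ∀ y ∈ refTriangle, Θ (q y) = e.symm (q y) := fun y hy => hΘ (hqm y hy)
  have hball : ∀ y ∈ refTriangle, q y ∈ Metric.ball x₀ R := fun y hy =>
    Metric.closedBall_subset_ball (by linarith) (hqm y hy)
  have hΨq : ∀ y ∈ refTriangle, Ψ (Θ (q y)) = q y := by
    intro y hy
    rw [hΘq y hy, ← hec]
    exact e.right_inv (hRs _ (hball y hy)).2
  have hΨν : ∀ x, inner ℝ ν (Ψ x - x₀) = Γ.d x := by
    intro x
    have : Ψ x - x₀ = (x - x₀) - (inner ℝ ν (x - x₀) : ℝ) • ν + Γ.d x • ν := by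
      simp only [hΨ]
      generalize (inner ℝ ν (x - x₀) : ℝ) • ν = a
      abel
    rw [this, inner_add_right, inner_sub_right, real_inner_smul_right, real_inner_smul_right, hνν]
    ring
  have hmaps : MapsTo (fun y => Θ (q y)) refTriangle Γ.carrier := by
    intro y hy
    have h1 : Θ (q y) ∈ Γ.U := by rw [hΘq y hy]; exact (hRs _ (hball y hy)).1.1
    refine (Γ.mem_carrier_iff h1).2 ?_
    rw [← hΨν, hΨq y hy, hq]
    simp [real_inner_smul_right, hJν]
  -- Since `Ψ ∘ Θ ∘ q = q` and `q` multiplies distances by `ρ`, the Lipschitz bound of `Ψ` is a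
  -- lower bound for `Θ ∘ q`. The `+ 1` only avoids a zero denominator.
  have hlow : ∀ y ∈ refTriangle, ∀ z ∈ refTriangle,
      ρ / (Lc + 1) * dist y z ≤ dist (Θ (q y)) (Θ (q z)) := by
    intro y hy z hz
    have h1 := hLip.dist_le_mul _ (by rw [hΘq y hy]; exact (hRs _ (hball y hy)).1.2.1 : Θ (q y) ∈ t)
      _ (by rw [hΘq z hz]; exact (hRs _ (hball z hz)).1.2.1 : Θ (q z) ∈ t)
    rw [hΨq y hy, hΨq z hz, hqd] at h1
    have hL0 : (0 : ℝ) ≤ Lc := Lc.2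
    rw [div_mul_eq_mul_div, div_le_iff₀ (by positivity)]
    have := dist_nonneg (x := Θ (q y)) (y := Θ (q z))
    linarith
  obtain ⟨Λ, hchart⟩ := IsChart.of_lower (hΘc.comp hqc) hmaps
    (by positivity : 0 < ρ / ((Lc : ℝ) + 1)) hlow n
  refine ⟨Λ, _, fun y => Θ (q y), hchart, ?_⟩
  obtain ⟨r₁, hr₁, hr₁s⟩ := Metric.isOpen_iff.1 e.open_source x₀ hes
  -- The radius `r₁` keeps `x` where `Ψ` is inverted; `ρ / 8` places its parameter in the disc of
  -- radius 1/8 about `centre`, which is interior to the triangle.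
  refine ⟨min r₁ (ρ / 8), lt_min hr₁ (by positivity), ?_⟩
  rintro x ⟨hxb, hxΓ⟩
  have hxs := hr₁s (Metric.ball_subset_ball (min_le_left _ _) hxb)
  set v : E3 := (x - x₀) - (inner ℝ ν (x - x₀) : ℝ) • ν with hv
  have hvν : v ∈ (ℝ ∙ ν)ᗮ := by
    rw [Submodule.mem_orthogonal_singleton_iff_inner_right, hv, inner_sub_right,
      real_inner_smul_right, hνν, mul_one, sub_self]
  have hvn : ‖v‖ ≤ ‖x - x₀‖ := by
    have h1 : ‖x - x₀‖ ^ 2 = ‖v‖ ^ 2 + (inner ℝ ν (x - x₀) : ℝ) ^ 2 := by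
      rw [hv, norm_sub_sq_real (x - x₀) (_ • ν), real_inner_smul_right, norm_smul, hν1, mul_one,
        Real.norm_eq_abs, sq_abs, real_inner_comm ν]
      ring
    exact le_of_sq_le_sq (by nlinarith [sq_nonneg (inner ℝ ν (x - x₀) : ℝ)]) (norm_nonneg _)
  set y : E2 := centre + ρ⁻¹ • β.repr ⟨v, hvν⟩ with hy
  have hyK : y ∈ interior refTriangle := by
    refine closedBall_centre_subset ?_
    have h1 : ‖β.repr ⟨v, hvν⟩‖ = ‖v‖ := β.repr.norm_map _
    rw [Metric.mem_closedBall, dist_eq_norm, hy, add_sub_cancel_left, norm_smul, h1, norm_inv,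
      Real.norm_of_nonneg hρ0.le, inv_mul_eq_div, div_le_iff₀ hρ0]
    have h2 : ‖x - x₀‖ < ρ / 8 := by
      rw [← dist_eq_norm]; exact lt_of_lt_of_le hxb (min_le_right _ _)
    linarith
  refine ⟨y, hyK, ?_⟩
  have hqy : q y = Ψ x := by
    have h1 : J (y - centre) = ρ⁻¹ • v := by
      rw [hJ, hy]
      simp
    have h2 : Ψ x = x₀ + v := by
      rw [hΨ, hv]; simp only [Γ.d_eq_zero hxΓ, zero_smul]; abel
    rw [h2, hq]
    simp only [h1, smul_inv_smul₀ hρ0.ne']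
  beta_reduce
  rw [hΘq y (interior_subset hyK), hqy, ← hec, e.left_inv hxs]

/-- Functions in `H²` of the surface have continuous representatives. -/
theorem exists_continuous_rep {m : ℕ} {w : E3 → ℝ} (hw : Γ.MemSobolev Γ.carrier (m + 2) w) :
    ∃ w' : E3 → ℝ, ContinuousOn w' Γ.carrier ∧ w' =ᵐ[area Γ.carrier] w := by
  have hm2 : ∀ {A : Set E3} {m : ℕ} {u : E3 → ℝ}, Γ.MemSobolev A (m + 1) u → Γ.MemSobolev A m u := by
    intro A m
    induction m with
    | zero => rintro u ⟨g, hg, -⟩; exact hg.memLp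
    | succ m ih => rintro u ⟨g, hg, hgm⟩; exact ⟨g, hg, fun i => ih (hgm i)⟩
  have hw2 : Γ.MemSobolev Γ.carrier 2 w := by
    induction m with
    | zero => exact hw
    | succ m ih => exact ih (hm2 hw)
  have hloc : ∀ x ∈ Γ.carrier, ∃ r > 0, ∃ g : E3 → ℝ, ContinuousOn g (Metric.ball x r ∩ Γ.carrier) ∧
      ∀ᵐ z ∂(area Γ.carrier), z ∈ Metric.ball x r → g z = w z := by
    intro x hx
    obtain ⟨Λ, l, G, H, r, hr, hsub⟩ := Γ.exists_chart hx 1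
    obtain ⟨Cf, hCf⟩ := exists_frame Λ l
    obtain ⟨b, Hb⟩ := hCf Γ 1 1 G le_rfl H
    obtain ⟨C, hC⟩ := exists_sobBd_comp Λ l 2
    obtain ⟨-, h1⟩ := hC H Hb le_rfl w (hw2.mono H.image_subset)
    -- The infinite bound is allowed: only the existence of square integrable weak derivatives is
    -- used, not their size.
    have h2 := h1 ⊤ (by simp)
    obtain ⟨g, hgc, hg⟩ := exists_continuous_representative h2
    refine ⟨r, hr, fun z => g (Function.invFunOn G refTriangle z), ?_, ?_⟩
    · refine ContinuousOn.comp hgc (H.continuousOn_inv.mono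
        (hsub.trans (image_mono interior_subset))) ?_
      intro z hz
      obtain ⟨y, hy, rfl⟩ := hsub hz
      rw [H.inv_apply (interior_subset hy)]
      exact interior_subset hy
    · have h3 : ∀ᵐ z ∂(area (G '' interior refTriangle)),
          g (Function.invFunOn G refTriangle z) = w z := by
        refine H.ae_of_comp ?_
        filter_upwards [hg, ae_muK_of_interior (q := fun y => y ∈ interior refTriangle) fun _ h => h]
          with y hy hyi
        rw [H.inv_apply (interior_subset hyi), hy]
      rw [area, ae_restrict_iff' H.biLip.measurableSet_image] at h3
      rw [area, ae_restrict_iff' Γ.isCompact.isClosed.measurableSet]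
      filter_upwards [h3] with z hz hzΓ hzb
      exact hz (hsub ⟨hzb, hzΓ⟩)
  choose! r hr g hgc hg using hloc
  obtain ⟨s, hs, hcov⟩ := Γ.isCompact.elim_nhds_subcover (fun x => Metric.ball x (r x / 2))
    fun x hx => Metric.ball_mem_nhds x (by linarith [hr x hx])
  -- Continuous weights supported in the half balls glue the local representatives. Each weight
  -- vanishes near the points where its representative is not known to be continuous, and the sum is
  -- positive on the surface.
  set χ : E3 → E3 → ℝ := fun x z => max 0 (r x / 2 - dist z x) with hχ
  have hχc : ∀ x, Continuous (χ x) := fun x => by simp only [hχ]; fun_prop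
  have hpos : ∀ z ∈ Γ.carrier, 0 < ∑ x ∈ s, χ x z := by
    intro z hz
    obtain ⟨x, hx, hzx⟩ := mem_iUnion₂.1 (hcov hz)
    refine Finset.sum_pos' (fun _ _ => le_max_left _ _) ⟨x, hx, lt_max_of_lt_right ?_⟩
    rw [Metric.mem_ball] at hzx
    linarith
  refine ⟨fun z => (∑ x ∈ s, χ x z * g x z) / ∑ x ∈ s, χ x z, ?_, ?_⟩
  · refine ContinuousOn.div (continuousOn_finsetSum _ fun x hx => ?_)
      (continuousOn_finsetSum _ fun x _ => (hχc x).continuousOn) fun z hz => (hpos z hz).ne'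
    have hxΓ := hs x hx
    intro z hz
    by_cases hzb : z ∈ Metric.ball x (r x)
    · have h1 : ContinuousWithinAt (g x) Γ.carrier z := by
        refine ((hgc x hxΓ) z ⟨hzb, hz⟩).mono_of_mem_nhdsWithin ?_
        exact inter_mem (nhdsWithin_le_nhds (Metric.isOpen_ball.mem_nhds hzb)) self_mem_nhdsWithin
      exact (hχc x).continuousWithinAt.mul h1
    · have h1 : ∀ᶠ y in 𝓝 z, χ x y * g x y = 0 := by
        have h2 : r x / 2 < dist z x := by
          rw [Metric.mem_ball, not_lt] at hzb
          linarith [hr x hxΓ]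
        have h3 : ContinuousAt (fun y => dist y x) z := by fun_prop
        filter_upwards [h3.eventually (lt_mem_nhds h2)] with y hy
        rw [hχ]
        simp only
        rw [max_eq_left (by linarith), zero_mul]
      exact (continuousAt_const.congr (h1.mono fun y hy => hy.symm)).continuousWithinAt
  · have h1 : ∀ᵐ z ∂(area Γ.carrier), ∀ x ∈ s, z ∈ Metric.ball x (r x) → g x z = w z :=
      (ae_ball_iff s.countable_toSet).2 fun x hx => hg x (hs x hx)
    filter_upwards [h1, ae_restrict_mem Γ.isCompact.isClosed.measurableSet] with z hz hzΓ
    rw [div_eq_iff (hpos z hzΓ).ne', Finset.mul_sum]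
    refine Finset.sum_congr rfl fun x hx => ?_
    by_cases hzb : z ∈ Metric.ball x (r x)
    · rw [hz x hx hzb, mul_comm]
    · rw [Metric.mem_ball, not_lt] at hzb
      rw [show χ x z = 0 from max_eq_left (by linarith [hr x (hs x hx)]), zero_mul, mul_zero]

end ClosedSurface

/-! ### Lifted elements are uniformly curved triangles -/

theorem bdK_const (n : ℕ) : ∀ {h A c : ℝ}, 0 ≤ h → |c| ≤ A → BdK n h A fun _ => c := by
  induction n with
  | zero => intro h A c _ hc; exact bdK_zero_iff.2 fun _ _ => hc
  | succ n ih =>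
    intro h A c hh hc
    refine (bdK_succ_iff contDiff_const).2 ⟨fun _ _ => hc, fun i => ?_⟩
    have h1 : pd i (fun _ : E2 => c) = fun _ => 0 := by ext x; simp [pd]
    rw [h1]
    exact ih hh (by rw [abs_zero]; exact mul_nonneg ((abs_nonneg c).trans hc) hh)

/-- Gains one order over `exists_bdK_comp`: the derivatives of `Φ`, known up to order `n`, are
already one order ahead of `Φ`. -/
theorem exists_bdK_succ_comp (n : ℕ) (A : ℝ) {g : E3 → ℝ} (hg : ContDiff ℝ ∞ g)
    (hgs : HasCompactSupport g) : ∃ C : ℝ, 0 ≤ C ∧ ∀ h : ℝ, 0 ≤ h → ∀ Φ : E2 → E3, ContDiff ℝ ∞ Φ →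
      (∀ i c, BdK n h (A * h) (pd i fun y => Φ y c)) → BdK (n + 1) h C (fun y => g (Φ y)) := by
  obtain ⟨C₀, h0, hC₀⟩ := exists_bdK_comp n A g hg hgs
  have hg' : ∀ c, ContDiff ℝ ∞ fun x => fderiv ℝ g x (e3 c) := fun c =>
    (hg.fderiv_right (m := ∞) (by simp)).clm_apply contDiff_const
  choose C h1 hC using fun c => exists_bdK_comp n A (fun x => fderiv ℝ g x (e3 c)) (hg' c)
    (hgs.fderiv_apply ℝ (e3 c))
  refine ⟨C₀ + |∑ c, 2 ^ n * C c * A|, by positivity, fun h hh Φ hΦ H => ?_⟩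
  refine (bdK_succ_iff (f := fun y => g (Φ y)) (hg.comp hΦ)).2 ⟨fun x hx => ?_, fun i => ?_⟩
  · have h2 : |g (Φ x)| ≤ C₀ := by simpa [D] using hC₀ h hh Φ hΦ H 0 0 (Nat.zero_le _) x hx
    exact h2.trans (le_add_of_nonneg_right (abs_nonneg _))
  · rw [pd_comp hg hΦ]
    have h3 := BdK.sum Finset.univ (f := fun c y => fderiv ℝ g (Φ y) (e3 c) * pd i (fun y => Φ y c) y)
      (A := fun c => 2 ^ n * C c * (A * h)) (n := n) (h := h)
      (fun c _ => ((hg' c).comp hΦ).mul (contDiff_pd (contDiff_coord hΦ c) i))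
      (fun c _ => BdK.mul hh ((hg' c).comp hΦ) (contDiff_pd (contDiff_coord hΦ c) i)
        (hC c h hh Φ hΦ H) (H i c))
    refine h3.mono hh ?_
    have h4 : ∑ c, 2 ^ n * C c * (A * h) = (∑ c, 2 ^ n * C c * A) * h := by
      rw [Finset.sum_mul]; exact Finset.sum_congr rfl fun c _ => by ring
    rw [h4]
    exact mul_le_mul_of_nonneg_right ((le_abs_self _).trans (le_add_of_nonneg_left h0)) hh

theorem norm_fderiv_le_of_pd {G : E2 → E3} (hG : ContDiff ℝ ∞ G) {y : E2} {A : ℝ}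
    (h : ∀ i c, |pd i (fun y => G y c) y| ≤ A) : ‖fderiv ℝ G y‖ ≤ 6 * A := by
  have hA : 0 ≤ A := (abs_nonneg _).trans (h 0 0)
  have h1 : ∀ i, ‖tv G i y‖ ≤ 3 * A := fun i => norm_e3_le _ fun c => by
    rw [tv_apply hG]; exact h i c
  refine ContinuousLinearMap.opNorm_le_bound _ (by positivity) fun v => ?_
  rw [fderiv_eq_tv]
  refine (norm_add_le _ _).trans ?_
  rw [norm_smul, norm_smul]
  have h0 := mul_le_mul (abs_e2_le v 0) (h1 0) (norm_nonneg _) (norm_nonneg _)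
  have h2 := mul_le_mul (abs_e2_le v 1) (h1 1) (norm_nonneg _) (norm_nonneg _)
  simp only [Real.norm_eq_abs]
  linarith

theorem vtx_mem (i : Fin 3) : vtx i ∈ refTriangle := by
  fin_cases i <;> simp [vtx, refTriangle]

/-- A function that vanishes at the vertices is controlled by the variation of its derivative. -/
theorem bound_of_vanishing_vertices {r : E2 → E3} (hr : ContDiff ℝ ∞ r) {M : ℝ}
    (hM : ∀ x ∈ refTriangle, ∀ y ∈ refTriangle, ‖fderiv ℝ r x - fderiv ℝ r y‖ ≤ M * ‖x - y‖)
    (h0 : ∀ i, r (vtx i) = 0) {x : E2} (hx : x ∈ refTriangle) :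
    ‖r x‖ ≤ 20 * M ∧ ‖fderiv ℝ r x‖ ≤ 16 * M := by
  have hn : ∀ {y z : E2}, y ∈ refTriangle → z ∈ refTriangle → ‖y - z‖ ≤ 2 := fun hy hz =>
    (norm_sub_le _ _).trans (by linarith [norm_le_of_mem_refTriangle hy, norm_le_of_mem_refTriangle hz])
  have hM0 : 0 ≤ M := by
    have h1 := hM (vtx 1) (vtx_mem 1) (vtx 0) (vtx_mem 0)
    refine nonneg_of_mul_nonneg_left ((norm_nonneg _).trans h1) (norm_pos_iff.2 ?_)
    intro h
    have := congrArg (fun v : E2 => v 0) h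
    simp [vtx] at this
  set L := fderiv ℝ r x
  -- Taylor's formula from `x` to a vertex, where `r` vanishes. Differences between vertices
  -- eliminate `r x` and bound `L` on the two edge directions, hence everywhere; then `r x` itself
  -- is recovered.
  have hT : ∀ i, ‖L (vtx i - x) + r x‖ ≤ 4 * M := by
    intro i
    have h1 := convex_refTriangle.norm_image_sub_le_of_norm_fderiv_le' (𝕜 := ℝ) (f := r) (φ := L)
      (C := M * 2) (fun z _ => hr.differentiable (by simp) z)
      (fun z hz => (hM z hz x hx).trans (mul_le_mul_of_nonneg_left (hn hz hx) hM0)) hx (vtx_mem i)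
    rw [h0 i] at h1
    have h2 : 0 - r x - L (vtx i - x) = -(L (vtx i - x) + r x) := by abel
    rw [h2, norm_neg] at h1
    have h3 := mul_le_mul_of_nonneg_left (hn (vtx_mem i) hx) (by positivity : 0 ≤ M * 2)
    linarith
  have hv0 : vtx 0 = 0 := by ext i; fin_cases i <;> simp [vtx]
  have hv1 : vtx 1 = eb 0 := by ext i; fin_cases i <;> simp [vtx, eb]
  have hv2 : vtx 2 = eb 1 := by ext i; fin_cases i <;> simp [vtx, eb]
  have hd : ∀ i, ‖L (vtx i)‖ ≤ 8 * M := by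
    intro i
    have h1 : L (vtx i) = (L (vtx i - x) + r x) - (L (vtx 0 - x) + r x) := by
      rw [hv0, map_sub, map_sub, map_zero]; abel
    rw [h1]
    exact (norm_sub_le _ _).trans (by linarith [hT i, hT 0])
  have hL : ‖L‖ ≤ 16 * M := by
    refine ContinuousLinearMap.opNorm_le_bound _ (by positivity) fun v => ?_
    rw [clm_apply_eq, ← hv1, ← hv2]
    refine (norm_add_le _ _).trans ?_
    rw [norm_smul, norm_smul]
    have h0 := mul_le_mul (abs_e2_le v 0) (hd 1) (norm_nonneg _) (norm_nonneg _)
    have h2 := mul_le_mul (abs_e2_le v 1) (hd 2) (norm_nonneg _) (norm_nonneg _)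
    simp only [Real.norm_eq_abs]
    linarith
  refine ⟨?_, hL⟩
  have h1 : r x = (L (vtx 0 - x) + r x) + L x := by
    rw [hv0, map_sub, map_zero]; abel
  rw [h1]
  refine (norm_add_le _ _).trans ?_
  have h2 := (L.le_opNorm x).trans (mul_le_mul hL (norm_le_of_mem_refTriangle hx) (norm_nonneg _)
    (by positivity))
  linarith [hT 0]

/-! ### The affine map -/

theorem contDiff_affineMap (p : Fin 3 → E3) : ContDiff ℝ ∞ (affineMap p) := by
  have h : ∀ i : Fin 2, ContDiff ℝ ∞ fun y : E2 => y i := fun i =>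
    (EuclideanSpace.proj i : E2 →L[ℝ] ℝ).contDiff
  exact (contDiff_const.add ((h 0).smul contDiff_const)).add ((h 1).smul contDiff_const)

theorem affineMap_sub (p : Fin 3 → E3) (x y : E2) :
    affineMap p x - affineMap p y = (x - y) 0 • (p 1 - p 0) + (x - y) 1 • (p 2 - p 0) := by
  simp only [affineMap, PiLp.sub_apply, sub_smul]; abel

theorem affineMap_vtx (p : Fin 3 → E3) (i : Fin 3) : affineMap p (vtx i) = p i := by
  fin_cases i <;> simp [affineMap, vtx]

theorem fderiv_affineMap (p : Fin 3 → E3) (y v : E2) :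
    fderiv ℝ (affineMap p) y v = v 0 • (p 1 - p 0) + v 1 • (p 2 - p 0) := by
  have h : ∀ i : Fin 2, HasFDerivAt (fun y : E2 => y i) (EuclideanSpace.proj i : E2 →L[ℝ] ℝ) y :=
    fun i => (EuclideanSpace.proj i : E2 →L[ℝ] ℝ).hasFDerivAt
  have h1 := ((((h 0).smul_const (p 1 - p 0)).const_add (p 0)).add ((h 1).smul_const (p 2 - p 0))).fderiv
  have h2 : (affineMap p) = (fun y : E2 => p 0 + y 0 • (p 1 - p 0)) + fun y : E2 => y 1 • (p 2 - p 0) := rfl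
  rw [h2, h1]
  rfl

theorem pd_affineMap (p : Fin 3 → E3) (i : Fin 2) (c : Fin 3) :
    pd i (fun y => affineMap p y c) = fun _ => (p (i.succ) - p 0) c := by
  funext y
  rw [← tv_apply (contDiff_affineMap p), tv, fderiv_affineMap]
  fin_cases i <;> simp [eb]

/-- `p` spans a triangle of size `h` with vertices on the surface and bounded aspect ratio. -/
structure IsGoodTriangle (Γ : ClosedSurface) (σ h : ℝ) (p : Fin 3 → E3) : Prop where
  h_pos : 0 < h
  mem : ∀ i, p i ∈ Γ.carrier
  le : ∀ i, ‖p i - p 0‖ ≤ h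
  ge : ∀ v : E2, h / (2 * σ) * ‖v‖ ≤ ‖v 0 • (p 1 - p 0) + v 1 • (p 2 - p 0)‖

theorem LagrangeNodes.interpolant_affineMap {k : ℕ} (N : LagrangeNodes k) (hk : 1 ≤ k)
    (p : Fin 3 → E3) (c : Fin 3) :
    N.interpolant (fun y => affineMap p y c) = fun y => affineMap p y c := by
  set q : MvPolynomial (Fin 2) ℝ := MvPolynomial.C (p 0 c) + MvPolynomial.C ((p 1 - p 0) c) * MvPolynomial.X 0 +
    MvPolynomial.C ((p 2 - p 0) c) * MvPolynomial.X 1 with hq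
  have h1 : (fun y => affineMap p y c) = polyEval q := by
    funext y
    simp [polyEval, hq, affineMap, mul_comm]
  have h2 : ∀ (a : ℝ) (i : Fin 2),
      (MvPolynomial.C a * MvPolynomial.X i : MvPolynomial (Fin 2) ℝ).totalDegree ≤ 1 := fun a i =>
    (MvPolynomial.totalDegree_mul _ _).trans (by simp)
  rw [h1]
  refine N.interpolant_polyEval (le_trans ?_ hk)
  refine (MvPolynomial.totalDegree_add _ _).trans (max_le ((MvPolynomial.totalDegree_add _ _).trans
    (max_le ?_ (h2 _ _))) (h2 _ _))
  simp

theorem contDiff_elemMap (Γ : ClosedSurface) {k : ℕ} (N : LagrangeNodes k) (p : Fin 3 → E3) :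
    ContDiff ℝ ∞ (elemMap Γ N p) :=
  ContDiff.sum fun _ _ => (contDiff_polyEval _).smul contDiff_const

namespace IsGoodTriangle

variable {Γ : ClosedSurface} {σ h : ℝ} {p : Fin 3 → E3} (H : IsGoodTriangle Γ σ h p)
include H

theorem norm_fderiv_le (y : E2) : ‖fderiv ℝ (affineMap p) y‖ ≤ 2 * h := by
  have hh := H.h_pos
  refine ContinuousLinearMap.opNorm_le_bound _ (by positivity) fun v => ?_
  rw [fderiv_affineMap]
  refine (norm_add_le _ _).trans ?_
  rw [norm_smul, norm_smul]
  have h0 := mul_le_mul (abs_e2_le v 0) (H.le 1) (norm_nonneg _) (norm_nonneg _)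
  have h2 := mul_le_mul (abs_e2_le v 1) (H.le 2) (norm_nonneg _) (norm_nonneg _)
  simp only [Real.norm_eq_abs]
  linarith

theorem norm_sub_le (x y : E2) : ‖affineMap p x - affineMap p y‖ ≤ 2 * h * ‖x - y‖ := by
  rw [affineMap_sub, ← fderiv_affineMap p x]
  exact (ContinuousLinearMap.le_opNorm _ _).trans
    (mul_le_mul_of_nonneg_right (H.norm_fderiv_le x) (norm_nonneg _))

theorem dist_vertex_le {y : E2} (hy : y ∈ refTriangle) : dist (affineMap p y) (p 0) ≤ 2 * h := by
  have hh := H.h_pos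
  have h1 := H.norm_sub_le y (vtx 0)
  have hv0 : vtx 0 = 0 := by ext i; fin_cases i <;> simp [vtx]
  rw [affineMap_vtx, hv0, sub_zero] at h1
  rw [dist_eq_norm]
  exact h1.trans (mul_le_of_le_one_right (by positivity) (norm_le_of_mem_refTriangle hy))

theorem bdK_affineMap (n : ℕ) (i : Fin 2) (c : Fin 3) :
    BdK n h h (pd i fun y => affineMap p y c) := by
  rw [pd_affineMap]
  exact bdK_const n H.h_pos.le ((PiLp.norm_apply_le (p i.succ - p 0) c).trans (H.le _))

end IsGoodTriangle

/-- One constant for all orders from 2 to `m`. Order 1 is excluded since the underlying argument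
needs the Sobolev inequality; the first derivatives of the element map are treated separately. -/
theorem LagrangeNodes.exists_D_interpolant_le_of_le {k : ℕ} (N : LagrangeNodes k) {m : ℕ}
    (hmk : m ≤ k + 1) : ∃ C : ℝ, 0 ≤ C ∧ ∀ j, 2 ≤ j → j ≤ m → ∀ f : E2 → ℝ, ContDiff ℝ ∞ f →
    ∀ M : ℝ, 0 ≤ M → (∀ a b, a + b = j → ∀ x ∈ refTriangle, |D a b f x| ≤ M) →
    ∀ a b, a + b = j → ∀ x ∈ refTriangle, |D a b (N.interpolant f) x| ≤ C * M := by
  have h1 : ∀ j, ∃ C : ℝ, 0 ≤ C ∧ (2 ≤ j → j ≤ m → ∀ f : E2 → ℝ, ContDiff ℝ ∞ f →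
      ∀ M : ℝ, 0 ≤ M → (∀ a b, a + b = j → ∀ x ∈ refTriangle, |D a b f x| ≤ M) →
      ∀ a b, a + b = j → ∀ x ∈ refTriangle, |D a b (N.interpolant f) x| ≤ C * M) := by
    intro j
    by_cases hj : 2 ≤ j ∧ j ≤ m
    · obtain ⟨C, hC, H⟩ := N.exists_D_interpolant_le hj.1 (hj.2.trans hmk)
      exact ⟨C, hC, fun _ _ => H⟩
    · exact ⟨0, le_rfl, fun h2 h3 => absurd ⟨h2, h3⟩ hj⟩
  choose C hC H using h1
  refine ⟨∑ j ∈ Finset.range (m + 1), C j, Finset.sum_nonneg fun j _ => hC j,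
    fun j hj hjm f hf M hM hfM a b hab x hx => (H j hj hjm f hf M hM hfM a b hab x hx).trans ?_⟩
  exact mul_le_mul_of_nonneg_right (Finset.single_le_sum (f := C) (fun j _ => hC j)
    (Finset.mem_range.2 (by omega))) hM

/-- Lifted elements of small triangles with bounded aspect ratio are uniformly curved triangles. -/
theorem LagrangeNodes.exists_chart_elemMap (Γ : ClosedSurface) {k : ℕ} (N : LagrangeNodes k) {m : ℕ}
    (hm : 1 ≤ m) (hmk : m + 1 ≤ k + 1) {σ : ℝ} (hσ : 0 < σ) :
    ∃ Λ h₀ : ℝ, 0 < h₀ ∧ ∀ (p : Fin 3 → E3) (h : ℝ), IsGoodTriangle Γ σ h p → h ≤ h₀ →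
      MapsTo (elemMap Γ N p) refTriangle Γ.U ∧ ∃ G, IsChart Γ m h Λ (1 / (4 * σ)) G ∧
        ∀ y ∈ refTriangle, liftMap Γ N p y = G y := by
  obtain ⟨ε, hε, hεU, P, hP, hPs, hPeq⟩ := Γ.exists_proj_extension
  have hPc : ∀ c : Fin 3, ContDiff ℝ ∞ fun x => P x c := fun c =>
    (EuclideanSpace.proj c : E3 →L[ℝ] ℝ).contDiff.comp hP
  have hPcs : ∀ c : Fin 3, HasCompactSupport fun x => P x c := fun c =>
    hPs.comp_left (g := fun v : E3 => v c) rfl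
  have hP' : ContDiff ℝ ∞ (fderiv ℝ P) := hP.fderiv_right (by simp)
  obtain ⟨B, hB⟩ := (hPs.fderiv ℝ).exists_bound_of_continuous hP'.continuous
  obtain ⟨B', hB'⟩ := hP'.lipschitzWith_of_hasCompactSupport (hPs.fderiv ℝ) (by simp)
  have hB0 : 0 ≤ B := (norm_nonneg _).trans (hB 0)
  have hB'0 : (0 : ℝ) ≤ B' := B'.2
  obtain ⟨C₁, hC₁0, hC₁⟩ := N.exists_interpolant_le 1
  obtain ⟨C₂, hC₂0, hC₂⟩ := N.exists_D_interpolant_le_of_le hmk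
  choose C₃ hC₃0 hC₃ using fun c => exists_bdK_succ_comp m 1 (hPc c) (hPcs c)
  set cη : ℝ := C₁ * (20 * (4 * B')) with hcη
  set Λ₁ : ℝ := 1 + cη + C₂ * ∑ c, C₃ c with hΛ₁
  choose C₄ hC₄0 hC₄ using fun c => exists_bdK_succ_comp m Λ₁ (hPc c) (hPcs c)
  set cZ : ℝ := 64 * B' + 6 * B * cη + 6 * B' * cη with hcZ
  have hcη0 : 0 ≤ cη := by positivity
  have hcZ0 : 0 ≤ cZ := by positivity
  have hS0 : 0 ≤ ∑ c, C₃ c := Finset.sum_nonneg fun c _ => hC₃0 c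
  -- The second threshold keeps the high order element in the tube, its points being within `2h + 3
  -- cη h²` of a vertex. The third makes the perturbation at most `1 / (4σ) * h`, half of the lower
  -- bound `1 / (2σ) * h` of the affine map.
  refine ⟨∑ c, C₄ c, min 1 (min (ε / (3 * cη + 2)) (1 / (4 * σ * (cZ + 1)))),
    lt_min one_pos (lt_min (by positivity) (by positivity)), fun p h H hh₀ => ?_⟩
  have hh := H.h_pos
  have hh1 : h ≤ 1 := hh₀.trans (min_le_left _ _)
  have hhε : (3 * cη + 2) * h ≤ ε := by
    have := hh₀.trans ((min_le_right _ _).trans (min_le_left _ _))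
    rwa [le_div_iff₀ (by positivity), mul_comm] at this
  have hhσ : cZ * h ≤ 1 / (4 * σ) := by
    have h1 := hh₀.trans ((min_le_right _ _).trans (min_le_right _ _))
    rw [le_div_iff₀ (by positivity)] at h1 ⊢
    nlinarith [mul_pos hσ hh]
  have hhh : h ^ 2 ≤ h := by nlinarith
  set F := affineMap p with hF
  have cF : ContDiff ℝ ∞ F := contDiff_affineMap p
  have hth : ∀ {z : E3}, dist z (p 0) ≤ ε → z ∈ Metric.cthickening ε Γ.carrier := fun hz =>
    Metric.mem_cthickening_of_dist_le _ (p 0) _ _ (H.mem 0) hz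
  have hFt : ∀ y ∈ refTriangle, F y ∈ Metric.cthickening ε Γ.carrier := fun y hy =>
    hth ((H.dist_vertex_le hy).trans (by nlinarith))
  -- the defect of the projection on the planar triangle
  set r : E2 → E3 := fun y => P (F y) - F y with hr
  have cr : ContDiff ℝ ∞ r := (hP.comp cF).sub cF
  have hr' : ∀ y, fderiv ℝ r y = (fderiv ℝ P (F y)).comp (fderiv ℝ F y) - fderiv ℝ F y := fun y =>
    (((hP.differentiable (by simp) (F y)).hasFDerivAt.comp y
      (cF.differentiable (by simp) y).hasFDerivAt).sub (cF.differentiable (by simp) y).hasFDerivAt).fderiv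
  have hF' : ∀ x y, fderiv ℝ F x = fderiv ℝ F y := fun x y => by
    ext v : 1
    rw [hF, fderiv_affineMap, fderiv_affineMap]
  have hrv : ∀ i, r (vtx i) = 0 := by
    intro i
    have h1 : F (vtx i) = p i := affineMap_vtx p i
    have h2 := hPeq (hFt _ (vtx_mem i))
    rw [h1] at h2
    simp only [hr, h1, h2, Γ.proj_eq_self (H.mem i), sub_self]
  -- The derivative of `F` is constant, so that of `r` varies only through the derivative of `P`
  -- along `F`. The Lipschitz constant `B'` and two factors `2 * h` give `M = 4 * B' * h ^ 2`.
  have hrM : ∀ x ∈ refTriangle, ‖r x‖ ≤ 20 * (4 * B' * h ^ 2) ∧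
      ‖fderiv ℝ r x‖ ≤ 16 * (4 * B' * h ^ 2) := by
    intro x hx
    refine bound_of_vanishing_vertices cr (fun y _ z _ => ?_) hrv hx
    rw [hr', hr', hF' z y, sub_sub_sub_cancel_right, ← ContinuousLinearMap.sub_comp]
    refine (ContinuousLinearMap.opNorm_comp_le _ _).trans ?_
    have h1 : ‖fderiv ℝ P (F y) - fderiv ℝ P (F z)‖ ≤ B' * (2 * h * ‖y - z‖) := by
      have := hB'.dist_le_mul (F y) (F z)
      rw [dist_eq_norm, dist_eq_norm] at this
      exact this.trans (mul_le_mul_of_nonneg_left (H.norm_sub_le y z) hB'0)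
    calc _ ≤ (B' * (2 * h * ‖y - z‖)) * (2 * h) :=
          mul_le_mul h1 (H.norm_fderiv_le y) (norm_nonneg _) (by positivity)
      _ = _ := by ring
  -- the interpolated defect
  set e := elemMap Γ N p with he
  have ce : ContDiff ℝ ∞ e := contDiff_elemMap Γ N p
  have hec : ∀ c, (fun y => e y c) = N.interpolant fun y => P (F y) c := by
    intro c
    funext y
    have h1 : e y c = ∑ a ∈ N.pts, polyEval (N.basis a) y * (Γ.proj (F a)) c := by
      rw [he, elemMap, WithLp.ofLp_sum, Finset.sum_apply]
      rfl
    rw [h1, LagrangeNodes.interpolant]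
    refine Finset.sum_congr rfl fun a ha => ?_
    rw [hPeq (hFt a (N.mem_refTriangle a ha)), mul_comm]
  set η : E2 → E3 := fun y => e y - F y with hη
  have cη' : ContDiff ℝ ∞ η := ce.sub cF
  have hηc : ∀ c, (fun y => η y c) = N.interpolant fun y => r y c := by
    intro c
    have h1 := N.interpolant_sub (fun y => P (F y) c) (fun y => F y c)
    rw [N.interpolant_affineMap (by omega) p c, ← hec c] at h1
    exact h1.symm
  have hηD : ∀ c a b, a + b ≤ 1 → ∀ x ∈ refTriangle, |D a b (fun y => η y c) x| ≤ cη * h ^ 2 := by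
    intro c a b hab x hx
    rw [hηc]
    refine (hC₁ _ (20 * (4 * B' * h ^ 2)) (by positivity) (fun z hz => ?_) a b hab x hx).trans
      (le_of_eq (by rw [hcη]; ring))
    exact (PiLp.norm_apply_le (r z) c).trans (hrM z (N.mem_refTriangle z hz)).1
  have hηn : ∀ x ∈ refTriangle, ‖η x‖ ≤ 3 * (cη * h ^ 2) := fun x hx => norm_e3_le _ fun c => by
    simpa [D] using hηD c 0 0 (by norm_num) x hx
  have hηpd : ∀ x ∈ refTriangle, ∀ i c, |pd i (fun y => η y c) x| ≤ cη * h ^ 2 := by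
    intro x hx i c
    have hi : i = 0 ∨ i = 1 := by omega
    rcases hi with rfl | rfl
    · simpa [D] using hηD c 1 0 (by norm_num) x hx
    · simpa [D] using hηD c 0 1 (by norm_num) x hx
  have hηf : ∀ x ∈ refTriangle, ‖fderiv ℝ η x‖ ≤ 6 * (cη * h ^ 2) := fun x hx =>
    norm_fderiv_le_of_pd cη' (hηpd x hx)
  have heF : ∀ y, e y = F y + η y := fun y => (add_sub_cancel (F y) (e y)).symm
  -- the high order element stays near the surface
  have het : ∀ y ∈ refTriangle, e y ∈ Metric.cthickening ε Γ.carrier := by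
    intro y hy
    refine hth ?_
    have h1 : dist (e y) (p 0) ≤ dist (F y) (p 0) + ‖η y‖ := by
      rw [dist_eq_norm, dist_eq_norm, heF, add_sub_right_comm]
      exact norm_add_le _ _
    have h2 := H.dist_vertex_le hy
    have h3 := hηn y hy
    have h4 : cη * h ^ 2 ≤ cη * h := mul_le_mul_of_nonneg_left hhh hcη0
    rw [← hF] at h2
    linarith
  -- derivative bounds of the high order element
  have hfbd : ∀ c, BdK (m + 1) h (C₃ c) fun y => P (F y) c := fun c =>
    hC₃ c h hh.le F cF fun i c' => by rw [one_mul]; exact H.bdK_affineMap m i c'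
  have hebd : ∀ i c, BdK m h (Λ₁ * h) (pd i fun y => e y c) := by
    intro i c
    -- Derivatives of `e` of order at least 2 come from the stability of interpolation, applied to
    -- `P ∘ F`. For order 1 the splitting `e = F + η` with small `η` is used instead.
    have key : ∀ a b, a + b ≤ m → ∀ x ∈ refTriangle, 1 ≤ a + b → ∀ a' b', a' + b' = a + b + 1 →
        |D a' b' (fun y => e y c) x| ≤ Λ₁ * h * h ^ (a + b) := by
      intro a b hab x hx h1 a' b' hab'
      rw [hec c]
      refine (hC₂ (a + b + 1) (by omega) (by omega) _ ((hPc c).comp cF) (C₃ c * h ^ (a + b + 1))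
        (mul_nonneg (hC₃0 c) (by positivity)) (fun a'' b'' h2 z hz => ?_) a' b' hab' x hx).trans ?_
      · have := hfbd c a'' b'' (by omega) z hz
        rwa [h2] at this
      · have h3 : C₃ c ≤ ∑ c, C₃ c := Finset.single_le_sum (f := C₃) (fun c _ => hC₃0 c) (Finset.mem_univ c)
        have h4 : C₂ * C₃ c ≤ Λ₁ := by
          have := mul_le_mul_of_nonneg_left h3 hC₂0
          rw [hΛ₁]; linarith
        calc C₂ * (C₃ c * h ^ (a + b + 1)) = (C₂ * C₃ c) * (h * h ^ (a + b)) := by ring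
          _ ≤ Λ₁ * (h * h ^ (a + b)) := mul_le_mul_of_nonneg_right h4 (by positivity)
          _ = _ := by ring
    intro a b hab x hx
    rcases Nat.eq_zero_or_pos (a + b) with h0 | h0
    · obtain ⟨rfl, rfl⟩ : a = 0 ∧ b = 0 := by omega
      have h1 : pd i (fun y => e y c) x = pd i (fun y => F y c) x + pd i (fun y => η y c) x := by
        have h2 : (fun y => e y c) = (fun y => F y c) + fun y => η y c := by
          funext y; rw [heF y]; rfl
        rw [h2, pd_add (contDiff_coord cF c) (contDiff_coord cη' c)]
        rfl
      have h2 : |pd i (fun y => F y c) x| ≤ h := by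
        simpa [D] using H.bdK_affineMap 0 i c 0 0 le_rfl x hx
      have h3 := hηpd x hx i c
      have h4 : cη * h ^ 2 ≤ cη * h := mul_le_mul_of_nonneg_left hhh hcη0
      have h5 : 0 ≤ C₂ * ∑ c, C₃ c := mul_nonneg hC₂0 hS0
      have h6 : |pd i (fun y => e y c) x| ≤ Λ₁ * h := by
        rw [h1, hΛ₁]
        refine (abs_add_le _ _).trans ?_
        nlinarith [mul_nonneg h5 hh.le]
      simpa [D] using h6
    · have hi : i = 0 ∨ i = 1 := by omega
      rcases hi with rfl | rfl
      · rw [D_pd_zero (contDiff_coord ce c)]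
        exact key a b hab x hx h0 _ _ (by omega)
      · rw [D_pd_one]
        exact key a b hab x hx h0 _ _ (by omega)
  refine ⟨fun y hy => hεU (het y hy), fun y => P (e y), ?_, fun y hy => (hPeq (het y hy)).symm⟩
  have cG : ContDiff ℝ ∞ fun y => P (e y) := hP.comp ce
  refine ⟨cG, hh, hh1, by positivity, fun y hy => ?_, fun x hx y hy => ?_, fun i c => ?_⟩
  · rw [hPeq (het y hy)]; exact Γ.proj_mem (hεU (het y hy))
  -- The lifted map is `F + Z`, where the derivative of `Z` is of order `h ^ 2`. On the convex
  -- triangle the mean value inequality bounds the increments of `Z`, and the expansion of `F`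
  -- dominates them.
  · set Z : E2 → E3 := fun y => r y + (P (e y) - P (F y)) with hZ
    have hZd : ∀ z, HasFDerivAt Z (fderiv ℝ r z + ((fderiv ℝ P (e z)).comp (fderiv ℝ e z) -
        (fderiv ℝ P (F z)).comp (fderiv ℝ F z))) z := fun z =>
      (cr.differentiable (by simp) z).hasFDerivAt.add
        (((hP.differentiable (by simp) _).hasFDerivAt.comp z (ce.differentiable (by simp) z).hasFDerivAt).sub
        ((hP.differentiable (by simp) _).hasFDerivAt.comp z (cF.differentiable (by simp) z).hasFDerivAt))
    have hZb : ∀ z ∈ refTriangle, ‖fderiv ℝ Z z‖ ≤ cZ * h ^ 2 := by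
      intro z hz
      rw [(hZd z).fderiv]
      have h1 : fderiv ℝ e z = fderiv ℝ F z + fderiv ℝ η z := by
        rw [← fderiv_add (cF.differentiable (by simp) z) (cη'.differentiable (by simp) z)]
        congr 1
        funext y; rw [heF y]; rfl
      have h2 : (fderiv ℝ P (e z)).comp (fderiv ℝ e z) - (fderiv ℝ P (F z)).comp (fderiv ℝ F z) =
          (fderiv ℝ P (e z) - fderiv ℝ P (F z)).comp (fderiv ℝ F z) +
          (fderiv ℝ P (e z)).comp (fderiv ℝ η z) := by
        rw [h1, ContinuousLinearMap.comp_add, ContinuousLinearMap.sub_comp]; abel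
      have h3 : ‖(fderiv ℝ P (e z) - fderiv ℝ P (F z)).comp (fderiv ℝ F z)‖ ≤
          B' * (3 * (cη * h ^ 2)) * (2 * h) := by
        refine (ContinuousLinearMap.opNorm_comp_le _ _).trans (mul_le_mul ?_ (H.norm_fderiv_le z)
          (norm_nonneg _) (by positivity))
        have := hB'.dist_le_mul (e z) (F z)
        rw [dist_eq_norm, dist_eq_norm, heF, add_sub_cancel_left, ← heF] at this
        exact this.trans (mul_le_mul_of_nonneg_left (hηn z hz) hB'0)
      have h4 : ‖(fderiv ℝ P (e z)).comp (fderiv ℝ η z)‖ ≤ B * (6 * (cη * h ^ 2)) :=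
        (ContinuousLinearMap.opNorm_comp_le _ _).trans (mul_le_mul (hB _) (hηf z hz)
          (norm_nonneg _) hB0)
      have h5 := (hrM z hz).2
      have h6 : B' * (3 * (cη * h ^ 2)) * (2 * h) ≤ 6 * B' * cη * h ^ 2 := by
        have : B' * (3 * (cη * h ^ 2)) * (2 * h) = 6 * B' * cη * h ^ 2 * h := by ring
        rw [this]
        exact mul_le_of_le_one_right (by positivity) hh1
      rw [h2]
      refine (norm_add_le _ _).trans ((add_le_add h5 ((norm_add_le _ _).trans
        (add_le_add (h3.trans h6) h4))).trans (le_of_eq ?_))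
      rw [hcZ]; ring
    have h1 := convex_refTriangle.norm_image_sub_le_of_norm_fderiv_le (𝕜 := ℝ) (f := Z)
      (fun z _ => (hZd z).differentiableAt) hZb hy hx
    have h2 : P (e x) - P (e y) = (F x - F y) + (Z x - Z y) := by
      simp only [hZ, hr]; abel
    have h3 := H.ge (x - y)
    rw [← affineMap_sub p x y, ← hF] at h3
    rw [dist_eq_norm, dist_eq_norm, h2]
    have h4 : ‖F x - F y‖ ≤ ‖(F x - F y) + (Z x - Z y)‖ + ‖Z x - Z y‖ := by
      have := _root_.norm_sub_le ((F x - F y) + (Z x - Z y)) (Z x - Z y)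
      rwa [add_sub_cancel_right] at this
    have h5 : cZ * h ^ 2 * ‖x - y‖ ≤ 1 / (4 * σ) * h * ‖x - y‖ := by
      refine mul_le_mul_of_nonneg_right ?_ (norm_nonneg _)
      calc cZ * h ^ 2 = cZ * h * h := by ring
        _ ≤ _ := mul_le_mul_of_nonneg_right hhσ hh.le
    have h6 : h / (2 * σ) * ‖x - y‖ = 1 / (4 * σ) * h * ‖x - y‖ + 1 / (4 * σ) * h * ‖x - y‖ := by
      field_simp; ring
    linarith
  · have h1 := ((bdK_succ_iff (contDiff_coord cG c)).1 (hC₄ c h hh.le e ce hebd)).2 i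
    refine h1.mono hh.le (mul_le_mul_of_nonneg_right ?_ hh.le)
    exact Finset.single_le_sum (f := C₄) (fun c _ => hC₄0 c) (Finset.mem_univ c)

/-! ### Shape regular elements and the mesh size -/

theorem convexHull_subset_image_affineMap (p : Fin 3 → E3) :
    convexHull ℝ (range p) ⊆ affineMap p '' refTriangle := by
  refine convexHull_min (range_subset_iff.2 fun i => ⟨vtx i, vtx_mem i, affineMap_vtx p i⟩) ?_
  rintro _ ⟨x, hx, rfl⟩ _ ⟨y, hy, rfl⟩ a b ha hb hab
  refine ⟨a • x + b • y, convex_refTriangle hx hy ha hb hab, ?_⟩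
  obtain rfl : b = 1 - a := by linarith
  simp only [affineMap, PiLp.add_apply, PiLp.smul_apply, smul_eq_mul]
  module

theorem affineMap_direction_eq_zero {p : Fin 3 → E3} (hp : AffineIndependent ℝ p) {v : E2}
    (hv : v 0 • (p 1 - p 0) + v 1 • (p 2 - p 0) = 0) : v = 0 := by
  have h := affineIndependent_iff.1 hp Finset.univ ![-v 0 - v 1, v 0, v 1]
    (by simp only [Fin.sum_univ_three, Matrix.cons_val_zero, Matrix.cons_val_one, Matrix.cons_val]
        ring) (by
      simp only [Fin.sum_univ_three, Matrix.cons_val_zero, Matrix.cons_val_one, Matrix.cons_val]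
      rw [← hv]; module)
  ext i
  fin_cases i
  · exact h 1 (Finset.mem_univ _)
  · exact h 2 (Finset.mem_univ _)

theorem IsElement.affineIndependent {T : Geometry.SimplicialComplex ℝ E3} {p : Fin 3 → E3}
    (hp : IsElement T p) : AffineIndependent ℝ p := by
  obtain ⟨hinj, s, hs, hsp⟩ := hp
  refine AffineIndependent.of_set_of_injective ?_ hinj
  rw [← hsp]
  exact T.indep hs

/-- A triangle that contains a disc of diameter `ρ` in its plane is non-degenerate at the scale
`ρ`. -/
theorem le_norm_of_disc_subset {p : Fin 3 → E3} (hp : AffineIndependent ℝ p) {c : E3}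
    (hc : c ∈ affineSpan ℝ (range p)) {ρ : ℝ} (hρ : 0 < ρ)
    (hsub : Metric.closedBall c (ρ / 2) ∩ (affineSpan ℝ (range p) : Set E3) ⊆
      convexHull ℝ (range p)) (v : E2) :
    ρ / 2 * ‖v‖ ≤ ‖v 0 • (p 1 - p 0) + v 1 • (p 2 - p 0)‖ := by
  set u := v 0 • (p 1 - p 0) + v 1 • (p 2 - p 0) with hu
  rcases eq_or_ne u 0 with h0 | h0
  · simp [affineMap_direction_eq_zero hp h0]
  have hn : 0 < ‖u‖ := norm_pos_iff.2 h0
  have hdir : u ∈ (affineSpan ℝ (range p)).direction := by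
    have h : ∀ i, p i - p 0 ∈ (affineSpan ℝ (range p)).direction := fun i =>
      AffineSubspace.vsub_mem_direction (subset_affineSpan ℝ _ ⟨i, rfl⟩)
        (subset_affineSpan ℝ _ ⟨0, rfl⟩)
    exact Submodule.add_mem _ (Submodule.smul_mem _ _ (h 1)) (Submodule.smul_mem _ _ (h 2))
  -- The diameter of the disc in direction `u` has endpoints `F y` and `F z` with `y, z` in the
  -- reference triangle. Then `y - z` is `(ρ / ‖u‖) v` and has length at most 2, which bounds `‖u‖`
  -- from below.
  have hmem : ∀ s : ℝ, |s| ≤ ρ / 2 / ‖u‖ → ∃ y ∈ refTriangle, affineMap p y = c + s • u := by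
    intro s hs
    refine convexHull_subset_image_affineMap p (hsub ⟨?_, ?_⟩)
    · rw [Metric.mem_closedBall, dist_eq_norm, add_sub_cancel_left, norm_smul, Real.norm_eq_abs]
      exact (le_div_iff₀ hn).1 hs
    · rw [add_comm]
      exact AffineSubspace.vadd_mem_of_mem_direction (Submodule.smul_mem _ s hdir) hc
  have hr : 0 < ρ / 2 / ‖u‖ := by positivity
  obtain ⟨y, hy, hyc⟩ := hmem (ρ / 2 / ‖u‖) (abs_of_pos hr).le
  obtain ⟨z, hz, hzc⟩ := hmem (-(ρ / 2 / ‖u‖)) (by rw [abs_neg, abs_of_pos hr])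
  have h1 : y - z = (ρ / ‖u‖) • v := by
    rw [← sub_eq_zero]
    refine affineMap_direction_eq_zero hp ?_
    have h2 : affineMap p y - affineMap p z = (ρ / ‖u‖) • u := by
      rw [hyc, hzc]
      have : ρ / ‖u‖ = ρ / 2 / ‖u‖ + ρ / 2 / ‖u‖ := by ring
      rw [this]; module
    rw [affineMap_sub, hu] at h2
    rw [← sub_eq_zero.2 h2]
    simp only [PiLp.sub_apply, PiLp.smul_apply, smul_eq_mul, ← hu]
    module
  have h2 : ‖y - z‖ ≤ 2 := (_root_.norm_sub_le y z).trans
    (by linarith [norm_le_of_mem_refTriangle hy, norm_le_of_mem_refTriangle hz])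
  rw [h1, norm_smul, Real.norm_of_nonneg (by positivity), div_mul_eq_mul_div,
    div_le_iff₀ hn] at h2
  linarith

/-- The size attached to an element is its own diameter, not the mesh size. The mesh is not assumed
quasi-uniform, and the lower bound holds only at the element's own scale. -/
theorem IsElement.isGoodTriangle {Γ : ClosedSurface} {T : Geometry.SimplicialComplex ℝ E3}
    (hT : IsTriangulation Γ T) {σ : ℝ} (hσ : 0 < σ) (hreg : IsShapeRegular σ T)
    {p : Fin 3 → E3} (hp : IsElement T p) :
    IsGoodTriangle Γ σ (Metric.diam (convexHull ℝ (range p))) p := by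
  have hdist : ∀ i, ‖p i - p 0‖ ≤ Metric.diam (convexHull ℝ (range p)) := by
    intro i
    rw [← dist_eq_norm, convexHull_diam]
    exact Metric.dist_le_diam_of_mem (finite_range p).isBounded ⟨i, rfl⟩ ⟨0, rfl⟩
  have hpos : 0 < Metric.diam (convexHull ℝ (range p)) :=
    (norm_pos_iff.2 (sub_ne_zero.2 (hp.1.ne (by decide)))).trans_le (hdist 1)
  refine ⟨hpos, fun i => ?_, hdist, fun v => ?_⟩
  · obtain ⟨-, s, hs, hsp⟩ := hp
    refine hT.vertices_subset ?_
    rw [Geometry.SimplicialComplex.vertices_eq]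
    exact mem_biUnion hs (hsp ▸ mem_range_self i)
  · obtain ⟨c, hc, ρ, hρ, hsub⟩ := hreg p hp
    have hρ0 : 0 < ρ := pos_of_mul_pos_right (hpos.trans_le hρ) hσ.le
    refine (mul_le_mul_of_nonneg_right ?_ (norm_nonneg v)).trans
      (le_norm_of_disc_subset hp.affineIndependent hc hρ0 hsub v)
    rw [div_le_div_iff₀ (by positivity) two_pos]
    nlinarith

theorem IsElement.diam_le_meshSize {Γ : ClosedSurface} {T : Geometry.SimplicialComplex ℝ E3}
    (hT : IsTriangulation Γ T) {p : Fin 3 → E3} (hp : IsElement T p) :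
    Metric.diam (convexHull ℝ (range p)) ≤ meshSize T := by
  obtain ⟨-, s, hs, hsp⟩ := hp
  exact le_csSup (hT.finite.image _).bddAbove ⟨s, hs, by rw [← hsp]⟩

/-- This reduces interpolation on the surface to the reference element: injectivity makes
`Function.invFunOn` a true inverse, and the nodes lie in the triangle, where the two
parametrizations agree. -/
theorem interp_liftMap {Γ : ClosedSurface} {k : ℕ} {N : LagrangeNodes k} {p : Fin 3 → E3}
    (hinj : InjOn (liftMap Γ N p) refTriangle) {G : E2 → E3}
    (hG : EqOn (liftMap Γ N p) G refTriangle) (w : E3 → ℝ) {y : E2} (hy : y ∈ refTriangle) :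
    interp Γ N p w (G y) = N.interpolant (fun y => w (G y)) y := by
  rw [← hG hy]
  simp only [interp, LagrangeNodes.interpolant, hinj.leftInvOn_invFunOn hy]
  refine Finset.sum_congr rfl fun a ha => ?_
  rw [← hG (N.mem_refTriangle a ha), liftMap]

/-- The estimates in terms of the diameter of an element combine to one in terms of a larger
mesh size. -/
theorem combine_estimates {C : ℝ≥0} {η h : ℝ} (hη : 0 < η) (hηh : η ≤ h) {m : ℕ} (hm : 2 ≤ m)
    {a b S : ℝ≥0∞} (ha : a ≤ C * ENNReal.ofReal η ^ (2 * m - 1) * S)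
    (hb : b ≤ C * ENNReal.ofReal η ^ (2 * m - 3) * S) :
    a + ENNReal.ofReal (h ^ 2) * b ≤ ENNReal.ofReal ((2 * C + 1) * h ^ (2 * m - 1)) * S := by
  have h0 : 0 ≤ h := hη.le.trans hηh
  -- With truncated subtraction the identity `2 + (2 * m - 3) = 2 * m - 1` relies on `2 ≤ m`.
  have hpow : ENNReal.ofReal h ^ 2 * ENNReal.ofReal h ^ (2 * m - 3) =
      ENNReal.ofReal h ^ (2 * m - 1) := by
    rw [← pow_add]; congr 1; omega
  have hle := ENNReal.ofReal_le_ofReal hηh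
  have hC : ENNReal.ofReal (2 * (C : ℝ) + 1) = 2 * C + 1 := by
    rw [ENNReal.ofReal_add (by positivity) zero_le_one, ENNReal.ofReal_mul zero_le_two]
    simp
  rw [ENNReal.ofReal_mul (by positivity), hC, ENNReal.ofReal_pow h0, ENNReal.ofReal_pow h0]
  calc a + ENNReal.ofReal h ^ 2 * b
      ≤ C * ENNReal.ofReal h ^ (2 * m - 1) * S +
          ENNReal.ofReal h ^ 2 * (C * ENNReal.ofReal h ^ (2 * m - 3) * S) :=
        add_le_add (ha.trans (by gcongr)) (mul_le_mul_right (hb.trans (by gcongr)) _)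
    _ = C * ENNReal.ofReal h ^ (2 * m - 1) * S +
          C * (ENNReal.ofReal h ^ 2 * ENNReal.ofReal h ^ (2 * m - 3)) * S := by ring
    _ = 2 * C * ENNReal.ofReal h ^ (2 * m - 1) * S := by rw [hpow]; ring
    _ ≤ (2 * C + 1) * ENNReal.ofReal h ^ (2 * m - 1) * S := by
        gcongr; exact le_self_add

end

end SurfaceDG

/-! ### The interpolation estimate on lifted elements -/

theorem lemma5p3 (Γ : ClosedSurface) (k : ℕ) (N : LagrangeNodes k) (m : ℕ) (hm : 2 ≤ m)
    (hmk : m ≤ k + 1) (σ : ℝ) (hσ : 0 < σ) :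
    -- every element of `H^m(Γ)` has a continuous representative
    (∀ w : E3 → ℝ, Γ.MemSobolev Γ.carrier m w →
      ∃ w' : E3 → ℝ, ContinuousOn w' Γ.carrier ∧ w' =ᵐ[area Γ.carrier] w) ∧
    -- and the interpolation estimate holds for it, uniformly over fine regular triangulations
    ∃ C : ℝ, 0 < C ∧ ∃ h₀ : ℝ, 0 < h₀ ∧
      ∀ T : Geometry.SimplicialComplex ℝ E3, IsTriangulation Γ T → IsShapeRegular σ T →
        meshSize T ≤ h₀ → ∀ p : Fin 3 → E3, IsElement T p →
        -- the lift is well defined on the element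
        MapsTo (elemMap Γ N p) refTriangle Γ.U ∧ InjOn (liftMap Γ N p) refTriangle ∧
        ∀ w : E3 → ℝ, Γ.MemSobolev Γ.carrier m w → ContinuousOn w Γ.carrier →
          (∃ t : E3 → E3, Γ.HasGradTrace (liftInterior Γ N p) (liftBoundary Γ N p)
            (fun ξ => w ξ - interp Γ N p w ξ) t) ∧
          ∀ t : E3 → E3, Γ.HasGradTrace (liftInterior Γ N p) (liftBoundary Γ N p)
            (fun ξ => w ξ - interp Γ N p w ξ) t →
            l2Sq (arc (liftBoundary Γ N p)) (fun ξ => w ξ - interp Γ N p w ξ) +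
                ENNReal.ofReal (meshSize T ^ 2) * l2Sq (arc (liftBoundary Γ N p)) t ≤
              ENNReal.ofReal (C * meshSize T ^ (2 * m - 1)) *
                Γ.sobolevSq (liftInterior Γ N p) m w := by
  obtain ⟨m', rfl⟩ := Nat.exists_eq_add_of_le' hm
  refine ⟨fun w hw => Γ.exists_continuous_rep hw, ?_⟩
  -- A chart of parameter `m - 1` controls derivatives of `G` up to order `m`, exactly what `m`
  -- derivatives of `w ∘ G` involve.
  obtain ⟨Λ, h₀, hh₀, hchart⟩ :=
    N.exists_chart_elemMap Γ (m := m' + 1) (by omega) (by omega) hσ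
  obtain ⟨C, hC⟩ := N.exists_chart_estimate hm hmk Λ (1 / (4 * σ))
  refine ⟨2 * C + 1, by positivity, h₀, hh₀, fun T hT hreg hmesh p hp => ?_⟩
  have hgood := hp.isGoodTriangle hT hσ hreg
  have hdiam := hp.diam_le_meshSize hT
  obtain ⟨hmaps, G, hG, hGeq⟩ := hchart p _ hgood (hdiam.trans hmesh)
  have heq : EqOn (liftMap Γ N p) G refTriangle := hGeq
  have hinj : InjOn (liftMap Γ N p) refTriangle := heq.injOn_iff.2 hG.injOn
  have hint : liftInterior Γ N p = G '' interior refTriangle :=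
    image_congr fun y hy => hGeq y (interior_subset hy)
  have hbd : liftBoundary Γ N p = G '' frontier refTriangle :=
    image_congr fun y hy => hGeq y (frontier_refTriangle_subset_self hy)
  refine ⟨hmaps, hinj, fun w hw hwc => ?_⟩
  rw [hint, hbd]
  obtain ⟨hex, hest⟩ := hC Γ (m' + 1) _ G le_rfl hG w (fun ξ => w ξ - interp Γ N p w ξ)
    (hw.mono hG.image_subset) hwc fun y hy => by rw [interp_liftMap hinj heq w hy]
  refine ⟨hex, fun t ht => ?_⟩
  obtain ⟨h1, h2⟩ := hest t ht
  -- The estimates hold at the scale of the element's diameter; positive exponents allow passing to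
  -- the mesh size.
  exact combine_estimates hgood.h_pos hdiam hm h1 h2
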